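/- **Setting.** Let $N\ge 1$ be an integer, $\zeta\in(0,\pi)$, $T>0$, $J\in\mathbb R$, $h,h'\in\mathbb R$, $\xi_-\in\mathbb C$, $\beta=J\sinh(-i\zeta)/T$, and assume $\sinh(2\beta/N)\neq0$. "Outside", "inside" and "distinct" are understood modulo $i\pi\mathbb Z$. Write $\sinh(s,s')=\sinh(s+s')\sinh(s-s')$. A contour is a positively oriented simple closed piecewise $C^1$ curve in $\mathbb C$ whose closed interior is disjoint from its translates by non-zero multiples of $i\pi$. *Bethe roots.* $\{\mu_a\}_1^N$ is a set of Bethe roots at field $h$ if the $\mu_a$ are pairwise distinct and, for all $p$, $$-1=e^{-h/T}\prod_{k=1}^N\frac{\sinh(i\zeta+\mu_k-\mu_p)}{\sinh(i\zeta+\mu_p-\mu_k)}\left(\frac{\sinh(\mu_p-\frac\beta N)\sinh(i\zeta+\mu_p+\frac\beta N)}{\sinh(\mu_p+\frac\beta N)\sinh(i\zeta-\mu_p+\frac\beta N)}\right)^{N}.$$ Its counting function is $$\hat{\mathfrak a}(\xi)=e^{-h/T}\prod_{k=1}^N\frac{\sinh(i\zeta-\xi+\mu_k)}{\sinh(i\zeta+\xi-\mu_k)}\left(\frac{\sinh(\xi-\frac\beta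 N)\sinh(i\zeta+\xi+\frac\beta N)}{\sinh(\xi+\frac\beta N)\sinh(i\zeta-\xi+\frac\beta N)}\right)^{N}.$$ *Boundary factor.* For pairwise distinct $\xi_1,\dots,\xi_N$ put $$\mathcal Z_N(\xi;\mu)=\frac{\prod_{a,b}\sinh(\xi_a,\mu_b)\,\sinh(\xi_a-i\zeta,\mu_b)}{\prod_{a<b}\sinh(\xi_a-\xi_b)\sinh(\xi_a+\xi_b-i\zeta)\sinh(\mu_b,\mu_a)}\;\det_{N}\left[\frac{\sinh(-i\zeta)\sinh(\xi_-+\mu_b)\sinh(2\xi_a)}{\sinh(\xi_a-i\zeta,\mu_b)\,\sinh(\xi_a,\mu_b)}\right],$$ let $\mathcal Z_N(\mu)$ be its limit when all $\xi_a\to-\beta/N$ (through pairwise distinct values), let $F^{(-)}_h(\mu)=e^{-Nh/2T}\mathcal Z_N(\mu)$, and $$\mathcal F_{\mathcal B}(\mu;\lambda;\xi_-)=e^{N(h'-h)/2T}\,\frac{F^{(-)}_{h'}(\mu)}{F^{(-)}_{h}(\lambda)} .$$ *States and contour.* Let $\{\lambda_a\}$ be Bethe roots at $h$, with counting function $\hat{\mathfrak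 a}_\emptyset$, and $\{\mu_a\}$ Bethe roots at $h'$, with counting function $\hat{\mathfrak a}_{\mathbb Y}$. Let $\mathscr C$ be a contour with interior $\mathscr D$ such that * $0,\pm\beta/N\in\mathscr D$; the points $\frac{i\pi}2,\ \frac{i\zeta}2,\ \frac{i\zeta-i\pi}2,\ \pm(i\zeta+\frac\beta N)$ are outside $\mathscr C$; $-\xi_-$ is not on $\mathscr C$; * the zeros of $1+\hat{\mathfrak a}_\emptyset$ in $\mathscr D$ are exactly the $\lambda_a$ (as for the dominant state of the quantum transfer matrix); * each $\mu_a$ is either in $\mathscr D$ or outside $\mathscr C$. The particles $\hat{\mathcal Y}=\{y_1,\dots,y_n\}$ are the $\mu_a$ outside $\mathscr C$; the holes $\hat{\mathfrak X}=\{x_1,\dots,x_n\}$ are the zeros of $1+\hat{\mathfrak a}_{\mathbb Y}$ in $\mathscr D$ that are not among the $\mu_a$; * for both states, $1+\hat{\mathfrak a}$ has no zero on $\mathscr C$ and $\oint_{\mathscr C}\hat{\mathfrak a}'/(1+\hat{\mathfrak a})=0$; the points $\lambda_a-i\zeta$, $\mu_a-i\zeta$ are outside $\mathscr C$; if $w\in\mathscr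 D$ is a zero of $1+\hat{\mathfrak a}$, then $-w\in\mathscr D$ and $i\zeta-w$ is outside $\mathscr C$; the points $-y_j$ and $i\zeta-y_j$ are outside $\mathscr C$. Let $\mathscr C'$ be a contour contained, with its interior, in $\mathscr D$, and encircling $0$, $-\beta/N$ and all the zeros of $1+\hat{\mathfrak a}_\emptyset$ and $1+\hat{\mathfrak a}_{\mathbb Y}$ in $\mathscr D$, the points $-s$ and $i\zeta-s$, $s\in\mathscr C$, being outside $\mathscr C'$. Assume $\sinh(\xi_--\frac\beta N)\ne0$, $\sinh(\lambda_a+\xi_-)\neq0$ and $\sinh(x_j+\xi_-)\ne0$ for all $a,j$. Let $\hat{\mathscr L}=\frac1{2i\pi}\ln(1+\hat{\mathfrak a})$ be a determination continuous along the contour of integration (cut at its base point). *The series $\hat{\mathscr F}$.* For each of the two states (roots $\mu$, field $h$, counting function $\hat{\mathfrak a}$), let $$\hat U(\omega,\omega')=\frac{-e^{-h/T}\sinh(2\omega'-i\zeta)}{\sinh(\omega+\omega')\sinh(\omega-\omega'-i\zeta)}\left(\frac{\sinh(\omega'-\frac\beta N)\sinh(\omega'+\frac\beta N-i\zeta)}{\sinh(\omega'+\frac\beta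 N)\sinh(\omega'-\frac\beta N-i\zeta)}\right)^{N} e^{-\oint_{\mathscr C_U}\hat{\mathscr L}(s)[\coth(\omega'+s)+\coth(\omega'-s)-\coth(\omega'+s-i\zeta)-\coth(\omega'-s-i\zeta)]ds},$$ $$\hat{\mathfrak r}(\omega)=e^{-2h/T}\left(\frac{\sinh(\omega-\frac\beta N+i\zeta)\sinh(\omega+\frac\beta N-i\zeta)}{\sinh(\omega+\frac\beta N+i\zeta)\sinh(\omega-\frac\beta N-i\zeta)}\right)^{N} e^{-\oint_{\mathscr C_U}\hat{\mathscr L}(s)[\coth(\omega+s+i\zeta)+\coth(\omega-s+i\zeta)-\coth(\omega+s-i\zeta)-\coth(\omega-s-i\zeta)]ds},$$ $$\hat{\mathscr F}=\sum_{k\ge0}\oint_{\mathscr C^{(1)}}\!\!\cdots\oint_{\mathscr C^{(2k+1)}}\frac{d^{2k+1}\omega}{(2i\pi)^{2k+1}}\sum_{n\ge k}\frac{\hat{\mathfrak r}(\omega_{2k+1})^{n-k}}{2n+1}\prod_{p=1}^{2k+1}\hat U(\omega_p,\omega_{p+1}) -\sum_{k\ge1}\oint_{\mathscr C^{(1)}}\!\!\cdots\oint_{\mathscr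 C^{(2k)}}\frac{d^{2k}\omega}{(2i\pi)^{2k}}\sum_{n\ge k}\frac{\hat{\mathfrak r}(\omega_{2k})^{n-k}}{2n}\prod_{p=1}^{2k}\hat U(\omega_p,\omega_{p+1})$$ with cyclic indices. Here the contours $\mathscr C^{(1)}\supset\mathscr C^{(2)}\supset\cdots$ are strictly encased, encircle $0$ and all $\pm\mu_a$, but none of $\frac{i\pi}2$, $\pm\mu_a\pm i\zeta$; for $p<q$ and $\omega\in\mathscr C^{(p)}$ the points $-\omega$, $\omega\pm i\zeta$ are outside $\mathscr C^{(q)}$. The contour $\mathscr C_U$ encircles $0$, $-\frac\beta N$, all the $\mu_a$ and no other zero of $1+\hat{\mathfrak a}$, none of $i\zeta+\frac\beta N$, $\mu_a-i\zeta$, and none of $\pm\omega$, $\pm(\omega+i\zeta)$, $\pm(\omega-i\zeta)$ with $\omega\in\mathscr C^{(p)}$; $1+\hat{\mathfrak a}$ has no zero and no monodromy along it. It is assumed that $|\hat{\mathfrak r}|<1$ on every $\mathscr C^{(p)}$ and that the two series converge absolutely as double series over $(k,n)$. The values for the two states are denoted $\hat{\mathscr F}_{\mathbb Y}$ and $\hat{\mathscr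 F}_\emptyset$. *Remaining notation.* $f(\lambda,\mu)=\dfrac{\sinh(\lambda+\mu-i\zeta)}{\sinh(\lambda+\mu)}$, $\ \phi_2^{(+)}(s,s')=\tfrac12\big[\coth'(s+s'-i\zeta)-\coth'(s+s')\big]$, $\ \phi_1(s)=\coth(2s-i\zeta)+\coth(2s)-\coth(s+\xi_-)$, and $$\mathcal K_N^{(1)}(\hat{\mathbb Y})=H\;\frac{\prod_{a<b}f(y_a,y_b)}{\prod_{a,b}f(x_a,y_b)}\prod_{a=1}^n\left\{\frac{\sinh(y_a+\xi_-)\sinh(2x_a-i\zeta)}{\sinh(x_a+\xi_-)\sinh(2y_a)}\{1+\hat{\mathfrak a}_{\mathbb Y}(-y_a)\}^{\frac12}\right\}\prod_{a=1}^n\left(\frac{\sinh(i\zeta+\frac\beta N,y_a)}{\sinh(i\zeta+\frac\beta N,x_a)}\right)^{N}\prod_{a=1}^n\frac{e^{-\oint_{\mathscr C}\hat{\mathscr L}_{\mathbb Y}(s)\partial_s\ln f(s,y_a)ds}}{e^{-\oint_{\mathscr C}\hat{\mathscr L}_{\mathbb Y}(s)\partial_s\ln f(s,x_a)ds}},$$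 where $H$ stands for $\prod_{a<b}f(x_a,x_b)\prod_a\{1+\hat{\mathfrak a}_{\mathbb Y}(-x_a)\}^{1/2}$, understood as a determination of the square root of $\lim_{\epsilon\to0}\prod_{a<b}f(x_a,x_b+\epsilon)^2\prod_a\{1+\hat{\mathfrak a}_{\mathbb Y}(-x_a-\epsilon)\}$. The fourth root below and the roots $\{1+\hat{\mathfrak a}_{\mathbb Y}(-y_a)\}^{1/2}$ are principal. **Proposition.** The limits $\mathcal Z_N(\mu)$ and $\mathcal Z_N(\lambda)$ exist and $\mathcal Z_N(\lambda)\neq0$. For all determinations of $\hat{\mathscr L}_{\mathbb Y}$ and $\hat{\mathscr L}_\emptyset$ along $\mathscr C$ there is a non-zero determination $H$ such that $$\mathcal F_{\mathcal B}(\mu;\lambda;\xi_-)=e^{\hat{\mathscr F}_{\mathbb Y}-\hat{\mathscr F}_\emptyset}\left[\frac{1-\hat{\mathfrak a}_\emptyset(0)^2}{1-\hat{\mathfrak a}_{\mathbb Y}(0)^2}\right]^{\frac14}\left[\frac{1+\hat{\mathfrak a}_{\mathbb Y}(-\xi_-)}{1+\hat{\mathfrak a}_\emptyset(-\xi_-)}\right]^{\mathbf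 1_{\mathscr D}(-\xi_-)}\mathcal K_N^{(1)}(\hat{\mathbb Y})$$ $$\times\exp\Big\{\oint_{\mathscr C}\!ds\oint_{\mathscr C'\subset\mathscr C}\!\!ds'\,\phi_2^{(+)}(s,s')\big[\hat{\mathscr L}_{\mathbb Y}(s)\hat{\mathscr L}_{\mathbb Y}(s')-\hat{\mathscr L}_\emptyset(s)\hat{\mathscr L}_\emptyset(s')\big]+\oint_{\mathscr C}\!ds\,\phi_1(s)\big[\hat{\mathscr L}_{\mathbb Y}(s)-\hat{\mathscr L}_\emptyset(s)\big]-N\oint_{\mathscr C}\!ds\,\big[\hat{\mathscr L}_{\mathbb Y}(s)-\hat{\mathscr L}_\emptyset(s)\big]\partial_s\ln\sinh\big(s,i\zeta+\tfrac\beta N\big)\Big\}.$$ Moreover, if $\mathscr D=-\mathscr D$, if $i\zeta-w$ is outside $\mathscr C$ for all $w\in\mathscr D$, and if for both states $1+\hat{\mathfrak a}$ avoids $(-\infty,0]$ and $\Big|e^{-2h/T}\prod_k\frac{\sinh(\mu_k+s+i\zeta)\sinh(\mu_k-s+i\zeta)}{\sinh(\mu_k+s-i\zeta)\sinh(\mu_k-s-i\zeta)}\Big|<1$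 for $s\in\mathscr C$ (with the roots and the field of the state), then the formula holds with the logarithms principal at the base point of $\mathscr C$ and with $H=\prod_{a<b}f(x_a,x_b)\prod_a\{1+\hat{\mathfrak a}_{\mathbb Y}(-x_a)\}^{1/2}$, all roots being principal. -/

import Mathlib

open Complex Filter Topology

noncomputable section

namespace BoundaryXXZ

/-! ### Contours on the cylinder `ℂ / iπℤ` -/

/-- `∫₀¹ g(t) γ'(t) dt`: the integral along the path `γ` of a weight `g` that is given as a
function of the parameter. -/
def pathIntegral (γ g : ℝ → ℂ) : ℂ := ∫ t in (0 : ℝ)..1, g t * deriv γ t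

/-- The set of points of a path. -/
def traceOf (γ : ℝ → ℂ) : Set ℂ := γ '' Set.Icc 0 1

/-- The points off the path around which the path winds exactly once in the positive sense. -/
def innerOf (γ : ℝ → ℂ) : Set ℂ :=
  {z | z ∉ traceOf γ ∧ pathIntegral γ (fun t => 1 / (γ t - z)) = 2 * Real.pi * I}

/-- A positively oriented, simple, closed, piecewise `C¹` curve in `ℂ`, whose closed interior
domain does not meet its translates by the nonzero multiples of `iπ`. -/
structure Contour where
  toFun : ℝ → ℂ
  continuousOn : ContinuousOn toFun (Set.Icc 0 1)
  closed : toFun 0 = toFun 1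
  simple : Set.InjOn toFun (Set.Ico 0 1)
  breaks : Finset ℝ
  differentiableAt : ∀ t ∈ Set.Ioo (0 : ℝ) 1, t ∉ breaks → DifferentiableAt ℝ toFun t
  continuousOn_deriv : ContinuousOn (deriv toFun) (Set.Ioo 0 1 \ (breaks : Set ℝ))
  bounded_deriv : ∃ B : ℝ, ∀ t ∈ Set.Ioo (0 : ℝ) 1, t ∉ breaks → ‖deriv toFun t‖ ≤ B
  positive : ∀ z ∉ traceOf toFun,
    pathIntegral toFun (fun t => 1 / (toFun t - z)) = 0 ∨
    pathIntegral toFun (fun t => 1 / (toFun t - z)) = 2 * Real.pi * I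
  separated : ∀ z ∈ traceOf toFun ∪ innerOf toFun, ∀ k : ℤ, k ≠ 0 →
    z + k * (Real.pi * I) ∉ traceOf toFun ∪ innerOf toFun

namespace Contour

/-- The points of the contour. -/
def trace (C : Contour) : Set ℂ := traceOf C.toFun

/-- `Int(C)`. -/
def inner (C : Contour) : Set ℂ := innerOf C.toFun

/-- `z ∈ Int(C)` modulo `iπℤ`. -/
def InsideMod (C : Contour) (z : ℂ) : Prop := ∃ k : ℤ, z + k * (Real.pi * I) ∈ C.inner

/-- `z` lies neither on `C` nor inside `C`, modulo `iπℤ`. -/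
def OutsideMod (C : Contour) (z : ℂ) : Prop :=
  ∀ k : ℤ, z + k * (Real.pi * I) ∉ C.trace ∪ C.inner

open Classical in
/-- The indicator function of the domain bounded by `C`, modulo `iπℤ`. -/
def ind (C : Contour) (z : ℂ) : ℕ := if C.InsideMod z then 1 else 0

/-- `∮_C f(s) ds`. -/
def integral (C : Contour) (f : ℂ → ℂ) : ℂ := pathIntegral C.toFun (fun t => f (C.toFun t))

/-- `∮_C f(s) L(s) ds`, where the weight `L` is given as a function of the parameter on `C`. -/
def integralW (C : Contour) (L : ℝ → ℂ) (f : ℂ → ℂ) : ℂ :=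
  pathIntegral C.toFun (fun t => f (C.toFun t) * L t)

/-- The determination along `C` of `(2iπ)⁻¹ ln(1 + a)` that starts from `v / (2iπ)` at the base
point `κ = C(0)`: `(2iπ)⁻¹ (v + ∫_κ^s a'/(1+a))`. -/
def logAlong (C : Contour) (a : ℂ → ℂ) (v : ℂ) (t : ℝ) : ℂ :=
  (v + ∫ u in (0 : ℝ)..t,
    deriv a (C.toFun u) / (1 + a (C.toFun u)) * deriv C.toFun u) / (2 * Real.pi * I)

/-- The monodromy `∮_C a'/(1+a)`. -/
def monodromy (C : Contour) (a : ℂ → ℂ) : ℂ := C.integral (fun s => deriv a s / (1 + a s))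

end Contour

/-- The iterated integral `∮_{Γ 0} dω₀ ∮_{Γ 1} dω₁ ⋯ ∮_{Γ (m-1)} dω_{m-1} f(ω₀, …, ω_{m-1})`. -/
def nestedIntegral : (ℕ → Contour) → (m : ℕ) → ((Fin m → ℂ) → ℂ) → ℂ
  | _, 0, f => f Fin.elim0
  | Γ, m + 1, f =>
      (Γ 0).integral (fun w => nestedIntegral (fun j => Γ (j + 1)) m (fun v => f (Fin.cons w v)))

/-! ### The model at finite Trotter number -/

/-- Trotter number, anisotropy `Δ = cos ζ`, coupling, temperature, left boundary parameter. -/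
structure Params where
  N : ℕ
  ζ : ℝ
  J : ℝ
  T : ℝ
  ξm : ℂ

/-- `coth`. -/
def coth (z : ℂ) : ℂ := cosh z / sinh z

/-- The two-variable shorthand `sinh(s, s') = sinh(s + s') sinh(s - s')`. -/
def sinh₂ (s s' : ℂ) : ℂ := sinh (s + s') * sinh (s - s')

namespace Params

variable (P : Params)

/-- `iζ`. -/
def iζ : ℂ := I * P.ζ

/-- `β = J sinh(-iζ) / T`. -/
def β : ℂ := P.J * sinh (-P.iζ) / P.T

/-- `β / N`. -/
def b : ℂ := P.β / P.N

/-- The Bethe equations of the quantum transfer matrix in the sector of spin zero, at magnetic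
field `h`, for roots that are pairwise distinct modulo `iπ`. -/
def IsBethe (h : ℝ) (μ : Fin P.N → ℂ) : Prop :=
  (∀ p, -1 = exp (-(h / P.T : ℝ)) *
      (∏ k, sinh (P.iζ + μ k - μ p) / sinh (P.iζ + μ p - μ k)) *
      (sinh (μ p + P.b + P.iζ) * sinh (μ p - P.b) /
        (sinh (P.iζ - μ p + P.b) * sinh (μ p + P.b))) ^ P.N) ∧
  ∀ p q, p ≠ q → sinh (μ p - μ q) ≠ 0

/-- The counting function of `μ` at magnetic field `h`. -/
def countingFn (h : ℝ) (μ : Fin P.N → ℂ) (ξ : ℂ) : ℂ :=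
  exp (-(h / P.T : ℝ)) *
    (∏ k, sinh (P.iζ - ξ + μ k) / sinh (P.iζ + ξ - μ k)) *
    (sinh (ξ - P.b) * sinh (P.iζ + ξ + P.b) /
      (sinh (ξ + P.b) * sinh (P.iζ - ξ + P.b))) ^ P.N

/-- The partition function of the six-vertex model with a reflecting end, in Tsuchiya's
determinant form, at pairwise distinct inhomogeneities `ξ`. -/
def tsuchiya (ξ μ : Fin P.N → ℂ) : ℂ :=
  (∏ a, ∏ c, (sinh (ξ a + μ c) * sinh (ξ a - P.iζ + μ c)) *
      (sinh (ξ a - μ c) * sinh (ξ a - P.iζ - μ c))) /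
  (∏ a, ∏ c ∈ Finset.Ioi a, sinh (ξ a - ξ c) * sinh (ξ a + ξ c - P.iζ) *
      (sinh (μ c + μ a) * sinh (μ c - μ a))) *
  Matrix.det (Matrix.of fun a c : Fin P.N =>
    sinh (-P.iζ) * sinh (P.ξm + μ c) * sinh (2 * ξ a) /
      ((sinh (ξ a - P.iζ + μ c) * sinh (ξ a + μ c)) *
        (sinh (ξ a - P.iζ - μ c) * sinh (ξ a - μ c))))

/-- The inhomogeneities tend to the common value `-β/N` through pairwise distinct values. -/
def homogeneous : Filter (Fin P.N → ℂ) :=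
  𝓝[{ξ | ∀ a c, a < c → sinh (ξ a - ξ c) ≠ 0}] (fun _ => -P.b)

/-- The partition function at the coinciding inhomogeneities `-β/N`. -/
def Z (μ : Fin P.N → ℂ) : ℂ := limUnder P.homogeneous (fun ξ => P.tsuchiya ξ μ)

/-- `F⁽⁻⁾`. -/
def Fminus (h : ℝ) (μ : Fin P.N → ℂ) : ℂ := exp (-(P.N * h / (2 * P.T) : ℝ)) * P.Z μ

/-- The boundary factor. -/
def boundaryFactor (h h' : ℝ) (μ lam : Fin P.N → ℂ) : ℂ :=
  exp ((P.N * (h' - h) / (2 * P.T) : ℝ)) * (P.Fminus h' μ / P.Fminus h lam)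

/-! ### The series `F̂` of multiple contour integrals -/

/-- The kernel `Û(ω, ω')`; `L` is a determination of `(2iπ)⁻¹ ln(1 + â)` along `CU`. -/
def kernelU (h : ℝ) (CU : Contour) (L : ℝ → ℂ) (ω ω' : ℂ) : ℂ :=
  -exp (-(h / P.T : ℝ)) * sinh (2 * ω' - P.iζ) / (sinh (ω + ω') * sinh (ω - ω' - P.iζ)) *
  (sinh (ω' - P.b) * sinh (ω' + P.b - P.iζ) /
    (sinh (ω' + P.b) * sinh (ω' - P.b - P.iζ))) ^ P.N *
  exp (-CU.integralW L (fun s =>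
    coth (ω' + s) + coth (ω' - s) - coth (ω' + s - P.iζ) - coth (ω' - s - P.iζ)))

/-- The function `r̂(ω)`. -/
def funR (h : ℝ) (CU : Contour) (L : ℝ → ℂ) (ω : ℂ) : ℂ :=
  exp (-(2 * h / P.T : ℝ)) *
  (sinh (ω - P.b + P.iζ) * sinh (ω + P.b - P.iζ) /
    (sinh (ω + P.b + P.iζ) * sinh (ω - P.b - P.iζ))) ^ P.N *
  exp (-CU.integralW L (fun s =>
    coth (s + ω + P.iζ) + coth (ω - s + P.iζ) - coth (ω + s - P.iζ) - coth (ω - s - P.iζ)))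

/-- `(2iπ)^{-(m+1)} ∮⋯∮ g(r̂(ω_m)) Û(ω₀, ω₁) Û(ω₁, ω₂) ⋯ Û(ω_m, ω₀)` over the encased contours
`Γ 0 ⊃ ⋯ ⊃ Γ m` (addition in `Fin (m + 1)` is cyclic). -/
def cyclicIntegral (h : ℝ) (CU : Contour) (L : ℝ → ℂ) (Γ : ℕ → Contour) (m : ℕ) (g : ℂ → ℂ) : ℂ :=
  nestedIntegral Γ (m + 1) (fun ω =>
    g (P.funR h CU L (ω (Fin.last m))) *
      ∏ p : Fin (m + 1), P.kernelU h CU L (ω p) (ω (p + 1))) / (2 * Real.pi * I) ^ (m + 1)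

/-- The determination of `(2iπ)⁻¹ ln(1 + â)` along `CU` used in `Û` and `r̂` (these do not depend
on the choice of the determination). -/
def logU (h : ℝ) (μ : Fin P.N → ℂ) (CU : Contour) : ℝ → ℂ :=
  CU.logAlong (P.countingFn h μ) (log (1 + P.countingFn h μ (CU.toFun 0)))

/-- The series `F̂`. The sums over `n ≥ k` are written with `n = k + j`; in the second series the
index `k ≥ 1` is written `k + 1`. -/
def seriesF (h : ℝ) (μ : Fin P.N → ℂ) (CU : Contour) (Γ : ℕ → Contour) : ℂ :=
  (∑' k : ℕ, P.cyclicIntegral h CU (P.logU h μ CU) Γ (2 * k)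
      (fun r => ∑' j : ℕ, r ^ j / (2 * (k + j : ℕ) + 1))) -
  ∑' k : ℕ, P.cyclicIntegral h CU (P.logU h μ CU) Γ (2 * k + 1)
      (fun r => ∑' j : ℕ, r ^ j / (2 * (k + 1 + j : ℕ)))

/-- The contours used in `F̂`, and the convergence of the series. -/
structure SeriesContours (h : ℝ) (μ : Fin P.N → ℂ) (CU : Contour) (Γ : ℕ → Contour) : Prop where
  /-- The contours are encased. -/
  nested : ∀ p, (Γ (p + 1)).trace ∪ (Γ (p + 1)).inner ⊆ (Γ p).inner
  /-- They encircle the origin and the points `±μ_a`, -/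
  zero_mem : ∀ p, (0 : ℂ) ∈ (Γ p).inner
  roots : ∀ p a, (Γ p).InsideMod (μ a) ∧ (Γ p).InsideMod (-μ a)
  /-- but neither these points shifted by `±iζ` nor the half-period. -/
  shifted : ∀ p a, (Γ p).OutsideMod (μ a + P.iζ) ∧ (Γ p).OutsideMod (μ a - P.iζ) ∧
    (Γ p).OutsideMod (-μ a + P.iζ) ∧ (Γ p).OutsideMod (-μ a - P.iζ)
  half_period : ∀ p, (Γ p).OutsideMod (Real.pi * I / 2)
  /-- For `ω` on an outer contour, the poles `-ω` and `ω ± iζ` are outside of the inner ones. -/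
  poles : ∀ p q, p < q → ∀ ω ∈ (Γ p).trace, (Γ q).OutsideMod (-ω) ∧
    (Γ q).OutsideMod (ω + P.iζ) ∧ (Γ q).OutsideMod (ω - P.iζ)
  /-- `CU` encircles the origin, the pole `-β/N` and the roots `μ_a`, but no other zero and no
  other pole of `1 + â`; the latter has no monodromy along `CU`. -/
  U_zero_mem : (0 : ℂ) ∈ CU.inner
  U_pole_mem : -P.b ∈ CU.inner
  U_roots : ∀ a, CU.InsideMod (μ a)
  U_zeros : ∀ w ∈ CU.inner, P.countingFn h μ w = -1 → ∃ a, sinh (w - μ a) = 0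
  U_ne : ∀ s ∈ CU.trace, 1 + P.countingFn h μ s ≠ 0
  U_poles : CU.OutsideMod (P.iζ + P.b) ∧ ∀ a, CU.OutsideMod (μ a - P.iζ)
  U_monodromy : CU.monodromy (P.countingFn h μ) = 0
  /-- `CU` surrounds none of the points `±ω`, `±(ω + iζ)`, `±(ω - iζ)` with `ω` on some `Γ p`. -/
  U_out : ∀ p, ∀ ω ∈ (Γ p).trace, CU.OutsideMod ω ∧ CU.OutsideMod (-ω) ∧
    CU.OutsideMod (ω + P.iζ) ∧ CU.OutsideMod (-(ω + P.iζ)) ∧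
    CU.OutsideMod (ω - P.iζ) ∧ CU.OutsideMod (-(ω - P.iζ))
  /-- Convergence of the sums over `n` under the integrals. -/
  r_lt_one : ∀ p, ∀ ω ∈ (Γ p).trace, ‖P.funR h CU (P.logU h μ CU) ω‖ < 1
  /-- Absolute convergence of the two series, as double series over `k` and `n = k + j`. -/
  summable_odd : Summable (fun q : ℕ × ℕ => P.cyclicIntegral h CU (P.logU h μ CU) Γ (2 * q.1)
    (fun r => r ^ q.2 / (2 * (q.1 + q.2 : ℕ) + 1)))
  summable_even : Summable (fun q : ℕ × ℕ =>
    P.cyclicIntegral h CU (P.logU h μ CU) Γ (2 * q.1 + 1)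
      (fun r => r ^ q.2 / (2 * (q.1 + 1 + q.2 : ℕ))))

/-! ### The base contour and the particle-hole description of a state -/

/-- `C` encircles a neighbourhood of the origin that contains `±β/N`; the poles of the explicit
kernels are outside of `C`, apart from those at `0` and at `-ξ₋`. -/
structure BaseContour (C : Contour) : Prop where
  zero_mem : (0 : ℂ) ∈ C.inner
  b_mem : P.b ∈ C.inner
  neg_b_mem : -P.b ∈ C.inner
  half_period : C.OutsideMod (Real.pi * I / 2)
  half_shift : C.OutsideMod (P.iζ / 2) ∧ C.OutsideMod ((P.iζ - Real.pi * I) / 2)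
  shift : C.OutsideMod (P.iζ + P.b) ∧ C.OutsideMod (-(P.iζ + P.b))
  ξm_off : ∀ k : ℤ, -P.ξm + k * (Real.pi * I) ∉ C.trace

/-- The Bethe roots `μ` at magnetic field `h` are described, relatively to `C`, by the set `y` of
particles (the roots outside of `C`) and the set `x` of holes (the zeros of `1 + â` inside of `C`
that are not roots). There are no singular roots, and the contour has the required position
with respect to the negatives of the zeros. For `n = 0` the roots are exactly the zeros of `1 + â`
inside of `C`. -/
structure ParticleHole (h : ℝ) (μ : Fin P.N → ℂ) (C : Contour) {n : ℕ} (x y : Fin n → ℂ) :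
    Prop where
  off : ∀ a, μ a ∈ C.inner ∨ C.OutsideMod (μ a)
  y_injective : Function.Injective y
  y_range : ∀ w, (∃ j, y j = w) ↔ ∃ a, μ a = w ∧ C.OutsideMod w
  x_injective : Function.Injective x
  x_range : ∀ w, (∃ j, x j = w) ↔
    w ∈ C.inner ∧ P.countingFn h μ w = -1 ∧ ∀ a, μ a ≠ w
  ne_zero : ∀ s ∈ C.trace, 1 + P.countingFn h μ s ≠ 0
  monodromy : C.monodromy (P.countingFn h μ) = 0
  no_singular : ∀ a, C.OutsideMod (μ a - P.iζ)
  zeros_neg : ∀ w ∈ C.inner, P.countingFn h μ w = -1 →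
    -w ∈ C.inner ∧ C.OutsideMod (P.iζ - w)
  y_neg : ∀ j, C.OutsideMod (-y j) ∧ C.OutsideMod (P.iζ - y j)

/-- `C' ⊂ C` encircles the origin, the pole `-β/N` and the zeros of `1 + a` inside of `C`, but not
the points `-s` and `iζ - s` for `s` on `C`. -/
structure InnerContour (a : ℂ → ℂ) (C C' : Contour) : Prop where
  subset : C'.trace ∪ C'.inner ⊆ C.inner
  zero_mem : (0 : ℂ) ∈ C'.inner
  neg_b_mem : -P.b ∈ C'.inner
  zeros_mem : ∀ w ∈ C.inner, a w = -1 → w ∈ C'.inner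
  poles : ∀ s ∈ C.trace, C'.OutsideMod (-s) ∧ C'.OutsideMod (P.iζ - s)

/-! ### The right-hand side -/

/-- `f(λ, μ)`. -/
def f (l m : ℂ) : ℂ := sinh (l + m - P.iζ) / sinh (l + m)

/-- `φ₂⁽⁺⁾(s, s')`. -/
def φ₂ (s s' : ℂ) : ℂ := (deriv coth (s + s' - P.iζ) - deriv coth (s + s')) / 2

/-- `φ₁(s)`. -/
def φ₁ (s : ℂ) : ℂ := coth (2 * s - P.iζ) + coth (2 * s) - coth (s + P.ξm)

/-- The part `∏_{a<b} f(x_a, x_b) · ∏_a {1 + â(-x_a)}^{1/2}` of the particle-hole factor, with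
principal square roots. -/
def holeFactor (a : ℂ → ℂ) {n : ℕ} (x : Fin n → ℂ) : ℂ :=
  (∏ i, ∏ j ∈ Finset.Ioi i, P.f (x i) (x j)) * ∏ i, (1 + a (-x i)) ^ (1 / 2 : ℂ)

/-- The square of the same product after the point splitting `x_a + x_b → x_a + x_b + ε`,
`-x_a → -x_a - ε`. -/
def holeFactorSq (a : ℂ → ℂ) {n : ℕ} (x : Fin n → ℂ) (ε : ℂ) : ℂ :=
  (∏ i, ∏ j ∈ Finset.Ioi i, P.f (x i) (x j + ε)) ^ 2 * ∏ i, (1 + a (-x i - ε))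

/-- `H` is a determination of the hole factor: its square is the limit, when the point splitting
is removed, of the square of the point-split hole factor. When no `1 + â(-x_a)` vanishes this says
`H ^ 2 = holeFactor ^ 2`; when `x_a + x_b = 0`, the factors `f(x_a, x_b)`, `{1 + â(-x_a)}^{1/2}` and
`{1 + â(-x_b)}^{1/2}` are infinite, zero and zero, and have to be read together. -/
def IsHoleFactor (a : ℂ → ℂ) {n : ℕ} (x : Fin n → ℂ) (H : ℂ) : Prop :=
  Tendsto (P.holeFactorSq a x) (𝓝[≠] 0) (𝓝 (H ^ 2))

/-- The particle-hole factor `K_N⁽¹⁾`, in which `H` is the hole factor and `L` a determination of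
`(2iπ)⁻¹ ln(1 + â)` along `C`. -/
def K₁ (a : ℂ → ℂ) (C : Contour) (L : ℝ → ℂ) {n : ℕ} (x y : Fin n → ℂ) (H : ℂ) : ℂ :=
  H * (∏ i, ∏ j ∈ Finset.Ioi i, P.f (y i) (y j)) / (∏ i, ∏ j, P.f (x i) (y j)) *
  (∏ i, sinh (y i + P.ξm) / sinh (x i + P.ξm) * (sinh (2 * x i - P.iζ) / sinh (2 * y i)) *
    (1 + a (-y i)) ^ (1 / 2 : ℂ)) *
  (∏ i, (sinh₂ (P.iζ + P.b) (y i) / sinh₂ (P.iζ + P.b) (x i)) ^ P.N) *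
  ((∏ i, exp (-C.integralW L (logDeriv fun s => P.f s (y i)))) /
    ∏ i, exp (-C.integralW L (logDeriv fun s => P.f s (x i))))

/-- The right-hand side of the representation of the boundary factor. `aY`, `aE` are the counting
functions of the two states, `FY`, `FE` the values of the series `F̂`; `vY`, `vE` are the values at
the base point of `C` of the logarithms of `1 + aY`, `1 + aE` along `C`. Along `C'` the principal
value at the base point is taken (the double integral does not depend on this choice). -/
def rhs (aY aE : ℂ → ℂ) (FY FE : ℂ) (C C' : Contour) {n : ℕ} (x y : Fin n → ℂ)
    (H vY vE : ℂ) : ℂ :=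
  let LY := C.logAlong aY vY
  let LE := C.logAlong aE vE
  let LY' := C'.logAlong aY (log (1 + aY (C'.toFun 0)))
  let LE' := C'.logAlong aE (log (1 + aE (C'.toFun 0)))
  exp (FY - FE) *
  ((1 - aE 0 ^ 2) / (1 - aY 0 ^ 2)) ^ (1 / 4 : ℂ) *
  ((1 + aY (-P.ξm)) / (1 + aE (-P.ξm))) ^ C.ind (-P.ξm) *
  P.K₁ aY C LY x y H *
  exp (pathIntegral C.toFun (fun t => pathIntegral C'.toFun (fun t' =>
        P.φ₂ (C.toFun t) (C'.toFun t') * (LY t * LY' t' - LE t * LE' t'))) +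
    C.integralW (fun t => LY t - LE t) P.φ₁ -
    P.N * C.integralW (fun t => LY t - LE t) (logDeriv fun s => sinh₂ s (P.iζ + P.b)))

/-- Sufficient conditions for the principal determinations to be the right ones: `Int(C)` is
symmetric about the origin and disjoint modulo `iπ` from its translate by `iζ`; and, along `C`,
`1 + â` avoids `]-∞, 0]` and `|r̂| < 1`, where `r̂` is given as a product over the roots. -/
structure Principal (h : ℝ) (μ : Fin P.N → ℂ) (C : Contour) : Prop where
  symm : ∀ w ∈ C.inner, -w ∈ C.inner
  shift : ∀ w ∈ C.inner, C.OutsideMod (P.iζ - w)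
  slit : ∀ s ∈ C.trace, 1 + P.countingFn h μ s ∈ slitPlane
  r_lt_one : ∀ s ∈ C.trace, ‖exp (-(2 * h / P.T : ℝ)) *
    ∏ k, sinh (μ k + s + P.iζ) * sinh (μ k - s + P.iζ) /
      (sinh (μ k + s - P.iζ) * sinh (μ k - s - P.iζ))‖ < 1

end Params

end BoundaryXXZ

end

namespace BoundaryXXZ

namespace Contour

open MeasureTheory Set
open scoped Interval

variable (C : Contour)

/-- The closed domain bounded by the contour. -/
def hull : Set ℂ := C.trace ∪ C.inner

theorem mem_trace {t : ℝ} (ht : t ∈ Icc (0 : ℝ) 1) : C.toFun t ∈ C.trace := ⟨t, ht, rfl⟩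

theorem inner_subset_hull : C.inner ⊆ C.hull := subset_union_right

theorem isCompact_trace : IsCompact C.trace := isCompact_Icc.image_of_continuousOn C.continuousOn

theorem intervalIntegrable_mul_deriv {g : ℝ → ℂ} (hg : ContinuousOn g (Icc 0 1)) :
    IntervalIntegrable (fun t => g t * deriv C.toFun t) volume 0 1 := by
  obtain ⟨B, hB⟩ := C.bounded_deriv
  obtain ⟨A, hA⟩ := isCompact_Icc.exists_bound_of_continuousOn hg
  rw [intervalIntegrable_iff_integrableOn_Ioo_of_le zero_le_one]
  refine IntegrableOn.of_bound (by simp) ?_ (A * B) ?_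
  · exact ((hg.mono Ioo_subset_Icc_self).aestronglyMeasurable measurableSet_Ioo).mul
      (aestronglyMeasurable_deriv _ _)
  · have h0 : ∀ᵐ t : ℝ, t ∉ (C.breaks : Set ℝ) :=
      measure_eq_zero_iff_ae_notMem.1 (C.breaks.finite_toSet.measure_zero volume)
    filter_upwards [ae_restrict_mem measurableSet_Ioo, ae_restrict_of_ae h0] with t ht htb
    rw [norm_mul]
    have h1 := hA t (Ioo_subset_Icc_self ht)
    have h2 := hB t ht (by simpa using htb)
    exact mul_le_mul h1 h2 (norm_nonneg _) ((norm_nonneg _).trans h1)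

/-- Two weights that agree on `[0, 1]` have the same integral. -/
theorem pathIntegral_congr {γ g g' : ℝ → ℂ} (h : ∀ t ∈ Icc (0 : ℝ) 1, g t = g' t) :
    pathIntegral γ g = pathIntegral γ g' := by
  apply intervalIntegral.integral_congr
  intro t ht
  rw [uIcc_of_le zero_le_one] at ht
  simp only [h t ht]

theorem pathIntegral_add {g g' : ℝ → ℂ} (hg : ContinuousOn g (Icc 0 1))
    (hg' : ContinuousOn g' (Icc 0 1)) :
    pathIntegral C.toFun (fun t => g t + g' t)
      = pathIntegral C.toFun g + pathIntegral C.toFun g' := by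
  unfold pathIntegral
  rw [← intervalIntegral.integral_add (C.intervalIntegrable_mul_deriv hg)
    (C.intervalIntegrable_mul_deriv hg')]
  simp only [add_mul]

theorem pathIntegral_const_mul (γ : ℝ → ℂ) (c : ℂ) (g : ℝ → ℂ) :
    pathIntegral γ (fun t => c * g t) = c * pathIntegral γ g := by
  unfold pathIntegral
  rw [← intervalIntegral.integral_const_mul]
  simp only [mul_assoc]

theorem pathIntegral_sub {g g' : ℝ → ℂ} (hg : ContinuousOn g (Icc 0 1))
    (hg' : ContinuousOn g' (Icc 0 1)) :
    pathIntegral C.toFun (fun t => g t - g' t)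
      = pathIntegral C.toFun g - pathIntegral C.toFun g' := by
  unfold pathIntegral
  rw [← intervalIntegral.integral_sub (C.intervalIntegrable_mul_deriv hg)
    (C.intervalIntegrable_mul_deriv hg')]
  simp only [sub_mul]

theorem pathIntegral_sum {ι : Type*} (s : Finset ι) {g : ι → ℝ → ℂ}
    (hg : ∀ i ∈ s, ContinuousOn (g i) (Icc 0 1)) :
    pathIntegral C.toFun (fun t => ∑ i ∈ s, g i t) = ∑ i ∈ s, pathIntegral C.toFun (g i) := by
  unfold pathIntegral
  rw [← intervalIntegral.integral_finsetSum
    (fun i hi => C.intervalIntegrable_mul_deriv (hg i hi))]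
  simp only [Finset.sum_mul]

/-- The fundamental theorem of calculus along a contour. -/
theorem pathIntegral_eq_sub {F g : ℝ → ℂ} (hF : ContinuousOn F (Icc 0 1))
    (hg : ContinuousOn g (Icc 0 1))
    (hd : ∀ t ∈ Ioo (0 : ℝ) 1, t ∉ C.breaks → HasDerivAt F (g t * deriv C.toFun t) t) :
    pathIntegral C.toFun g = F 1 - F 0 :=
  integral_eq_of_hasDerivAt_off_countable_of_le F _ zero_le_one C.breaks.countable_toSet hF
    (fun t ht => hd t ht.1 (by simpa using ht.2)) (C.intervalIntegrable_mul_deriv hg)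

theorem hasDerivAt_toFun {t : ℝ} (ht : t ∈ Ioo (0 : ℝ) 1) (hb : t ∉ C.breaks) :
    HasDerivAt C.toFun (deriv C.toFun t) t := (C.differentiableAt t ht hb).hasDerivAt

theorem continuousOn_comp {f : ℂ → ℂ} (hf : ∀ s ∈ C.trace, ContinuousAt f s) :
    ContinuousOn (fun t => f (C.toFun t)) (Icc 0 1) := fun t ht =>
  (hf _ (C.mem_trace ht)).comp_continuousWithinAt (C.continuousOn t ht)

/-- The integral along the contour is a bounded functional of the weight. -/
theorem exists_norm_pathIntegral_le :
    ∃ B : ℝ, 0 < B ∧ ∀ (g : ℝ → ℂ) (A : ℝ), 0 ≤ A → (∀ t ∈ Icc (0 : ℝ) 1, ‖g t‖ ≤ A) →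
      ‖pathIntegral C.toFun g‖ ≤ A * B := by
  obtain ⟨B, hB⟩ := C.bounded_deriv
  refine ⟨max B 1, by positivity, fun g A hA0 hA => ?_⟩
  have h0 : ∀ᵐ t : ℝ, t ∉ (C.breaks : Set ℝ) :=
      measure_eq_zero_iff_ae_notMem.1 (C.breaks.finite_toSet.measure_zero volume)
  have h1 : ∀ᵐ t : ℝ, t ≠ 1 := by
    have : ({1} : Set ℝ).Finite := finite_singleton 1
    simpa using measure_eq_zero_iff_ae_notMem.1 (this.measure_zero volume)
  have := intervalIntegral.norm_integral_le_of_norm_le_const_ae (a := (0 : ℝ)) (b := 1)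
    (C := A * max B 1) (f := fun t => g t * deriv C.toFun t) ?_
  · simpa [pathIntegral] using this
  · filter_upwards [h0, h1] with t htb ht1 ht
    rw [uIoc_of_le zero_le_one] at ht
    have ht' : t ∈ Ioo (0 : ℝ) 1 := ⟨ht.1, lt_of_le_of_ne ht.2 ht1⟩
    rw [norm_mul]
    exact mul_le_mul (hA t ⟨ht.1.le, ht.2⟩) ((hB t ht' (by simpa using htb)).trans (le_max_left _ _))
      (norm_nonneg _) hA0

/-- Integrals over the contour depend continuously on parameters. -/
theorem continuousAt_integralW {X : Type*} [TopologicalSpace X] {x₀ : X} {L : ℝ → ℂ}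
    (hL : ContinuousOn L (Icc 0 1)) {g : X → ℂ → ℂ}
    (hc : ∀ᶠ x in 𝓝 x₀, ∀ s ∈ C.trace, ContinuousAt (g x) s)
    (hg : ∀ s ∈ C.trace, ContinuousAt (fun p : X × ℂ => g p.1 p.2) (x₀, s)) :
    ContinuousAt (fun x => C.integralW L (g x)) x₀ := by
  obtain ⟨B, hB0, hB⟩ := C.exists_norm_pathIntegral_le
  obtain ⟨A, hA⟩ := isCompact_Icc.exists_bound_of_continuousOn hL
  have hA0 : 0 ≤ A := (norm_nonneg _).trans (hA 0 (by simp))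
  have hslice := hc.self_of_nhds
  rw [ContinuousAt, Metric.tendsto_nhds]
  intro ε hε
  have hε' : 0 < ε / ((A + 1) * B + 1) := by positivity
  have key : ∀ᶠ x in 𝓝 x₀, ∀ s ∈ C.trace, ‖g x s - g x₀ s‖ < ε / ((A + 1) * B + 1) := by
    refine C.isCompact_trace.eventually_forall_of_forall_eventually fun s hs => ?_
    have h1 : Tendsto (fun p : X × ℂ => g p.1 p.2 - g x₀ p.2) (𝓝 (x₀, s)) (𝓝 0) := by
      have h2 : ContinuousAt (fun p : X × ℂ => g x₀ p.2) (x₀, s) :=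
        ContinuousAt.comp (g := g x₀) (f := Prod.snd) (hslice s hs) continuousAt_snd
      have h3 : Tendsto (fun p : X × ℂ => g p.1 p.2 - g x₀ p.2) (𝓝 (x₀, s))
          (𝓝 (g x₀ s - g x₀ s)) := (hg s hs).sub h2
      rwa [sub_self] at h3
    have := h1.norm
    rw [norm_zero] at this
    exact this.eventually_lt_const hε'
  filter_upwards [key, hc] with x hx hcx
  have h1 := C.pathIntegral_sub (g := fun t => g x (C.toFun t) * L t)
    (g' := fun t => g x₀ (C.toFun t) * L t) ((C.continuousOn_comp hcx).mul hL)
    ((C.continuousOn_comp hslice).mul hL)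
  rw [dist_eq_norm, integralW, integralW, ← h1]
  refine lt_of_le_of_lt (hB _ (ε / ((A + 1) * B + 1) * (A + 1)) (by positivity) ?_) ?_
  · intro t ht
    rw [← sub_mul, norm_mul]
    exact mul_le_mul (hx _ (C.mem_trace ht)).le ((hA t ht).trans (by linarith)) (norm_nonneg _)
      hε'.le
  · rw [div_mul_eq_mul_div, div_mul_eq_mul_div, div_lt_iff₀ (by positivity)]
    nlinarith [mul_pos (by linarith : 0 < A + 1) hB0]

theorem integral_eq_integralW (f : ℂ → ℂ) : C.integral f = C.integralW (fun _ => 1) f := by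
  simp [integral, integralW]

/-- Integrals over the contour depend holomorphically on parameters. -/
theorem hasDerivAt_integralW {U : Set ℂ} (hU : IsOpen U) {L : ℝ → ℂ}
    (hL : ContinuousOn L (Icc 0 1)) {g : ℂ → ℂ → ℂ}
    (hg : ∀ z ∈ U, ∀ s ∈ C.trace, ContinuousAt (fun p : ℂ × ℂ => g p.1 p.2) (z, s))
    (hd : ∀ s ∈ C.trace, DifferentiableOn ℂ (fun z => g z s) U) {z₀ : ℂ} (hz₀ : z₀ ∈ U) :
    HasDerivAt (fun z => C.integralW L (g z))
      (C.integralW L (fun s => deriv (fun z => g z s) z₀)) z₀ := by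
  have hslice : ∀ z ∈ U, ∀ s ∈ C.trace, ContinuousAt (g z) s := fun z hz s hs =>
    (hg z hz s hs).comp (f := fun s => (z, s)) (by fun_prop)
  obtain ⟨ρ, hρ, hball⟩ := Metric.nhds_basis_closedBall.mem_iff.1 (hU.mem_nhds hz₀)
  -- a uniform bound on `g`
  obtain ⟨M, hM⟩ : ∃ M, ∀ p ∈ Metric.closedBall z₀ ρ ×ˢ C.trace, ‖g p.1 p.2‖ ≤ M :=
    ((isCompact_closedBall z₀ ρ).prod C.isCompact_trace).exists_bound_of_continuousOn
      fun p hp => (hg p.1 (hball hp.1) p.2 hp.2).continuousWithinAt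
  have hbound : ∀ z ∈ Metric.ball z₀ (ρ / 2), ∀ s ∈ C.trace,
      ‖deriv (fun z => g z s) z‖ ≤ M / (ρ / 2) := by
    intro z hz s hs
    have hsub : Metric.closedBall z (ρ / 2) ⊆ Metric.closedBall z₀ ρ := by
      refine Metric.closedBall_subset_closedBall' ?_
      have := Metric.mem_ball.1 hz
      linarith
    refine norm_deriv_le_of_forall_mem_sphere_norm_le (by positivity) ?_ ?_
    · refine DifferentiableOn.diffContOnCl ?_
      rw [closure_ball _ (by positivity)]
      exact (hd s hs).mono (hsub.trans hball)
    · intro w hw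
      exact hM (w, s) ⟨hsub (Metric.sphere_subset_closedBall hw), hs⟩
  have hdiff : ∀ z ∈ Metric.ball z₀ (ρ / 2), ∀ s ∈ C.trace,
      HasDerivAt (fun z => g z s) (deriv (fun z => g z s) z) z := by
    intro z hz s hs
    have : z ∈ U := hball (Metric.ball_subset_closedBall
      (Metric.ball_subset_ball (by linarith) hz))
    exact ((hd s hs).differentiableAt (hU.mem_nhds this)).hasDerivAt
  obtain ⟨A, hA⟩ := isCompact_Icc.exists_bound_of_continuousOn hL
  have hA0 : 0 ≤ A := (norm_nonneg _).trans (hA 0 (by simp))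
  have hM0 : 0 ≤ M := (norm_nonneg _).trans
    (hM (z₀, C.toFun 0) ⟨Metric.mem_closedBall_self hρ.le, C.mem_trace (by simp)⟩)
  have hII : ∀ z ∈ U, IntervalIntegrable (fun t => g z (C.toFun t) * L t * deriv C.toFun t)
      volume 0 1 := fun z hz =>
    C.intervalIntegrable_mul_deriv ((C.continuousOn_comp (hslice z hz)).mul hL)
  have hmem : ∀ t ∈ Ι (0 : ℝ) 1, t ∈ Icc (0 : ℝ) 1 := fun t ht => by
    rw [uIoc_of_le zero_le_one] at ht
    exact ⟨ht.1.le, ht.2⟩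
  have := intervalIntegral.hasDerivAt_integral_of_dominated_loc_of_deriv_le
    (μ := volume) (a := 0) (b := 1)
    (F := fun z t => g z (C.toFun t) * L t * deriv C.toFun t)
    (F' := fun z t => deriv (fun z => g z (C.toFun t)) z * L t * deriv C.toFun t)
    (bound := fun t => ‖(M / (ρ / 2) * A : ℂ) * deriv C.toFun t‖)
    (Metric.ball_mem_nhds z₀ (half_pos hρ)) ?_ (hII z₀ hz₀) ?_ ?_ ?_ ?_
  · exact this.2
  · filter_upwards [hU.mem_nhds hz₀] with z hz
    exact (intervalIntegrable_iff.1 (hII z hz)).aestronglyMeasurable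
  · have hseq : Tendsto (fun n : ℕ => (1 / ((n : ℂ) + 1))) atTop (𝓝[≠] 0) := by
      rw [tendsto_nhdsWithin_iff]
      refine ⟨tendsto_one_div_add_atTop_nhds_zero_nat, Eventually.of_forall fun n => ?_⟩
      have : (n : ℂ) + 1 ≠ 0 := by exact_mod_cast n.succ_ne_zero
      simpa using this
    have hlim : AEStronglyMeasurable (fun t => deriv (fun z => g z (C.toFun t)) z₀)
        (volume.restrict (Ι (0 : ℝ) 1)) := by
      have hev : ∀ᶠ n : ℕ in atTop, z₀ + 1 / ((n : ℂ) + 1) ∈ U := by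
        have : Tendsto (fun n : ℕ => z₀ + 1 / ((n : ℂ) + 1)) atTop (𝓝 (z₀ + 0)) :=
          tendsto_const_nhds.add (hseq.mono_right nhdsWithin_le_nhds)
        rw [add_zero] at this
        exact this.eventually (hU.mem_nhds hz₀)
      obtain ⟨n₀, hn₀⟩ := eventually_atTop.1 hev
      refine aestronglyMeasurable_of_tendsto_ae atTop
        (f := fun (n : ℕ) t => (1 / (((n + n₀ : ℕ) : ℂ) + 1))⁻¹ •
          (g (z₀ + 1 / (((n + n₀ : ℕ) : ℂ) + 1)) (C.toFun t) - g z₀ (C.toFun t))) ?_ ?_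
      · intro n
        have hc1 := C.continuousOn_comp (hslice _ (hn₀ (n + n₀) (by omega)))
        have hc2 := C.continuousOn_comp (hslice _ hz₀)
        have hcont : ∀ c : ℂ, ContinuousOn (fun t => c •
            (g (z₀ + 1 / (((n + n₀ : ℕ) : ℂ) + 1)) (C.toFun t) - g z₀ (C.toFun t))) (Icc 0 1) :=
          fun c => continuousOn_const.mul (hc1.sub hc2)
        rw [uIoc_of_le zero_le_one]
        exact ((hcont _).mono Ioc_subset_Icc_self).aestronglyMeasurable measurableSet_Ioc
      · filter_upwards [ae_restrict_mem measurableSet_uIoc] with t ht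
        have h1 := hdiff z₀ (Metric.mem_ball_self (by positivity)) _ (C.mem_trace (hmem t ht))
        rw [hasDerivAt_iff_tendsto_slope_zero] at h1
        exact (h1.comp hseq).comp (tendsto_add_atTop_nat n₀)
    refine (hlim.mul ?_).mul (aestronglyMeasurable_deriv _ _)
    rw [uIoc_of_le zero_le_one]
    exact (hL.mono Ioc_subset_Icc_self).aestronglyMeasurable measurableSet_Ioc
  · refine Eventually.of_forall fun t ht z hz => ?_
    rw [norm_mul, norm_mul, norm_mul]
    refine mul_le_mul_of_nonneg_right ?_ (norm_nonneg _)
    have e : ‖(M / (ρ / 2) * A : ℂ)‖ = M / (ρ / 2) * A := by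
      rw [show (M / (ρ / 2) * A : ℂ) = ((M / (ρ / 2) * A : ℝ) : ℂ) by push_cast; ring,
        Complex.norm_real, Real.norm_of_nonneg (by positivity)]
    rw [e]
    exact mul_le_mul (hbound z hz _ (C.mem_trace (hmem t ht))) (hA t (hmem t ht)) (norm_nonneg _)
      (by positivity)
  · exact (C.intervalIntegrable_mul_deriv continuousOn_const).norm
  · refine Eventually.of_forall fun t ht z hz => ?_
    exact ((hdiff z hz _ (C.mem_trace (hmem t ht))).mul_const _).mul_const _

theorem differentiableOn_integralW {U : Set ℂ} (hU : IsOpen U) {L : ℝ → ℂ}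
    (hL : ContinuousOn L (Icc 0 1)) {g : ℂ → ℂ → ℂ}
    (hg : ∀ z ∈ U, ∀ s ∈ C.trace, ContinuousAt (fun p : ℂ × ℂ => g p.1 p.2) (z, s))
    (hd : ∀ s ∈ C.trace, DifferentiableOn ℂ (fun z => g z s) U) :
    DifferentiableOn ℂ (fun z => C.integralW L (g z)) U := fun _ hz =>
  (C.hasDerivAt_integralW hU hL hg hd hz).differentiableAt.differentiableWithinAt

end Contour

namespace Contour

open MeasureTheory Set
open scoped Interval

variable (C : Contour)

theorem pathIntegral_sub_inv_eq_integralW (z : ℂ) :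
    pathIntegral C.toFun (fun t => 1 / (C.toFun t - z))
      = C.integralW (fun _ => 1) (fun s => 1 / (s - z)) := by simp [integralW]

theorem winding_continuousAt {z : ℂ} (hz : z ∉ C.trace) :
    ContinuousAt (fun z => pathIntegral C.toFun (fun t => 1 / (C.toFun t - z))) z := by
  simp only [pathIntegral_sub_inv_eq_integralW]
  refine C.continuousAt_integralW continuousOn_const ?_ ?_
  · filter_upwards [C.isCompact_trace.isClosed.isOpen_compl.mem_nhds hz] with x hx s hs
    have : s - x ≠ 0 := sub_ne_zero.2 fun h => hx (h ▸ hs)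
    fun_prop (disch := assumption)
  · intro s hs
    have : s - z ≠ 0 := sub_ne_zero.2 fun h => hz (h ▸ hs)
    fun_prop (disch := assumption)

/-- The winding number is locally constant off the contour. -/
theorem eventually_winding_eq {z : ℂ} (hz : z ∉ C.trace) :
    ∀ᶠ w in 𝓝 z, w ∉ C.trace ∧ (w ∈ C.inner ↔ z ∈ C.inner) := by
  have h0 : ∀ᶠ w in 𝓝 z, w ∉ C.trace := C.isCompact_trace.isClosed.isOpen_compl.mem_nhds hz
  have hpi : (2 * Real.pi * I : ℂ) ≠ 0 := two_pi_I_ne_zero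
  have h1 := C.winding_continuousAt hz
  by_cases hin : z ∈ C.inner
  · have h2 := h1.eventually_ne (y := 0) (by rw [hin.2]; exact hpi)
    filter_upwards [h0, h2] with w hw hw2
    exact ⟨hw, fun _ => hin, fun _ => ⟨hw, (C.positive w hw).resolve_left hw2⟩⟩
  · have h2 := h1.eventually_ne (y := 2 * Real.pi * I) fun h => hin ⟨hz, h⟩
    filter_upwards [h0, h2] with w hw hw2
    exact ⟨hw, fun h => absurd h.2 hw2, fun h => absurd h hin⟩

theorem isOpen_inner : IsOpen C.inner := isOpen_iff_mem_nhds.2 fun z hz => by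
  filter_upwards [C.eventually_winding_eq hz.1] with w hw using hw.2.2 hz

theorem notMem_trace_of_notMem_hull {z : ℂ} (hz : z ∉ C.hull) : z ∉ C.trace :=
  fun h => hz (Or.inl h)

theorem isClosed_hull : IsClosed C.hull := by
  rw [← isOpen_compl_iff, isOpen_iff_mem_nhds]
  intro z hz
  filter_upwards [C.eventually_winding_eq (C.notMem_trace_of_notMem_hull hz)] with w hw h
  rcases h with h | h
  · exact hw.1 h
  · exact hz (Or.inr (hw.2.1 h))

/-- The winding number vanishes outside of the contour. -/
theorem winding_eq_zero {z : ℂ} (hz : z ∉ C.hull) :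
    pathIntegral C.toFun (fun t => 1 / (C.toFun t - z)) = 0 :=
  (C.positive z (C.notMem_trace_of_notMem_hull hz)).resolve_right
    fun h => hz (Or.inr ⟨C.notMem_trace_of_notMem_hull hz, h⟩)

theorem exists_trace_bound : ∃ R : ℝ, 0 < R ∧ ∀ s ∈ C.trace, ‖s‖ ≤ R := by
  obtain ⟨R, hR⟩ := C.isCompact_trace.isBounded.exists_norm_le
  exact ⟨max R 1, by positivity, fun s hs => (hR s hs).trans (le_max_left _ _)⟩

/-- Cauchy transforms vanish at infinity. -/
theorem tendsto_cauchyTransform {f : ℂ → ℂ} (hf : ∀ s ∈ C.trace, ContinuousAt f s) :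
    Tendsto (fun z => C.integral (fun s => f s / (s - z))) (cocompact ℂ) (𝓝 0) := by
  obtain ⟨B, hB0, hB⟩ := C.exists_norm_pathIntegral_le
  obtain ⟨R, hR0, hR⟩ := C.exists_trace_bound
  obtain ⟨A, hA⟩ := C.isCompact_trace.exists_bound_of_continuousOn
    fun s hs => (hf s hs).continuousWithinAt
  have hA0 : 0 ≤ A := (norm_nonneg _).trans (hA _ (C.mem_trace (t := 0) (by simp)))
  have hlim : Tendsto (fun z : ℂ => A / (‖z‖ - R) * B) (cocompact ℂ) (𝓝 0) := by
    have h1 : Tendsto (fun z : ℂ => ‖z‖ - R) (cocompact ℂ) atTop :=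
      tendsto_atTop_add_const_right _ _ tendsto_norm_cocompact_atTop
    simpa using (h1.const_div_atTop A).mul_const B
  refine squeeze_zero_norm' ?_ hlim
  have h2 : ∀ᶠ z : ℂ in cocompact ℂ, R + 1 ≤ ‖z‖ :=
    tendsto_norm_cocompact_atTop.eventually_ge_atTop _
  filter_upwards [h2] with z hz
  refine hB _ _ (div_nonneg hA0 (by linarith)) fun t ht => ?_
  have hs := C.mem_trace ht
  rw [norm_div]
  have h3 : ‖z‖ - R ≤ ‖C.toFun t - z‖ := by
    have h4 := norm_sub_norm_le z (C.toFun t)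
    rw [norm_sub_rev] at h4
    linarith [hR _ hs]
  exact div_le_div₀ hA0 (hA _ hs) (by linarith) h3

theorem isBounded_hull : Bornology.IsBounded C.hull := by
  have h := C.tendsto_cauchyTransform (f := fun _ => 1) fun s _ => continuousAt_const
  have h1 : ∀ᶠ z in cocompact ℂ, z ∉ C.trace := C.isCompact_trace.compl_mem_cocompact
  have h2 := h.eventually_ne (b₂ := 2 * Real.pi * I) two_pi_I_ne_zero.symm
  have h3 : ∀ᶠ z in cocompact ℂ, z ∉ C.hull := by
    filter_upwards [h1, h2] with z hz hz2 hz3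
    rcases hz3 with h | h
    · exact hz h
    · exact hz2 h.2
  rw [← Metric.cobounded_eq_cocompact] at h3
  simpa using! h3

theorem isCompact_hull : IsCompact C.hull :=
  Metric.isCompact_of_isClosed_isBounded C.isClosed_hull C.isBounded_hull

theorem continuousAt_dslope_uncurry {f : ℂ → ℂ} {z s : ℂ} (hz : AnalyticAt ℂ f z)
    (hs : AnalyticAt ℂ f s) : ContinuousAt (fun p : ℂ × ℂ => dslope f p.1 p.2) (z, s) := by
  by_cases h : z = s
  · subst h
    have h1 := hz.hasStrictDerivAt.hasStrictFDerivAt.isLittleO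
    rw [ContinuousAt, dslope_same]
    have h2 : Tendsto (fun p : ℂ × ℂ => deriv f p.1) (𝓝 (z, z)) (𝓝 (deriv f z)) :=
      (hz.deriv.continuousAt).tendsto.comp continuousAt_fst
    rw [Asymptotics.isLittleO_iff] at h1
    rw [Metric.tendsto_nhds] at h2 ⊢
    intro ε hε
    filter_upwards [h1 (half_pos hε), h2 ε hε] with p hp1 hp2
    have hp3 : ‖f p.1 - f p.2 - (p.1 - p.2) • deriv f z‖ ≤ ε / 2 * ‖p.1 - p.2‖ := by
      simpa using hp1
    by_cases hp : p.2 = p.1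
    · rw [hp, dslope_same]; exact hp2
    · rw [dslope_of_ne _ hp, slope_def_field, dist_eq_norm]
      have h3 : p.2 - p.1 ≠ 0 := sub_ne_zero.2 hp
      have h4 : (f p.2 - f p.1) / (p.2 - p.1) - deriv f z
          = (f p.1 - f p.2 - (p.1 - p.2) • deriv f z) / (p.1 - p.2) := by
        have h5 : p.1 - p.2 ≠ 0 := sub_ne_zero.2 (Ne.symm hp)
        rw [smul_eq_mul]
        field_simp
        ring
      rw [h4, norm_div]
      have h5 : 0 < ‖p.1 - p.2‖ := norm_pos_iff.2 (sub_ne_zero.2 (Ne.symm hp))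
      rw [div_lt_iff₀ h5]
      nlinarith
  · have hne : ∀ᶠ p : ℂ × ℂ in 𝓝 (z, s), p.2 ≠ p.1 := by
      have : ContinuousAt (fun p : ℂ × ℂ => p.2 - p.1) (z, s) := by fun_prop
      filter_upwards [this.eventually_ne (y := 0) (sub_ne_zero.2 (Ne.symm h))] with p hp
      exact sub_ne_zero.1 hp
    have h1 : ContinuousAt (fun p : ℂ × ℂ => (f p.2 - f p.1) / (p.2 - p.1)) (z, s) := by
      have a1 : ContinuousAt (fun p : ℂ × ℂ => f p.2) (z, s) :=
        ContinuousAt.comp (g := f) (f := Prod.snd) hs.continuousAt continuousAt_snd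
      have a2 : ContinuousAt (fun p : ℂ × ℂ => f p.1) (z, s) :=
        ContinuousAt.comp (g := f) (f := Prod.fst) hz.continuousAt continuousAt_fst
      exact (a1.sub a2).div (by fun_prop) (sub_ne_zero.2 (Ne.symm h))
    refine h1.congr ?_
    filter_upwards [hne] with p hp
    rw [dslope_of_ne _ hp, slope_def_field]

theorem dslope_symm (f : ℂ → ℂ) (z s : ℂ) : dslope f z s = dslope f s z := by
  by_cases h : z = s
  · rw [h]
  · rw [dslope_of_ne _ h, dslope_of_ne _ (Ne.symm h), slope_comm]

/-- **Cauchy's theorem**, homology version (Dixon's proof). -/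
theorem integral_eq_zero {f : ℂ → ℂ} (hf : ∀ s ∈ C.hull, AnalyticAt ℂ f s) :
    C.integral f = 0 := by
  set Ω : Set ℂ := {s | AnalyticAt ℂ f s} with hΩdef
  have hΩ : IsOpen Ω := isOpen_analyticAt ℂ f
  -- the statement for difference quotients
  have main : ∀ F : ℂ → ℂ, (∀ s ∈ Ω, AnalyticAt ℂ F s) → ∀ z ∈ Ω,
      C.integral (dslope F z) = 0 := by
    intro F hF
    have hFt : ∀ s ∈ C.trace, AnalyticAt ℂ F s := fun s hs => hF s (hf s (Or.inl hs))
    classical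
    let H : ℂ → ℂ := fun z => if z ∈ Ω then C.integral (dslope F z)
      else C.integral (fun s => F s / (s - z))
    have hH1 : ∀ z ∈ Ω, H z = C.integral (dslope F z) := fun z hz => if_pos hz
    have hH2 : ∀ z ∉ C.hull, H z = C.integral (fun s => F s / (s - z)) := by
      intro z hz
      by_cases hzΩ : z ∈ Ω
      · rw [hH1 z hzΩ]
        have hzt := C.notMem_trace_of_notMem_hull hz
        have hne : ∀ s ∈ C.trace, s - z ≠ 0 := fun s hs => sub_ne_zero.2 fun h => hzt (h ▸ hs)
        have e1 : C.integral (dslope F z) = pathIntegral C.toFun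
            (fun t => F (C.toFun t) / (C.toFun t - z) - F z * (1 / (C.toFun t - z))) := by
          refine pathIntegral_congr fun t ht => ?_
          have := hne _ (C.mem_trace ht)
          rw [dslope_of_ne _ (sub_ne_zero.1 this), slope_def_field]
          field_simp
        rw [e1, C.pathIntegral_sub, pathIntegral_const_mul, C.winding_eq_zero hz, mul_zero,
          sub_zero]
        · rfl
        · exact C.continuousOn_comp (f := fun s => F s / (s - z)) fun s hs =>
            (hFt s hs).continuousAt.div (by fun_prop) (hne s hs)
        · exact C.continuousOn_comp (f := fun s => F z * (1 / (s - z))) fun s hs => by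
            have := hne s hs
            fun_prop (disch := assumption)
      · exact if_neg hzΩ
    have hdiff1 : DifferentiableOn ℂ (fun z => C.integral (dslope F z)) Ω := by
      simp only [integral_eq_integralW]
      refine C.differentiableOn_integralW hΩ continuousOn_const ?_ ?_
      · intro z hz s hs
        exact continuousAt_dslope_uncurry (hF z hz) (hFt s hs)
      · intro s hs
        simp only [dslope_symm F _ s]
        refine (differentiableOn_dslope (hΩ.mem_nhds (hf s (Or.inl hs)))).2 ?_
        exact fun z hz => (hF z hz).differentiableAt.differentiableWithinAt
    have hdiff2 : DifferentiableOn ℂ (fun z => C.integral (fun s => F s / (s - z))) C.hullᶜ := by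
      simp only [integral_eq_integralW]
      refine C.differentiableOn_integralW C.isClosed_hull.isOpen_compl continuousOn_const ?_ ?_
      · intro z hz s hs
        have hne : s - z ≠ 0 :=
          sub_ne_zero.2 fun h => C.notMem_trace_of_notMem_hull hz (h ▸ hs)
        have a1 : ContinuousAt (fun p : ℂ × ℂ => F p.2) (z, s) :=
          ContinuousAt.comp (g := F) (f := Prod.snd) (hFt s hs).continuousAt continuousAt_snd
        exact a1.div (by fun_prop) hne
      · intro s hs z hz
        have hne : s - z ≠ 0 :=
          sub_ne_zero.2 fun h => C.notMem_trace_of_notMem_hull hz (h ▸ hs)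
        have : DifferentiableAt ℂ (fun z => F s / (s - z)) z := by fun_prop (disch := assumption)
        exact this.differentiableWithinAt
    have hHd : Differentiable ℂ H := by
      intro z
      by_cases hz : z ∈ C.hull
      · have hzΩ : z ∈ Ω := hf z hz
        refine (hdiff1.differentiableAt (hΩ.mem_nhds hzΩ)).congr_of_eventuallyEq ?_
        filter_upwards [hΩ.mem_nhds hzΩ] with w hw using hH1 w hw
      · refine (hdiff2.differentiableAt (C.isClosed_hull.isOpen_compl.mem_nhds
          hz)).congr_of_eventuallyEq ?_
        filter_upwards [C.isClosed_hull.isOpen_compl.mem_nhds hz] with w hw using hH2 w hw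
    have hHlim : Tendsto H (cocompact ℂ) (𝓝 0) := by
      refine (C.tendsto_cauchyTransform (f := F) fun s hs => (hFt s hs).continuousAt).congr' ?_
      filter_upwards [C.isCompact_hull.compl_mem_cocompact] with z hz using (hH2 z hz).symm
    intro z hz
    rw [← hH1 z hz]
    exact hHd.apply_eq_of_tendsto_cocompact z hHlim
  have hz₀ : C.toFun 0 ∈ Ω := hf _ (Or.inl (C.mem_trace (by simp)))
  set z₀ := C.toFun 0
  have hF : ∀ s ∈ Ω, AnalyticAt ℂ (fun s => (s - z₀) * f s) s := fun s hs =>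
    (analyticAt_id.sub analyticAt_const).mul hs
  rw [← main _ hF z₀ hz₀]
  refine pathIntegral_congr fun t ht => ?_
  by_cases h : C.toFun t = z₀
  · rw [h, dslope_same]
    have h1 : HasDerivAt (fun s => (s - z₀) * f s) (1 * f z₀ + (z₀ - z₀) * deriv f z₀) z₀ :=
      ((hasDerivAt_id z₀).sub_const z₀).mul hz₀.differentiableAt.hasDerivAt
    rw [h1.deriv]; simp
  · rw [dslope_of_ne _ h, slope_def_field]
    have : C.toFun t - z₀ ≠ 0 := sub_ne_zero.2 h
    field_simp
    simp

end Contour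

theorem sinh_eq_zero_iff {z : ℂ} : sinh z = 0 ↔ ∃ k : ℤ, z = k * (Real.pi * I) := by
  have h1 : sinh z = 0 ↔ Complex.sin (z * I) = 0 := by
    rw [sin_mul_I]; simp
  rw [h1, Complex.sin_eq_zero_iff]
  constructor
  · rintro ⟨k, hk⟩
    refine ⟨-k, ?_⟩
    have := congrArg (fun w => -(w * I)) hk
    simp only [mul_assoc, I_mul_I] at this
    push_cast
    linear_combination this
  · rintro ⟨k, hk⟩
    refine ⟨-k, ?_⟩
    rw [hk]
    push_cast
    linear_combination (k * Real.pi : ℂ) * I_mul_I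

theorem cosh_int_mul_pi (k : ℤ) : cosh (k * (Real.pi * I)) = (-1) ^ k := by
  rw [← mul_assoc, cosh_mul_I, show ((k : ℂ) * (Real.pi : ℂ)) = ((k * Real.pi : ℝ) : ℂ) by
    push_cast; rfl, ← ofReal_cos, Real.cos_int_mul_pi]
  push_cast; rfl

theorem sinh_add_int_mul_pi (z : ℂ) (k : ℤ) :
    sinh (z + k * (Real.pi * I)) = (-1) ^ k * sinh z := by
  rw [sinh_add, cosh_int_mul_pi, sinh_eq_zero_iff.2 ⟨k, rfl⟩]
  ring

theorem cosh_add_int_mul_pi (z : ℂ) (k : ℤ) :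
    cosh (z + k * (Real.pi * I)) = (-1) ^ k * cosh z := by
  rw [cosh_add, cosh_int_mul_pi, sinh_eq_zero_iff.2 ⟨k, rfl⟩]
  ring

theorem coth_add_int_mul_pi (z : ℂ) (k : ℤ) : coth (z + k * (Real.pi * I)) = coth z := by
  rw [coth, coth, sinh_add_int_mul_pi, cosh_add_int_mul_pi]
  exact mul_div_mul_left _ _ (zpow_ne_zero _ (by norm_num))

theorem coth_neg (z : ℂ) : coth (-z) = -coth z := by
  rw [coth, coth, cosh_neg, sinh_neg, div_neg]

theorem analyticAt_sinh (z : ℂ) : AnalyticAt ℂ sinh z := by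
  have : Differentiable ℂ sinh := differentiable_sinh
  exact this.analyticAt z

theorem analyticAt_sinh_comp {f : ℂ → ℂ} {z : ℂ} (hf : AnalyticAt ℂ f z) :
    AnalyticAt ℂ (fun s => sinh (f s)) z := (analyticAt_sinh _).comp hf

theorem analyticAt_cosh_comp {f : ℂ → ℂ} {z : ℂ} (hf : AnalyticAt ℂ f z) :
    AnalyticAt ℂ (fun s => cosh (f s)) z := by
  have : Differentiable ℂ cosh := differentiable_cosh
  exact (this.analyticAt _).comp hf

theorem analyticAt_coth_comp {f : ℂ → ℂ} {z : ℂ} (hf : AnalyticAt ℂ f z) (h : sinh (f z) ≠ 0) :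
    AnalyticAt ℂ (fun s => coth (f s)) z :=
  (analyticAt_cosh_comp hf).div (analyticAt_sinh_comp hf) h

theorem tendsto_sub_mul_coth (w : ℂ) :
    Tendsto (fun s => (s - w) * coth (s - w)) (𝓝[≠] w) (𝓝 1) := by
  have h1 : HasDerivAt (fun s : ℂ => sinh (s - w)) 1 w := by
    simpa using ((hasDerivAt_id w).sub_const w).csinh
  rw [hasDerivAt_iff_tendsto_slope] at h1
  have h2 : Tendsto (fun s : ℂ => cosh (s - w)) (𝓝[≠] w) (𝓝 1) := by
    have : ContinuousAt (fun s : ℂ => cosh (s - w)) w := by fun_prop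
    have h3 := this.tendsto
    simp only [sub_self, cosh_zero] at h3
    exact h3.mono_left nhdsWithin_le_nhds
  have h3 := h2.div h1 one_ne_zero
  simp only [div_one] at h3
  refine h3.congr' ?_
  filter_upwards [self_mem_nhdsWithin] with s hs
  have : s - w ≠ 0 := sub_ne_zero.2 hs
  simp only [Pi.div_apply, slope_def_field, sub_self, sinh_zero, sub_zero, coth]
  rw [div_div_eq_mul_div]; ring

namespace Contour

open MeasureTheory Set
open scoped Interval

variable (C : Contour)

theorem sinh_sub_ne_zero_of_outsideMod {C : Contour} {p s : ℂ} (hp : C.OutsideMod p)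
    (hs : s ∈ C.hull) : sinh (s - p) ≠ 0 := fun h => by
  obtain ⟨k, hk⟩ := sinh_eq_zero_iff.1 h
  exact hp k (by rw [← hk]; simpa using! hs)

theorem sinh_sub_ne_zero_of_mem {C : Contour} {w s : ℂ} (hw : w ∈ C.hull) (hs : s ∈ C.hull)
    (h : s ≠ w) : sinh (s - w) ≠ 0 := fun h0 => by
  obtain ⟨k, hk⟩ := sinh_eq_zero_iff.1 h0
  have hk0 : k ≠ 0 := fun hk0 => h (by simpa [hk0, sub_eq_zero] using hk)
  refine C.separated w hw k hk0 ?_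
  rw [← hk]; simpa using! hs

theorem sinh_sub_ne_zero_of_inner_of_trace {C : Contour} {w s : ℂ} (hw : w ∈ C.inner)
    (hs : s ∈ C.trace) : sinh (s - w) ≠ 0 :=
  sinh_sub_ne_zero_of_mem (Or.inr hw) (Or.inl hs) fun h => hw.1 (h ▸ hs)

theorem OutsideMod.add_int {C : Contour} {p : ℂ} (hp : C.OutsideMod p) (k : ℤ) :
    C.OutsideMod (p + k * (Real.pi * I)) := fun j => by
  have := hp (k + j)
  push_cast at this
  rwa [add_mul, ← add_assoc] at this

/-- Poles of the integrand: **residue theorem** for simple poles. -/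
theorem integral_eq_sum_residues (S : Finset ℂ) (hS : ∀ w ∈ S, w ∈ C.inner) (R F : ℂ → ℂ)
    (hF : ∀ s ∈ C.hull, s ∉ S → AnalyticAt ℂ F s)
    (hR : ∀ w ∈ S, Tendsto (fun s => (s - w) * F s) (𝓝[≠] w) (𝓝 (R w))) :
    C.integral F = 2 * Real.pi * I * ∑ w ∈ S, R w := by
  classical
  let h : ℂ → ℂ := fun s => F s - ∑ w ∈ S, R w * (1 / (s - w))
  have hh : ∀ s ∈ C.hull, s ∉ S → AnalyticAt ℂ h s := by
    intro s hs hsS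
    refine (hF s hs hsS).sub (Finset.analyticAt_fun_sum _ fun w hw => ?_)
    have : s - w ≠ 0 := sub_ne_zero.2 fun h => hsS (h ▸ hw)
    exact analyticAt_const.mul (analyticAt_const.div (analyticAt_id.sub analyticAt_const) this)
  have hlim : ∀ w ∈ S, Tendsto (fun s => (s - w) * h s) (𝓝[≠] w) (𝓝 0) := by
    intro w hw
    have h1 : Tendsto (fun s => (s - w) * ∑ v ∈ S, R v * (1 / (s - v))) (𝓝[≠] w) (𝓝 (R w)) := by
      simp only [Finset.mul_sum]
      have h2 : R w = ∑ v ∈ S, if v = w then R w else 0 := by simp [hw]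
      rw [h2]
      refine tendsto_finsetSum _ fun v hv => ?_
      by_cases hvw : v = w
      · subst hvw
        simp only [if_true]
        refine tendsto_const_nhds.congr' ?_
        filter_upwards [self_mem_nhdsWithin] with s hs
        have : s - v ≠ 0 := sub_ne_zero.2 hs
        field_simp
      · simp only [hvw, if_false]
        have h3 : w - v ≠ 0 := sub_ne_zero.2 (Ne.symm hvw)
        have h4 : ContinuousAt (fun s => (s - w) * (R v * (1 / (s - v)))) w := by
          fun_prop (disch := assumption)
        have h5 := h4.tendsto
        simp only [sub_self, zero_mul] at h5
        exact h5.mono_left nhdsWithin_le_nhds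
    have h2 := (hR w hw).sub h1
    rw [sub_self] at h2
    refine h2.congr fun s => ?_
    simp only [h]; ring
  let H : ℂ → ℂ := fun s => if s ∈ S then limUnder (𝓝[≠] s) h else h s
  have hHan : ∀ s ∈ C.hull, AnalyticAt ℂ H s := by
    intro s hs
    by_cases hsS : s ∈ S
    · have hU : C.inner \ (S.erase s : Set ℂ) ∈ 𝓝 s := by
        refine (C.isOpen_inner.sdiff (Finset.finite_toSet _).isClosed).mem_nhds ⟨hS s hsS, ?_⟩
        simp
      have hd : DifferentiableOn ℂ h ((C.inner \ (S.erase s : Set ℂ)) \ {s}) := by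
        intro z hz
        refine (hh z (Or.inr hz.1.1) fun hzS => hz.1.2 ?_).differentiableAt.differentiableWithinAt
        rw [Finset.coe_erase]
        exact ⟨hzS, hz.2⟩
      have ho : (fun z => h z - h s) =o[𝓝[≠] s] fun z => (z - s)⁻¹ := by
        rw [Asymptotics.isLittleO_iff_tendsto']
        · have h1 : Tendsto (fun z => (z - s) * h s) (𝓝[≠] s) (𝓝 0) := by
            have h4 : ContinuousAt (fun z => (z - s) * h s) s := by fun_prop
            have h5 := h4.tendsto
            simp only [sub_self, zero_mul] at h5
            exact h5.mono_left nhdsWithin_le_nhds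
          have h2 := (hlim s hsS).sub h1
          rw [sub_self] at h2
          refine h2.congr fun z => ?_
          rw [div_inv_eq_mul]; ring
        · filter_upwards [self_mem_nhdsWithin] with z hz h0
          exact absurd (inv_eq_zero.1 h0) (sub_ne_zero.2 hz)
      have h1 := differentiableOn_update_limUnder_of_isLittleO hU hd ho
      have h2 : AnalyticAt ℂ (Function.update h s (limUnder (𝓝[≠] s) h)) s := h1.analyticAt hU
      refine h2.congr ?_
      filter_upwards [hU] with z hz
      by_cases hzs : z = s
      · subst hzs; simp [H, hsS]
      · have : z ∉ S := fun hzS => hz.2 (by simp [hzS, hzs])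
        simp [H, this, hzs]
    · refine (hh s hs hsS).congr ?_
      filter_upwards [S.finite_toSet.isClosed.isOpen_compl.mem_nhds (by simpa using hsS)] with z hz
      have : z ∉ S := by simpa using hz
      simp [H, this]
  have hnS : ∀ s ∈ C.trace, s ∉ S := fun s hs hsS => (hS s hsS).1 hs
  have e1 : C.integral F = pathIntegral C.toFun
      (fun t => H (C.toFun t) + ∑ w ∈ S, R w * (1 / (C.toFun t - w))) := by
    refine pathIntegral_congr fun t ht => ?_
    simp [H, hnS _ (C.mem_trace ht), h]
  have hcs : ∀ w ∈ S, ContinuousOn (fun t => R w * (1 / (C.toFun t - w))) (Icc 0 1) := by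
    intro w hw
    refine C.continuousOn_comp (f := fun s => R w * (1 / (s - w))) fun s hs => ?_
    have : s - w ≠ 0 := sub_ne_zero.2 fun h => (hS w hw).1 (h ▸ hs)
    fun_prop (disch := assumption)
  rw [e1, C.pathIntegral_add
      (C.continuousOn_comp fun s hs => (hHan s (Or.inl hs)).continuousAt)
      (continuousOn_finsetSum _ hcs), C.pathIntegral_sum S hcs]
  have e2 : pathIntegral C.toFun (fun t => H (C.toFun t)) = 0 := C.integral_eq_zero hHan
  rw [e2, zero_add, Finset.mul_sum]
  refine Finset.sum_congr rfl fun w hw => ?_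
  rw [pathIntegral_const_mul, (hS w hw).2, mul_comm]

theorem integral_mul_coth_inside {H : ℂ → ℂ} (hH : ∀ s ∈ C.hull, AnalyticAt ℂ H s) {w : ℂ}
    (hw : w ∈ C.inner) : C.integral (fun s => H s * coth (s - w)) = 2 * Real.pi * I * H w := by
  have := C.integral_eq_sum_residues {w} (by simpa using hw) H (fun s => H s * coth (s - w)) ?_ ?_
  · simpa using this
  · intro s hs hsw
    refine (hH s hs).mul (analyticAt_coth_comp (analyticAt_id.sub analyticAt_const) ?_)
    exact sinh_sub_ne_zero_of_mem (Or.inr hw) hs (by simpa using hsw)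
  · intro v hv
    obtain rfl : v = w := by simpa using hv
    have h1 := ((hH v (Or.inr hw)).continuousAt.tendsto.mono_left
      (nhdsWithin_le_nhds (s := {v}ᶜ))).mul (tendsto_sub_mul_coth v)
    rw [mul_one] at h1
    refine h1.congr fun s => ?_
    ring

theorem frontier_inner_subset : frontier C.inner ⊆ C.trace := by
  intro z hz
  have h1 : z ∈ C.hull := C.isClosed_hull.closure_subset_iff.2 C.inner_subset_hull hz.1
  rw [C.isOpen_inner.frontier_eq] at hz
  exact h1.resolve_right hz.2

/-- The maximum principle. -/
theorem norm_lt_one_of_trace {r : ℂ → ℂ} (hr : ∀ s ∈ C.hull, AnalyticAt ℂ r s)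
    (h : ∀ s ∈ C.trace, ‖r s‖ < 1) : ∀ s ∈ C.hull, ‖r s‖ < 1 := by
  obtain ⟨s₀, hs₀, hmax⟩ := C.isCompact_trace.exists_isMaxOn ⟨_, C.mem_trace (t := 0) (by simp)⟩
    (f := fun s => ‖r s‖) fun s hs =>
      (hr s (Or.inl hs)).continuousAt.norm.continuousWithinAt
  rintro s (hs | hs)
  · exact h s hs
  refine lt_of_le_of_lt ?_ (h s₀ hs₀)
  refine norm_le_of_forall_mem_frontier_norm_le (U := C.inner)
    (C.isBounded_hull.subset C.inner_subset_hull) ?_ ?_ (subset_closure hs)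
  · refine ⟨fun z hz => (hr z (Or.inr hz)).differentiableAt.differentiableWithinAt, fun z hz => ?_⟩
    exact (hr z (C.isClosed_hull.closure_subset_iff.2 C.inner_subset_hull
      hz)).continuousAt.continuousWithinAt
  · exact fun z hz => hmax (C.frontier_inner_subset hz)

/-! ### Logarithms along a contour -/

theorem mapsTo_Icc {t : ℝ} (ht : t ∈ Icc (0 : ℝ) 1) : uIcc (0 : ℝ) t ⊆ uIcc 0 1 := by
  rw [uIcc_of_le ht.1, uIcc_of_le zero_le_one]
  exact Icc_subset_Icc_right ht.2

theorem continuousOn_primitive_path {g : ℝ → ℂ} (hg : ContinuousOn g (Icc 0 1)) :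
    ContinuousOn (fun t => ∫ u in (0 : ℝ)..t, g u * deriv C.toFun u) (Icc 0 1) := by
  have := intervalIntegral.continuousOn_primitive_interval
    ((intervalIntegrable_iff' enorm_ne_top).1 (C.intervalIntegrable_mul_deriv hg))
  rwa [uIcc_of_le zero_le_one] at this

theorem hasDerivAt_primitive_path {g : ℝ → ℂ} (hg : ContinuousOn g (Icc 0 1)) {t : ℝ}
    (ht : t ∈ Ioo (0 : ℝ) 1) (hb : t ∉ C.breaks) :
    HasDerivAt (fun t => ∫ u in (0 : ℝ)..t, g u * deriv C.toFun u) (g t * deriv C.toFun t) t := by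
  have hopen : IsOpen (Ioo (0 : ℝ) 1 \ (C.breaks : Set ℝ)) :=
    isOpen_Ioo.sdiff C.breaks.finite_toSet.isClosed
  have hc : ContinuousOn (fun u => g u * deriv C.toFun u) (Ioo (0 : ℝ) 1 \ (C.breaks : Set ℝ)) :=
    (hg.mono (sdiff_subset.trans Ioo_subset_Icc_self)).mul C.continuousOn_deriv
  have hmem : t ∈ Ioo (0 : ℝ) 1 \ (C.breaks : Set ℝ) := ⟨ht, by simpa using hb⟩
  refine intervalIntegral.integral_hasDerivAt_right
    ((C.intervalIntegrable_mul_deriv hg).mono_set (mapsTo_Icc (Ioo_subset_Icc_self ht))) ?_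
    (hc.continuousAt (hopen.mem_nhds hmem))
  exact hc.stronglyMeasurableAtFilter hopen t hmem

end Contour

theorem exp_lift_unique {X : Type*} [TopologicalSpace X] [PreconnectedSpace X] {g₁ g₂ : X → ℂ}
    (h₁ : Continuous g₁) (h₂ : Continuous g₂) (h : ∀ x, exp (g₁ x) = exp (g₂ x)) {a : X}
    (ha : g₁ a = g₂ a) : g₁ = g₂ :=
  isCoveringMap_exp.eq_of_comp_eq h₁ h₂ (by ext x; simpa using h x) a ha

/-- A continuous function that does not vanish cannot coincide with `s ↦ s - p` off a bounded set
that contains `p`. -/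
theorem not_exists_nonvanishing_extension {B : Set ℂ} (hB : Bornology.IsBounded B) {p : ℂ}
    {F : ℂ → ℂ} (hF : Continuous F) (h0 : ∀ s, F s ≠ 0) (h : ∀ s ∉ B, F s = s - p) : False := by
  obtain ⟨⟨f, hfc'⟩, ⟨-, hf'⟩, -⟩ := isCoveringMapOn_exp.existsUnique_continuousMap_lifts
    ⟨F, hF⟩ (exp_log (h0 0)) (fun s => h0 s)
  have hf : ∀ s, exp (f s) = F s := fun s => congrFun hf' s
  obtain ⟨R, hR⟩ := hB.subset_ball p
  set R' : ℝ := max R 1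
  have hR' : 0 < R' := by positivity
  have hcirc : ∀ θ : ℝ, F (p + R' * exp (θ * I)) = R' * exp (θ * I) := by
    intro θ
    rw [h]
    · ring
    · intro hmem
      have := hR hmem
      rw [Metric.mem_ball, dist_eq_norm, add_sub_cancel_left, norm_mul, norm_exp_ofReal_mul_I,
        mul_one, norm_real, Real.norm_of_nonneg hR'.le] at this
      exact absurd this (not_lt.2 (le_max_left _ _))
  have key := exp_lift_unique (X := ℝ) (g₁ := fun θ => f (p + R' * exp (θ * I)))
    (g₂ := fun θ => f (p + R') + θ * I) (by fun_prop) (by fun_prop) (a := 0) ?_ (by simp)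
  · have h1 := congrFun key (2 * Real.pi)
    simp only [ofReal_mul, ofReal_ofNat, exp_two_pi_mul_I, mul_one] at h1
    exact two_pi_I_ne_zero (left_eq_add.1 h1)
  · intro θ
    have e1 : exp (f (p + R' * exp (θ * I))) = F (p + R' * exp (θ * I)) := hf _
    have e2 : exp (f (p + R')) = R' := by
      have e3 := hcirc 0
      have e4 : exp (f (p + R')) = F (p + R') := hf _
      simp only [ofReal_zero, zero_mul, exp_zero, mul_one] at e3
      rw [e4, e3]
    rw [exp_add, e1, e2, hcirc]

namespace Contour

open MeasureTheory Set
open scoped Interval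

variable (C : Contour)

/-- A logarithm along the contour exponentiates to the function. -/
theorem exp_primitive {G : ℂ → ℂ} (hG : ∀ s ∈ C.trace, AnalyticAt ℂ G s)
    (h0 : ∀ s ∈ C.trace, G s ≠ 0) {t : ℝ} (ht : t ∈ Icc (0 : ℝ) 1) :
    exp (∫ u in (0 : ℝ)..t, logDeriv G (C.toFun u) * deriv C.toFun u) * G (C.toFun 0)
      = G (C.toFun t) := by
  have hg : ContinuousOn (fun t => logDeriv G (C.toFun t)) (Icc 0 1) :=
    C.continuousOn_comp fun s hs =>
      ((hG s hs).deriv.continuousAt.div (hG s hs).continuousAt (h0 s hs))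
  set J : ℝ → ℂ := fun t => ∫ u in (0 : ℝ)..t, logDeriv G (C.toFun u) * deriv C.toFun u with hJ
  have hJc : ContinuousOn J (Icc 0 1) := C.continuousOn_primitive_path hg
  have hGc : ContinuousOn (fun t => G (C.toFun t)) (Icc 0 1) :=
    C.continuousOn_comp fun s hs => (hG s hs).continuousAt
  have hsub : Icc (0 : ℝ) t ⊆ Icc 0 1 := Icc_subset_Icc_right ht.2
  have key := integral_eq_of_hasDerivAt_off_countable_of_le
    (fun t => exp (-J t) * G (C.toFun t)) (fun _ => 0) ht.1 C.breaks.countable_toSet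
    ((hJc.mono hsub).neg.cexp.mul (hGc.mono hsub)) ?_ (by simp)
  · have hJ0 : J 0 = 0 := by simp [hJ]
    have h2 : exp (J t) ≠ 0 := exp_ne_zero _
    simp only [intervalIntegral.integral_zero, hJ0, neg_zero, exp_zero, one_mul] at key
    have h3 : exp (-J t) * G (C.toFun t) = G (C.toFun 0) := by
      linear_combination -key
    rw [← h3, ← mul_assoc, ← exp_add, add_neg_cancel, exp_zero, one_mul]
  · intro u hu
    have hu1 : u ∈ Ioo (0 : ℝ) 1 := ⟨hu.1.1, hu.1.2.trans_le ht.2⟩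
    have hub : u ∉ C.breaks := by simpa using hu.2
    have hmem := C.mem_trace (Ioo_subset_Icc_self hu1)
    have d1 : HasDerivAt J _ u := C.hasDerivAt_primitive_path hg hu1 hub
    have d2 : HasDerivAt (fun t => G (C.toFun t)) (deriv G (C.toFun u) * deriv C.toFun u) u :=
      (hG _ hmem).differentiableAt.hasDerivAt.comp u (C.hasDerivAt_toFun hu1 hub)
    have d3 := d1.neg.cexp.mul d2
    refine d3.congr_deriv ?_
    have := h0 _ hmem
    simp only [logDeriv_apply]
    field_simp
    ring

/-- A continuous function of the parameter with equal values at the end points is the restriction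
of a continuous function on the plane. -/
theorem exists_continuous_extension {v : ℝ → ℂ} (hv : ContinuousOn v (Icc 0 1)) (h : v 0 = v 1) :
    ∃ ℓ : ℂ → ℂ, Continuous ℓ ∧ ∀ t ∈ Icc (0 : ℝ) 1, ℓ (C.toFun t) = v t := by
  have hfib : ∀ t ∈ Icc (0 : ℝ) 1, ∀ u ∈ Icc (0 : ℝ) 1, C.toFun t = C.toFun u → v t = v u := by
    have aux : ∀ t ∈ Icc (0 : ℝ) 1, ∃ t' ∈ Ico (0 : ℝ) 1, C.toFun t' = C.toFun t ∧ v t' = v t := by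
      intro t ht
      rcases ht.2.lt_or_eq with h1 | h1
      · exact ⟨t, ⟨ht.1, h1⟩, rfl, rfl⟩
      · exact ⟨0, by simp, by rw [h1, C.closed], by rw [h1, h]⟩
    intro t ht u hu e
    obtain ⟨t', ht', e1, e2⟩ := aux t ht
    obtain ⟨u', hu', e3, e4⟩ := aux u hu
    have := C.simple ht' hu' (by rw [e1, e3, e])
    rw [← e2, ← e4, this]
  let q : Icc (0 : ℝ) 1 → C.trace := fun t => ⟨C.toFun t, C.mem_trace t.2⟩
  have hq : Continuous q := by
    refine Continuous.subtype_mk ?_ _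
    exact continuousOn_iff_continuous_domRestrict.1 C.continuousOn
  have hqs : Function.Surjective q := by
    rintro ⟨_, t, ht, rfl⟩
    exact ⟨⟨t, ht⟩, rfl⟩
  have hqq : IsQuotientMap q := hq.isClosedMap.isQuotientMap hq hqs
  let w : C.trace → ℂ := fun s => v (hqs s).choose
  have hw : ∀ t : Icc (0 : ℝ) 1, w (q t) = v t := fun t =>
    hfib _ (hqs (q t)).choose.2 _ t.2 (congrArg Subtype.val (hqs (q t)).choose_spec)
  have hwc : Continuous w := by
    rw [hqq.continuous_iff]
    have : w ∘ q = fun t : Icc (0 : ℝ) 1 => v t := funext hw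
    rw [this]
    exact continuousOn_iff_continuous_domRestrict.1 hv
  obtain ⟨ℓ, hℓ⟩ := ContinuousMap.exists_restrict_eq C.isCompact_trace.isClosed ⟨w, hwc⟩
  refine ⟨ℓ, ℓ.continuous, fun t ht => ?_⟩
  have := DFunLike.congr_fun hℓ (q ⟨t, ht⟩)
  rw [← hw ⟨t, ht⟩]
  exact this

/-- Separation argument of Borsuk: there is no bounded open `B`, with boundary on the contour, such
that `s - p`, `p ∈ B`, has the same winding number along the contour as a function `g` without
zeros on `B`. -/
theorem borsuk_separation {B : Set ℂ} (hB : Bornology.IsBounded B)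
    (hfr : frontier B ⊆ C.trace) {p : ℂ} (hp : p ∈ B) (hpt : p ∉ C.trace) {g : ℂ → ℂ}
    (hg : Differentiable ℂ g) (hg0 : ∀ s ∈ B ∪ C.trace, g s ≠ 0)
    (hw : C.integral (fun s => 1 / (s - p)) = C.integral (logDeriv g)) : False := by
  have hpne : ∀ s ∈ C.trace, s - p ≠ 0 := fun s hs => sub_ne_zero.2 fun h => hpt (h ▸ hs)
  let G : ℂ → ℂ := fun s => (s - p) / g s
  have hGan : ∀ s ∈ C.trace, AnalyticAt ℂ G s := fun s hs =>
    (analyticAt_id.sub analyticAt_const).div (hg.analyticAt s) (hg0 s (Or.inr hs))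
  have hG0 : ∀ s ∈ C.trace, G s ≠ 0 := fun s hs => div_ne_zero (hpne s hs) (hg0 s (Or.inr hs))
  have hGl : ∀ s ∈ C.trace, logDeriv G s = 1 / (s - p) - logDeriv g s := by
    intro s hs
    have h1 : logDeriv (fun s => s - p) s = 1 / (s - p) := by
      simp [logDeriv_apply]
    rw [← h1]
    exact logDeriv_div s (hpne s hs) (hg0 s (Or.inr hs)) (by fun_prop) (hg s)
  have hGc : ContinuousOn (fun t => logDeriv G (C.toFun t)) (Icc 0 1) :=
    C.continuousOn_comp fun s hs =>
      ((hGan s hs).deriv.continuousAt.div (hGan s hs).continuousAt (hG0 s hs))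
  have hgc : ∀ s ∈ C.trace, ContinuousAt (logDeriv g) s := fun s hs =>
    ((hg.analyticAt s).deriv.continuousAt.div (hg.analyticAt s).continuousAt (hg0 s (Or.inr hs)))
  let v : ℝ → ℂ := fun t => log (G (C.toFun 0)) +
    ∫ u in (0 : ℝ)..t, logDeriv G (C.toFun u) * deriv C.toFun u
  have hvc : ContinuousOn v (Icc 0 1) :=
    continuousOn_const.add (C.continuousOn_primitive_path hGc)
  have hv1 : v 0 = v 1 := by
    have e1 : ∫ u in (0 : ℝ)..1, logDeriv G (C.toFun u) * deriv C.toFun u = 0 := by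
      have e2 : C.integral (logDeriv G) = C.integral (fun s => 1 / (s - p))
          - C.integral (logDeriv g) := by
        unfold integral
        rw [← C.pathIntegral_sub]
        · exact pathIntegral_congr fun t ht => hGl _ (C.mem_trace ht)
        · refine C.continuousOn_comp (f := fun s => 1 / (s - p)) fun s hs => ?_
          have := hpne s hs
          fun_prop (disch := assumption)
        · exact C.continuousOn_comp hgc
      rw [hw, sub_self] at e2
      exact e2
    simp [v, e1]
  have hvexp : ∀ t ∈ Icc (0 : ℝ) 1, exp (v t) = G (C.toFun t) := by
    intro t ht
    simp only [v]
    rw [exp_add, exp_log (hG0 _ (C.mem_trace (by simp))), mul_comm]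
    exact C.exp_primitive hGan hG0 ht
  obtain ⟨ℓ, hℓc, hℓ⟩ := C.exists_continuous_extension hvc hv1
  classical
  let F : ℂ → ℂ := fun s => if s ∈ B then exp (ℓ s) * g s else s - p
  refine not_exists_nonvanishing_extension hB (F := F) (p := p) ?_ ?_ ?_
  · refine Continuous.if ?_ (by have := hg.continuous; fun_prop) (by fun_prop)
    intro s hs
    obtain ⟨t, ht, rfl⟩ := hfr hs
    have hmem := C.mem_trace ht
    have := hg0 _ (Or.inr hmem)
    rw [hℓ t ht, hvexp t ht]
    simp only [G]
    field_simp
  · intro s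
    by_cases hs : s ∈ B
    · simp only [F, hs, if_true]
      exact mul_ne_zero (exp_ne_zero _) (hg0 s (Or.inl hs))
    · simp only [F, hs, if_false]
      exact sub_ne_zero.2 fun h => hs (h ▸ hp)
  · intro s hs
    simp [F, hs]

theorem isPreconnected_inner : IsPreconnected C.inner := by
  rintro u v hu hv hsub ⟨p, hp, hpu⟩ ⟨q, hq, hqv⟩
  by_contra hne
  rw [not_nonempty_iff_eq_empty] at hne
  have hdis : ∀ s ∈ C.inner, s ∈ u → s ∈ v → False := fun s h1 h2 h3 =>
    (hne ▸ (⟨h1, h2, h3⟩ : s ∈ C.inner ∩ (u ∩ v)) : s ∈ (∅ : Set ℂ))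
  refine C.borsuk_separation (B := C.inner ∩ u) 
    (C.isBounded_hull.subset (inter_subset_left.trans C.inner_subset_hull)) ?_ ⟨hp, hpu⟩ hp.1
    (g := fun s => s - q) (by fun_prop) ?_ ?_
  · intro s hs
    have h1 : s ∈ C.hull := C.isClosed_hull.closure_subset_iff.2
      (inter_subset_left.trans C.inner_subset_hull) hs.1
    refine h1.resolve_right fun hin => ?_
    rw [(C.isOpen_inner.inter hu).frontier_eq] at hs
    rcases hsub hin with h | h
    · exact hs.2 ⟨hin, h⟩
    · obtain ⟨z, hz1, hz2⟩ := mem_closure_iff.1 hs.1 _ (C.isOpen_inner.inter hv) ⟨hin, h⟩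
      exact hdis z hz1.1 hz2.2 hz1.2
  · rintro s (hs | hs) h
    · rw [sub_eq_zero.1 h] at hs
      exact hdis q hq hs.2 hqv
    · rw [sub_eq_zero.1 h] at hs
      exact hq.1 hs
  · have e : ∀ z, logDeriv (fun s : ℂ => s - z) = fun s => 1 / (s - z) := by
      intro z; ext s; simp [logDeriv_apply]
    rw [e]
    exact hp.2.trans hq.2.symm

end Contour

/-- The function `e` has an analytic logarithm on a neighbourhood of `K`. -/
def LogNear (K : Set ℂ) (e : ℂ → ℂ) : Prop :=
  ∃ ℓ : ℂ → ℂ, ∀ s ∈ K, AnalyticAt ℂ ℓ s ∧ ∀ᶠ z in 𝓝 s, exp (ℓ z) = e z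

namespace LogNear

variable {K : Set ℂ} {e e' : ℂ → ℂ}

theorem analyticAt (h : LogNear K e) {s : ℂ} (hs : s ∈ K) : AnalyticAt ℂ e s := by
  obtain ⟨ℓ, hℓ⟩ := h
  exact ((hℓ s hs).1.cexp).congr (hℓ s hs).2

theorem ne_zero (h : LogNear K e) {s : ℂ} (hs : s ∈ K) : e s ≠ 0 := by
  obtain ⟨ℓ, hℓ⟩ := h
  rw [← (hℓ s hs).2.self_of_nhds]
  exact exp_ne_zero _

theorem mono (h : LogNear K e) {K' : Set ℂ} (hK : K' ⊆ K) : LogNear K' e :=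
  h.imp fun _ hℓ s hs => hℓ s (hK hs)

theorem congr (h : LogNear K e) (h' : ∀ s ∈ K, ∀ᶠ z in 𝓝 s, e z = e' z) : LogNear K e' := by
  obtain ⟨ℓ, hℓ⟩ := h
  refine ⟨ℓ, fun s hs => ⟨(hℓ s hs).1, ?_⟩⟩
  filter_upwards [(hℓ s hs).2, h' s hs] with z h1 h2 using h1.trans h2

theorem mul (h : LogNear K e) (h' : LogNear K e') : LogNear K (fun s => e s * e' s) := by
  obtain ⟨ℓ, hℓ⟩ := h
  obtain ⟨ℓ', hℓ'⟩ := h'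
  refine ⟨fun s => ℓ s + ℓ' s, fun s hs => ⟨(hℓ s hs).1.add (hℓ' s hs).1, ?_⟩⟩
  filter_upwards [(hℓ s hs).2, (hℓ' s hs).2] with z h1 h2
  rw [exp_add, h1, h2]

theorem inv (h : LogNear K e) : LogNear K (fun s => (e s)⁻¹) := by
  obtain ⟨ℓ, hℓ⟩ := h
  refine ⟨fun s => -ℓ s, fun s hs => ⟨(hℓ s hs).1.neg, ?_⟩⟩
  filter_upwards [(hℓ s hs).2] with z h1
  rw [exp_neg, h1]

theorem div (h : LogNear K e) (h' : LogNear K e') : LogNear K (fun s => e s / e' s) := by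
  simpa only [div_eq_mul_inv] using h.mul h'.inv

theorem const {c : ℂ} (hc : c ≠ 0) : LogNear K (fun _ => c) :=
  ⟨fun _ => log c, fun _ _ => ⟨analyticAt_const, Eventually.of_forall fun _ => exp_log hc⟩⟩

theorem prod {ι : Type*} (S : Finset ι) {e : ι → ℂ → ℂ} (h : ∀ i ∈ S, LogNear K (e i)) :
    LogNear K (fun s => ∏ i ∈ S, e i s) := by
  classical
  induction S using Finset.induction_on with
  | empty => simpa using const one_ne_zero
  | insert a S ha ih =>
    simp only [Finset.prod_insert ha]
    exact (h a (by simp)).mul (ih fun i hi => h i (by simp [hi]))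

theorem multiset_prod (Z : Multiset ℂ) {e : ℂ → ℂ → ℂ} (h : ∀ u ∈ Z, LogNear K (e u)) :
    LogNear K (fun s => (Z.map fun u => e u s).prod) := by
  induction Z using Multiset.induction_on with
  | empty => simpa using const one_ne_zero
  | cons a Z ih =>
    simp only [Multiset.map_cons, Multiset.prod_cons]
    exact (h a (by simp)).mul (ih fun i hi => h i (by simp [hi]))

/-- Division by a function close to `1`. -/
theorem of_slitPlane (h : ∀ s ∈ K, AnalyticAt ℂ e s ∧ e s ∈ slitPlane) : LogNear K e := by
  refine ⟨fun s => log (e s), fun s hs => ⟨(h s hs).1.clog (h s hs).2, ?_⟩⟩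
  have : ∀ᶠ z in 𝓝 s, e z ∈ slitPlane :=
    (h s hs).1.continuousAt.eventually (isOpen_slitPlane.mem_nhds (h s hs).2)
  filter_upwards [this] with z hz using exp_log (slitPlane_ne_zero hz)

end LogNear

/-! ### Factorization of entire functions -/

theorem exists_factor_pow {f : ℂ → ℂ} (hf : Differentiable ℂ f) (h0 : ∃ z, f z ≠ 0) (u : ℂ) :
    ∃ (n : ℕ) (g : ℂ → ℂ), Differentiable ℂ g ∧ (∀ s, f s = (s - u) ^ n * g s) ∧ g u ≠ 0 := by
  classical
  have hord : analyticOrderAt f u ≠ ⊤ := by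
    intro htop
    rw [analyticOrderAt_eq_top] at htop
    obtain ⟨z, hz⟩ := h0
    have h1 : AnalyticOnNhd ℂ f Set.univ := fun s _ => hf.analyticAt s
    exact hz (h1.eqOn_zero_of_preconnected_of_eventuallyEq_zero isPreconnected_univ
      (Set.mem_univ u) htop (Set.mem_univ z))
  obtain ⟨g₀, hg₀, hg0, hfg⟩ := (hf.analyticAt u).analyticOrderAt_ne_top.1 hord
  set n := analyticOrderNatAt f u
  let g : ℂ → ℂ := fun s => if s = u then g₀ u else f s / (s - u) ^ n
  have hgu : g =ᶠ[𝓝 u] g₀ := by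
    filter_upwards [hfg] with s hs
    by_cases hsu : s = u
    · simp [g, hsu]
    · have : s - u ≠ 0 := sub_ne_zero.2 hsu
      simp only [g, hsu, if_false, hs, smul_eq_mul]
      field_simp
  refine ⟨n, g, fun s => ?_, fun s => ?_, ?_⟩
  · by_cases hsu : s = u
    · subst hsu
      exact hg₀.differentiableAt.congr_of_eventuallyEq hgu
    · have h1 : g =ᶠ[𝓝 s] fun s => f s / (s - u) ^ n := by
        filter_upwards [isOpen_ne.mem_nhds hsu] with z hz
        simp only [g, if_neg hz]
      refine DifferentiableAt.congr_of_eventuallyEq ?_ h1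
      exact (hf s).div (by fun_prop) (pow_ne_zero _ (sub_ne_zero.2 hsu))
  · by_cases hsu : s = u
    · subst hsu
      simpa [g] using hfg.self_of_nhds
    · have : s - u ≠ 0 := sub_ne_zero.2 hsu
      simp only [g, hsu, if_false]
      field_simp
  · simpa [g] using hg0

theorem finite_zeros {f : ℂ → ℂ} (hf : Differentiable ℂ f) (h0 : ∃ z, f z ≠ 0) {K : Set ℂ}
    (hK : IsCompact K) : {z ∈ K | f z = 0}.Finite := by
  by_contra hinf
  obtain ⟨x, -, hx⟩ := Set.Infinite.exists_accPt_of_subset_isCompact hinf hK (Set.sep_subset _ _)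
  have h1 : ∃ᶠ z in 𝓝[≠] x, f z = 0 := by
    rw [accPt_iff_frequently_nhdsNE] at hx
    exact hx.mono fun z hz => hz.2
  have h2 : AnalyticOnNhd ℂ f Set.univ := fun s _ => hf.analyticAt s
  obtain ⟨z, hz⟩ := h0
  exact hz (h2.eqOn_zero_of_preconnected_of_frequently_eq_zero isPreconnected_univ
    (Set.mem_univ x) h1 (Set.mem_univ z))

theorem exists_factorization {K : Set ℂ} (hK : IsCompact K) {f : ℂ → ℂ} (hf : Differentiable ℂ f)
    (h0 : ∃ z, f z ≠ 0) :
    ∃ (Z : Multiset ℂ) (g : ℂ → ℂ), Differentiable ℂ g ∧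
      (∀ s, f s = (Z.map fun u => s - u).prod * g s) ∧ (∀ s ∈ K, g s ≠ 0) ∧
      ∀ u ∈ Z, f u = 0 := by
  obtain ⟨n, hn⟩ : ∃ n, n = ({z ∈ K | f z = 0}).ncard := ⟨_, rfl⟩
  induction n using Nat.strong_induction_on generalizing f with
  | _ n ih =>
    by_cases hz : ∃ u ∈ K, f u = 0
    · obtain ⟨u, huK, hu⟩ := hz
      obtain ⟨m, g, hg, hfg, hgu⟩ := exists_factor_pow hf h0 u
      have hlt : ({z ∈ K | g z = 0}).ncard < n := by
        rw [hn]
        refine Set.ncard_lt_ncard ⟨fun z hz => ⟨hz.1, by rw [hfg, hz.2, mul_zero]⟩, fun hsub => ?_⟩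
          (finite_zeros hf h0 hK)
        exact hgu (hsub ⟨huK, hu⟩).2
      obtain ⟨Z, g', hg', hgg', hne, hzero⟩ := ih _ hlt hg ⟨u, hgu⟩ rfl
      refine ⟨Multiset.replicate m u + Z, g', hg', fun s => ?_, hne, fun v hv => ?_⟩
      · rw [hfg, hgg']
        simp [mul_assoc]
      · rcases Multiset.mem_add.1 hv with h | h
        · rw [Multiset.eq_of_mem_replicate h, hu]
        · rw [hfg, hzero v h, mul_zero]
    · push Not at hz
      exact ⟨0, f, hf, by simp, hz, by simp⟩

/-- A zero-free holomorphic function on a ball has a logarithm. -/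
theorem logNear_ball {g : ℂ → ℂ} (hg : Differentiable ℂ g) {c : ℂ} {R : ℝ}
    (h0 : ∀ s ∈ Metric.ball c R, g s ≠ 0) : LogNear (Metric.ball c R) g := by
  have hd : DifferentiableOn ℂ (fun s => deriv g s / g s) (Metric.ball c R) := fun s hs =>
    ((hg.analyticAt s).deriv.differentiableAt.div (hg s) (h0 s hs)).differentiableWithinAt
  obtain ⟨q, hq⟩ := hd.isExactOn_ball
  by_cases hne : (Metric.ball c R).Nonempty
  · obtain ⟨s₀, hs₀⟩ := hne
    have hconst : ∀ s ∈ Metric.ball c R, exp (-q s) * g s = exp (-q s₀) * g s₀ := by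
      intro s hs
      refine Metric.isOpen_ball.is_const_of_deriv_eq_zero (convex_ball c R).isPreconnected
        (f := fun s => exp (-q s) * g s) ?_ ?_ hs hs₀
      · intro z hz
        exact ((hq z hz).neg.cexp.mul (hg z).hasDerivAt).differentiableAt.differentiableWithinAt
      · intro z hz
        have := ((hq z hz).neg.cexp.mul (hg z).hasDerivAt).deriv
        have hgz := h0 z hz
        refine this.trans ?_
        simp only [Pi.zero_apply]
        field_simp
        ring
    set A := exp (-q s₀) * g s₀
    have hA : A ≠ 0 := mul_ne_zero (exp_ne_zero _) (h0 _ hs₀)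
    refine ⟨fun s => q s + log A, fun s hs => ⟨?_, ?_⟩⟩
    · refine AnalyticAt.add ?_ analyticAt_const
      have : DifferentiableOn ℂ q (Metric.ball c R) := fun z hz =>
        (hq z hz).differentiableAt.differentiableWithinAt
      exact this.analyticAt (Metric.isOpen_ball.mem_nhds hs)
    · filter_upwards [Metric.isOpen_ball.mem_nhds hs] with z hz
      rw [exp_add, exp_log hA, ← hconst z hz, ← mul_assoc, ← exp_add, add_neg_cancel, exp_zero,
        one_mul]
  · rw [Set.not_nonempty_iff_eq_empty] at hne
    exact ⟨0, by simp [hne]⟩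

namespace Contour

open Set

variable (C : Contour)

theorem logNear_sub_of_near {q q' : ℂ} (hq : LogNear C.hull (fun s => s - q))
    (h : ∀ s ∈ C.hull, ‖q' - q‖ < ‖s - q‖) : LogNear C.hull (fun s => s - q') := by
  have hne : ∀ s ∈ C.hull, s - q ≠ 0 := fun s hs => hq.ne_zero hs
  have h1 : LogNear C.hull (fun s => (s - q') / (s - q)) := by
    refine LogNear.of_slitPlane fun s hs => ⟨?_, ?_⟩
    · exact (analyticAt_id.sub analyticAt_const).div (analyticAt_id.sub analyticAt_const) (hne s hs)
    · have e : (s - q') / (s - q) = 1 + -((q' - q) / (s - q)) := by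
        have := hne s hs
        field_simp
        ring
      rw [e]
      refine mem_slitPlane_of_norm_lt_one ?_
      rw [norm_neg, norm_div, div_lt_one (norm_pos_iff.2 (hne s hs))]
      exact h s hs
  refine (h1.mul hq).congr fun s hs => ?_
  have : ContinuousAt (fun z : ℂ => z - q) s := by fun_prop
  filter_upwards [this.eventually_ne (hne s hs)] with z hz
  field_simp

/-- Off the closed domain bounded by the contour, `s ↦ s - p` has a logarithm. -/
theorem logNear_sub {p : ℂ} (hp : p ∉ C.hull) : LogNear C.hull (fun s => s - p) := by
  by_contra hcon
  let B : Set ℂ := {q | q ∉ C.hull ∧ ¬ LogNear C.hull (fun s => s - q)}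
  obtain ⟨R, hR⟩ := C.isBounded_hull.exists_norm_le
  refine C.borsuk_separation (B := B) (p := p) ?_ ?_ ⟨hp, hcon⟩ (C.notMem_trace_of_notMem_hull hp)
    (g := fun _ => 1) (by fun_prop) (fun _ _ => one_ne_zero) ?_
  · refine (Metric.isBounded_closedBall (x := (0 : ℂ)) (r := max R 0)).subset fun q hq => ?_
    rw [mem_closedBall_zero_iff]
    by_contra hqR
    push Not at hqR
    have hq0 : q ≠ 0 := fun h => by rw [h, norm_zero] at hqR; exact absurd hqR (by simp)
    refine hq.2 (LogNear.congr (e := fun s => (-q) * (1 + -(s / q)))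
      ((LogNear.const (neg_ne_zero.2 hq0)).mul (LogNear.of_slitPlane fun s hs => ⟨?_, ?_⟩)) ?_)
    · exact analyticAt_const.add (analyticAt_id.div analyticAt_const hq0).neg
    · refine mem_slitPlane_of_norm_lt_one ?_
      rw [norm_neg, norm_div, div_lt_one (norm_pos_iff.2 hq0)]
      exact ((hR s hs).trans (le_max_left _ _)).trans_lt hqR
    · exact fun s _ => Eventually.of_forall fun z => by field_simp; ring
  · intro s hs
    have hs1 : s ∈ C.hull := by
      by_contra hsh
      obtain ⟨δ, hδ, hball⟩ := Metric.isOpen_iff.1 C.isClosed_hull.isOpen_compl s hsh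
      have hd : ∀ q ∈ Metric.ball s (δ / 3), ∀ q' ∈ Metric.ball s (δ / 3), ∀ z ∈ C.hull,
          ‖q' - q‖ < ‖z - q‖ := by
        intro q hq q' hq' z hz
        have h1 : δ ≤ dist z s := by
          by_contra hlt
          exact hball (not_le.1 hlt) hz
        rw [Metric.mem_ball] at hq hq'
        have h2 := dist_triangle z q s
        have h3 := dist_triangle_right q' q s
        rw [dist_eq_norm q' q] at h3
        rw [dist_eq_norm z q] at h2
        linarith
      have hs0 : s ∈ Metric.ball s (δ / 3) := Metric.mem_ball_self (by positivity)
      by_cases hL : LogNear C.hull (fun z => z - s)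
      · obtain ⟨q, hq1, hq2⟩ := mem_closure_iff.1 hs.1 _ Metric.isOpen_ball hs0
        exact hq2.2 (C.logNear_sub_of_near hL (hd s hs0 q hq1))
      · refine hs.2 (mem_interior.2 ⟨Metric.ball s (δ / 3), fun q hq => ⟨?_, fun hq' => ?_⟩,
          Metric.isOpen_ball, hs0⟩)
        · exact hball (Metric.ball_subset_ball (by linarith) hq)
        · exact hL (C.logNear_sub_of_near hq' (hd q hq s hs0))
    refine hs1.resolve_right fun hin => ?_
    obtain ⟨q, hq1, hq2⟩ := mem_closure_iff.1 hs.1 _ C.isOpen_inner hin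
    exact hq2.1 (Or.inr hq1)
  · have e : logDeriv (fun _ : ℂ => (1 : ℂ)) = fun _ => 0 := by
      ext s; simp [logDeriv_apply]
    rw [e]
    refine (C.winding_eq_zero hp).trans ?_
    simp [integral, pathIntegral]

/-- Zeros of an entire function with respect to the contour. -/
theorem exists_inner_factorization {f : ℂ → ℂ} (hf : Differentiable ℂ f)
    (h0 : ∀ s ∈ C.trace, f s ≠ 0) :
    ∃ (W : Multiset ℂ) (e : ℂ → ℂ), LogNear C.hull e ∧
      (∀ s, f s = (W.map fun u => s - u).prod * e s) ∧ ∀ u ∈ W, u ∈ C.inner ∧ f u = 0 := by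
  classical
  obtain ⟨R, hR0, hR⟩ : ∃ R : ℝ, 0 < R ∧ C.hull ⊆ Metric.ball 0 R := by
    obtain ⟨R, hR⟩ := C.isBounded_hull.subset_ball 0
    exact ⟨max R 1, by positivity, hR.trans (Metric.ball_subset_ball (le_max_left _ _))⟩
  obtain ⟨Z, g, hg, hfg, hgne, hZ⟩ := exists_factorization (isCompact_closedBall (0 : ℂ) R) hf
    ⟨_, h0 _ (C.mem_trace (t := 0) (by simp))⟩
  refine ⟨Z.filter (· ∈ C.inner), fun s => ((Z.filter (· ∉ C.inner)).map fun u => s - u).prod * g s,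
    ?_, fun s => ?_, fun u hu => ?_⟩
  · refine (LogNear.multiset_prod _ fun u hu => C.logNear_sub ?_).mul
      ((logNear_ball hg fun s hs => hgne s (Metric.ball_subset_closedBall hs)).mono hR)
    rw [Multiset.mem_filter] at hu
    rintro (h | h)
    · exact h0 u h (hZ u hu.1)
    · exact hu.2 h
  · rw [hfg, ← mul_assoc, ← Multiset.prod_add, ← Multiset.map_add, Multiset.filter_add_not]
  · rw [Multiset.mem_filter] at hu
    exact ⟨hu.2, hZ u hu.1⟩

theorem logNear_of_entire {f : ℂ → ℂ} (hf : Differentiable ℂ f) (h0 : ∀ s ∈ C.hull, f s ≠ 0) :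
    LogNear C.hull f := by
  obtain ⟨W, e, he, hfe, hW⟩ := C.exists_inner_factorization hf fun s hs => h0 s (Or.inl hs)
  have : W = 0 := Multiset.eq_zero_of_forall_notMem fun u hu => h0 u (Or.inr (hW u hu).1) (hW u hu).2
  refine he.congr fun s _ => Eventually.of_forall fun z => ?_
  simp [hfe z, this]

theorem logNear_sinh_sub {p : ℂ} (hp : C.OutsideMod p) : LogNear C.hull (fun s => sinh (s - p)) :=
  C.logNear_of_entire (by fun_prop) fun _ hs => sinh_sub_ne_zero_of_outsideMod hp hs

theorem exists_sinh_factor {w : ℂ} (hw : w ∈ C.inner) :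
    ∃ e : ℂ → ℂ, LogNear C.hull e ∧ ∀ s, s - w = e s * sinh (s - w) ∨ e s = 0 := by
  let f : ℂ → ℂ := fun s => sinh (s - w)
  have hf : Differentiable ℂ f := by fun_prop
  have hd : Differentiable ℂ (dslope f w) := by
    have := (Complex.differentiableOn_dslope (s := univ) (c := w) (f := f) univ_mem).2
      hf.differentiableOn
    exact differentiableOn_univ.1 this
  have hmul : ∀ s, (s - w) * dslope f w s = f s := by
    intro s
    have := sub_smul_dslope f w s
    simpa [f] using this
  have h0 : ∀ s ∈ C.hull, dslope f w s ≠ 0 := by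
    intro s hs h
    by_cases hsw : s = w
    · subst hsw
      rw [dslope_same] at h
      have h1 : HasDerivAt f 1 s := by simpa using ((hasDerivAt_id s).sub_const s).csinh
      rw [h1.deriv] at h
      exact one_ne_zero h
    · have := hmul s
      rw [h, mul_zero] at this
      exact sinh_sub_ne_zero_of_mem (Or.inr hw) hs hsw this.symm
  refine ⟨fun s => (dslope f w s)⁻¹, (C.logNear_of_entire hd h0).inv, fun s => ?_⟩
  by_cases h : dslope f w s = 0
  · right; simp [h]
  · left
    change _ = _ * f s
    rw [← hmul s]
    field_simp

end Contour

theorem hasDerivAt_coth {z : ℂ} (hz : sinh z ≠ 0) : HasDerivAt coth (1 - coth z ^ 2) z := by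
  have h := (hasDerivAt_cosh z).div (hasDerivAt_sinh z) hz
  refine h.congr_deriv ?_
  rw [coth]
  field_simp

theorem logDeriv_sinh_sub (p s : ℂ) : logDeriv (fun s => sinh (s - p)) s = coth (s - p) := by
  have h1 : HasDerivAt (fun s => sinh (s - p)) (cosh (s - p)) s := by
    simpa using ((hasDerivAt_id s).sub_const p).csinh
  rw [logDeriv_apply, h1.deriv, coth]

theorem deriv_log_eq_logDeriv {ℓ e : ℂ → ℂ} {s : ℂ} (hℓ : AnalyticAt ℂ ℓ s)
    (h : ∀ᶠ z in 𝓝 s, exp (ℓ z) = e z) : deriv ℓ s = logDeriv e s := by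
  have h1 : HasDerivAt e (exp (ℓ s) * deriv ℓ s) s :=
    (hℓ.differentiableAt.hasDerivAt.cexp).congr_of_eventuallyEq (h.mono fun z hz => hz.symm)
  rw [logDeriv_apply, h1.deriv, ← h.self_of_nhds]
  field_simp [exp_ne_zero]

namespace Contour

open Set

variable (C : Contour)

/-- `φ` is the product of a function with a logarithm near the closed domain bounded by `C` and of
`∏ sinh(s - w_i) / sinh(s - v)^N`, with `v` and the `w_i` inside of `C`. -/
structure IsFactored (φ : ℂ → ℂ) (v : ℂ) (N : ℕ) {ι : Type*} [Fintype ι] (w : ι → ℂ)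
    (e : ℂ → ℂ) : Prop where
  v_mem : v ∈ C.inner
  w_mem : ∀ i, w i ∈ C.inner
  logNear : LogNear C.hull e
  eq : ∀ s ∈ C.hull, ∀ᶠ z in 𝓝 s, z ≠ v → φ z * sinh (z - v) ^ N = e z * ∏ i, sinh (z - w i)

/-- `L` is a determination of `(2iπ)⁻¹ ln φ` along `C`, without monodromy. -/
structure IsLogAlong (φ : ℂ → ℂ) (L : ℝ → ℂ) : Prop where
  continuousOn : ContinuousOn L (Icc 0 1)
  closed : L 0 = L 1
  exp_eq : ∀ t ∈ Icc (0 : ℝ) 1, exp (2 * Real.pi * I * L t) = φ (C.toFun t)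
  analyticAt : ∀ s ∈ C.trace, AnalyticAt ℂ φ s
  ne_zero : ∀ s ∈ C.trace, φ s ≠ 0
  hasDerivAt : ∀ t ∈ Ioo (0 : ℝ) 1, t ∉ C.breaks →
    HasDerivAt L (logDeriv φ (C.toFun t) / (2 * Real.pi * I) * deriv C.toFun t) t

theorem logDeriv_one_add (a : ℂ → ℂ) (s : ℂ) :
    logDeriv (fun s => 1 + a s) s = deriv a s / (1 + a s) := by
  rw [logDeriv_apply, deriv_const_add]

theorem isLogAlong_logAlong {a : ℂ → ℂ} (ha : ∀ s ∈ C.trace, AnalyticAt ℂ a s)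
    (h0 : ∀ s ∈ C.trace, 1 + a s ≠ 0) (hm : C.monodromy a = 0) {v : ℂ}
    (hv : exp v = 1 + a (C.toFun 0)) :
    C.IsLogAlong (fun s => 1 + a s) (C.logAlong a v) := by
  have hpi : (2 * Real.pi * I : ℂ) ≠ 0 := two_pi_I_ne_zero
  have han : ∀ s ∈ C.trace, AnalyticAt ℂ (fun s => 1 + a s) s := fun s hs =>
    analyticAt_const.add (ha s hs)
  have hc : ContinuousOn (fun t => deriv a (C.toFun t) / (1 + a (C.toFun t))) (Icc 0 1) :=
    C.continuousOn_comp (f := fun s => deriv a s / (1 + a s)) fun s hs =>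
      (ha s hs).deriv.continuousAt.div (han s hs).continuousAt (h0 s hs)
  refine ⟨?_, ?_, fun t ht => ?_, han, h0, fun t ht hb => ?_⟩
  · exact (continuousOn_const.add (C.continuousOn_primitive_path hc)).div_const _
  · have : ∫ u in (0 : ℝ)..1, deriv a (C.toFun u) / (1 + a (C.toFun u)) * deriv C.toFun u = 0 := hm
    simp [logAlong, this]
  · have := C.exp_primitive han h0 ht
    simp only [logDeriv_one_add] at this
    rw [logAlong, mul_div_cancel₀ _ hpi, exp_add, hv, mul_comm]
    exact this
  · have h1 := ((C.hasDerivAt_primitive_path hc ht hb).const_add v).div_const (2 * Real.pi * I)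
    refine h1.congr_deriv ?_
    rw [logDeriv_one_add]
    ring

variable {C}

theorem IsFactored.logDeriv_eq {φ : ℂ → ℂ} {v : ℂ} {N : ℕ} {ι : Type*} [Fintype ι] {w : ι → ℂ}
    {e : ℂ → ℂ} (h : C.IsFactored φ v N w e) {s : ℂ} (hs : s ∈ C.trace) :
    logDeriv φ s = logDeriv e s + ∑ i, coth (s - w i) - N * coth (s - v) := by
  have hv0 : sinh (s - v) ≠ 0 := sinh_sub_ne_zero_of_inner_of_trace h.v_mem hs
  have hw0 : ∀ i, sinh (s - w i) ≠ 0 := fun i => sinh_sub_ne_zero_of_inner_of_trace (h.w_mem i) hs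
  have hsv : s ≠ v := fun hsv => hv0 (by simp [hsv])
  have hea := h.logNear.analyticAt (Or.inl hs)
  have he0 := h.logNear.ne_zero (Or.inl hs)
  have hcont : ContinuousAt (fun z => sinh (z - v)) s := by fun_prop
  have hev : φ =ᶠ[𝓝 s] fun z => (e z * ∏ i, sinh (z - w i)) / sinh (z - v) ^ N := by
    filter_upwards [h.eq s (Or.inl hs), hcont.eventually_ne hv0, isOpen_ne.mem_nhds hsv]
      with z h1 h2 h3
    rw [← h1 h3]
    field_simp
  have hdp : ∀ i ∈ Finset.univ, DifferentiableAt ℂ (fun z => sinh (z - w i)) s := fun i _ => by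
    fun_prop
  have hprod : DifferentiableAt ℂ (fun z => ∏ i, sinh (z - w i)) s := by
    exact DifferentiableAt.fun_finsetProd hdp
  rw [logDeriv_apply, hev.deriv_eq, hev.self_of_nhds, ← logDeriv_apply]
  rw [logDeriv_div (f := fun z => e z * ∏ i, sinh (z - w i)) (g := fun z => sinh (z - v) ^ N) s
    (mul_ne_zero he0 (Finset.prod_ne_zero_iff.2 fun i _ => hw0 i))
    (pow_ne_zero _ hv0) (hea.differentiableAt.mul hprod) (by fun_prop)]
  rw [logDeriv_mul (f := e) (g := fun z => ∏ i, sinh (z - w i)) s he0 (Finset.prod_ne_zero_iff.2 fun i _ => hw0 i) hea.differentiableAt hprod]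
  rw [logDeriv_prod (f := fun i z => sinh (z - w i)) (fun i _ => hw0 i) hdp, logDeriv_fun_pow (by fun_prop)]
  simp only [logDeriv_sinh_sub]

theorem continuousOn_integrand {φ : ℂ → ℂ} (hφ : ∀ s ∈ C.trace, AnalyticAt ℂ φ s)
    (h0 : ∀ s ∈ C.trace, φ s ≠ 0) : ∀ s ∈ C.trace, ContinuousAt (logDeriv φ) s := fun s hs =>
  (hφ s hs).deriv.continuousAt.div (hφ s hs).continuousAt (h0 s hs)

/-- The argument principle. -/
theorem IsFactored.integral_logDeriv_mul {φ : ℂ → ℂ} {v : ℂ} {N : ℕ} {ι : Type*} [Fintype ι]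
    {w : ι → ℂ} {e : ℂ → ℂ} (h : C.IsFactored φ v N w e) {H : ℂ → ℂ}
    (hH : ∀ s ∈ C.hull, AnalyticAt ℂ H s) :
    C.integral (fun s => logDeriv φ s * H s) = 2 * Real.pi * I * (∑ i, H (w i) - N * H v) := by
  have he : ∀ s ∈ C.hull, AnalyticAt ℂ (fun s => logDeriv e s * H s) s := fun s hs =>
    ((h.logNear.analyticAt hs).deriv.div (h.logNear.analyticAt hs) (h.logNear.ne_zero hs)).mul
      (hH s hs)
  have hc : ∀ u ∈ C.inner, ContinuousOn (fun t => H (C.toFun t) * coth (C.toFun t - u)) (Icc 0 1) :=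
    fun u hu => C.continuousOn_comp (f := fun s => H s * coth (s - u)) fun s hs =>
      ((hH s (Or.inl hs)).mul (analyticAt_coth_comp (analyticAt_id.sub analyticAt_const)
        (sinh_sub_ne_zero_of_inner_of_trace hu hs))).continuousAt
  have e1 : C.integral (fun s => logDeriv φ s * H s) = pathIntegral C.toFun (fun t =>
      (logDeriv e (C.toFun t) * H (C.toFun t)
        + ∑ i, H (C.toFun t) * coth (C.toFun t - w i))
        - N * (H (C.toFun t) * coth (C.toFun t - v))) := by
    refine pathIntegral_congr fun t ht => ?_
    show logDeriv φ (C.toFun t) * H (C.toFun t) = _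
    rw [h.logDeriv_eq (C.mem_trace ht), ← Finset.mul_sum]
    ring
  have c1 : ContinuousOn (fun t => logDeriv e (C.toFun t) * H (C.toFun t)) (Icc 0 1) :=
    C.continuousOn_comp fun s hs => (he s (Or.inl hs)).continuousAt
  rw [e1, C.pathIntegral_sub, C.pathIntegral_add c1, C.pathIntegral_sum, pathIntegral_const_mul]
  · have e2 : pathIntegral C.toFun (fun t => logDeriv e (C.toFun t) * H (C.toFun t)) = 0 :=
      C.integral_eq_zero he
    have e3 : ∀ u ∈ C.inner, pathIntegral C.toFun (fun t => H (C.toFun t) * coth (C.toFun t - u))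
        = 2 * Real.pi * I * H u := fun u hu => C.integral_mul_coth_inside hH hu
    rw [e2, e3 v h.v_mem, Finset.sum_congr rfl fun i _ => e3 (w i) (h.w_mem i), ← Finset.mul_sum]
    ring
  · exact fun i _ => hc _ (h.w_mem i)
  · exact continuousOn_finsetSum _ fun i _ => hc _ (h.w_mem i)
  · exact c1.add (continuousOn_finsetSum _ fun i _ => hc _ (h.w_mem i))
  · exact continuousOn_const.mul (hc _ h.v_mem)

/-- Integration by parts along the contour. -/
theorem IsLogAlong.integralW_deriv {φ : ℂ → ℂ} {L : ℝ → ℂ} (hL : C.IsLogAlong φ L) {H : ℂ → ℂ}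
    (hH : ∀ s ∈ C.trace, AnalyticAt ℂ H s) :
    C.integralW L (deriv H) = -(C.integral (fun s => logDeriv φ s * H s) / (2 * Real.pi * I)) := by
  have c1 : ContinuousOn (fun t => H (C.toFun t)) (Icc 0 1) :=
    C.continuousOn_comp fun s hs => (hH s hs).continuousAt
  have c2 : ContinuousOn (fun t => deriv H (C.toFun t)) (Icc 0 1) :=
    C.continuousOn_comp fun s hs => (hH s hs).deriv.continuousAt
  have c3 : ContinuousOn (fun t => logDeriv φ (C.toFun t)) (Icc 0 1) :=
    C.continuousOn_comp (continuousOn_integrand hL.analyticAt hL.ne_zero)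
  have key := C.pathIntegral_eq_sub (F := fun t => L t * H (C.toFun t))
    (g := fun t => deriv H (C.toFun t) * L t
      + (1 / (2 * Real.pi * I)) * (logDeriv φ (C.toFun t) * H (C.toFun t)))
    (hL.continuousOn.mul c1) ((c2.mul hL.continuousOn).add (continuousOn_const.mul (c3.mul c1))) ?_
  · rw [C.pathIntegral_add (g := fun t => deriv H (C.toFun t) * L t)
      (g' := fun t => (1 / (2 * Real.pi * I)) * (logDeriv φ (C.toFun t) * H (C.toFun t))) (c2.mul hL.continuousOn)
      (continuousOn_const.mul (c3.mul c1)), pathIntegral_const_mul, hL.closed, C.closed,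
      sub_self] at key
    rw [integralW, integral]
    linear_combination key
  · intro t ht hb
    have d1 := hL.hasDerivAt t ht hb
    have hmem := C.mem_trace (Ioo_subset_Icc_self ht)
    have d2 : HasDerivAt (fun t => H (C.toFun t)) (deriv H (C.toFun t) * deriv C.toFun t) t :=
      (hH _ hmem).differentiableAt.hasDerivAt.comp t (C.hasDerivAt_toFun ht hb)
    refine (d1.mul d2).congr_deriv ?_
    ring

theorem IsFactored.integralW_deriv {φ : ℂ → ℂ} {v : ℂ} {N : ℕ} {ι : Type*} [Fintype ι] {w : ι → ℂ}
    {e : ℂ → ℂ} (h : C.IsFactored φ v N w e) {L : ℝ → ℂ} (hL : C.IsLogAlong φ L) {H : ℂ → ℂ}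
    (hH : ∀ s ∈ C.hull, AnalyticAt ℂ H s) :
    C.integralW L (deriv H) = N * H v - ∑ i, H (w i) := by
  rw [hL.integralW_deriv fun s hs => hH s (Or.inl hs), h.integral_logDeriv_mul hH,
    mul_div_cancel_left₀ _ two_pi_I_ne_zero]
  ring

theorem integralW_congr {L : ℝ → ℂ} {f g : ℂ → ℂ} (h : ∀ s ∈ C.trace, f s = g s) :
    C.integralW L f = C.integralW L g :=
  pathIntegral_congr fun t ht => by rw [h _ (C.mem_trace ht)]

/-- `exp ∮ L(s) coth(s - p) ds` for `p` outside of the contour. -/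
theorem IsFactored.exp_coth_outside {φ : ℂ → ℂ} {v : ℂ} {N : ℕ} {ι : Type*} [Fintype ι] {w : ι → ℂ}
    {e : ℂ → ℂ} (h : C.IsFactored φ v N w e) {L : ℝ → ℂ} (hL : C.IsLogAlong φ L) {p : ℂ}
    (hp : C.OutsideMod p) :
    exp (C.integralW L (fun s => coth (s - p))) = sinh (v - p) ^ N / ∏ i, sinh (w i - p) := by
  obtain ⟨ℓ, hℓ⟩ := C.logNear_sinh_sub hp
  have e1 : C.integralW L (fun s => coth (s - p)) = C.integralW L (deriv ℓ) :=
    integralW_congr fun s hs => by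
      rw [deriv_log_eq_logDeriv (hℓ s (Or.inl hs)).1 (hℓ s (Or.inl hs)).2, logDeriv_sinh_sub]
  rw [e1, h.integralW_deriv hL fun s hs => (hℓ s hs).1, exp_sub, exp_sum, exp_nat_mul,
    (hℓ v (Or.inr h.v_mem)).2.self_of_nhds,
    Finset.prod_congr rfl fun i _ => (hℓ (w i) (Or.inr (h.w_mem i))).2.self_of_nhds]

theorem integral_coth_mul_coth {w p : ℂ} (hw : w ∈ C.inner) (hp : p ∈ C.inner) :
    C.integral (fun s => coth (s - w) * coth (s - p)) = 0 := by
  classical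
  by_cases h : w = p
  · subst h
    have hd : ∀ s ∈ C.trace, HasDerivAt (fun s => s - coth (s - w)) (coth (s - w) * coth (s - w)) s :=
      fun s hs => by
        have h1 := (hasDerivAt_coth (sinh_sub_ne_zero_of_inner_of_trace hw hs)).comp s
          ((hasDerivAt_id s).sub_const w)
        refine ((hasDerivAt_id s).sub h1).congr_deriv ?_
        ring
    have c1 : ∀ s ∈ C.trace, ContinuousAt (fun s => coth (s - w)) s := fun s hs =>
      (analyticAt_coth_comp (analyticAt_id.sub analyticAt_const)
        (sinh_sub_ne_zero_of_inner_of_trace hw hs)).continuousAt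
    have := C.pathIntegral_eq_sub (F := fun t => C.toFun t - coth (C.toFun t - w))
      (g := fun t => coth (C.toFun t - w) * coth (C.toFun t - w)) ?_ ?_ ?_
    · rw [C.closed, sub_self] at this
      exact this
    · exact C.continuousOn_comp (f := fun s => s - coth (s - w)) fun s hs => (hd s hs).continuousAt
    · exact C.continuousOn_comp (f := fun s => coth (s - w) * coth (s - w)) fun s hs =>
        (c1 s hs).mul (c1 s hs)
    · intro t ht hb
      exact (hd _ (C.mem_trace (Ioo_subset_Icc_self ht))).comp t (C.hasDerivAt_toFun ht hb)
  · have key := C.integral_eq_sum_residues {w, p} ?_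
      (fun u => if u = w then coth (w - p) else coth (p - w))
      (fun s => coth (s - w) * coth (s - p)) ?_ ?_
    · rw [key, Finset.sum_pair h]
      simp only [if_true, Ne.symm h, if_false]
      rw [← neg_sub w p, coth_neg]
      ring
    · intro u hu
      simp only [Finset.mem_insert, Finset.mem_singleton] at hu
      rcases hu with rfl | rfl <;> assumption
    · intro s hs hsS
      simp only [Finset.mem_insert, Finset.mem_singleton, not_or] at hsS
      exact (analyticAt_coth_comp (analyticAt_id.sub analyticAt_const)
        (sinh_sub_ne_zero_of_mem (Or.inr hw) hs hsS.1)).mul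
        (analyticAt_coth_comp (analyticAt_id.sub analyticAt_const)
        (sinh_sub_ne_zero_of_mem (Or.inr hp) hs hsS.2))
    · have aux : ∀ a ∈ C.inner, ∀ b ∈ C.inner, a ≠ b →
          Tendsto (fun s => (s - a) * (coth (s - a) * coth (s - b))) (𝓝[≠] a) (𝓝 (coth (a - b))) := by
        intro a ha b hb hab
        have h1 : ContinuousAt (fun s => coth (s - b)) a :=
          (analyticAt_coth_comp (analyticAt_id.sub analyticAt_const)
            (sinh_sub_ne_zero_of_mem (Or.inr hb) (Or.inr ha) hab)).continuousAt
        have h2 := (tendsto_sub_mul_coth a).mul (h1.tendsto.mono_left nhdsWithin_le_nhds)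
        rw [one_mul] at h2
        exact h2.congr fun s => by ring
      intro u hu
      simp only [Finset.mem_insert, Finset.mem_singleton] at hu
      rcases hu with rfl | rfl
      · simpa using aux u hw p hp h
      · simp only [Ne.symm h, if_false]
        refine (aux u hp w hw (Ne.symm h)).congr fun s => by ring

/-- A logarithm of `sinh(s - w) / sinh(s - v)` along the contour has a vanishing Cauchy transform
modulo `2iπ`, when `v` and `w` are inside. -/
theorem exp_integralW_ratio {v p : ℂ} (hv : v ∈ C.inner) (hp : p ∈ C.inner) {w : ℂ}
    (hw : w ∈ C.inner) {l : ℝ → ℂ} (hl : ContinuousOn l (Icc 0 1))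
    (hexp : ∀ t ∈ Icc (0 : ℝ) 1, exp (l t) = sinh (C.toFun t - w) / sinh (C.toFun t - v)) :
    exp (C.integralW l (fun s => coth (s - p)) / (2 * Real.pi * I)) = 1 := by
  have hpi : (2 * Real.pi * I : ℂ) ≠ 0 := two_pi_I_ne_zero
  have hcp : ContinuousOn (fun t => coth (C.toFun t - p)) (Icc 0 1) :=
    C.continuousOn_comp (f := fun s => coth (s - p)) fun s hs =>
      (analyticAt_coth_comp (analyticAt_id.sub analyticAt_const)
        (sinh_sub_ne_zero_of_inner_of_trace hp hs)).continuousAt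
  let P : ℂ → Prop := fun w => ∀ l : ℝ → ℂ, ContinuousOn l (Icc 0 1) →
    (∀ t ∈ Icc (0 : ℝ) 1, exp (l t) = sinh (C.toFun t - w) / sinh (C.toFun t - v)) →
    exp (C.integralW l (fun s => coth (s - p)) / (2 * Real.pi * I)) = 1
  have hPv : P v := by
    intro l hl he
    have he1 : ∀ t ∈ Icc (0 : ℝ) 1, exp (l t) = 1 := fun t ht => by
      rw [he t ht, div_self (sinh_sub_ne_zero_of_inner_of_trace hv (C.mem_trace ht))]
    have key := exp_lift_unique (X := Icc (0 : ℝ) 1) (g₁ := fun t => l t) (g₂ := fun _ => l 0)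
      (continuousOn_iff_continuous_domRestrict.1 hl) continuous_const
      (fun t => by rw [he1 t t.2, he1 0 (by simp)]) (a := ⟨0, by simp⟩) rfl
    have e1 : C.integralW l (fun s => coth (s - p))
        = l 0 * C.integral (fun s => 1 * coth (s - p)) := by
      rw [integral, ← pathIntegral_const_mul]
      refine pathIntegral_congr fun t ht => ?_
      rw [congrFun key ⟨t, ht⟩]
      ring
    rw [e1, C.integral_mul_coth_inside (fun s _ => analyticAt_const) hp]
    rw [show l 0 * (2 * Real.pi * I * 1) / (2 * Real.pi * I) = l 0 by field_simp]
    exact he1 0 (by simp)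
  -- the property is locally constant
  have hloc : ∀ w₀ ∈ C.inner, ∀ᶠ w in 𝓝 w₀, (P w ↔ P w₀) := by
    intro w₀ hw₀
    have hne0 : ∀ s ∈ C.trace, sinh (s - w₀) ≠ 0 := fun s hs =>
      sinh_sub_ne_zero_of_inner_of_trace hw₀ hs
    have hev : ∀ᶠ w in 𝓝 w₀, w ∈ C.inner ∧
        ∀ s ∈ C.trace, sinh (s - w) / sinh (s - w₀) ∈ slitPlane := by
      refine Filter.Eventually.and
        (show ∀ᶠ w in 𝓝 w₀, w ∈ C.inner from C.isOpen_inner.mem_nhds hw₀)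
        (C.isCompact_trace.eventually_forall_of_forall_eventually fun s hs => ?_)
      have hc : ContinuousAt (fun q : ℂ × ℂ => sinh (q.2 - q.1) / sinh (q.2 - w₀)) (w₀, s) := by
        have := hne0 s hs
        fun_prop (disch := assumption)
      refine hc.eventually (isOpen_slitPlane.mem_nhds ?_)
      simp [div_self (hne0 s hs)]
    obtain ⟨ρ, hρ, hball⟩ := Metric.eventually_nhds_iff_ball.1 hev
    let g : ℂ → ℂ → ℂ := fun w s => log (sinh (s - w) / sinh (s - w₀)) * coth (s - p)
    have hzero : ∀ w ∈ Metric.ball w₀ ρ, C.integralW (fun _ => 1) (g w) = 0 := by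
      have hcont : ∀ z ∈ Metric.ball w₀ ρ, ∀ s ∈ C.trace,
          ContinuousAt (fun q : ℂ × ℂ => g q.1 q.2) (z, s) := by
        intro z hz s hs
        have h1 := hne0 s hs
        have h2 := (hball z hz).2 s hs
        have h3 : sinh (s - p) ≠ 0 := sinh_sub_ne_zero_of_inner_of_trace hp hs
        have c1 : ContinuousAt (fun q : ℂ × ℂ => sinh (q.2 - q.1) / sinh (q.2 - w₀)) (z, s) := by
          fun_prop (disch := assumption)
        have c2 : ContinuousAt (fun q : ℂ × ℂ => coth (q.2 - p)) (z, s) := by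
          unfold coth
          fun_prop (disch := assumption)
        exact (c1.clog h2).mul c2
      have hder : ∀ s ∈ C.trace, ∀ z ∈ Metric.ball w₀ ρ,
          HasDerivAt (fun z => g z s) (-coth (s - z) * coth (s - p)) z := by
        intro s hs z hz
        have h1 := hne0 s hs
        have h2 := (hball z hz).2 s hs
        have h3 : sinh (s - z) ≠ 0 := sinh_sub_ne_zero_of_inner_of_trace (hball z hz).1 hs
        have d1 : HasDerivAt (fun z => sinh (s - z) / sinh (s - w₀))
            (-cosh (s - z) / sinh (s - w₀)) z := by
          have d0 := (((hasDerivAt_id z).const_sub s).csinh).div_const (sinh (s - w₀))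
          refine d0.congr_deriv ?_
          simp
        refine ((d1.clog h2).mul_const (coth (s - p))).congr_deriv ?_
        congr 1
        rw [coth]
        field_simp
      have hd0 : ∀ z ∈ Metric.ball w₀ ρ,
          HasDerivAt (fun z => C.integralW (fun _ => 1) (g z)) 0 z := by
        intro z hz
        have h1 := C.hasDerivAt_integralW Metric.isOpen_ball (L := fun _ => 1) continuousOn_const
          hcont (fun s hs z hz => (hder s hs z hz).differentiableAt.differentiableWithinAt) hz
        refine h1.congr_deriv ?_
        have e1 : C.integralW (fun _ => 1) (fun s => deriv (fun z => g z s) z)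
            = -1 * C.integral (fun s => coth (s - z) * coth (s - p)) := by
          rw [integral, ← pathIntegral_const_mul]
          refine pathIntegral_congr fun t ht => ?_
          show deriv (fun z => g z (C.toFun t)) z * 1 = _
          rw [(hder _ (C.mem_trace ht) z hz).deriv]
          ring
        rw [e1, integral_coth_mul_coth (hball z hz).1 hp, mul_zero]
      intro w hw
      have h1 := Metric.isOpen_ball.is_const_of_deriv_eq_zero (convex_ball w₀ ρ).isPreconnected
        (f := fun z => C.integralW (fun _ => 1) (g z))
        (fun z hz => (hd0 z hz).differentiableAt.differentiableWithinAt)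
        (fun z hz => (hd0 z hz).deriv) hw (Metric.mem_ball_self hρ)
      refine h1.trans ?_
      have : C.integralW (fun _ => 1) (g w₀) = C.integralW (fun _ => 1) (fun _ => 0) :=
        integralW_congr fun s hs => by simp [g, div_self (hne0 s hs)]
      rw [this]
      simp [integralW, pathIntegral]
    have hlc : ∀ w ∈ Metric.ball w₀ ρ,
        ContinuousOn (fun t => log (sinh (C.toFun t - w) / sinh (C.toFun t - w₀))) (Icc 0 1) := by
      intro w hw
      refine C.continuousOn_comp (f := fun s => log (sinh (s - w) / sinh (s - w₀))) fun s hs => ?_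
      have h1 := hne0 s hs
      have c1 : ContinuousAt (fun s => sinh (s - w) / sinh (s - w₀)) s := by
        fun_prop (disch := assumption)
      exact c1.clog ((hball w hw).2 s hs)
    have hshift : ∀ w ∈ Metric.ball w₀ ρ, ∀ (σ : ℂ) (l : ℝ → ℂ), ContinuousOn l (Icc 0 1) →
        C.integralW (fun t => l t + σ * log (sinh (C.toFun t - w) / sinh (C.toFun t - w₀)))
          (fun s => coth (s - p)) = C.integralW l (fun s => coth (s - p)) := by
      intro w hw σ l hl
      have h1 := C.pathIntegral_add (g := fun t => coth (C.toFun t - p) * l t)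
        (g' := fun t => σ * (log (sinh (C.toFun t - w) / sinh (C.toFun t - w₀))
          * coth (C.toFun t - p)))
        (hcp.mul hl) (continuousOn_const.mul ((hlc w hw).mul hcp))
      rw [pathIntegral_const_mul] at h1
      have h2 : pathIntegral C.toFun (fun t => log (sinh (C.toFun t - w) / sinh (C.toFun t - w₀))
          * coth (C.toFun t - p)) = 0 := by
        rw [← hzero w hw]
        simp [integralW, g]
      rw [h2, mul_zero, add_zero] at h1
      rw [integralW, integralW, ← h1]
      refine pathIntegral_congr fun t _ => ?_
      ring
    filter_upwards [Metric.ball_mem_nhds w₀ hρ] with w hw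
    have hrat : ∀ t ∈ Icc (0 : ℝ) 1, exp (log (sinh (C.toFun t - w) / sinh (C.toFun t - w₀)))
        = sinh (C.toFun t - w) / sinh (C.toFun t - w₀) := fun t ht =>
      exp_log (slitPlane_ne_zero ((hball w hw).2 _ (C.mem_trace ht)))
    constructor
    · intro hP l hl he
      rw [← hshift w hw 1 l hl]
      refine hP _ (hl.add (continuousOn_const.mul (hlc w hw))) fun t ht => ?_
      have h1 := hne0 _ (C.mem_trace ht)
      rw [one_mul, exp_add, he t ht, hrat t ht]
      field_simp
    · intro hP l hl he
      rw [← hshift w hw (-1) l hl]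
      refine hP _ (hl.add (continuousOn_const.mul (hlc w hw))) fun t ht => ?_
      have h1 := hne0 _ (C.mem_trace ht)
      have h2 : sinh (C.toFun t - w) ≠ 0 :=
        sinh_sub_ne_zero_of_inner_of_trace (hball w hw).1 (C.mem_trace ht)
      rw [neg_one_mul, exp_add, exp_neg, he t ht, hrat t ht]
      field_simp
  -- hence constant
  have hall : P w := by
    by_contra hPw
    let u : Set ℂ := interior {z | P z}
    let u' : Set ℂ := interior {z | ¬ P z}
    have hu : ∀ z ∈ C.inner, P z → z ∈ u := fun z hz hPz => by
      rw [mem_interior_iff_mem_nhds]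
      filter_upwards [hloc z hz] with y hy using hy.2 hPz
    have hu' : ∀ z ∈ C.inner, ¬ P z → z ∈ u' := fun z hz hPz => by
      rw [mem_interior_iff_mem_nhds]
      filter_upwards [hloc z hz] with y hy using fun h => hPz (hy.1 h)
    obtain ⟨z, -, hz1, hz2⟩ := C.isPreconnected_inner u u' isOpen_interior isOpen_interior
      (fun z hz => by
        by_cases hPz : P z
        · exact Or.inl (hu z hz hPz)
        · exact Or.inr (hu' z hz hPz)) ⟨v, hv, hu v hv hPv⟩ ⟨w, hw, hu' w hw hPw⟩
    exact interior_subset hz2 (interior_subset hz1)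
  exact hall l hl hexp

/-- `exp ∮ L(s) coth(s - p) ds` for `p` inside of the contour. -/
theorem IsFactored.exp_coth_inside {φ : ℂ → ℂ} {v : ℂ} {N : ℕ} {w : Fin N → ℂ} {e : ℂ → ℂ}
    (h : C.IsFactored φ v N w e) {L : ℝ → ℂ} (hL : C.IsLogAlong φ L) {p : ℂ} (hp : p ∈ C.inner) :
    exp (C.integralW L (fun s => coth (s - p))) = e p := by
  have hpi : (2 * Real.pi * I : ℂ) ≠ 0 := two_pi_I_ne_zero
  obtain ⟨ℓ, hℓ⟩ := h.logNear
  have hv0 : ∀ s ∈ C.trace, sinh (s - v) ≠ 0 := fun s hs =>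
    sinh_sub_ne_zero_of_inner_of_trace h.v_mem hs
  have hw0 : ∀ i, ∀ s ∈ C.trace, sinh (s - w i) ≠ 0 := fun i s hs =>
    sinh_sub_ne_zero_of_inner_of_trace (h.w_mem i) hs
  have hcp : ContinuousOn (fun t => coth (C.toFun t - p)) (Icc 0 1) :=
    C.continuousOn_comp (f := fun s => coth (s - p)) fun s hs =>
      (analyticAt_coth_comp (analyticAt_id.sub analyticAt_const)
        (sinh_sub_ne_zero_of_inner_of_trace hp hs)).continuousAt
  have hGan : ∀ i, ∀ s ∈ C.trace, AnalyticAt ℂ (fun s => sinh (s - w i) / sinh (s - v)) s :=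
    fun i s hs => (analyticAt_sinh_comp (analyticAt_id.sub analyticAt_const)).div
      (analyticAt_sinh_comp (analyticAt_id.sub analyticAt_const)) (hv0 s hs)
  have hG0 : ∀ i, ∀ s ∈ C.trace, sinh (s - w i) / sinh (s - v) ≠ 0 := fun i s hs =>
    div_ne_zero (hw0 i s hs) (hv0 s hs)
  have hlog : ∀ i, ∃ l : ℝ → ℂ, ContinuousOn l (Icc 0 1) ∧
      ∀ t ∈ Icc (0 : ℝ) 1, exp (l t) = sinh (C.toFun t - w i) / sinh (C.toFun t - v) := by
    intro i
    refine ⟨fun t => log (sinh (C.toFun 0 - w i) / sinh (C.toFun 0 - v)) + ∫ u in (0 : ℝ)..t,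
      logDeriv (fun s => sinh (s - w i) / sinh (s - v)) (C.toFun u) * deriv C.toFun u,
      continuousOn_const.add (C.continuousOn_primitive_path
        (C.continuousOn_comp (continuousOn_integrand (hGan i) (hG0 i)))), fun t ht => ?_⟩
    rw [exp_add, exp_log (hG0 i _ (C.mem_trace (by simp))), mul_comm]
    exact C.exp_primitive (hGan i) (hG0 i) ht
  choose l hlc hle using hlog
  have hℓc : ContinuousOn (fun t => ℓ (C.toFun t)) (Icc 0 1) :=
    C.continuousOn_comp fun s hs => (hℓ s (Or.inl hs)).1.continuousAt
  have hφ : ∀ t ∈ Icc (0 : ℝ) 1, φ (C.toFun t) = exp (ℓ (C.toFun t) + ∑ i, l i t) := by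
    intro t ht
    have hmem := C.mem_trace ht
    have h1 := hv0 _ hmem
    have hne : C.toFun t ≠ v := fun h0 => h1 (by simp [h0])
    have h2 := (h.eq _ (Or.inl hmem)).self_of_nhds hne
    rw [exp_add, (hℓ _ (Or.inl hmem)).2.self_of_nhds, exp_sum,
      Finset.prod_congr rfl fun i _ => hle i t ht, Finset.prod_div_distrib, Finset.prod_const,
      Finset.card_univ, Fintype.card_fin, ← mul_div_assoc, ← h2]
    field_simp
  set c : ℂ := 2 * Real.pi * I * L 0 - (ℓ (C.toFun 0) + ∑ i, l i 0) with hc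
  have hexpc : exp c = 1 := by
    rw [hc, exp_sub, hL.exp_eq 0 (by simp), hφ 0 (by simp), div_self (exp_ne_zero _)]
  have hsumc : ContinuousOn (fun t => ∑ i, l i t) (Icc 0 1) :=
    continuousOn_finsetSum _ fun i _ => hlc i
  have key := exp_lift_unique (X := Icc (0 : ℝ) 1) (g₁ := fun t => 2 * Real.pi * I * L t)
    (g₂ := fun t => (ℓ (C.toFun t) + ∑ i, l i t) + c)
    (continuousOn_iff_continuous_domRestrict.1 (continuousOn_const.mul hL.continuousOn))
    (continuousOn_iff_continuous_domRestrict.1 ((hℓc.add hsumc).add continuousOn_const))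
    (fun t => by rw [hL.exp_eq t t.2, hφ t t.2, exp_add _ c, hexpc, mul_one])
    (a := ⟨0, by simp⟩) (by simp [hc])
  have e1 : C.integralW L (fun s => coth (s - p)) = (1 / (2 * Real.pi * I)) *
      pathIntegral C.toFun (fun t => (ℓ (C.toFun t) * coth (C.toFun t - p)
        + ∑ i, coth (C.toFun t - p) * l i t) + c * (1 * coth (C.toFun t - p))) := by
    rw [← pathIntegral_const_mul]
    refine pathIntegral_congr fun t ht => ?_
    have := congrFun key ⟨t, ht⟩
    simp only at this
    rw [← Finset.mul_sum, show L t = 1 / (2 * Real.pi * I) * (2 * Real.pi * I * L t) by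
      field_simp, this]
    ring
  have a1 : ContinuousOn (fun t => ℓ (C.toFun t) * coth (C.toFun t - p)) (Icc 0 1) := hℓc.mul hcp
  have a2 : ∀ i ∈ Finset.univ, ContinuousOn (fun t => coth (C.toFun t - p) * l i t) (Icc 0 1) :=
    fun i _ => hcp.mul (hlc i)
  have i1 : pathIntegral C.toFun (fun t => ℓ (C.toFun t) * coth (C.toFun t - p))
      = 2 * Real.pi * I * ℓ p := C.integral_mul_coth_inside (fun s hs => (hℓ s hs).1) hp
  have i2 : pathIntegral C.toFun (fun t => 1 * coth (C.toFun t - p)) = 2 * Real.pi * I * 1 :=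
    C.integral_mul_coth_inside (H := fun _ => 1) (fun s _ => analyticAt_const) hp
  rw [e1, C.pathIntegral_add
    (g := fun t => ℓ (C.toFun t) * coth (C.toFun t - p) + ∑ i, coth (C.toFun t - p) * l i t)
    (g' := fun t => c * (1 * coth (C.toFun t - p))) (a1.add (continuousOn_finsetSum _ a2))
    (continuousOn_const.mul (continuousOn_const.mul hcp)),
    C.pathIntegral_add a1 (continuousOn_finsetSum _ a2), C.pathIntegral_sum _ a2,
    pathIntegral_const_mul, i1, i2]
  have e2 : 1 / (2 * Real.pi * I) * (2 * Real.pi * I * ℓ p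
      + ∑ i, pathIntegral C.toFun (fun t => coth (C.toFun t - p) * l i t)
      + c * (2 * Real.pi * I * 1)) = (ℓ p + c)
      + ∑ i, C.integralW (l i) (fun s => coth (s - p)) / (2 * Real.pi * I) := by
    rw [← Finset.sum_div]
    simp only [integralW]
    field_simp
    ring
  rw [e2, exp_add, exp_add, hexpc, mul_one, exp_sum,
    Finset.prod_congr rfl fun i _ => exp_integralW_ratio h.v_mem hp (h.w_mem i) (hlc i) (hle i)]
  simp [(hℓ p (Or.inr hp)).2.self_of_nhds]

theorem integralW_coth_add_int (L : ℝ → ℂ) (p : ℂ) (k : ℤ) :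
    C.integralW L (fun s => coth (s - (p + k * (Real.pi * I)))) = C.integralW L (fun s => coth (s - p)) :=
  integralW_congr fun s _ => by
    rw [← coth_add_int_mul_pi (s - (p + k * (Real.pi * I))) k]
    congr 1; ring

end Contour

namespace Contour

open Set

variable {C : Contour}

theorem IsFactored.perm {φ : ℂ → ℂ} {v : ℂ} {N : ℕ} {w : Fin N → ℂ} {e : ℂ → ℂ}
    (h : C.IsFactored φ v N w e) {u : Fin N → ℂ} (hu : Function.Injective u)
    (hmem : ∀ i, u i ∈ C.inner) (h0 : ∀ i, φ (u i) = 0) (hv : ∀ i, u i ≠ v) :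
    C.IsFactored φ v N u e := by
  have key : ∀ i, ∃ j, u i = w j := by
    intro i
    have hi : u i ∈ C.hull := Or.inr (hmem i)
    have h1 := (h.eq _ hi).self_of_nhds (hv i)
    rw [h0 i, zero_mul, eq_comm, mul_eq_zero, or_iff_right (h.logNear.ne_zero hi),
      Finset.prod_eq_zero_iff] at h1
    obtain ⟨j, -, hj⟩ := h1
    refine ⟨j, by_contra fun hne => ?_⟩
    exact sinh_sub_ne_zero_of_mem (Or.inr (h.w_mem j)) hi hne hj
  choose σ hσ using key
  have hσi : Function.Injective σ := fun i j hij => hu (by rw [hσ i, hσ j, hij])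
  have hσb : Function.Bijective σ := Finite.injective_iff_bijective.1 hσi
  refine ⟨h.v_mem, hmem, h.logNear, fun s hs => ?_⟩
  filter_upwards [h.eq s hs] with z hz hzv
  rw [hz hzv]
  congr 1
  rw [← Function.Bijective.prod_comp hσb (fun j => sinh (z - w j))]
  exact Finset.prod_congr rfl fun i _ => by rw [hσ i]

theorem IsFactored.restrict {φ : ℂ → ℂ} {v : ℂ} {N : ℕ} {w : Fin N → ℂ} {e : ℂ → ℂ}
    (h : C.IsFactored φ v N w e) {C' : Contour} (hsub : C'.hull ⊆ C.hull) (hv : v ∈ C'.inner)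
    (hw : ∀ i, w i ∈ C'.inner) : C'.IsFactored φ v N w e :=
  ⟨hv, hw, h.logNear.mono hsub, fun s hs => h.eq s (hsub hs)⟩

/-- Zeros and poles inside of a contour along which a meromorphic function with a single pole has
no monodromy. -/
theorem exists_isFactored {φ n d : ℂ → ℂ} {v : ℂ} {N : ℕ} (hn : Differentiable ℂ n)
    (hd : Differentiable ℂ d) (hd0 : ∀ s ∈ C.hull, d s ≠ 0) (hv : v ∈ C.inner)
    (hφ : ∀ z, sinh (z - v) ≠ 0 → d z ≠ 0 → φ z * (sinh (z - v) ^ N * d z) = n z)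
    (h0 : ∀ s ∈ C.trace, φ s ≠ 0) (hm : C.integral (logDeriv φ) = 0) :
    ∃ (w : Fin N → ℂ) (e : ℂ → ℂ), C.IsFactored φ v N w e ∧ ∀ i, n (w i) = 0 := by
  obtain ⟨W, g, hg, hW, hWz⟩ := C.exists_inner_factorization hn fun s hs => by
    have h1 := sinh_sub_ne_zero_of_inner_of_trace hv hs
    have h2 := hd0 s (Or.inl hs)
    rw [← hφ s h1 h2]
    exact mul_ne_zero (h0 s hs) (mul_ne_zero (pow_ne_zero _ h1) h2)
  obtain ⟨l, rfl⟩ : ∃ l : List ℂ, W = l := ⟨W.toList, by simp⟩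
  let w : Fin l.length → ℂ := l.get
  have hw : ∀ i, w i ∈ C.inner ∧ n (w i) = 0 := fun i => hWz _ (by simp [w])
  have hprod : ∀ s, n s = (∏ i, (s - w i)) * g s := fun s => by
    rw [hW s]
    congr 1
    have h := List.prod_ofFn (f := fun i => s - w i)
    rw [← h]
    simp only [Multiset.map_coe, Multiset.prod_coe]
    congr 1
    exact (List.ofFn_getElem_eq_map l fun u => s - u).symm
  choose E hE hEs using fun i => C.exists_sinh_factor (hw i).1
  have hfac : C.IsFactored φ v N w (fun s => g s * (∏ i, E i s) / d s) := by
    refine ⟨hv, fun i => (hw i).1, (hg.mul (LogNear.prod _ fun i _ => hE i)).div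
      (C.logNear_of_entire hd hd0), fun s hs => ?_⟩
    have ev1 : ∀ᶠ z in 𝓝 s, ∀ i, E i z ≠ 0 := eventually_all.2 fun i =>
      ((hE i).analyticAt hs).continuousAt.eventually_ne ((hE i).ne_zero hs)
    have ev2 : ∀ᶠ z in 𝓝 s, d z ≠ 0 := hd.continuous.continuousAt.eventually_ne (hd0 s hs)
    have ev3 : ∀ᶠ z in 𝓝 s, z ≠ v → sinh (z - v) ≠ 0 := by
      by_cases hsv : s = v
      · subst hsv
        have := (tendsto_sub_mul_coth s).eventually_ne one_ne_zero
        rw [eventually_nhdsWithin_iff] at this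
        filter_upwards [this] with z hz hzs h0
        exact hz hzs (by simp [coth, h0])
      · have hc : ContinuousAt (fun z => sinh (z - v)) s := by fun_prop
        filter_upwards [hc.eventually_ne (sinh_sub_ne_zero_of_mem (Or.inr hv) hs hsv)] with z hz _
          using hz
    filter_upwards [ev1, ev2, ev3] with z h1 h2 h3 hzv
    have h4 := hφ z (h3 hzv) h2
    rw [hprod z, Finset.prod_congr rfl fun i _ => (hEs i z).resolve_right (h1 i),
      Finset.prod_mul_distrib] at h4
    field_simp
    linear_combination h4
  have hcard : l.length = N := by
    have h1 := hfac.integral_logDeriv_mul (H := fun _ => 1) fun _ _ => analyticAt_const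
    simp only [mul_one, Finset.sum_const, Finset.card_univ, Fintype.card_fin, nsmul_eq_mul] at h1
    have h2 : C.integral (fun s => logDeriv φ s) = 0 := hm
    rw [h2, eq_comm, mul_eq_zero, or_iff_right two_pi_I_ne_zero, sub_eq_zero] at h1
    exact_mod_cast h1
  have hw2 : ∀ i, n (w i) = 0 := fun i => (hw i).2
  clear_value w
  subst hcard
  exact ⟨w, _, hfac, hw2⟩

theorem IsFactored.integral_logDeriv {φ : ℂ → ℂ} {v : ℂ} {N : ℕ} {w : Fin N → ℂ} {e : ℂ → ℂ}
    (h : C.IsFactored φ v N w e) : C.integral (logDeriv φ) = 0 := by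
  have h1 := h.integral_logDeriv_mul (H := fun _ => 1) fun _ _ => analyticAt_const
  simpa using h1

end Contour

namespace Params

variable (P : Params) (h : ℝ) (μ : Fin P.N → ℂ)

theorem countingFn_add_int (ξ : ℂ) (k : ℤ) :
    P.countingFn h μ (ξ + k * (Real.pi * I)) = P.countingFn h μ ξ := by
  have hk : ((-1 : ℂ) ^ k) ≠ 0 := zpow_ne_zero _ (by norm_num)
  have hk' : ((-1 : ℂ) ^ (-k)) = (-1) ^ k := by
    rw [zpow_neg, ← inv_zpow]; norm_num
  have s1 : ∀ c : ℂ, sinh (c + (ξ + k * (Real.pi * I))) = (-1) ^ k * sinh (c + ξ) := fun c => by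
    rw [← sinh_add_int_mul_pi]; congr 1; ring
  have s2 : ∀ c : ℂ, sinh (c - (ξ + k * (Real.pi * I))) = (-1) ^ k * sinh (c - ξ) := fun c => by
    rw [← hk', ← sinh_add_int_mul_pi]; congr 1; push_cast; ring
  unfold countingFn
  congr 1
  · congr 1
    refine Finset.prod_congr rfl fun c _ => ?_
    rw [show P.iζ - (ξ + k * (Real.pi * I)) + μ c = (P.iζ + μ c) - (ξ + k * (Real.pi * I)) by ring,
      show P.iζ + (ξ + k * (Real.pi * I)) - μ c = (P.iζ - μ c) + (ξ + k * (Real.pi * I)) by ring,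
      s1, s2, mul_div_mul_left _ _ hk]
    congr 2 <;> ring
  · congr 1
    rw [show ξ + k * (Real.pi * I) - P.b = -P.b + (ξ + k * (Real.pi * I)) by ring,
      show P.iζ + (ξ + k * (Real.pi * I)) + P.b = (P.iζ + P.b) + (ξ + k * (Real.pi * I)) by ring,
      show ξ + k * (Real.pi * I) + P.b = P.b + (ξ + k * (Real.pi * I)) by ring,
      show P.iζ - (ξ + k * (Real.pi * I)) + P.b = (P.iζ + P.b) - (ξ + k * (Real.pi * I)) by ring,
      s1, s1, s1, s2, mul_mul_mul_comm _ (sinh (-P.b + ξ)), mul_mul_mul_comm _ (sinh (P.b + ξ)),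
      mul_div_mul_left _ _ (mul_ne_zero hk hk)]
    congr 2 <;> ring_nf

theorem countingFn_neg_b (hN : 0 < P.N) : P.countingFn h μ (-P.b) = 0 := by
  simp [countingFn, hN.ne']

/-- The nonvanishing part of the denominator of the counting function. -/
noncomputable def cden (s : ℂ) : ℂ := (∏ k, sinh (P.iζ + s - μ k)) * sinh (P.iζ - s + P.b) ^ P.N

/-- The numerator of the counting function. -/
noncomputable def cnum (s : ℂ) : ℂ :=
  exp (-(h / P.T : ℝ)) * (∏ k, sinh (P.iζ - s + μ k)) * (sinh (s - P.b) * sinh (P.iζ + s + P.b)) ^ P.N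

theorem countingFn_eq_div (s : ℂ) :
    P.countingFn h μ s = P.cnum h μ s / (sinh (s + P.b) ^ P.N * P.cden μ s) := by
  rw [countingFn, cnum, cden, Finset.prod_div_distrib, div_pow, mul_pow (sinh (s + P.b))]
  simp only [div_eq_mul_inv, mul_inv]
  ring

theorem differentiable_cden : Differentiable ℂ (P.cden μ) := by
  unfold cden
  refine Differentiable.mul ?_ (by fun_prop)
  exact Differentiable.fun_finsetProd fun k _ => by fun_prop

theorem differentiable_cnum : Differentiable ℂ (P.cnum h μ) := by
  unfold cnum
  refine Differentiable.mul ((differentiable_const _).mul ?_) (by fun_prop)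
  exact Differentiable.fun_finsetProd fun k _ => by fun_prop

variable {P h μ}

theorem cden_ne_zero {C : Contour} (h1 : C.OutsideMod (P.iζ + P.b))
    (h2 : ∀ k, C.OutsideMod (μ k - P.iζ)) {s : ℂ} (hs : s ∈ C.hull) : P.cden μ s ≠ 0 := by
  refine mul_ne_zero (Finset.prod_ne_zero_iff.2 fun k _ => ?_) (pow_ne_zero _ ?_)
  · have := Contour.sinh_sub_ne_zero_of_outsideMod (h2 k) hs
    rwa [show P.iζ + s - μ k = s - (μ k - P.iζ) by ring]
  · have := Contour.sinh_sub_ne_zero_of_outsideMod h1 hs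
    rw [show P.iζ - s + P.b = -(s - (P.iζ + P.b)) by ring, sinh_neg]
    exact neg_ne_zero.2 this

theorem analyticAt_countingFn {s : ℂ} (h1 : sinh (s + P.b) ≠ 0) (h2 : P.cden μ s ≠ 0) :
    AnalyticAt ℂ (P.countingFn h μ) s := by
  rw [show P.countingFn h μ = fun s => P.cnum h μ s / (sinh (s + P.b) ^ P.N * P.cden μ s) from
    funext fun s => P.countingFn_eq_div h μ s]
  refine ((P.differentiable_cnum h μ).analyticAt s).div ?_ (mul_ne_zero (pow_ne_zero _ h1) h2)
  exact ((analyticAt_sinh_comp (analyticAt_id.add analyticAt_const)).pow _).mul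
    ((P.differentiable_cden μ).analyticAt s)

theorem countingFn_mul {s : ℂ} (h1 : sinh (s + P.b) ≠ 0) (h2 : P.cden μ s ≠ 0) :
    P.countingFn h μ s * (sinh (s + P.b) ^ P.N * P.cden μ s) = P.cnum h μ s := by
  rw [countingFn_eq_div, div_mul_cancel₀]
  exact mul_ne_zero (pow_ne_zero _ h1) h2

theorem exists_isFactored_countingFn {C : Contour} (hb : -P.b ∈ C.inner)
    (h1 : C.OutsideMod (P.iζ + P.b)) (h2 : ∀ k, C.OutsideMod (μ k - P.iζ)) (τ : ℂ)
    (h0 : ∀ s ∈ C.trace, 1 + τ * P.countingFn h μ s ≠ 0)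
    (hm : C.integral (logDeriv fun s => 1 + τ * P.countingFn h μ s) = 0) :
    ∃ (w : Fin P.N → ℂ) (e : ℂ → ℂ),
      C.IsFactored (fun s => 1 + τ * P.countingFn h μ s) (-P.b) P.N w e ∧
      ∀ i, sinh (w i + P.b) ^ P.N * P.cden μ (w i) + τ * P.cnum h μ (w i) = 0 := by
  refine Contour.exists_isFactored (φ := fun s => 1 + τ * P.countingFn h μ s)
    (n := fun s => sinh (s + P.b) ^ P.N * P.cden μ s + τ * P.cnum h μ s) (d := P.cden μ)
    ?_ (P.differentiable_cden μ) (fun s hs => cden_ne_zero h1 h2 hs) hb ?_ h0 hm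
  · have := P.differentiable_cden μ
    have := P.differentiable_cnum h μ
    fun_prop
  · intro z hz1 hz2
    rw [sub_neg_eq_add] at hz1 ⊢
    rw [← countingFn_mul (h := h) hz1 hz2]
    ring

/-- The roots of the Bethe equations are zeros of `1 + â`. -/
theorem IsBethe.countingFn_eq (hμ : P.IsBethe h μ) (p : Fin P.N) : P.countingFn h μ (μ p) = -1 := by
  rw [hμ.1 p, countingFn]
  congr 1
  · congr 1
    exact Finset.prod_congr rfl fun k _ => by congr 2; ring
  · congr 2
    rw [mul_comm (sinh (μ p - P.b))]
    congr 2
    · ring_nf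
    · rw [mul_comm]

end Params

namespace Params

variable {P : Params} {h : ℝ} {μ : Fin P.N → ℂ}

/-! ### The kernel of the series -/

variable (P h μ) in
/-- `U(ω, ω') sinh(ω + ω') sinh(ω - ω' - iζ)` as a product over the roots. -/
noncomputable def bV (ω : ℂ) : ℂ :=
  -exp (-(h / P.T : ℝ)) * sinh (2 * ω - P.iζ) *
    ∏ l, (sinh (ω + μ l) * sinh (ω - μ l - P.iζ)) / (sinh (ω - μ l) * sinh (ω + μ l - P.iζ))

variable (P h μ) in
/-- `r` as a product over the roots. -/
noncomputable def bR (ω : ℂ) : ℂ :=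
  exp (-(2 * h / P.T : ℝ)) *
    ∏ l, (sinh (ω + μ l + P.iζ) * sinh (ω - μ l - P.iζ)) /
      (sinh (ω - μ l + P.iζ) * sinh (ω + μ l - P.iζ))

variable (P h μ) in
/-- The residue of `bV` at a root. -/
noncomputable def bRes (k : Fin P.N) : ℂ :=
  exp (-(h / P.T : ℝ)) * sinh P.iζ * sinh (2 * μ k) *
    ∏ l ∈ Finset.univ.erase k, (sinh (μ k + μ l) * sinh (μ k - μ l - P.iζ)) /
      (sinh (μ k - μ l) * sinh (μ k + μ l - P.iζ))

variable (P h μ) in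
/-- The matrix of residues of the kernel. -/
noncomputable def bM : Matrix (Fin P.N) (Fin P.N) ℂ :=
  Matrix.of fun j k => P.bRes h μ k / (sinh (μ j + μ k) * sinh (μ j - μ k - P.iζ))

theorem sign_cases (k : ℤ) : ((-1 : ℂ) ^ k) = 1 ∨ ((-1 : ℂ) ^ k) = -1 := by
  rcases Int.even_or_odd k with hk | hk
  · exact Or.inl hk.neg_one_zpow
  · exact Or.inr hk.neg_one_zpow

theorem sinh_add_rep {x μ ν : ℂ} {k : ℤ} (hk : ν = μ + k * (Real.pi * I)) :
    sinh (x + ν) = (-1) ^ k * sinh (x + μ) := by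
  rw [hk, ← sinh_add_int_mul_pi]; congr 1; ring

theorem sinh_sub_rep {x μ ν : ℂ} {k : ℤ} (hk : ν = μ + k * (Real.pi * I)) :
    sinh (x - ν) = (-1) ^ k * sinh (x - μ) := by
  rw [← neg_sub, sinh_neg, ← neg_sub μ, sinh_neg, hk,
    show μ + k * (Real.pi * I) - x = μ - x + k * (Real.pi * I) by ring, sinh_add_int_mul_pi]
  ring

theorem IsBethe.injective_rep (hμ : P.IsBethe h μ) {ν : Fin P.N → ℂ}
    (hν : ∀ a, ∃ k : ℤ, ν a = μ a + k * (Real.pi * I)) : Function.Injective ν := by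
  intro p q hpq
  by_contra hne
  obtain ⟨k, hk⟩ := hν p
  obtain ⟨j, hj⟩ := hν q
  refine hμ.2 p q hne (sinh_eq_zero_iff.2 ⟨j - k, ?_⟩)
  push_cast
  linear_combination hk.symm.trans (hpq.trans hj)

theorem SeriesContours.exists_isFactored {CU : Contour} {Γ : ℕ → Contour}
    (S : P.SeriesContours h μ CU Γ) (hN : 0 < P.N) (hμ : P.IsBethe h μ) :
    ∃ (ν : Fin P.N → ℂ) (e : ℂ → ℂ), (∀ a, ∃ k : ℤ, ν a = μ a + k * (Real.pi * I)) ∧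
      CU.IsFactored (fun s => 1 + P.countingFn h μ s) (-P.b) P.N ν e := by
  choose k hk using S.U_roots
  obtain ⟨w, e, hw, -⟩ := exists_isFactored_countingFn (h := h) S.U_pole_mem S.U_poles.1
    S.U_poles.2 1 (by simpa using S.U_ne) (by
      simp only [one_mul]
      have := S.U_monodromy
      simpa only [Contour.monodromy, ← Contour.logDeriv_one_add] using! this)
  simp only [one_mul] at hw
  have hval : ∀ a, P.countingFn h μ (μ a + k a * (Real.pi * I)) = -1 := fun a => by
    rw [countingFn_add_int, hμ.countingFn_eq]
  refine ⟨fun a => μ a + k a * (Real.pi * I), e, fun a => ⟨k a, rfl⟩,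
    hw.perm (hμ.injective_rep fun a => ⟨k a, rfl⟩) hk (fun a => by simp [hval]) fun a ha => ?_⟩
  have := hval a
  rw [ha, countingFn_neg_b _ _ _ hN] at this
  norm_num at this

theorem isLogAlong_countingFn {C : Contour} (hb : -P.b ∈ C.inner)
    (h1 : C.OutsideMod (P.iζ + P.b)) (h2 : ∀ k, C.OutsideMod (μ k - P.iζ))
    (h0 : ∀ s ∈ C.trace, 1 + P.countingFn h μ s ≠ 0) (hm : C.monodromy (P.countingFn h μ) = 0)
    {v : ℂ} (hv : exp v = 1 + P.countingFn h μ (C.toFun 0)) :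
    C.IsLogAlong (fun s => 1 + P.countingFn h μ s) (C.logAlong (P.countingFn h μ) v) := by
  refine C.isLogAlong_logAlong (fun s hs => analyticAt_countingFn ?_
    (cden_ne_zero h1 h2 (Or.inl hs))) h0 hm hv
  simpa using Contour.sinh_sub_ne_zero_of_inner_of_trace hb hs

theorem SeriesContours.isLogAlong {CU : Contour} {Γ : ℕ → Contour}
    (S : P.SeriesContours h μ CU Γ) :
    CU.IsLogAlong (fun s => 1 + P.countingFn h μ s) (P.logU h μ CU) :=
  isLogAlong_countingFn S.U_pole_mem S.U_poles.1 S.U_poles.2 S.U_ne S.U_monodromy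
    (exp_log (S.U_ne _ (CU.mem_trace (by simp))))

theorem _root_.BoundaryXXZ.Contour.IsLogAlong.exp_integralW_four {C : Contour} {φ : ℂ → ℂ}
    {L : ℝ → ℂ} (hL : C.IsLogAlong φ L) {p₁ p₂ p₃ p₄ : ℂ} (h₁ : C.OutsideMod p₁)
    (h₂ : C.OutsideMod p₂) (h₃ : C.OutsideMod p₃) (h₄ : C.OutsideMod p₄) {g : ℂ → ℂ}
    (hg : ∀ s, g s = coth (s - p₁) - coth (s - p₂) - coth (s - p₃) + coth (s - p₄)) :
    exp (-C.integralW L g) =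
      exp (C.integralW L fun s => coth (s - p₂)) * exp (C.integralW L fun s => coth (s - p₃)) /
      (exp (C.integralW L fun s => coth (s - p₁)) * exp (C.integralW L fun s => coth (s - p₄))) := by
  have hc : ∀ p, C.OutsideMod p →
      ContinuousOn (fun t => coth (C.toFun t - p) * L t) (Set.Icc 0 1) := fun p hp =>
    ContinuousOn.mul (C.continuousOn_comp (f := fun s => coth (s - p)) fun s hs =>
      (analyticAt_coth_comp (analyticAt_id.sub analyticAt_const)
        (Contour.sinh_sub_ne_zero_of_outsideMod hp (Or.inl hs))).continuousAt) hL.continuousOn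
  have e1 : C.integralW L g = C.integralW L (fun s => coth (s - p₁))
      - C.integralW L (fun s => coth (s - p₂)) - C.integralW L (fun s => coth (s - p₃))
      + C.integralW L (fun s => coth (s - p₄)) := by
    simp only [Contour.integralW]
    rw [← C.pathIntegral_sub (hc _ h₁) (hc _ h₂), ← C.pathIntegral_sub
      (g := fun t => coth (C.toFun t - p₁) * L t - coth (C.toFun t - p₂) * L t)
      ((hc _ h₁).sub (hc _ h₂)) (hc _ h₃), ← C.pathIntegral_add
      (g := fun t => coth (C.toFun t - p₁) * L t - coth (C.toFun t - p₂) * L t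
        - coth (C.toFun t - p₃) * L t)
      (((hc _ h₁).sub (hc _ h₂)).sub (hc _ h₃)) (hc _ h₄)]
    refine Contour.pathIntegral_congr fun t _ => ?_
    rw [hg]
    ring
  rw [e1, ← exp_add, ← exp_add, ← exp_sub]
  congr 1
  ring

theorem kernelU_eq {CU : Contour} {Γ : ℕ → Contour} (S : P.SeriesContours h μ CU Γ)
    (hN : 0 < P.N) (hμ : P.IsBethe h μ) {p : ℕ} (ω : ℂ) {ω' : ℂ} (hω : ω' ∈ (Γ p).trace) :
    P.kernelU h CU (P.logU h μ CU) ω ω'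
      = P.bV h μ ω' / (sinh (ω + ω') * sinh (ω - ω' - P.iζ)) := by
  obtain ⟨ν, e, hν, hF⟩ := S.exists_isFactored hN hμ
  have hL := S.isLogAlong
  obtain ⟨o1, o2, -, -, o3, o4⟩ := S.U_out p ω' hω
  have hb : -P.b ∈ CU.hull := Or.inr S.U_pole_mem
  have n1 := Contour.sinh_sub_ne_zero_of_outsideMod o1 hb
  have n2 := Contour.sinh_sub_ne_zero_of_outsideMod o2 hb
  have n3 := Contour.sinh_sub_ne_zero_of_outsideMod o3 hb
  have n4 := Contour.sinh_sub_ne_zero_of_outsideMod o4 hb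
  have m1 : ∀ i, sinh (ν i - ω') ≠ 0 := fun i =>
    Contour.sinh_sub_ne_zero_of_outsideMod o1 (Or.inr (hF.w_mem i))
  have m2 : ∀ i, sinh (ν i - -ω') ≠ 0 := fun i =>
    Contour.sinh_sub_ne_zero_of_outsideMod o2 (Or.inr (hF.w_mem i))
  have m3 : ∀ i, sinh (ν i - (ω' - P.iζ)) ≠ 0 := fun i =>
    Contour.sinh_sub_ne_zero_of_outsideMod o3 (Or.inr (hF.w_mem i))
  have m4 : ∀ i, sinh (ν i - -(ω' - P.iζ)) ≠ 0 := fun i =>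
    Contour.sinh_sub_ne_zero_of_outsideMod o4 (Or.inr (hF.w_mem i))
  rw [kernelU, hL.exp_integralW_four (p₁ := -ω') (p₂ := ω') (p₃ := -(ω' - P.iζ))
    (p₄ := ω' - P.iζ) o2 o1 o4 o3, hF.exp_coth_outside hL o1, hF.exp_coth_outside hL o2,
    hF.exp_coth_outside hL o3, hF.exp_coth_outside hL o4]
  · have key : (sinh (ω' - P.b) * sinh (ω' + P.b - P.iζ) /
        (sinh (ω' + P.b) * sinh (ω' - P.b - P.iζ))) ^ P.N *
        (sinh (-P.b - ω') ^ P.N / (∏ i, sinh (ν i - ω')) *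
          (sinh (-P.b - -(ω' - P.iζ)) ^ P.N / ∏ i, sinh (ν i - -(ω' - P.iζ))) /
        (sinh (-P.b - -ω') ^ P.N / (∏ i, sinh (ν i - -ω')) *
          (sinh (-P.b - (ω' - P.iζ)) ^ P.N / ∏ i, sinh (ν i - (ω' - P.iζ)))))
        = ∏ l, (sinh (ω' + μ l) * sinh (ω' - μ l - P.iζ)) /
          (sinh (ω' - μ l) * sinh (ω' + μ l - P.iζ)) := by
      have e1 : (∏ l, (sinh (ω' + μ l) * sinh (ω' - μ l - P.iζ)) /
          (sinh (ω' - μ l) * sinh (ω' + μ l - P.iζ)))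
          = ∏ i, (sinh (ν i - -ω') * sinh (ν i - (ω' - P.iζ))) /
            (sinh (ν i - ω') * sinh (ν i - -(ω' - P.iζ))) := by
        refine Finset.prod_congr rfl fun i _ => ?_
        obtain ⟨k, hk⟩ := hν i
        have r : ∀ q, sinh (ν i - q) = (-1) ^ k * sinh (μ i - q) := fun q => by
          rw [hk, ← sinh_add_int_mul_pi]; congr 1; ring
        have hk0 : ((-1 : ℂ) ^ k) ≠ 0 := zpow_ne_zero _ (by norm_num)
        rw [r, r, r, r, mul_mul_mul_comm _ (sinh (μ i - -ω')), mul_mul_mul_comm _ (sinh (μ i - ω')),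
          mul_div_mul_left _ _ (mul_ne_zero hk0 hk0), sub_neg_eq_add, sub_neg_eq_add,
          ← neg_sub ω' (μ i), ← neg_sub (ω' - P.iζ), sinh_neg, sinh_neg, mul_neg, neg_mul, neg_div_neg_eq]
        congr 2
        · ring_nf
        · ring_nf
        · ring_nf
      rw [e1, Finset.prod_div_distrib, Finset.prod_mul_distrib, Finset.prod_mul_distrib]
      have a1 := Finset.prod_ne_zero_iff.2 fun i (_ : i ∈ Finset.univ) => m1 i
      have a2 := Finset.prod_ne_zero_iff.2 fun i (_ : i ∈ Finset.univ) => m2 i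
      have a3 := Finset.prod_ne_zero_iff.2 fun i (_ : i ∈ Finset.univ) => m3 i
      have a4 := Finset.prod_ne_zero_iff.2 fun i (_ : i ∈ Finset.univ) => m4 i
      rw [show sinh (ω' - P.b) = sinh (-P.b - -ω') by ring_nf,
        show sinh (ω' + P.b - P.iζ) = -sinh (-P.b - (ω' - P.iζ)) by rw [← sinh_neg]; ring_nf,
        show sinh (ω' + P.b) = -sinh (-P.b - ω') by rw [← sinh_neg]; ring_nf,
        show sinh (ω' - P.b - P.iζ) = sinh (-P.b - -(ω' - P.iζ)) by ring_nf,
        mul_neg, neg_mul, neg_div_neg_eq, div_pow, mul_pow, mul_pow]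
      field_simp
    rw [mul_assoc, key, bV]
    ring
  · intro s
    rw [show ω' - s - P.iζ = -(s - (ω' - P.iζ)) by ring, show ω' - s = -(s - ω') by ring, coth_neg,
      coth_neg, show ω' + s - P.iζ = s - -(ω' - P.iζ) by ring, show ω' + s = s - -ω' by ring]
    ring

theorem funR_eq {CU : Contour} {Γ : ℕ → Contour} (S : P.SeriesContours h μ CU Γ)
    (hN : 0 < P.N) (hμ : P.IsBethe h μ) {p : ℕ} {ω : ℂ} (hω : ω ∈ (Γ p).trace) :
    P.funR h CU (P.logU h μ CU) ω = P.bR h μ ω := by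
  obtain ⟨ν, e, hν, hF⟩ := S.exists_isFactored hN hμ
  have hL := S.isLogAlong
  obtain ⟨-, -, o1, o2, o3, o4⟩ := S.U_out p ω hω
  have hb : -P.b ∈ CU.hull := Or.inr S.U_pole_mem
  have n1 := Contour.sinh_sub_ne_zero_of_outsideMod o1 hb
  have n2 := Contour.sinh_sub_ne_zero_of_outsideMod o2 hb
  have n3 := Contour.sinh_sub_ne_zero_of_outsideMod o3 hb
  have n4 := Contour.sinh_sub_ne_zero_of_outsideMod o4 hb
  have m1 : ∀ i, sinh (ν i - (ω + P.iζ)) ≠ 0 := fun i =>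
    Contour.sinh_sub_ne_zero_of_outsideMod o1 (Or.inr (hF.w_mem i))
  have m2 : ∀ i, sinh (ν i - -(ω + P.iζ)) ≠ 0 := fun i =>
    Contour.sinh_sub_ne_zero_of_outsideMod o2 (Or.inr (hF.w_mem i))
  have m3 : ∀ i, sinh (ν i - (ω - P.iζ)) ≠ 0 := fun i =>
    Contour.sinh_sub_ne_zero_of_outsideMod o3 (Or.inr (hF.w_mem i))
  have m4 : ∀ i, sinh (ν i - -(ω - P.iζ)) ≠ 0 := fun i =>
    Contour.sinh_sub_ne_zero_of_outsideMod o4 (Or.inr (hF.w_mem i))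
  rw [funR, hL.exp_integralW_four (p₁ := -(ω + P.iζ)) (p₂ := ω + P.iζ) (p₃ := -(ω - P.iζ))
    (p₄ := ω - P.iζ) o2 o1 o4 o3, hF.exp_coth_outside hL o1, hF.exp_coth_outside hL o2,
    hF.exp_coth_outside hL o3, hF.exp_coth_outside hL o4]
  · have key : (sinh (ω - P.b + P.iζ) * sinh (ω + P.b - P.iζ) /
        (sinh (ω + P.b + P.iζ) * sinh (ω - P.b - P.iζ))) ^ P.N *
        (sinh (-P.b - (ω + P.iζ)) ^ P.N / (∏ i, sinh (ν i - (ω + P.iζ))) *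
          (sinh (-P.b - -(ω - P.iζ)) ^ P.N / ∏ i, sinh (ν i - -(ω - P.iζ))) /
        (sinh (-P.b - -(ω + P.iζ)) ^ P.N / (∏ i, sinh (ν i - -(ω + P.iζ))) *
          (sinh (-P.b - (ω - P.iζ)) ^ P.N / ∏ i, sinh (ν i - (ω - P.iζ)))))
        = ∏ l, (sinh (ω + μ l + P.iζ) * sinh (ω - μ l - P.iζ)) /
          (sinh (ω - μ l + P.iζ) * sinh (ω + μ l - P.iζ)) := by
      have e1 : (∏ l, (sinh (ω + μ l + P.iζ) * sinh (ω - μ l - P.iζ)) /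
          (sinh (ω - μ l + P.iζ) * sinh (ω + μ l - P.iζ)))
          = ∏ i, (sinh (ν i - -(ω + P.iζ)) * sinh (ν i - (ω - P.iζ))) /
            (sinh (ν i - (ω + P.iζ)) * sinh (ν i - -(ω - P.iζ))) := by
        refine Finset.prod_congr rfl fun i _ => ?_
        obtain ⟨k, hk⟩ := hν i
        have r : ∀ q, sinh (ν i - q) = (-1) ^ k * sinh (μ i - q) := fun q => by
          rw [hk, ← sinh_add_int_mul_pi]; congr 1; ring
        have hk0 : ((-1 : ℂ) ^ k) ≠ 0 := zpow_ne_zero _ (by norm_num)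
        rw [r, r, r, r, mul_mul_mul_comm _ (sinh (μ i - -(ω + P.iζ))),
          mul_mul_mul_comm _ (sinh (μ i - (ω + P.iζ))),
          mul_div_mul_left _ _ (mul_ne_zero hk0 hk0), sub_neg_eq_add, sub_neg_eq_add,
          ← neg_sub (ω + P.iζ) (μ i), ← neg_sub (ω - P.iζ), sinh_neg, sinh_neg, mul_neg, neg_mul,
          neg_div_neg_eq]
        congr 2
        · ring_nf
        · ring_nf
        · ring_nf
        · ring_nf
      rw [e1, Finset.prod_div_distrib, Finset.prod_mul_distrib, Finset.prod_mul_distrib]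
      have a1 := Finset.prod_ne_zero_iff.2 fun i (_ : i ∈ Finset.univ) => m1 i
      have a2 := Finset.prod_ne_zero_iff.2 fun i (_ : i ∈ Finset.univ) => m2 i
      have a3 := Finset.prod_ne_zero_iff.2 fun i (_ : i ∈ Finset.univ) => m3 i
      have a4 := Finset.prod_ne_zero_iff.2 fun i (_ : i ∈ Finset.univ) => m4 i
      rw [show sinh (ω - P.b + P.iζ) = sinh (-P.b - -(ω + P.iζ)) by ring_nf,
        show sinh (ω + P.b - P.iζ) = -sinh (-P.b - (ω - P.iζ)) by rw [← sinh_neg]; ring_nf,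
        show sinh (ω + P.b + P.iζ) = -sinh (-P.b - (ω + P.iζ)) by rw [← sinh_neg]; ring_nf,
        show sinh (ω - P.b - P.iζ) = sinh (-P.b - -(ω - P.iζ)) by ring_nf,
        mul_neg, neg_mul, neg_div_neg_eq, div_pow, mul_pow, mul_pow]
      field_simp
    rw [mul_assoc, key, bR]
  · intro s
    rw [show ω - s + P.iζ = -(s - (ω + P.iζ)) by ring,
      show ω - s - P.iζ = -(s - (ω - P.iζ)) by ring, coth_neg,
      coth_neg, show s + ω + P.iζ = s - -(ω + P.iζ) by ring,
      show ω + s - P.iζ = s - -(ω - P.iζ) by ring]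
    ring

end Params

namespace Contour

variable (C : Contour)

/-- The residue theorem for the poles of `∏ sinh(v - p_i)⁻¹`. -/
theorem integral_div_prod_sinh {ι : Type*} [Fintype ι] [DecidableEq ι] {p : ι → ℂ}
    (hp : ∀ i, p i ∈ C.inner) (hinj : Function.Injective p) {F : ℂ → ℂ}
    (hF : ∀ s ∈ C.hull, AnalyticAt ℂ F s) :
    C.integral (fun v => F v / ∏ i, sinh (v - p i)) =
      2 * Real.pi * I * ∑ i, F (p i) / ∏ l ∈ Finset.univ.erase i, sinh (p i - p l) := by
  classical
  have key := C.integral_eq_sum_residues (Finset.univ.image p) ?_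
    (fun u => ∑ i, if p i = u then F (p i) / ∏ l ∈ Finset.univ.erase i, sinh (p i - p l) else 0)
    (fun v => F v / ∏ i, sinh (v - p i)) ?_ ?_
  · rw [key, Finset.sum_image fun i _ j _ hij => hinj hij]
    congr 1
    refine Finset.sum_congr rfl fun i _ => ?_
    simp [hinj.eq_iff]
  · intro w hw
    obtain ⟨i, -, rfl⟩ := Finset.mem_image.1 hw
    exact hp i
  · intro s hs hsS
    refine (hF s hs).div (Finset.analyticAt_fun_prod _ fun i _ =>
      analyticAt_sinh_comp (analyticAt_id.sub analyticAt_const)) ?_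
    refine Finset.prod_ne_zero_iff.2 fun i _ => sinh_sub_ne_zero_of_mem (Or.inr (hp i)) hs ?_
    rintro rfl
    exact hsS (Finset.mem_image_of_mem _ (Finset.mem_univ i))
  · intro w hw
    obtain ⟨i, -, rfl⟩ := Finset.mem_image.1 hw
    simp only [hinj.eq_iff, Finset.sum_ite_eq', Finset.mem_univ, if_true]
    have h1 : ContinuousAt (fun v => F v / (∏ l ∈ Finset.univ.erase i, sinh (v - p l)) / cosh (v - p i))
        (p i) := by
      refine ((hF _ (Or.inr (hp i))).continuousAt.div ?_ ?_).div (by fun_prop) (by simp)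
      · exact tendsto_finsetProd _ fun l _ =>
          (by fun_prop : ContinuousAt (fun v => sinh (v - p l)) (p i))
      · refine Finset.prod_ne_zero_iff.2 fun l hl =>
          sinh_sub_ne_zero_of_mem (Or.inr (hp l)) (Or.inr (hp i)) ?_
        exact fun h => (Finset.mem_erase.1 hl).1 (hinj h).symm
    have h2 := (h1.tendsto.mono_left (nhdsWithin_le_nhds (s := {p i}ᶜ))).mul
      (tendsto_sub_mul_coth (p i))
    simp only [sub_self, cosh_zero, div_one, mul_one] at h2
    have hcosh : ∀ᶠ v in 𝓝[≠] (p i), cosh (v - p i) ≠ 0 := by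
      have : ContinuousAt (fun v => cosh (v - p i)) (p i) := by fun_prop
      exact (this.eventually_ne (y := 0) (by simp)).filter_mono nhdsWithin_le_nhds
    refine h2.congr' ?_
    filter_upwards [hcosh] with v hv
    rw [← Finset.mul_prod_erase Finset.univ _ (Finset.mem_univ i), coth]
    field_simp

theorem integral_div_sinh_mul_prod {ι : Type*} [Fintype ι] [DecidableEq ι] {p : ι → ℂ} {q : ℂ}
    (hp : ∀ i, p i ∈ C.inner) (hinj : Function.Injective p) (hq : q ∈ C.inner)
    (hqp : ∀ i, p i ≠ q) {F : ℂ → ℂ} (hF : ∀ s ∈ C.hull, AnalyticAt ℂ F s) :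
    C.integral (fun v => F v / (sinh (v - q) * ∏ i, sinh (v - p i))) =
      2 * Real.pi * I * (F q / ∏ i, sinh (q - p i) +
        ∑ i, F (p i) / (sinh (p i - q) * ∏ l ∈ Finset.univ.erase i, sinh (p i - p l))) := by
  have key := C.integral_div_prod_sinh (p := fun o : Option ι => o.elim q p)
    (by rintro (_ | i); exacts [hq, hp i]) (by
      rintro (_ | i) (_ | j) hij
      · rfl
      · exact absurd hij.symm (hqp j)
      · exact absurd hij (hqp i)
      · exact congrArg _ (hinj hij)) hF
  simp only [Fintype.prod_option, Option.elim_none, Option.elim_some, Fintype.sum_option] at key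
  rw [key]
  have e1 : (Finset.univ.erase none : Finset (Option ι)) = Finset.univ.map Function.Embedding.some := by
    ext o; cases o <;> simp
  have e2 : ∀ i : ι, (Finset.univ.erase (some i) : Finset (Option ι))
      = Finset.insertNone (Finset.univ.erase i) := by
    intro i; ext o; cases o <;> simp
  rw [e1, Finset.prod_map]
  congr 2
  refine Finset.sum_congr rfl fun i _ => ?_
  rw [e2, Finset.prod_insertNone]
  rfl

end Contour

theorem nestedIntegral_const_mul (Γ : ℕ → Contour) (m : ℕ) (c : ℂ) (f : (Fin m → ℂ) → ℂ) :
    nestedIntegral Γ m (fun v => c * f v) = c * nestedIntegral Γ m f := by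
  induction m generalizing Γ with
  | zero => rfl
  | succ m ih =>
    simp only [nestedIntegral, ih, Contour.integral]
    exact Contour.pathIntegral_const_mul _ _ _

/-- The integrand of a chain of kernels between `w` and `z`. -/
noncomputable def chainFn (K : ℂ → ℂ → ℂ) (G : ℂ → ℂ) (m : ℕ) (w z : ℂ) (v : Fin m → ℂ) : ℂ :=
  G ((Fin.cons w v : Fin (m + 1) → ℂ) (Fin.last m)) *
    (∏ p : Fin m, K ((Fin.cons w v : Fin (m + 1) → ℂ) p.castSucc) (v p)) *
    K ((Fin.cons w v : Fin (m + 1) → ℂ) (Fin.last m)) z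

theorem chainFn_cons (K : ℂ → ℂ → ℂ) (G : ℂ → ℂ) (m : ℕ) (w z w' : ℂ) (v : Fin m → ℂ) :
    chainFn K G (m + 1) w z (Fin.cons w' v) = K w w' * chainFn K G m w' z v := by
  have h1 : (Fin.cons w (Fin.cons w' v : Fin (m + 1) → ℂ) : Fin (m + 2) → ℂ) (Fin.last (m + 1))
      = (Fin.cons w' v : Fin (m + 1) → ℂ) (Fin.last m) := by
    rw [← Fin.succ_last, Fin.cons_succ]
  have h2 : ∏ p : Fin (m + 1), K ((Fin.cons w (Fin.cons w' v : Fin (m + 1) → ℂ) : Fin (m + 2) → ℂ)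
        p.castSucc) ((Fin.cons w' v : Fin (m + 1) → ℂ) p)
      = K w w' * ∏ p : Fin m, K ((Fin.cons w' v : Fin (m + 1) → ℂ) p.castSucc) (v p) := by
    rw [Fin.prod_univ_succ]
    simp only [Fin.castSucc_zero, Fin.cons_zero, Fin.cons_succ]
    rfl
  unfold chainFn
  rw [h1, h2]
  ring

theorem cyclic_eq_chainFn (K : ℂ → ℂ → ℂ) (G : ℂ → ℂ) (m : ℕ) (w : ℂ) (v : Fin m → ℂ) :
    G ((Fin.cons w v : Fin (m + 1) → ℂ) (Fin.last m)) *
      ∏ p : Fin (m + 1), K ((Fin.cons w v : Fin (m + 1) → ℂ) p)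
        ((Fin.cons w v : Fin (m + 1) → ℂ) (p + 1)) = chainFn K G m w w v := by
  rw [Fin.prod_univ_castSucc, chainFn]
  simp only [Fin.coeSucc_eq_succ, Fin.last_add_one, Fin.cons_zero, Fin.cons_succ]
  ring

namespace Params

variable {P : Params} {h : ℝ} {μ : Fin P.N → ℂ}

theorem cyclicIntegral_eq (CU : Contour) (L : ℝ → ℂ) (Γ : ℕ → Contour) (m : ℕ) (g : ℂ → ℂ) :
    P.cyclicIntegral h CU L Γ m g = (Γ 0).integral (fun w => nestedIntegral (fun j => Γ (j + 1)) m
      (chainFn (P.kernelU h CU L) (fun ω => g (P.funR h CU L ω)) m w w)) / (2 * Real.pi * I) ^ (m + 1) := by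
  unfold cyclicIntegral
  rw [nestedIntegral]
  congr 2
  funext w
  congr 1
  funext v
  exact cyclic_eq_chainFn (P.kernelU h CU L) (fun ω => g (P.funR h CU L ω)) m w v

end Params

namespace Params

variable {P : Params} {h : ℝ} {μ : Fin P.N → ℂ}

/-! ### Residues of the kernel -/

theorem IsBethe.ne_zero (hμ : P.IsBethe h μ) (hN : 0 < P.N) (p : Fin P.N) :
    sinh (μ p + P.b + P.iζ) ≠ 0 ∧ sinh (μ p - P.b) ≠ 0 ∧ sinh (P.iζ - μ p + P.b) ≠ 0 ∧
      sinh (μ p + P.b) ≠ 0 := by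
  have h1 := hμ.1 p
  have h2 : (sinh (μ p + P.b + P.iζ) * sinh (μ p - P.b) /
        (sinh (P.iζ - μ p + P.b) * sinh (μ p + P.b))) ≠ 0 := fun h0 => by
    rw [h0, zero_pow hN.ne', mul_zero] at h1
    norm_num at h1
  rw [div_ne_zero_iff, mul_ne_zero_iff, mul_ne_zero_iff] at h2
  exact ⟨h2.1.1, h2.1.2, h2.2.1, h2.2.2⟩

/-- `r(ω) = a(ω) a(-ω)`. -/
theorem countingFn_mul_neg {ω : ℂ} (h1 : sinh (ω - P.b) ≠ 0) (h2 : sinh (ω + P.b) ≠ 0)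
    (h3 : sinh (P.iζ + ω + P.b) ≠ 0) (h4 : sinh (P.iζ - ω + P.b) ≠ 0) :
    P.countingFn h μ ω * P.countingFn h μ (-ω) = P.bR h μ ω := by
  have e1 : (sinh (ω - P.b) * sinh (P.iζ + ω + P.b) /
      (sinh (ω + P.b) * sinh (P.iζ - ω + P.b))) ^ P.N *
      (sinh (-ω - P.b) * sinh (P.iζ + -ω + P.b) /
      (sinh (-ω + P.b) * sinh (P.iζ - -ω + P.b))) ^ P.N = 1 := by
    rw [← mul_pow]
    rw [show -ω - P.b = -(ω + P.b) by ring, show -ω + P.b = -(ω - P.b) by ring, sinh_neg, sinh_neg,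
      sub_neg_eq_add, ← sub_eq_add_neg]
    convert one_pow _
    field_simp
  have e2 : (∏ k, sinh (P.iζ - ω + μ k) / sinh (P.iζ + ω - μ k)) *
      (∏ k, sinh (P.iζ - -ω + μ k) / sinh (P.iζ + -ω - μ k)) =
      ∏ l, (sinh (ω + μ l + P.iζ) * sinh (ω - μ l - P.iζ)) /
        (sinh (ω - μ l + P.iζ) * sinh (ω + μ l - P.iζ)) := by
    rw [← Finset.prod_mul_distrib]
    refine Finset.prod_congr rfl fun k _ => ?_
    rw [show P.iζ - ω + μ k = -(ω - μ k - P.iζ) by ring,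
      show P.iζ + -ω - μ k = -(ω + μ k - P.iζ) by ring, sinh_neg, sinh_neg,
      show P.iζ + ω - μ k = ω - μ k + P.iζ by ring, show P.iζ - -ω + μ k = ω + μ k + P.iζ by ring,
      div_mul_div_comm, neg_mul, mul_neg, neg_div_neg_eq, mul_comm (sinh (ω - μ k - P.iζ))]
  have e3 : exp (-(h / P.T : ℝ)) * exp (-(h / P.T : ℝ)) = exp (-(2 * h / P.T : ℝ)) := by
    rw [← exp_add]; congr 1; push_cast; ring
  rw [countingFn, countingFn, bR, ← e2, ← e3]
  linear_combination (exp (-(h / P.T : ℝ)) * exp (-(h / P.T : ℝ)) *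
    ((∏ k, sinh (P.iζ - ω + μ k) / sinh (P.iζ + ω - μ k)) *
      (∏ k, sinh (P.iζ - -ω + μ k) / sinh (P.iζ + -ω - μ k)))) * e1

theorem IsBethe.countingFn_neg (hμ : P.IsBethe h μ) (hN : 0 < P.N) (k : Fin P.N) :
    P.countingFn h μ (-μ k) = -P.bR h μ (μ k) := by
  obtain ⟨h1, h2, h3, h4⟩ := hμ.ne_zero hN k
  have := countingFn_mul_neg (h := h) (μ := μ) h2 h4
    (by rwa [show P.iζ + μ k + P.b = μ k + P.b + P.iζ by ring]) h3
  rw [hμ.countingFn_eq] at this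
  linear_combination -this

/-- The data on the contours of the series that the computation of the integrals uses: the roots
are represented by points inside of all contours. -/
structure SeriesCore (P : Params) (h : ℝ) (μ : Fin P.N → ℂ) (Γ : ℕ → Contour) : Prop where
  zero_mem : ∀ p, (0 : ℂ) ∈ (Γ p).inner
  mem : ∀ p a, μ a ∈ (Γ p).inner
  neg : ∀ p a, (Γ p).InsideMod (-μ a)
  add : ∀ p a, (Γ p).OutsideMod (μ a + P.iζ)
  sub : ∀ p a, (Γ p).OutsideMod (μ a - P.iζ)
  neg_add : ∀ p a, (Γ p).OutsideMod (-μ a + P.iζ)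
  half_period : ∀ p, (Γ p).OutsideMod (Real.pi * I / 2)
  poles : ∀ p q, p < q → ∀ ω ∈ (Γ p).trace, (Γ q).OutsideMod (-ω) ∧
    (Γ q).OutsideMod (ω + P.iζ) ∧ (Γ q).OutsideMod (ω - P.iζ)
  inj : Function.Injective μ
  r_lt : ∀ p, ∀ s ∈ (Γ p).hull, ‖P.bR h μ s‖ < 1
  ne : ∀ j k, sinh (μ j + μ k) ≠ 0
  iζ_ne : sinh P.iζ ≠ 0

theorem analyticAt_prod {ι : Type*} {S : Finset ι} {f : ι → ℂ → ℂ} {z : ℂ}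
    (hf : ∀ i ∈ S, AnalyticAt ℂ (f i) z) : AnalyticAt ℂ (fun z => ∏ i ∈ S, f i z) z :=
  Finset.analyticAt_fun_prod _ hf

theorem analyticAt_bR {s : ℂ} (h1 : ∀ l, sinh (s - μ l + P.iζ) ≠ 0)
    (h2 : ∀ l, sinh (s + μ l - P.iζ) ≠ 0) : AnalyticAt ℂ (P.bR h μ) s := by
  refine analyticAt_const.mul (analyticAt_prod fun l _ => ?_)
  have d : ∀ f : ℂ → ℂ, Differentiable ℂ f → AnalyticAt ℂ f s := fun f hf => hf.analyticAt s
  exact (d _ (by fun_prop)).div (d _ (by fun_prop)) (mul_ne_zero (h1 l) (h2 l))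

variable (P h μ) in
/-- The product `bV(v) ∏ sinh(v - μ_l)` without the factors of index in the complement of `S` in the
numerator. -/
noncomputable def bA (S : Finset (Fin P.N)) (v : ℂ) : ℂ :=
  -exp (-(h / P.T : ℝ)) * sinh (2 * v - P.iζ) *
    (∏ l ∈ S, sinh (v + μ l) * sinh (v - μ l - P.iζ)) / ∏ l, sinh (v + μ l - P.iζ)

theorem bV_eq_bA (v : ℂ) :
    P.bV h μ v = P.bA h μ Finset.univ v / ∏ l, sinh (v - μ l) := by
  rw [bV, bA, Finset.prod_div_distrib, Finset.prod_mul_distrib (f := fun l => sinh (v - μ l))]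
  simp only [div_eq_mul_inv, mul_inv]
  ring

theorem bA_erase (j : Fin P.N) (v : ℂ) :
    P.bA h μ Finset.univ v =
      P.bA h μ (Finset.univ.erase j) v * (sinh (v + μ j) * sinh (v - μ j - P.iζ)) := by
  rw [bA, bA, ← Finset.mul_prod_erase Finset.univ _ (Finset.mem_univ j)]
  ring

variable {Γ : ℕ → Contour}

namespace SeriesCore

theorem ne_sub_add (D : P.SeriesCore h μ Γ) {p : ℕ} {s : ℂ} (hs : s ∈ (Γ p).hull) (l : Fin P.N) :
    sinh (s + μ l - P.iζ) ≠ 0 := by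
  have := Contour.sinh_sub_ne_zero_of_outsideMod (D.neg_add p l) hs
  rwa [show s + μ l - P.iζ = s - (-μ l + P.iζ) by ring]

theorem ne_sub_sub (D : P.SeriesCore h μ Γ) {p : ℕ} {s : ℂ} (hs : s ∈ (Γ p).hull) (l : Fin P.N) :
    sinh (s - μ l - P.iζ) ≠ 0 := by
  have := Contour.sinh_sub_ne_zero_of_outsideMod (D.add p l) hs
  rwa [show s - μ l - P.iζ = s - (μ l + P.iζ) by ring]

theorem ne_rev (D : P.SeriesCore h μ Γ) {p : ℕ} {s : ℂ} (hs : s ∈ (Γ p).hull) (l : Fin P.N) :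
    sinh (μ l - s - P.iζ) ≠ 0 := by
  have := Contour.sinh_sub_ne_zero_of_outsideMod (D.sub p l) hs
  rw [show μ l - s - P.iζ = -(s - (μ l - P.iζ)) by ring, sinh_neg]
  exact neg_ne_zero.2 this

theorem ne_root (D : P.SeriesCore h μ Γ) (j k : Fin P.N) : sinh (μ j - μ k - P.iζ) ≠ 0 :=
  D.ne_sub_sub (p := 0) (Or.inr (D.mem 0 j)) k

theorem ne_trace (D : P.SeriesCore h μ Γ) {p : ℕ} {s : ℂ} (hs : s ∈ (Γ p).trace) (l : Fin P.N) :
    sinh (s + μ l) ≠ 0 := by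
  obtain ⟨k, hk⟩ := D.neg p l
  have h1 := Contour.sinh_sub_ne_zero_of_inner_of_trace hk hs
  rw [sinh_sub_rep rfl, sub_neg_eq_add] at h1
  exact right_ne_zero_of_mul h1

theorem analyticAt_bA (D : P.SeriesCore h μ Γ) {p : ℕ} (S : Finset (Fin P.N)) {s : ℂ}
    (hs : s ∈ (Γ p).hull) : AnalyticAt ℂ (P.bA h μ S) s := by
  have d : ∀ f : ℂ → ℂ, Differentiable ℂ f → AnalyticAt ℂ f s := fun f hf => hf.analyticAt s
  refine ((d (fun v => -exp (-(h / P.T : ℝ)) * sinh (2 * v - P.iζ)) (by fun_prop)).mul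
    (analyticAt_prod fun l _ => d _ (by fun_prop))).div
    (analyticAt_prod fun l _ => d _ (by fun_prop)) ?_
  exact Finset.prod_ne_zero_iff.2 fun l _ => D.ne_sub_add hs l

theorem analyticAt_bR (D : P.SeriesCore h μ Γ) {p : ℕ} {s : ℂ} (hs : s ∈ (Γ p).hull) :
    AnalyticAt ℂ (P.bR h μ) s :=
  Params.analyticAt_bR (fun l => by
    have := Contour.sinh_sub_ne_zero_of_outsideMod (D.sub p l) hs
    rwa [show s - μ l + P.iζ = s - (μ l - P.iζ) by ring]) (D.ne_sub_add hs)

theorem bA_root (D : P.SeriesCore h μ Γ) (k : Fin P.N) :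
    P.bA h μ Finset.univ (μ k) / ∏ l ∈ Finset.univ.erase k, sinh (μ k - μ l) = P.bRes h μ k := by
  have h1 : sinh (μ k + μ k - P.iζ) ≠ 0 := D.ne_sub_add (p := 0) (Or.inr (D.mem 0 k)) k
  rw [bA, bRes, Finset.prod_div_distrib, Finset.prod_mul_distrib (f := fun l => sinh (μ k - μ l)),
    ← Finset.mul_prod_erase Finset.univ (fun l => sinh (μ k + μ l - P.iζ)) (Finset.mem_univ k),
    ← Finset.mul_prod_erase Finset.univ (fun l => sinh (μ k + μ l) * sinh (μ k - μ l - P.iζ))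
      (Finset.mem_univ k), sub_self, zero_sub, sinh_neg, two_mul]
  generalize sinh (μ k + μ k - P.iζ) = A at h1 ⊢
  have h2 : ∏ l ∈ Finset.univ.erase k, sinh (μ k + μ l - P.iζ) ≠ 0 :=
    Finset.prod_ne_zero_iff.2 fun l _ => D.ne_sub_add (p := 0) (Or.inr (D.mem 0 k)) l
  have h3 : ∏ l ∈ Finset.univ.erase k, sinh (μ k - μ l) ≠ 0 :=
    Finset.prod_ne_zero_iff.2 fun l hl => Contour.sinh_sub_ne_zero_of_mem (Or.inr (D.mem 0 l))
      (Or.inr (D.mem 0 k)) fun he => (Finset.mem_erase.1 hl).1 (D.inj he).symm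
  field_simp

theorem bA_erase_root (D : P.SeriesCore h μ Γ) (j k : Fin P.N) :
    P.bA h μ (Finset.univ.erase j) (μ k) / ∏ l ∈ Finset.univ.erase k, sinh (μ k - μ l)
      = P.bRes h μ k / (sinh (μ k + μ j) * sinh (μ k - μ j - P.iζ)) := by
  have h1 := D.ne k j
  have h2 := D.ne_root k j
  rw [← D.bA_root k, bA_erase j]
  field_simp

/-- Residues at the roots. -/
theorem integral_bV (D : P.SeriesCore h μ Γ) (q : ℕ) {F : ℂ → ℂ}
    (hF : ∀ s ∈ (Γ q).hull, AnalyticAt ℂ F s) :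
    (Γ q).integral (fun v => P.bV h μ v * F v) = 2 * Real.pi * I * ∑ k, P.bRes h μ k * F (μ k) := by
  have key := (Γ q).integral_div_prod_sinh (D.mem q) D.inj
    (F := fun v => P.bA h μ Finset.univ v * F v) fun s hs => (D.analyticAt_bA _ hs).mul (hF s hs)
  rw [show (fun v => P.bV h μ v * F v) = fun v => P.bA h μ Finset.univ v * F v / ∏ i, sinh (v - μ i)
    from funext fun v => by rw [bV_eq_bA]; ring, key]
  congr 1
  refine Finset.sum_congr rfl fun k _ => ?_
  rw [← D.bA_root k]
  ring

theorem integral_bV_div (D : P.SeriesCore h μ Γ) (q : ℕ) (j : Fin P.N) {F : ℂ → ℂ}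
    (hF : ∀ s ∈ (Γ q).hull, AnalyticAt ℂ F s) :
    (Γ q).integral (fun v => P.bV h μ v / (sinh (v + μ j) * sinh (v - μ j - P.iζ)) * F v)
      = 2 * Real.pi * I *
        ∑ k, P.bRes h μ k / (sinh (μ k + μ j) * sinh (μ k - μ j - P.iζ)) * F (μ k) := by
  have key := (Γ q).integral_div_prod_sinh (D.mem q) D.inj
    (F := fun v => P.bA h μ (Finset.univ.erase j) v * F v)
    fun s hs => (D.analyticAt_bA _ hs).mul (hF s hs)
  have e1 : (Γ q).integral (fun v => P.bV h μ v / (sinh (v + μ j) * sinh (v - μ j - P.iζ)) * F v)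
      = (Γ q).integral
        (fun v => P.bA h μ (Finset.univ.erase j) v * F v / ∏ i, sinh (v - μ i)) := by
    refine Contour.pathIntegral_congr fun t ht => ?_
    have hs := (Γ q).mem_trace ht
    have h1 := D.ne_trace hs j
    have h2 := D.ne_sub_sub (Or.inl hs) j
    show P.bV h μ ((Γ q).toFun t) / _ * _ = _
    rw [bV_eq_bA, bA_erase j]
    generalize (Γ q).toFun t = v at *
    field_simp
  rw [e1, key]
  congr 1
  refine Finset.sum_congr rfl fun k _ => ?_
  rw [← D.bA_erase_root j k]
  ring

theorem analyticAt_poles (D : P.SeriesCore h μ Γ) {p q : ℕ} (hpq : p < q) {w : ℂ}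
    (hw : w ∈ (Γ p).trace) {s : ℂ} (hs : s ∈ (Γ q).hull) :
    AnalyticAt ℂ (fun v => (sinh (w + v) * sinh (w - v - P.iζ))⁻¹) s ∧
    AnalyticAt ℂ (fun v => (sinh (v + w) * sinh (v - w - P.iζ))⁻¹) s := by
  obtain ⟨o1, o2, o3⟩ := D.poles p q hpq w hw
  have d : ∀ f : ℂ → ℂ, Differentiable ℂ f → AnalyticAt ℂ f s := fun f hf => hf.analyticAt s
  have h1 := Contour.sinh_sub_ne_zero_of_outsideMod o1 hs
  have h2 := Contour.sinh_sub_ne_zero_of_outsideMod o2 hs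
  have h3 := Contour.sinh_sub_ne_zero_of_outsideMod o3 hs
  rw [sub_neg_eq_add] at h1
  constructor
  · refine (d _ (by fun_prop)).inv (mul_ne_zero (by rwa [add_comm]) ?_)
    rw [show w - s - P.iζ = -(s - (w - P.iζ)) by ring, sinh_neg]
    exact neg_ne_zero.2 h3
  · refine (d _ (by fun_prop)).inv (mul_ne_zero h1 ?_)
    rwa [show s - w - P.iζ = s - (w + P.iζ) by ring]

/-- The integral of a chain of kernels. -/
theorem nestedIntegral_chainFn (D : P.SeriesCore h μ Γ) {K : ℂ → ℂ → ℂ} {G g : ℂ → ℂ}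
    (hK : ∀ p, ∀ v ∈ (Γ p).trace, ∀ u, K u v = P.bV h μ v / (sinh (u + v) * sinh (u - v - P.iζ)))
    (hG : ∀ p, ∀ v ∈ (Γ p).trace, G v = g (P.bR h μ v))
    (hg : ∀ r : ℂ, ‖r‖ < 1 → AnalyticAt ℂ g r) (m : ℕ) {q p p' : ℕ} (hp : p < q) (hp' : p' < q)
    {w z : ℂ} (hw : w ∈ (Γ p).trace) (hz : z ∈ (Γ p').trace) :
    nestedIntegral (fun j => Γ (q + j)) (m + 1) (chainFn K G (m + 1) w z) =
      (2 * Real.pi * I) ^ (m + 1) * ∑ j, P.bRes h μ j / (sinh (w + μ j) * sinh (w - μ j - P.iζ)) *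
        (P.bM h μ ^ m).mulVec (fun k => g (P.bR h μ (μ k)) *
          (P.bV h μ z / (sinh (μ k + z) * sinh (μ k - z - P.iζ)))) j := by
  induction m generalizing q p w with
  | zero =>
    have key := D.integral_bV q (F := fun v => g (P.bR h μ v) *
      (P.bV h μ z * (sinh (v + z) * sinh (v - z - P.iζ))⁻¹) *
      (sinh (w + v) * sinh (w - v - P.iζ))⁻¹) fun s hs => by
        refine AnalyticAt.mul (AnalyticAt.mul ?_ (analyticAt_const.mul
          (D.analyticAt_poles hp' hz hs).2)) (D.analyticAt_poles hp hw hs).1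
        exact (hg _ (D.r_lt q s hs)).comp (D.analyticAt_bR hs)
    have e1 : nestedIntegral (fun j => Γ (q + j)) (0 + 1) (chainFn K G (0 + 1) w z)
        = (Γ q).integral (fun v => P.bV h μ v * (g (P.bR h μ v) *
          (P.bV h μ z * (sinh (v + z) * sinh (v - z - P.iζ))⁻¹) *
          (sinh (w + v) * sinh (w - v - P.iζ))⁻¹)) := by
      refine Contour.pathIntegral_congr fun t ht => ?_
      have hs := (Γ q).mem_trace ht
      simp only [nestedIntegral, add_zero]
      rw [chainFn_cons, chainFn, hK q _ hs, hK p' z hz]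
      simp only [Fin.last_zero, Fin.cons_zero, Finset.univ_eq_empty, Finset.prod_empty]
      rw [hG q _ hs]
      ring
    rw [e1, key, zero_add, pow_one]
    congr 1
    refine Finset.sum_congr rfl fun k _ => ?_
    rw [pow_zero, Matrix.one_mulVec]
    ring
  | succ m ih =>
    set c : Fin P.N → ℂ := (P.bM h μ ^ m).mulVec (fun k => g (P.bR h μ (μ k)) *
          (P.bV h μ z / (sinh (μ k + z) * sinh (μ k - z - P.iζ)))) with hc
    have e1 : nestedIntegral (fun j => Γ (q + j)) (m + 1 + 1) (chainFn K G (m + 1 + 1) w z)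
        = pathIntegral (Γ q).toFun (fun t => ∑ j, (2 * Real.pi * I) ^ (m + 1) * (P.bRes h μ j * c j) *
          (P.bV h μ ((Γ q).toFun t) / (sinh ((Γ q).toFun t + μ j) * sinh ((Γ q).toFun t - μ j - P.iζ))
            * (sinh (w + (Γ q).toFun t) * sinh (w - (Γ q).toFun t - P.iζ))⁻¹)) := by
      refine Contour.pathIntegral_congr fun t ht => ?_
      have hs := (Γ q).mem_trace ht
      show nestedIntegral (fun j => Γ (q + (j + 1))) (m + 1)
        (fun v => chainFn K G (m + 1 + 1) w z (Fin.cons ((Γ q).toFun t) v)) = _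
      simp only [chainFn_cons]
      rw [nestedIntegral_const_mul, show (fun j => Γ (q + (j + 1))) = fun j => Γ (q + 1 + j) from
        funext fun j => by rw [add_assoc, add_comm 1 j], ih (q := q + 1) (p := q) (by omega) (by omega)
        hs, hK q _ hs, Finset.mul_sum, Finset.mul_sum]
      refine Finset.sum_congr rfl fun j _ => ?_
      ring
    have hcont : ∀ j ∈ Finset.univ, ContinuousOn (fun t => (2 * Real.pi * I) ^ (m + 1) *
          (P.bRes h μ j * c j) *
          (P.bV h μ ((Γ q).toFun t) / (sinh ((Γ q).toFun t + μ j) * sinh ((Γ q).toFun t - μ j - P.iζ))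
            * (sinh (w + (Γ q).toFun t) * sinh (w - (Γ q).toFun t - P.iζ))⁻¹)) (Set.Icc 0 1) := by
      intro j _
      refine (Γ q).continuousOn_comp (f := fun v => (2 * Real.pi * I) ^ (m + 1) *
          (P.bRes h μ j * c j) * (P.bV h μ v / (sinh (v + μ j) * sinh (v - μ j - P.iζ))
            * (sinh (w + v) * sinh (w - v - P.iζ))⁻¹)) fun s hs => ?_
      refine continuousAt_const.mul (ContinuousAt.mul (ContinuousAt.div ?_ (by fun_prop)
        (mul_ne_zero (D.ne_trace hs j) (D.ne_sub_sub (Or.inl hs) j)))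
        (D.analyticAt_poles hp hw (Or.inl hs)).1.continuousAt)
      rw [show P.bV h μ = fun v => P.bA h μ Finset.univ v / ∏ l, sinh (v - μ l) from
        funext bV_eq_bA]
      refine (D.analyticAt_bA _ (Or.inl hs)).continuousAt.div
        (tendsto_finsetProd _ fun l _ => (by fun_prop : ContinuousAt (fun v => sinh (v - μ l)) s))
        (Finset.prod_ne_zero_iff.2 fun l _ =>
          Contour.sinh_sub_ne_zero_of_inner_of_trace (D.mem q l) hs)
    rw [e1, (Γ q).pathIntegral_sum _ hcont]
    have e2 : ∀ j, pathIntegral (Γ q).toFun (fun t => (2 * Real.pi * I) ^ (m + 1) *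
          (P.bRes h μ j * c j) *
          (P.bV h μ ((Γ q).toFun t) / (sinh ((Γ q).toFun t + μ j) * sinh ((Γ q).toFun t - μ j - P.iζ))
            * (sinh (w + (Γ q).toFun t) * sinh (w - (Γ q).toFun t - P.iζ))⁻¹))
        = (2 * Real.pi * I) ^ (m + 1 + 1) *
          ∑ k, P.bRes h μ k / (sinh (w + μ k) * sinh (w - μ k - P.iζ)) * (P.bM h μ k j * c j) := by
      intro j
      rw [Contour.pathIntegral_const_mul]
      have := D.integral_bV_div q j (F := fun v => (sinh (w + v) * sinh (w - v - P.iζ))⁻¹)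
        fun s hs => (D.analyticAt_poles hp hw hs).1
      rw [Contour.integral] at this
      rw [this, pow_succ, Finset.mul_sum, Finset.mul_sum, Finset.mul_sum]
      refine Finset.sum_congr rfl fun k _ => ?_
      rw [bM, Matrix.of_apply]
      ring
    simp only [e2]
    rw [← Finset.mul_sum, Finset.sum_comm]
    congr 1
    refine Finset.sum_congr rfl fun k _ => ?_
    rw [← Finset.mul_sum, pow_succ', ← Matrix.mulVec_mulVec, ← hc]
    rfl

end SeriesCore
end Params

namespace Params

variable {P : Params} {h : ℝ} {μ : Fin P.N → ℂ} {Γ : ℕ → Contour}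

theorem bA_div_add_int (S : Finset (Fin P.N)) (v : ℂ) (n : ℤ) :
    P.bA h μ S (v + n * (Real.pi * I)) / ∏ l, sinh (v + n * (Real.pi * I) - μ l)
      = P.bA h μ S v / ∏ l, sinh (v - μ l) := by
  have hε : ((-1 : ℂ) ^ n) * (-1) ^ n = 1 := by rcases sign_cases n with h | h <;> simp [h]
  have s1 : ∀ x y : ℂ, sinh (v + n * (Real.pi * I) + x - y) = (-1) ^ n * sinh (v + x - y) :=
    fun x y => by rw [← sinh_add_int_mul_pi]; congr 1; ring
  have s2 : ∀ x : ℂ, sinh (v + n * (Real.pi * I) + x) = (-1) ^ n * sinh (v + x) :=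
    fun x => by rw [← sinh_add_int_mul_pi]; congr 1; ring
  have s3 : ∀ x : ℂ, sinh (v + n * (Real.pi * I) - x) = (-1) ^ n * sinh (v - x) :=
    fun x => by rw [← sinh_add_int_mul_pi]; congr 1; ring
  have s4 : ∀ x y : ℂ, sinh (v + n * (Real.pi * I) - x - y) = (-1) ^ n * sinh (v - x - y) :=
    fun x y => by rw [← sinh_add_int_mul_pi]; congr 1; ring
  have s5 : sinh (2 * (v + n * (Real.pi * I)) - P.iζ) = sinh (2 * v - P.iζ) := by
    have := sinh_add_int_mul_pi (2 * v - P.iζ) (n + n)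
    rw [zpow_add₀ (by norm_num), hε, one_mul] at this
    rw [← this]
    congr 1
    push_cast
    ring
  unfold bA
  simp only [s1, s2, s3, s4, s5]
  have e1 : ∀ l, (-1 : ℂ) ^ n * sinh (v + μ l) * ((-1) ^ n * sinh (v - μ l - P.iζ))
      = sinh (v + μ l) * sinh (v - μ l - P.iζ) := fun l => by
    rw [mul_mul_mul_comm, hε, one_mul]
  simp only [e1, Finset.prod_mul_distrib (f := fun _ => (-1 : ℂ) ^ n), Finset.prod_const]
  rw [div_div, div_div, mul_mul_mul_comm, ← mul_pow, hε, one_pow, one_mul]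

theorem bRes_mul (hne : ∀ j k, sinh (μ j + μ k) ≠ 0)
    (hd : ∀ j k, j ≠ k → sinh (μ j - μ k) ≠ 0) (hζ : sinh P.iζ ≠ 0) (k : Fin P.N) :
    P.bRes h μ k * (P.bA h μ (Finset.univ.erase k) (-μ k) / (∏ l, sinh (-μ k - μ l)))
      / sinh (2 * μ k - P.iζ) = -P.bR h μ (μ k) := by
  have e0 : (∏ l ∈ Finset.univ.erase k, (sinh (μ k + μ l) * sinh (μ k - μ l - P.iζ)) /
      (sinh (μ k - μ l) * sinh (μ k + μ l - P.iζ))) *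
      ((∏ l ∈ Finset.univ.erase k, sinh (-μ k + μ l) * sinh (-μ k - μ l - P.iζ)) /
        (∏ l ∈ Finset.univ.erase k, sinh (-μ k + μ l - P.iζ)) /
        (∏ l ∈ Finset.univ.erase k, sinh (-μ k - μ l))) =
      ∏ l ∈ Finset.univ.erase k, (sinh (μ k + μ l + P.iζ) * sinh (μ k - μ l - P.iζ)) /
        (sinh (μ k - μ l + P.iζ) * sinh (μ k + μ l - P.iζ)) := by
    rw [← Finset.prod_div_distrib, ← Finset.prod_div_distrib, ← Finset.prod_mul_distrib]
    refine Finset.prod_congr rfl fun l hl => ?_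
    have h1 := hne k l
    have h2 := hd k l (Finset.mem_erase.1 hl).1.symm
    rw [show -μ k + μ l - P.iζ = -(μ k - μ l + P.iζ) by ring,
      show -μ k - μ l - P.iζ = -(μ k + μ l + P.iζ) by ring,
      show -μ k + μ l = -(μ k - μ l) by ring, show -μ k - μ l = -(μ k + μ l) by ring,
      sinh_neg, sinh_neg, sinh_neg, sinh_neg]
    generalize sinh (μ k - μ l + P.iζ) = A
    generalize sinh (μ k + μ l + P.iζ) = B
    generalize sinh (μ k + μ l - P.iζ) = B'
    generalize sinh (μ k - μ l) = D at *
    generalize sinh (μ k + μ l) = E at *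
    field_simp
  have e3 : exp (-(h / P.T : ℝ)) * exp (-(h / P.T : ℝ)) = exp (-(2 * h / P.T : ℝ)) := by
    rw [← exp_add]; congr 1; push_cast; ring
  rw [bR, ← Finset.mul_prod_erase Finset.univ (fun l =>
      (sinh (μ k + μ l + P.iζ) * sinh (μ k - μ l - P.iζ)) /
        (sinh (μ k - μ l + P.iζ) * sinh (μ k + μ l - P.iζ))) (Finset.mem_univ k), ← e0, ← e3, bRes, bA,
    ← Finset.mul_prod_erase Finset.univ (fun l => sinh (-μ k - μ l)) (Finset.mem_univ k),
    ← Finset.mul_prod_erase Finset.univ (fun l => sinh (-μ k + μ l - P.iζ)) (Finset.mem_univ k)]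
  rw [show -μ k + μ k - P.iζ = -P.iζ by ring, show 2 * -μ k - P.iζ = -(μ k + μ k + P.iζ) by ring,
    show -μ k - μ k = -(μ k + μ k) by ring, show μ k - μ k - P.iζ = -P.iζ by ring,
    show μ k - μ k + P.iζ = P.iζ by ring, sinh_neg, sinh_neg, sinh_neg, two_mul]
  have h1 := hne k k
  generalize sinh (μ k + μ k + P.iζ) = A
  generalize sinh (μ k + μ k - P.iζ) = A'
  generalize sinh (μ k + μ k) = E at *
  field_simp

theorem bV_zero (hb : sinh P.b ≠ 0) (hηb : sinh (P.iζ + P.b) ≠ 0)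
    (hμ : ∀ k, sinh (μ k) ≠ 0) : P.bV h μ 0 = P.countingFn h μ 0 * sinh P.iζ := by
  have e1 : (sinh (0 - P.b) * sinh (P.iζ + 0 + P.b) / (sinh (0 + P.b) * sinh (P.iζ - 0 + P.b))) ^ P.N
      = ∏ _k : Fin P.N, (-1 : ℂ) := by
    rw [Finset.prod_const, Finset.card_univ, Fintype.card_fin]
    congr 1
    rw [zero_sub, add_zero, zero_add, sub_zero, sinh_neg]
    field_simp
  rw [bV, countingFn, e1, mul_assoc (exp _) (∏ k, _), ← Finset.prod_mul_distrib]
  rw [mul_zero, zero_sub, sinh_neg]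
  have e2 : ∀ k, sinh (0 + μ k) * sinh (0 - μ k - P.iζ) / (sinh (0 - μ k) * sinh (0 + μ k - P.iζ))
      = sinh (P.iζ - 0 + μ k) / sinh (P.iζ + 0 - μ k) * -1 := fun k => by
    have := hμ k
    rw [zero_add, zero_sub, sub_zero, add_zero, show -μ k - P.iζ = -(P.iζ + μ k) by ring,
      show μ k - P.iζ = -(P.iζ - μ k) by ring, sinh_neg, sinh_neg, sinh_neg]
    generalize sinh (P.iζ + μ k) = A
    generalize sinh (P.iζ - μ k) = B
    field_simp
  simp only [e2]
  ring

namespace SeriesCore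

theorem integral_cyclic_one (D : P.SeriesCore h μ Γ) {K : ℂ → ℂ → ℂ} {G g : ℂ → ℂ}
    (hK : ∀ p, ∀ v ∈ (Γ p).trace, ∀ u, K u v = P.bV h μ v / (sinh (u + v) * sinh (u - v - P.iζ)))
    (hG : ∀ p, ∀ v ∈ (Γ p).trace, G v = g (P.bR h μ v))
    (hg : ∀ r : ℂ, ‖r‖ < 1 → AnalyticAt ℂ g r) {a₀ : ℂ} (h0 : P.bV h μ 0 = a₀ * sinh P.iζ) :
    (Γ 0).integral (fun w => nestedIntegral (fun j => Γ (j + 1)) 0 (chainFn K G 0 w w))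
      = 2 * Real.pi * I *
        (∑ k, P.bM h μ k k * g (P.bR h μ (μ k)) - a₀ / 2 * g (P.bR h μ 0)) := by
  have hcosh : ∀ s ∈ (Γ 0).hull, cosh s ≠ 0 := fun s hs h1 => by
    have := Contour.sinh_sub_ne_zero_of_outsideMod (D.half_period 0) hs
    rw [sinh_sub, h1, zero_mul, sub_zero, show (Real.pi * I / 2 : ℂ) = (Real.pi / 2 : ℂ) * I by ring,
      cosh_mul_I, Complex.cos_pi_div_two, mul_zero] at this
    exact this rfl
  have hs0 : ∀ k, μ k ≠ 0 := fun k hk => D.ne k k (by simp [hk])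
  have key := (Γ 0).integral_div_sinh_mul_prod (D.mem 0) D.inj (D.zero_mem 0) hs0
    (F := fun v => P.bA h μ Finset.univ v * g (P.bR h μ v) * (2 * cosh v * sinh (-P.iζ))⁻¹)
    fun s hs => by
      refine ((D.analyticAt_bA _ hs).mul ((hg _ (D.r_lt 0 s hs)).comp (D.analyticAt_bR hs))).mul
        (AnalyticAt.inv ?_ ?_)
      · have : Differentiable ℂ fun v => 2 * cosh v * sinh (-P.iζ) := by fun_prop
        exact this.analyticAt s
      · rw [sinh_neg]
        exact mul_ne_zero (mul_ne_zero two_ne_zero (hcosh s hs)) (neg_ne_zero.2 D.iζ_ne)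
  have e1 : (Γ 0).integral (fun w => nestedIntegral (fun j => Γ (j + 1)) 0 (chainFn K G 0 w w))
      = (Γ 0).integral (fun v => P.bA h μ Finset.univ v * g (P.bR h μ v) *
        (2 * cosh v * sinh (-P.iζ))⁻¹ / (sinh (v - 0) * ∏ i, sinh (v - μ i))) := by
    refine Contour.pathIntegral_congr fun t ht => ?_
    have hs := (Γ 0).mem_trace ht
    simp only [nestedIntegral, chainFn, Fin.last_zero, Fin.cons_zero, Finset.univ_eq_empty,
      Finset.prod_empty]
    rw [hG 0 _ hs, hK 0 _ hs, bV_eq_bA, ← two_mul, sinh_two_mul, sub_self, zero_sub, sub_zero]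
    simp only [div_eq_mul_inv, mul_inv]
    ring
  rw [e1, key]
  congr 1
  have e2 : P.bA h μ Finset.univ 0 * g (P.bR h μ 0) * (2 * cosh 0 * sinh (-P.iζ))⁻¹
      / (∏ i, sinh (0 - μ i)) = -(a₀ / 2 * g (P.bR h μ 0)) := by
    rw [bV_eq_bA] at h0
    rw [mul_assoc, mul_div_right_comm, h0, sinh_neg, cosh_zero]
    have := D.iζ_ne
    field_simp
  rw [e2, add_comm, ← sub_eq_add_neg]
  congr 1
  refine Finset.sum_congr rfl fun k _ => ?_
  have h1 := D.ne k k
  rw [bM, Matrix.of_apply, ← D.bA_root k, ← two_mul, sinh_two_mul, sub_self, zero_sub, sub_zero]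
  simp only [div_eq_mul_inv, mul_inv]
  ring

theorem integral_cyclic_pair (D : P.SeriesCore h μ Γ) (j k : Fin P.N) :
    (Γ 0).integral (fun w => P.bV h μ w / (sinh (w + μ j) * sinh (w - μ j - P.iζ)) *
        (P.bRes h μ j * (sinh (μ k + w) * sinh (μ k - w - P.iζ))⁻¹)) =
      2 * Real.pi * I * ((∑ i, P.bM h μ k i * P.bM h μ i j)
        - if j = k then P.bR h μ (μ k) else 0) := by
  obtain ⟨n, hn⟩ := D.neg 0 k
  set κ : ℂ := -μ k + n * (Real.pi * I) with hκ
  have hε : ((-1 : ℂ) ^ n) * (-1) ^ n = 1 := by rcases sign_cases n with h | h <;> simp [h]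
  have hε0 : ((-1 : ℂ) ^ n) ≠ 0 := left_ne_zero_of_mul (hε.trans_ne one_ne_zero)
  have hsκ : ∀ v, sinh (v - κ) = (-1) ^ n * sinh (v + μ k) := fun v => by
    rw [sinh_sub_rep hκ, sub_neg_eq_add]
  have hne : ∀ i, μ i ≠ κ := fun i hi => by
    have : sinh (μ i - κ) = 0 := by simp [hi]
    rw [hsκ] at this
    exact mul_ne_zero hε0 (D.ne i k) this
  have key := (Γ 0).integral_div_sinh_mul_prod (D.mem 0) D.inj hn hne
    (F := fun v => P.bA h μ (Finset.univ.erase j) v * (P.bRes h μ j * (-1) ^ n) *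
      (sinh (μ k - v - P.iζ))⁻¹)
    fun s hs => by
      refine ((D.analyticAt_bA _ hs).mul analyticAt_const).mul (AnalyticAt.inv ?_ (D.ne_rev hs k))
      have : Differentiable ℂ fun v => sinh (μ k - v - P.iζ) := by fun_prop
      exact this.analyticAt s
  have e1 : (Γ 0).integral (fun w => P.bV h μ w / (sinh (w + μ j) * sinh (w - μ j - P.iζ)) *
        (P.bRes h μ j * (sinh (μ k + w) * sinh (μ k - w - P.iζ))⁻¹))
      = (Γ 0).integral (fun v => P.bA h μ (Finset.univ.erase j) v * (P.bRes h μ j * (-1) ^ n) *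
      (sinh (μ k - v - P.iζ))⁻¹ / (sinh (v - κ) * ∏ i, sinh (v - μ i))) := by
    refine Contour.pathIntegral_congr fun t ht => ?_
    have hs := (Γ 0).mem_trace ht
    have h1 := D.ne_trace hs j
    have h2 := D.ne_sub_sub (Or.inl hs) j
    have h3 := D.ne_trace hs k
    beta_reduce
    rw [bV_eq_bA, bA_erase j, hsκ, add_comm (μ k)]
    generalize (Γ 0).toFun t = v at *
    have h5 : ((-1 : ℂ) ^ n)⁻¹ = (-1) ^ n := inv_eq_of_mul_eq_one_left hε
    simp only [div_eq_mul_inv, mul_inv, h5]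
    have h6 : sinh (v + μ j) * (sinh (v + μ j))⁻¹ = 1 := mul_inv_cancel₀ h1
    have h7 : sinh (v - μ j - P.iζ) * (sinh (v - μ j - P.iζ))⁻¹ = 1 := mul_inv_cancel₀ h2
    linear_combination (P.bA h μ (Finset.univ.erase j) v * (∏ l, sinh (v - μ l))⁻¹ * P.bRes h μ j *
      (sinh (v + μ k))⁻¹ * (sinh (μ k - v - P.iζ))⁻¹) *
      (sinh (v - μ j - P.iζ) * (sinh (v - μ j - P.iζ))⁻¹ * h6 + h7 - hε)
  rw [e1, key]
  congr 1
  have e2 : P.bA h μ (Finset.univ.erase j) κ * (P.bRes h μ j * (-1) ^ n) *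
      (sinh (μ k - κ - P.iζ))⁻¹ / (∏ i, sinh (κ - μ i)) = -if j = k then P.bR h μ (μ k) else 0 := by
    split_ifs with hjk
    · subst hjk
      rw [← bRes_mul D.ne (fun i l hil => Contour.sinh_sub_ne_zero_of_mem (Or.inr (D.mem 0 l))
        (Or.inr (D.mem 0 i)) fun he => hil (D.inj he)) D.iζ_ne j, ← bA_div_add_int _ _ n, ← hκ,
        show μ j - κ - P.iζ = (2 * μ j - P.iζ) + (-n : ℤ) * (Real.pi * I) by
          rw [hκ]; push_cast; ring, sinh_add_int_mul_pi, zpow_neg]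
      simp only [div_eq_mul_inv, mul_inv, inv_inv]
      linear_combination (P.bA h μ (Finset.univ.erase j) κ * P.bRes h μ j * (sinh (2 * μ j - P.iζ))⁻¹ *
        (∏ i, sinh (κ - μ i))⁻¹) * hε
    · have : P.bA h μ (Finset.univ.erase j) κ = 0 := by
        rw [bA, Finset.prod_eq_zero (i := k) (by simp [Ne.symm hjk])]
        · simp
        · rw [hκ, add_right_comm, neg_add_cancel, zero_add, sinh_eq_zero_iff.2 ⟨n, rfl⟩, zero_mul]
      simp [this]
  rw [e2, add_comm, ← sub_eq_add_neg]
  congr 1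
  refine Finset.sum_congr rfl fun i _ => ?_
  have h5 : ((-1 : ℂ) ^ n)⁻¹ = (-1) ^ n := inv_eq_of_mul_eq_one_left hε
  have h6 := D.bA_erase_root j i
  rw [hsκ, bM, Matrix.of_apply, Matrix.of_apply, add_comm (μ k)]
  simp only [div_eq_mul_inv, mul_inv, h5] at h6 ⊢
  linear_combination ((-1) ^ n * (-1) ^ n * P.bRes h μ j * (sinh (μ k - μ i - P.iζ))⁻¹ *
    (sinh (μ i + μ k))⁻¹) * h6 + P.bRes h μ i * ((sinh (μ i + μ j))⁻¹ * (sinh (μ i - μ j - P.iζ))⁻¹) *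
    P.bRes h μ j * (sinh (μ k - μ i - P.iζ))⁻¹ * (sinh (μ i + μ k))⁻¹ * hε

theorem integral_cyclic_succ (D : P.SeriesCore h μ Γ) {K : ℂ → ℂ → ℂ} {G g : ℂ → ℂ}
    (hK : ∀ p, ∀ v ∈ (Γ p).trace, ∀ u, K u v = P.bV h μ v / (sinh (u + v) * sinh (u - v - P.iζ)))
    (hG : ∀ p, ∀ v ∈ (Γ p).trace, G v = g (P.bR h μ v))
    (hg : ∀ r : ℂ, ‖r‖ < 1 → AnalyticAt ℂ g r) (m : ℕ) :
    (Γ 0).integral (fun w => nestedIntegral (fun j => Γ (j + 1)) (m + 1) (chainFn K G (m + 1) w w))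
      = (2 * Real.pi * I) ^ (m + 2) * ∑ k, ((P.bM h μ ^ (m + 2)) k k
        - (P.bM h μ ^ m) k k * P.bR h μ (μ k)) * g (P.bR h μ (μ k)) := by
  let T : Fin P.N → Fin P.N → ℂ → ℂ := fun j k w =>
    P.bV h μ w / (sinh (w + μ j) * sinh (w - μ j - P.iζ)) *
        (P.bRes h μ j * (sinh (μ k + w) * sinh (μ k - w - P.iζ))⁻¹)
  have e1 : (Γ 0).integral (fun w => nestedIntegral (fun j => Γ (j + 1)) (m + 1)
        (chainFn K G (m + 1) w w))
      = pathIntegral (Γ 0).toFun (fun t => ∑ q : Fin P.N × Fin P.N, (2 * Real.pi * I) ^ (m + 1) *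
        ((P.bM h μ ^ m) q.1 q.2 * g (P.bR h μ (μ q.2))) * T q.1 q.2 ((Γ 0).toFun t)) := by
    refine Contour.pathIntegral_congr fun t ht => ?_
    have hs := (Γ 0).mem_trace ht
    show nestedIntegral (fun j => Γ (j + 1)) (m + 1) _ = _
    rw [show (fun j => Γ (j + 1)) = fun j => Γ (1 + j) from funext fun j => by rw [add_comm],
      D.nestedIntegral_chainFn hK hG hg m (q := 1) (p := 0) (p' := 0) zero_lt_one zero_lt_one hs hs,
      Fintype.sum_prod_type, Finset.mul_sum]
    refine Finset.sum_congr rfl fun j _ => ?_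
    rw [Matrix.mulVec, dotProduct, Finset.mul_sum, Finset.mul_sum]
    refine Finset.sum_congr rfl fun k _ => ?_
    simp only [T]
    ring
  have hcont : ∀ q ∈ (Finset.univ : Finset (Fin P.N × Fin P.N)),
      ContinuousOn (fun t => (2 * Real.pi * I) ^ (m + 1) *
        ((P.bM h μ ^ m) q.1 q.2 * g (P.bR h μ (μ q.2))) * T q.1 q.2 ((Γ 0).toFun t))
        (Set.Icc 0 1) := by
    intro q _
    refine (Γ 0).continuousOn_comp (f := fun s => (2 * Real.pi * I) ^ (m + 1) *
        ((P.bM h μ ^ m) q.1 q.2 * g (P.bR h μ (μ q.2))) * T q.1 q.2 s) fun s hs => ?_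
    refine continuousAt_const.mul (ContinuousAt.mul (ContinuousAt.div ?_ (by fun_prop)
        (mul_ne_zero (D.ne_trace hs _) (D.ne_sub_sub (Or.inl hs) _))) (continuousAt_const.mul
        (ContinuousAt.inv₀ (by fun_prop) ?_)))
    · rw [show P.bV h μ = fun v => P.bA h μ Finset.univ v / ∏ l, sinh (v - μ l) from
        funext bV_eq_bA]
      refine (D.analyticAt_bA _ (Or.inl hs)).continuousAt.div
        (tendsto_finsetProd _ fun l _ => (by fun_prop : ContinuousAt (fun v => sinh (v - μ l)) s))
        (Finset.prod_ne_zero_iff.2 fun l _ =>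
          Contour.sinh_sub_ne_zero_of_inner_of_trace (D.mem 0 l) hs)
    · rw [add_comm]
      exact mul_ne_zero (D.ne_trace hs _) (D.ne_rev (Or.inl hs) _)
  rw [e1, (Γ 0).pathIntegral_sum _ hcont]
  have e2 : ∀ q : Fin P.N × Fin P.N, pathIntegral (Γ 0).toFun (fun t => (2 * Real.pi * I) ^ (m + 1) *
        ((P.bM h μ ^ m) q.1 q.2 * g (P.bR h μ (μ q.2))) * T q.1 q.2 ((Γ 0).toFun t))
      = (2 * Real.pi * I) ^ (m + 2) * (((P.bM h μ ^ m) q.1 q.2 * g (P.bR h μ (μ q.2))) *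
        ((∑ i, P.bM h μ q.2 i * P.bM h μ i q.1) - if q.1 = q.2 then P.bR h μ (μ q.2) else 0)) := by
    intro q
    rw [Contour.pathIntegral_const_mul]
    have := D.integral_cyclic_pair q.1 q.2
    rw [Contour.integral] at this
    rw [this, pow_succ]
    ring
  simp only [e2]
  rw [← Finset.mul_sum, Fintype.sum_prod_type, Finset.sum_comm]
  congr 1
  refine Finset.sum_congr rfl fun k _ => ?_
  have e3 : (P.bM h μ ^ (m + 2)) k k
      = ∑ j, (P.bM h μ ^ m) j k * ∑ i, P.bM h μ k i * P.bM h μ i j := by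
    rw [pow_succ', pow_succ', ← mul_assoc, Matrix.mul_apply]
    refine Finset.sum_congr rfl fun j _ => ?_
    rw [Matrix.mul_apply, mul_comm]
  rw [e3, sub_mul, Finset.sum_mul]
  simp only [mul_sub, Finset.sum_sub_distrib, mul_ite, mul_zero, Finset.sum_ite_eq',
    Finset.mem_univ, if_true]
  congr 1
  · refine Finset.sum_congr rfl fun j _ => by ring
  · ring

end SeriesCore
end Params

section MatrixSeries

open scoped Matrix.Norms.Operator

variable {ι : Type*} [Fintype ι] [DecidableEq ι]

theorem hasDerivAt_det_one_add_smul (M : Matrix ι ι ℂ) {z : ℂ} {B : Matrix ι ι ℂ}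
    (hB : (1 + z • M) * B = 1) :
    HasDerivAt (fun z => Matrix.det (1 + z • M)) (Matrix.det (1 + z • M) * Matrix.trace (B * M)) z := by
  let p : Polynomial ℂ := Matrix.det (1 + (Polynomial.X : Polynomial ℂ) • (B * M).map Polynomial.C)
  have hp : ∀ x, p.eval x = Matrix.det (1 + x • (B * M)) := fun x => by
    rw [← Polynomial.coe_evalRingHom, RingHom.map_det]
    congr 1
    ext i j
    generalize B * M = A
    by_cases hij : i = j <;> simp [hij, mul_comm x]
  have e1 : (fun x => Matrix.det (1 + x • M))
      = fun x => Matrix.det (1 + z • M) * p.eval (x - z) := by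
    funext x
    rw [hp, ← Matrix.det_mul, mul_add, mul_one, mul_smul_comm, ← mul_assoc, hB, one_mul]
    congr 1
    module
  rw [e1]
  have h1 : HasDerivAt (fun x => p.eval (x - z)) (p.derivative.eval (z - z) * 1) z :=
    (p.hasDerivAt (z - z)).comp (h := fun x => x - z) z ((hasDerivAt_id z).sub_const z)
  rw [sub_self, Matrix.derivative_det_one_add_X_smul, mul_one] at h1
  exact h1.const_mul _

/-- `exp tr ln(1 + M) = det(1 + M)`, as soon as the power series of `tr ln(1 + M)` converges. -/
theorem exp_tsum_trace_pow (M : Matrix ι ι ℂ)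
    (hs : Summable fun n : ℕ => (-1 : ℂ) ^ n * Matrix.trace (M ^ (n + 1)) / (n + 1)) :
    exp (∑' n : ℕ, (-1 : ℂ) ^ n * Matrix.trace (M ^ (n + 1)) / (n + 1)) = Matrix.det (1 + M) := by
  set c : ℕ → ℂ := fun n => (-1 : ℂ) ^ n * Matrix.trace (M ^ (n + 1)) / (n + 1) with hc
  let F : ℕ → ℂ → ℂ := fun n z => c n * z ^ (n + 1)
  have hbound : ∀ n, ∀ z ∈ Metric.closedBall (0 : ℂ) 1, ‖F n z‖ ≤ ‖c n‖ := fun n z hz => by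
    rw [norm_mul, norm_pow]
    exact mul_le_of_le_one_right (norm_nonneg _)
      (pow_le_one₀ (norm_nonneg _) (by simpa using hz))
  have hcont : ContinuousOn (fun z => ∑' n, F n z) (Metric.closedBall 0 1) :=
    continuousOn_tsum (fun n => by fun_prop) hs.norm hbound
  have hdiff : DifferentiableOn ℂ (fun z => ∑' n, F n z) (Metric.ball 0 1) :=
    differentiableOn_tsum_of_summable_norm hs.norm (fun n => by fun_prop) Metric.isOpen_ball
      fun n z hz => hbound n z (Metric.ball_subset_closedBall hz)
  have hdet : Differentiable ℂ fun z : ℂ => Matrix.det (1 + z • M) := by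
    simp only [Matrix.det_apply, Matrix.add_apply, Matrix.smul_apply, smul_eq_mul]
    fun_prop
  -- near the origin
  obtain ⟨ρ, hρ0, hρ1, hρM⟩ : ∃ ρ : ℝ, 0 < ρ ∧ ρ ≤ 1 ∧ ρ * ‖M‖ < 1 := by
    refine ⟨1 / (‖M‖ + 1), by positivity, ?_, ?_⟩
    · rw [div_le_one (by positivity)]; linarith [norm_nonneg M]
    · rw [one_div, inv_mul_lt_one₀ (by positivity)]; linarith
  have htr : ∀ A : Matrix ι ι ℂ, ‖Matrix.trace A‖ ≤ Fintype.card ι * ‖A‖ := fun A => by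
    refine (norm_sum_le _ _).trans ?_
    rw [← nsmul_eq_mul]
    refine (Finset.sum_le_card_nsmul Finset.univ _ ‖A‖ fun i _ => ?_)
    rw [Matrix.diag_apply, ← coe_nnnorm, ← coe_nnnorm, NNReal.coe_le_coe, Matrix.linfty_opNNNorm_def]
    exact (Finset.single_le_sum (f := fun j => ‖A i j‖₊) (fun _ _ => zero_le)
      (Finset.mem_univ i)).trans (Finset.le_sup (f := fun i => ∑ j, ‖A i j‖₊) (Finset.mem_univ i))
  have hgeom : ∀ z ∈ Metric.ball (0 : ℂ) ρ, ‖(-z) • M‖ ≤ ρ * ‖M‖ := fun z hz => by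
    rw [norm_smul, norm_neg]
    exact mul_le_mul_of_nonneg_right (by simpa using (Metric.mem_ball.1 hz).le) (norm_nonneg _)
  have hderF : ∀ z ∈ Metric.ball (0 : ℂ) ρ, HasDerivAt (fun z => ∑' n, F n z)
      (∑' n : ℕ, Matrix.trace (((-z) • M) ^ n * M)) z := by
    intro z hz
    refine hasDerivAt_tsum_of_isPreconnected (g := F)
      (g' := fun n z => Matrix.trace (((-z) • M) ^ n * M)) (u := fun n => Fintype.card ι * ((ρ * ‖M‖) ^ n * ‖1 * M‖) *
      max 1 ‖(1 : Matrix ι ι ℂ)‖)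
      (((summable_geometric_of_lt_one (by positivity) hρM).mul_right _).mul_left _ |>.mul_right _)
      Metric.isOpen_ball (convex_ball _ _).isPreconnected (fun n y hy => ?_) (fun n y hy => ?_)
      (Metric.mem_ball_self hρ0) (by simp [F]) hz
    · refine ((hasDerivAt_pow (n + 1) y).const_mul (c n)).congr_deriv ?_
      rw [smul_pow, smul_mul_assoc, Matrix.trace_smul, ← pow_succ, neg_pow, hc]
      simp only [smul_eq_mul, Nat.add_sub_cancel]
      push_cast
      field_simp
    · refine (htr _).trans ?_
      rw [mul_assoc]
      refine mul_le_mul_of_nonneg_left ?_ (Nat.cast_nonneg _)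
      have h1 : ‖((-y) • M) ^ n‖ ≤ (ρ * ‖M‖) ^ n * max 1 ‖(1 : Matrix ι ι ℂ)‖ := by
        rcases Nat.eq_zero_or_pos n with rfl | hn
        · simp
        · refine (norm_pow_le' _ hn).trans ?_
          refine (pow_le_pow_left₀ (norm_nonneg _) (hgeom y hy) n).trans ?_
          exact le_mul_of_one_le_right (by positivity) (le_max_left _ _)
      rw [one_mul]
      refine (norm_mul_le _ _).trans ((mul_le_mul_of_nonneg_right h1 (norm_nonneg _)).trans_eq ?_)
      ring
  have hconst : ∀ z ∈ Metric.ball (0 : ℂ) ρ,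
      Matrix.det (1 + z • M) * exp (-∑' n, F n z) = 1 := by
    have hd : ∀ z ∈ Metric.ball (0 : ℂ) ρ,
        HasDerivAt (fun z => Matrix.det (1 + z • M) * exp (-∑' n, F n z)) 0 z := by
      intro z hz
      have hlt : ‖(-z) • M‖ < 1 := (hgeom z hz).trans_lt hρM
      have hsum := summable_geometric_of_norm_lt_one hlt
      have hB : (1 + z • M) * (∑' n, ((-z) • M) ^ n) = 1 := by
        have := mul_neg_geom_series ((-z) • M) hlt
        rwa [neg_smul, sub_neg_eq_add, ← neg_smul] at this
      have h1 := (hasDerivAt_det_one_add_smul M hB).mul (hderF z hz).neg.cexp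
      refine h1.congr_deriv ?_
      have h2 : ∑' n : ℕ, Matrix.trace (((-z) • M) ^ n * M) = Matrix.trace ((∑' n, ((-z) • M) ^ n) * M) := by
        exact ((hsum.hasSum.mul_right M).map (Matrix.traceAddMonoidHom ι ℂ)
          continuous_id.matrix_trace).tsum_eq
      rw [h2]
      ring
    intro z hz
    have := Metric.isOpen_ball.is_const_of_deriv_eq_zero (convex_ball (0 : ℂ) ρ).isPreconnected
      (f := fun z => Matrix.det (1 + z • M) * exp (-∑' n, F n z))
      (fun z hz => (hd z hz).differentiableAt.differentiableWithinAt)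
      (fun z hz => (hd z hz).deriv) hz (Metric.mem_ball_self hρ0)
    simpa [F] using this
  have hU : Set.EqOn (fun z => exp (∑' n, F n z)) (fun z => Matrix.det (1 + z • M))
      (Metric.ball 0 1) := by
    refine AnalyticOnNhd.eqOn_of_preconnected_of_eventuallyEq
      (DifferentiableOn.analyticOnNhd hdiff.cexp Metric.isOpen_ball)
      (DifferentiableOn.analyticOnNhd hdet.differentiableOn Metric.isOpen_ball)
      (convex_ball _ _).isPreconnected (Metric.mem_ball_self one_pos) ?_
    filter_upwards [Metric.ball_mem_nhds (0 : ℂ) hρ0] with z hz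
    have := hconst z hz
    rw [exp_neg, ← div_eq_mul_inv, div_eq_one_iff_eq (exp_ne_zero _)] at this
    exact this.symm
  have hcl : Set.EqOn (fun z => exp (∑' n, F n z)) (fun z => Matrix.det (1 + z • M))
      (closure (Metric.ball 0 1)) := by
    refine hU.of_subset_closure ?_ hdet.continuous.continuousOn subset_closure subset_rfl
    rw [closure_ball _ one_ne_zero]
    exact hcont.cexp
  have h1 := hcl (show (1 : ℂ) ∈ closure (Metric.ball 0 1) by
    rw [closure_ball _ one_ne_zero]; simp)
  simpa [F] using h1

end MatrixSeries

/-- Rearrangement of a double series along the antidiagonals. -/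
theorem hasSum_antidiagonal {f : ℕ × ℕ → ℂ} (hf : Summable f) :
    HasSum (fun n => ∑ q ∈ Finset.HasAntidiagonal.antidiagonal n, f q) (∑' q, f q) := by
  have h1 : HasSum (fun x : Σ n : ℕ, Finset.HasAntidiagonal.antidiagonal n => f x.2)
      (∑' q, f q) :=
    (Finset.HasAntidiagonal.sigmaAntidiagonalEquivProd (A := ℕ)).hasSum_iff.2 hf.hasSum
  have h2 := h1.sigma fun n => hasSum_fintype _
  convert h2 using 2 with n
  exact (Finset.sum_coe_sort _ f).symm

theorem HasSum.of_eq {f g : ℕ → ℂ} {a : ℂ} (h : HasSum g a) (e : ∀ n, f n = g n) : HasSum f a := by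
  rwa [funext e]

theorem hasSum_pow_div {d : ℕ → ℂ} (hd : ∀ j, 1 ≤ ‖d j‖) {r : ℂ} (hr : ‖r‖ < 1) :
    HasSum (fun j => r ^ j / d j) (∑' j, r ^ j / d j) := by
  refine (Summable.of_norm_bounded (summable_geometric_of_lt_one (norm_nonneg r) hr)
    fun j => ?_).hasSum
  rw [norm_div, norm_pow]
  exact div_le_self (by positivity) (hd j)

theorem analyticAt_tsum_pow_div {d : ℕ → ℂ} (hd : ∀ j, 1 ≤ ‖d j‖) {r : ℂ} (hr : ‖r‖ < 1) :
    AnalyticAt ℂ (fun r => ∑' j, r ^ j / d j) r := by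
  obtain ⟨ρ, h1, h2⟩ := exists_between hr
  have hρ : 0 ≤ ρ := (norm_nonneg r).trans h1.le
  have h : DifferentiableOn ℂ (fun r => ∑' j, r ^ j / d j) (Metric.ball 0 ρ) := by
    refine differentiableOn_tsum_of_summable_norm (summable_geometric_of_lt_one hρ h2)
      (fun j => by fun_prop) Metric.isOpen_ball fun j w hw => ?_
    rw [norm_div, norm_pow]
    refine (div_le_self (by positivity) (hd j)).trans (pow_le_pow_left₀ (norm_nonneg _) ?_ _)
    simpa using (Metric.mem_ball.1 hw).le
  exact h.analyticAt (Metric.isOpen_ball.mem_nhds (by simpa using h1))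

theorem hasSum_artanh {a : ℂ} (ha : ‖a‖ < 1) :
    HasSum (fun n : ℕ => a ^ (2 * n + 1) / (2 * n + 1)) ((log (1 + a) - log (1 - a)) / 2) := by
  have h1 := ((hasSum_taylorSeries_log ha).add (hasSum_taylorSeries_neg_log ha)).div_const 2
  have hinj : Function.Injective fun n : ℕ => 2 * n + 1 := fun m n h => by simpa using h
  rw [← hinj.hasSum_iff] at h1
  · rw [sub_eq_add_neg]
    refine HasSum.of_eq h1 fun n => ?_
    simp only [Function.comp_apply]
    rw [Even.neg_one_pow (by simp [parity_simps])]
    push_cast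
    ring
  · intro n hn
    have : Even n := by
      rw [← Nat.not_odd_iff_even]
      rintro ⟨k, rfl⟩
      exact hn ⟨k, rfl⟩
    rw [Odd.neg_one_pow this.add_one]
    ring

/-- Summation of the series, once the integrals have been computed. -/
theorem exp_series_eq {N : ℕ} {M : Matrix (Fin N) (Fin N) ℂ} {r : Fin N → ℂ} {a : ℂ}
    (hr : ∀ k, ‖r k‖ < 1) (ha : ‖a‖ < 1) {E : ℕ → (ℂ → ℂ) → ℂ}
    (hE0 : ∀ g : ℂ → ℂ, (∀ z : ℂ, ‖z‖ < 1 → AnalyticAt ℂ g z) →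
      E 0 g = ∑ k, M k k * g (r k) - a / 2 * g (a ^ 2))
    (hE : ∀ (m : ℕ) (g : ℂ → ℂ), (∀ z : ℂ, ‖z‖ < 1 → AnalyticAt ℂ g z) →
      E (m + 1) g = ∑ k, ((M ^ (m + 2)) k k - (M ^ m) k k * r k) * g (r k))
    (ho : Summable fun q : ℕ × ℕ => E (2 * q.1) fun r => r ^ q.2 / (2 * (q.1 + q.2 : ℕ) + 1))
    (he : Summable fun q : ℕ × ℕ => E (2 * q.1 + 1) fun r => r ^ q.2 / (2 * (q.1 + 1 + q.2 : ℕ))) :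
    exp ((∑' k : ℕ, E (2 * k) fun r => ∑' j : ℕ, r ^ j / (2 * (k + j : ℕ) + 1)) -
        ∑' k : ℕ, E (2 * k + 1) fun r => ∑' j : ℕ, r ^ j / (2 * (k + 1 + j : ℕ))) =
      Matrix.det (1 + M) * (∏ k, exp (-(1 / 2) * log (1 - r k))) *
        exp (-(1 / 4) * (log (1 + a) - log (1 - a))) := by
  have ha2 : ‖a ^ 2‖ < 1 := by rw [norm_pow]; exact pow_lt_one₀ (norm_nonneg _) ha two_ne_zero
  -- termwise integration
  have hlin : ∀ (m : ℕ) (d : ℕ → ℂ), (∀ j, 1 ≤ ‖d j‖) →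
      E m (fun r => ∑' j, r ^ j / d j) = ∑' j, E m (fun r => r ^ j / d j) := by
    intro m d hd
    have hpow : ∀ j, ∀ z : ℂ, ‖z‖ < 1 → AnalyticAt ℂ (fun r => r ^ j / d j) z := fun j z _ => by
      have : Differentiable ℂ fun r : ℂ => r ^ j / d j := by fun_prop
      exact this.analyticAt z
    rcases m with _ | m
    · rw [hE0 _ fun z hz => analyticAt_tsum_pow_div hd hz]
      simp only [fun j => hE0 _ (hpow j)]
      refine (HasSum.tsum_eq ?_).symm
      exact (hasSum_sum fun k _ => (hasSum_pow_div hd (hr k)).mul_left _).sub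
        ((hasSum_pow_div hd ha2).mul_left _)
    · rw [hE _ _ fun z hz => analyticAt_tsum_pow_div hd hz]
      simp only [fun j => hE m _ (hpow j)]
      refine (HasSum.tsum_eq ?_).symm
      exact hasSum_sum fun k _ => (hasSum_pow_div hd (hr k)).mul_left _
  have hpowd : ∀ (j : ℕ) (d : ℂ), ∀ z : ℂ, ‖z‖ < 1 → AnalyticAt ℂ (fun r => r ^ j / d) z :=
    fun j d z _ => by
      have : Differentiable ℂ fun r : ℂ => r ^ j / d := by fun_prop
      exact this.analyticAt z
  have hd1 : ∀ k j : ℕ, 1 ≤ ‖(2 * (k + j : ℕ) + 1 : ℂ)‖ := fun k j => by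
    have : ((2 * (k + j : ℕ) + 1 : ℂ)) = ((2 * (k + j) + 1 : ℕ) : ℂ) := by push_cast; ring
    rw [this, norm_natCast]
    exact_mod_cast Nat.le_add_left 1 _
  have hd2 : ∀ k j : ℕ, 1 ≤ ‖(2 * (k + 1 + j : ℕ) : ℂ)‖ := fun k j => by
    have : ((2 * (k + 1 + j : ℕ) : ℂ)) = ((2 * (k + 1 + j) : ℕ) : ℂ) := by push_cast; ring
    rw [this, norm_natCast]
    exact_mod_cast by omega
  have eo : (∑' k : ℕ, E (2 * k) fun r => ∑' j : ℕ, r ^ j / (2 * (k + j : ℕ) + 1))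
      = ∑' q : ℕ × ℕ, E (2 * q.1) fun r => r ^ q.2 / (2 * (q.1 + q.2 : ℕ) + 1) := by
    rw [ho.tsum_prod]
    exact tsum_congr fun k => hlin _ _ (hd1 k)
  have ee : (∑' k : ℕ, E (2 * k + 1) fun r => ∑' j : ℕ, r ^ j / (2 * (k + 1 + j : ℕ)))
      = ∑' q : ℕ × ℕ, E (2 * q.1 + 1) fun r => r ^ q.2 / (2 * (q.1 + 1 + q.2 : ℕ)) := by
    rw [he.tsum_prod]
    exact tsum_congr fun k => hlin _ _ (hd2 k)
  have so := hasSum_antidiagonal ho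
  have se := hasSum_antidiagonal he
  -- telescoping
  have tlo : ∀ n : ℕ, ∑ q ∈ Finset.HasAntidiagonal.antidiagonal n,
      (E (2 * q.1) fun r => r ^ q.2 / (2 * (q.1 + q.2 : ℕ) + 1))
      = Matrix.trace (M ^ (2 * n + 1)) / (2 * n + 1) - a ^ (2 * n + 1) / (2 * n + 1) / 2 := by
    intro n
    rw [Finset.Nat.sum_antidiagonal_eq_sum_range_succ_mk]
    have key : ∀ K ≤ n, ∑ k ∈ Finset.range (K + 1),
        (E (2 * k) fun r => r ^ (n - k) / (2 * (k + (n - k) : ℕ) + 1))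
        = (∑ i, (M ^ (2 * K + 1)) i i * r i ^ (n - K)) / (2 * n + 1)
          - a ^ (2 * n + 1) / (2 * n + 1) / 2 := by
      intro K
      induction K with
      | zero =>
        intro _
        rw [Finset.sum_range_one, mul_zero, hE0 _ (hpowd _ _), Finset.sum_div]
        simp only [zero_add, Nat.sub_zero, pow_one, mul_div_assoc]
        congr 1
        ring
      | succ K ih =>
        intro hK
        rw [Finset.sum_range_succ, ih (by omega), show 2 * (K + 1) = 2 * K + 1 + 1 by ring,
          hE _ _ (hpowd _ _), show K + 1 + (n - (K + 1)) = n by omega,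
          show n - K = n - (K + 1) + 1 by omega]
        have : ∀ i, ((M ^ (2 * K + 1 + 2)) i i - (M ^ (2 * K + 1)) i i * r i) *
            (r i ^ (n - (K + 1)) / (2 * (n : ℂ) + 1))
            = (M ^ (2 * K + 1 + 1 + 1)) i i * r i ^ (n - (K + 1)) / (2 * n + 1)
              - (M ^ (2 * K + 1)) i i * r i ^ (n - (K + 1) + 1) / (2 * n + 1) := fun i => by ring
        simp only [this, Finset.sum_sub_distrib, ← Finset.sum_div]
        ring
    rw [key n le_rfl]
    simp [Matrix.trace]
  have tle : ∀ n : ℕ, ∑ q ∈ Finset.HasAntidiagonal.antidiagonal n,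
      (E (2 * q.1 + 1) fun r => r ^ q.2 / (2 * (q.1 + 1 + q.2 : ℕ)))
      = Matrix.trace (M ^ (2 * n + 1 + 1)) / (2 * n + 1 + 1)
        - (∑ i, r i ^ (n + 1) / (n + 1)) / 2 := by
    intro n
    rw [Finset.Nat.sum_antidiagonal_eq_sum_range_succ_mk]
    have key : ∀ K ≤ n, ∑ k ∈ Finset.range (K + 1),
        (E (2 * k + 1) fun r => r ^ (n - k) / (2 * (k + 1 + (n - k) : ℕ)))
        = (∑ i, (M ^ (2 * K + 2)) i i * r i ^ (n - K)) / (2 * (n + 1))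
          - (∑ i, r i ^ (n + 1)) / (2 * (n + 1)) := by
      intro K
      induction K with
      | zero =>
        intro _
        rw [Finset.sum_range_one, hE _ _ (hpowd _ _), ← sub_div, ← Finset.sum_sub_distrib,
          Finset.sum_div]
        refine Finset.sum_congr rfl fun i _ => ?_
        simp only [zero_add, mul_zero, Nat.sub_zero, pow_zero, Matrix.one_apply_eq]
        push_cast
        ring
      | succ K ih =>
        intro hK
        rw [Finset.sum_range_succ, ih (by omega),
          hE _ _ (hpowd _ _), show K + 1 + 1 + (n - (K + 1)) = n + 1 by omega,
          show n - K = n - (K + 1) + 1 by omega]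
        have : ∀ i, ((M ^ (2 * (K + 1) + 2)) i i - (M ^ (2 * (K + 1))) i i * r i) *
            (r i ^ (n - (K + 1)) / (2 * ((n + 1 : ℕ) : ℂ)))
            = (M ^ (2 * (K + 1) + 2)) i i * r i ^ (n - (K + 1)) / (2 * (n + 1))
              - (M ^ (2 * K + 2)) i i * r i ^ (n - (K + 1) + 1) / (2 * (n + 1)) := fun i => by
          push_cast
          rw [show 2 * (K + 1) = 2 * K + 2 by ring]
          ring
        simp only [this, Finset.sum_sub_distrib, ← Finset.sum_div]
        ring
    rw [key n le_rfl]
    simp only [Nat.sub_self, pow_zero, mul_one, ← Finset.sum_div, Matrix.trace, Matrix.diag]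
    congr 1
    · congr 1; ring
    · rw [div_div]; congr 1; ring
  simp only [tlo] at so
  simp only [tle] at se
  have sa := (hasSum_artanh ha).div_const 2
  have sr : HasSum (fun n : ℕ => (∑ i, r i ^ (n + 1) / (n + 1)) / 2) ((∑ i, -log (1 - r i)) / 2) := by
    refine (hasSum_sum fun i _ => ?_).div_const 2
    exact hasSum_taylorSeries_neg_log' (hr i)
  have so' := so.add sa
  have se' := (se.add sr).neg
  simp only [sub_add_cancel] at so' se'
  have hall := HasSum.even_add_odd
    (f := fun n : ℕ => (-1 : ℂ) ^ n * Matrix.trace (M ^ (n + 1)) / (n + 1))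
    (HasSum.of_eq so' fun n => by rw [Even.neg_one_pow (by simp)]; push_cast; ring)
    (HasSum.of_eq se' fun n => by rw [Odd.neg_one_pow (by simp)]; push_cast; ring)
  have hdet := exp_tsum_trace_pow M hall.summable
  rw [hall.tsum_eq] at hdet
  rw [eo, ee, ← hdet, ← exp_sum, ← exp_add, ← exp_add]
  congr 1
  rw [← Finset.mul_sum, Finset.sum_neg_distrib]
  ring

namespace Params

variable {P : Params} {h : ℝ} {μ ν : Fin P.N → ℂ} {Γ : ℕ → Contour} {CU : Contour}

theorem mul_mul_div_cancel_sign {ε a b c d : ℂ} (hε : ε ≠ 0) :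
    ε * a * (ε * b) / (ε * c * (ε * d)) = a * b / (c * d) := by
  rw [mul_mul_mul_comm, mul_mul_mul_comm ε c, mul_div_mul_left _ _ (mul_ne_zero hε hε)]

theorem exists_sign (hν : ∀ a, ∃ k : ℤ, ν a = μ a + k * (Real.pi * I)) :
    ∃ ε : Fin P.N → ℂ, (∀ a, ε a ≠ 0) ∧ (∀ a, ε a * ε a = 1) ∧
    (∀ x a, sinh (x + ν a) = ε a * sinh (x + μ a)) ∧
    ∀ x a, sinh (x - ν a) = ε a * sinh (x - μ a) := by
  choose k hk using hν
  have hε : ∀ a, ((-1 : ℂ) ^ k a) * (-1) ^ k a = 1 := fun a => by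
    rcases sign_cases (k a) with h | h <;> simp [h]
  exact ⟨fun a => (-1) ^ k a, fun a => left_ne_zero_of_mul ((hε a).trans_ne one_ne_zero), hε,
    fun x a => sinh_add_rep (hk a), fun x a => sinh_sub_rep (hk a)⟩

theorem bR_rep (hν : ∀ a, ∃ k : ℤ, ν a = μ a + k * (Real.pi * I)) :
    P.bR h ν = P.bR h μ := by
  obtain ⟨ε, h0, -, h1, h2⟩ := exists_sign hν
  funext ω
  unfold bR
  congr 1
  refine Finset.prod_congr rfl fun l _ => ?_
  rw [add_right_comm ω, sub_right_comm ω, sub_add_eq_add_sub ω, add_sub_right_comm ω (ν l), h1, h2,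
    h1, h2, mul_mul_div_cancel_sign (h0 l), add_right_comm ω, sub_right_comm ω,
    sub_add_eq_add_sub ω P.iζ, add_sub_right_comm ω (μ l), sub_add_eq_add_sub ω (μ l)]

theorem bV_rep (hν : ∀ a, ∃ k : ℤ, ν a = μ a + k * (Real.pi * I)) :
    P.bV h ν = P.bV h μ := by
  obtain ⟨ε, h0, -, h1, h2⟩ := exists_sign hν
  funext ω
  unfold bV
  congr 1
  refine Finset.prod_congr rfl fun l _ => ?_
  rw [sub_right_comm ω, add_sub_right_comm ω, h1, h2, h1, h2,
    mul_mul_div_cancel_sign (h0 l), sub_right_comm ω, add_sub_right_comm ω (μ l)]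

theorem bM_rep (hν : ∀ a, ∃ k : ℤ, ν a = μ a + k * (Real.pi * I)) :
    P.bM h ν = P.bM h μ := by
  obtain ⟨ε, h0, hs, h1, h2⟩ := exists_sign hν
  have s1 : ∀ j k, sinh (ν j + ν k) = ε j * (ε k * sinh (μ j + μ k)) := fun j k => by
    rw [h1, add_comm, h1, add_comm (μ k)]; ring
  have s2 : ∀ j k, sinh (ν j + ν k - P.iζ) = ε j * (ε k * sinh (μ j + μ k - P.iζ)) := fun j k => by
    rw [show ν j + ν k - P.iζ = (ν j - P.iζ) + ν k by ring, h1,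
      show ν j - P.iζ + μ k = (μ k - P.iζ) + ν j by ring, h1,
      show μ k - P.iζ + μ j = μ j + μ k - P.iζ by ring]; ring
  have s3 : ∀ j k, sinh (ν j - ν k) = ε j * (ε k * sinh (μ j - μ k)) := fun j k => by
    rw [h2, show ν j - μ k = -μ k + ν j by ring, h1, show -μ k + μ j = μ j - μ k by ring]; ring
  have s4 : ∀ j k, sinh (ν j - ν k - P.iζ) = ε j * (ε k * sinh (μ j - μ k - P.iζ)) := fun j k => by
    rw [show ν j - ν k - P.iζ = (ν j - P.iζ) - ν k by ring, h2,
      show ν j - P.iζ - μ k = (-μ k - P.iζ) + ν j by ring, h1,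
      show -μ k - P.iζ + μ j = μ j - μ k - P.iζ by ring]; ring
  have hres : ∀ k, P.bRes h ν k = P.bRes h μ k := fun k => by
    unfold bRes
    have e1 : sinh (2 * ν k) = sinh (2 * μ k) := by
      rw [two_mul, s1, ← mul_assoc, hs, one_mul, two_mul]
    rw [e1]
    congr 1
    refine Finset.prod_congr rfl fun l _ => ?_
    rw [s1, s2, s3, s4, mul_mul_div_cancel_sign (h0 k), mul_mul_div_cancel_sign (h0 l)]
  ext j k
  rw [bM, bM, Matrix.of_apply, Matrix.of_apply, hres, s1, s4]
  congr 1
  linear_combination (ε k * ε k * sinh (μ j + μ k) * sinh (μ j - μ k - P.iζ)) * hs j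
    + sinh (μ j + μ k) * sinh (μ j - μ k - P.iζ) * hs k

theorem bR_add_int (ω : ℂ) (k : ℤ) : P.bR h μ (ω + k * (Real.pi * I)) = P.bR h μ ω := by
  have r1 : ∀ x, sinh (ω + k * (Real.pi * I) + x) = (-1) ^ k * sinh (ω + x) := fun x => by
    rw [← sinh_add_int_mul_pi]; congr 1; ring
  have hk0 : ((-1 : ℂ) ^ k) ≠ 0 := zpow_ne_zero _ (by norm_num)
  unfold bR
  congr 1
  refine Finset.prod_congr rfl fun l _ => ?_
  simp only [sub_eq_add_neg, add_assoc (ω + k * (Real.pi * I)), r1, mul_mul_div_cancel_sign hk0,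
    ← add_assoc ω]

theorem outsideMod_rep {C : Contour} {p q : ℂ} (hp : C.OutsideMod p)
    (hq : ∃ k : ℤ, q = p + k * (Real.pi * I)) : C.OutsideMod q := by
  obtain ⟨k, rfl⟩ := hq
  exact hp.add_int k

theorem SeriesContours.exists_rep (S : P.SeriesContours h μ CU Γ) :
    ∃ ν : Fin P.N → ℂ, (∀ a, ∃ k : ℤ, ν a = μ a + k * (Real.pi * I)) ∧
      ∀ p a, ν a ∈ (Γ p).inner := by
  have hsub : ∀ p, (Γ p).inner ⊆ (Γ 0).inner := fun p => by
    induction p with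
    | zero => exact subset_rfl
    | succ p ih => exact (Set.subset_union_right.trans (S.nested p)).trans ih
  choose k hk using fun p a => (S.roots p a).1
  refine ⟨fun a => μ a + k 0 a * (Real.pi * I), fun a => ⟨k 0 a, rfl⟩, fun p a => ?_⟩
  have h1 := hk p a
  by_cases hkp : k p a = k 0 a
  · rwa [hkp] at h1
  · exfalso
    refine (Γ 0).separated _ (Or.inr (hk 0 a)) (k p a - k 0 a) (sub_ne_zero.2 hkp) (Or.inr ?_)
    have := hsub p h1
    rw [show μ a + k 0 a * (Real.pi * I) + (k p a - k 0 a : ℤ) * (Real.pi * I)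
      = μ a + k p a * (Real.pi * I) by push_cast; ring]
    exact this

theorem SeriesContours.core (S : P.SeriesContours h μ CU Γ) (hN : 0 < P.N) (hμ : P.IsBethe h μ)
    (hζ : sinh P.iζ ≠ 0) (hν : ∀ a, ∃ k : ℤ, ν a = μ a + k * (Real.pi * I))
    (hmem : ∀ p a, ν a ∈ (Γ p).inner) : P.SeriesCore h ν Γ := by
  have o1 : ∀ p a, (Γ p).OutsideMod (ν a + P.iζ) := fun p a => outsideMod_rep (S.shifted p a).1 (by
    obtain ⟨k, hk⟩ := hν a; exact ⟨k, by rw [hk]; ring⟩)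
  have o2 : ∀ p a, (Γ p).OutsideMod (ν a - P.iζ) := fun p a => outsideMod_rep (S.shifted p a).2.1 (by
    obtain ⟨k, hk⟩ := hν a; exact ⟨k, by rw [hk]; ring⟩)
  have o3 : ∀ p a, (Γ p).OutsideMod (-ν a + P.iζ) := fun p a =>
    outsideMod_rep (S.shifted p a).2.2.1 (by
      obtain ⟨k, hk⟩ := hν a; exact ⟨-k, by rw [hk]; push_cast; ring⟩)
  have hr : ∀ p, ∀ s ∈ (Γ p).hull, ‖P.bR h ν s‖ < 1 := fun p => by
    refine (Γ p).norm_lt_one_of_trace (fun s hs => analyticAt_bR (fun l => ?_) fun l => ?_) ?_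
    · have := Contour.sinh_sub_ne_zero_of_outsideMod (o2 p l) hs
      rwa [show s - ν l + P.iζ = s - (ν l - P.iζ) by ring]
    · have := Contour.sinh_sub_ne_zero_of_outsideMod (o3 p l) hs
      rwa [show s + ν l - P.iζ = s - (-ν l + P.iζ) by ring]
    · intro s hs
      rw [bR_rep hν, ← funR_eq S hN hμ hs]
      exact S.r_lt_one p s hs
  refine ⟨S.zero_mem, hmem, fun p a => ?_, o1, o2, o3, S.half_period,
    S.poles, hμ.injective_rep hν, hr, fun j k h0 => ?_, hζ⟩
  · obtain ⟨j, hj⟩ := (S.roots p a).2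
    obtain ⟨k, hk⟩ := hν a
    refine ⟨j + k, ?_⟩
    convert hj using 1
    rw [hk]
    push_cast
    ring
  obtain ⟨n, hn⟩ := sinh_eq_zero_iff.1 h0
  have hrep : ∀ a, P.countingFn h μ (ν a) = -1 := fun a => by
    obtain ⟨k, hk⟩ := hν a
    rw [hk, countingFn_add_int, hμ.countingFn_eq]
  have hrep' : ∀ a, P.countingFn h μ (-ν a) = P.countingFn h μ (-μ a) := fun a => by
    obtain ⟨k, hk⟩ := hν a
    rw [← countingFn_add_int P h μ (-ν a) k]
    congr 1
    rw [hk]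
    ring
  have h1 : P.countingFn h μ (-ν k) = -1 := by
    rw [← countingFn_add_int P h μ (-ν k) n, ← hn]
    simpa using hrep j
  rw [hrep', hμ.countingFn_neg hN, neg_inj] at h1
  have hb : P.bR h μ (ν k) = P.bR h μ (μ k) := by
    obtain ⟨k', hk'⟩ := hν k
    rw [hk', bR_add_int]
  have := hr 0 (ν k) (Or.inr (hmem 0 k))
  rw [bR_rep hν, hb, h1, norm_one] at this
  exact lt_irrefl _ this

/-- What the series is: a Fredholm-type determinant. -/
theorem SeriesContours.exp_seriesF (S : P.SeriesContours h μ CU Γ) (hN : 0 < P.N)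
    (hμ : P.IsBethe h μ) (hζ : sinh P.iζ ≠ 0) (hb : sinh (2 * P.b) ≠ 0) :
    exp (P.seriesF h μ CU Γ) = Matrix.det (1 + P.bM h μ) *
      (∏ k, exp (-(1 / 2) * log (1 + P.countingFn h μ (-μ k)))) *
      exp (-(1 / 4) * (log (1 + P.countingFn h μ 0) - log (1 - P.countingFn h μ 0))) ∧
    ‖P.countingFn h μ 0‖ < 1 ∧ (∀ k, ‖P.countingFn h μ (-μ k)‖ < 1) ∧
    (∀ j k, sinh (μ j + μ k) ≠ 0) ∧ (∀ j k, sinh (μ j - μ k - P.iζ) ≠ 0) ∧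
    ∀ j k, sinh (μ j + μ k - P.iζ) ≠ 0 := by
  obtain ⟨ν, hν, hmem⟩ := S.exists_rep
  have D := S.core hN hμ hζ hν hmem
  obtain ⟨ε, hε0, hε, hs1, hs2⟩ := exists_sign hν
  have n1 : ∀ j k, sinh (μ j + μ k) ≠ 0 := fun j k h0 => by
    have := D.ne j k
    rw [hs1, add_comm, hs1, add_comm, h0] at this
    simp at this
  have n2 : ∀ j k, sinh (μ j - μ k - P.iζ) ≠ 0 := fun j k h0 => by
    have := D.ne_root j k
    rw [show ν j - ν k - P.iζ = (ν j - P.iζ) - ν k by ring, hs2,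
      show ν j - P.iζ - μ k = (-μ k - P.iζ) + ν j by ring, hs1,
      show -μ k - P.iζ + μ j = μ j - μ k - P.iζ by ring, h0] at this
    simp at this
  have n3 : ∀ j k, sinh (μ j + μ k - P.iζ) ≠ 0 := fun j k h0 => by
    have := D.ne_sub_add (p := 0) (Or.inr (D.mem 0 j)) k
    rw [show ν j + ν k - P.iζ = (ν j - P.iζ) + ν k by ring, hs1,
      show ν j - P.iζ + μ k = (μ k - P.iζ) + ν j by ring, hs1,
      show μ k - P.iζ + μ j = μ j + μ k - P.iζ by ring, h0] at this
    simp at this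
  have hb0 : sinh P.b ≠ 0 := fun h0 => hb (by rw [sinh_two_mul, h0]; simp)
  have hηb : sinh (P.iζ + P.b) ≠ 0 := fun h0 => by
    have := Contour.sinh_sub_ne_zero_of_outsideMod S.U_poles.1 (Or.inr S.U_zero_mem)
    rw [zero_sub, sinh_neg, h0, neg_zero] at this
    exact this rfl
  have hr0 : P.bR h μ 0 = P.countingFn h μ 0 ^ 2 := by
    have := countingFn_mul_neg (P := P) (h := h) (μ := μ) (ω := 0)
      (by rw [zero_sub, sinh_neg]; exact neg_ne_zero.2 hb0) (by rwa [zero_add])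
      (by rwa [add_zero]) (by rwa [sub_zero])
    rw [neg_zero] at this
    rw [← this, sq]
  have hrk : ∀ k, P.bR h ν (ν k) = -P.countingFn h μ (-μ k) := fun k => by
    obtain ⟨k', hk'⟩ := hν k
    rw [hμ.countingFn_neg hN, neg_neg, bR_rep hν, hk', bR_add_int]
  have hrn : ∀ k, ‖P.countingFn h μ (-μ k)‖ < 1 := fun k => by
    rw [← norm_neg, ← hrk]
    exact D.r_lt 0 _ (Or.inr (D.mem 0 k))
  have ha : ‖P.countingFn h μ 0‖ < 1 := by
    have := D.r_lt 0 0 (Or.inr (D.zero_mem 0))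
    rw [bR_rep hν, hr0, norm_pow] at this
    exact (pow_lt_one_iff_of_nonneg (norm_nonneg _) two_ne_zero).1 this
  refine ⟨?_, ha, hrn, n1, n2, n3⟩
  have hK : ∀ p, ∀ v ∈ (Γ p).trace, ∀ u, P.kernelU h CU (P.logU h μ CU) u v
      = P.bV h ν v / (sinh (u + v) * sinh (u - v - P.iζ)) := fun p v hv u => by
    rw [kernelU_eq S hN hμ u hv, bV_rep hν]
  have hG : ∀ g : ℂ → ℂ, ∀ p, ∀ v ∈ (Γ p).trace, (fun ω => g (P.funR h CU (P.logU h μ CU) ω)) v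
      = g (P.bR h ν v) := fun g p v hv => by
    show g _ = _
    rw [funR_eq S hN hμ hv, bR_rep hν]
  have hpi : (2 * Real.pi * I : ℂ) ≠ 0 := two_pi_I_ne_zero
  have key := exp_series_eq (M := P.bM h ν) (r := fun k => P.bR h ν (ν k))
    (a := P.countingFn h μ 0) (E := P.cyclicIntegral h CU (P.logU h μ CU) Γ)
    (fun k => D.r_lt 0 _ (Or.inr (D.mem 0 k))) ha (fun g hg => ?_) (fun m g hg => ?_)
    S.summable_odd S.summable_even
  · rw [bM_rep hν] at key
    simp only [hrk, sub_neg_eq_add] at key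
    exact key
  · have hV : P.bV h ν 0 = P.countingFn h μ 0 * sinh P.iζ := by
      rw [bV_rep hν]
      refine bV_zero hb0 hηb fun k h0 => n1 k k ?_
      rw [← two_mul, sinh_two_mul, h0]; simp
    rw [cyclicIntegral_eq, D.integral_cyclic_one hK (hG g) hg hV, zero_add, pow_one,
      mul_div_cancel_left₀ _ hpi, ← hr0, ← bR_rep hν]
  · rw [cyclicIntegral_eq, D.integral_cyclic_succ hK (hG g) hg,
      mul_div_cancel_left₀ _ (pow_ne_zero _ hpi)]

end Params

section Cauchy

variable {K : Type*} [Field K] {n : ℕ}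

/-- The determinant of a Cauchy matrix. -/
theorem prod_mul_det_cauchy (x y : Fin n → K) (hy : Function.Injective y)
    (hxy : ∀ a c, x a ≠ y c) :
    (∏ a, ∏ c, (x a - y c)) * Matrix.det (Matrix.of fun a c => 1 / (x a - y c)) =
      ∏ a, ∏ c ∈ Finset.Ioi a, (x a - x c) * (y c - y a) := by
  classical
  let p : Fin n → Polynomial K := fun c => Lagrange.nodal (Finset.univ.erase c) y
  let B : Matrix (Fin n) (Fin n) K := Matrix.of fun k c => (p c).coeff k
  have hdeg : ∀ c, (p c).natDegree < n := by
    intro c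
    have : 0 < n := c.pos
    simp only [p, Lagrange.natDegree_nodal, Finset.card_erase_of_mem (Finset.mem_univ c),
      Finset.card_univ, Fintype.card_fin]
    omega
  have hG : ∀ v : Fin n → K, (Matrix.of fun a c => (p c).eval (v a)) =
      Matrix.vandermonde v * B := by
    intro v
    ext a c
    rw [Matrix.of_apply, Matrix.mul_apply, Polynomial.eval_eq_sum_range' (hdeg c),
      ← Fin.sum_univ_eq_sum_range (fun i => (p c).coeff i * v a ^ i) n]
    refine Finset.sum_congr rfl fun i _ => ?_
    simp [B, Matrix.vandermonde_apply, mul_comm]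
  have hdiag : (Matrix.of fun a c => (p c).eval (y a)) =
      Matrix.diagonal fun c => (p c).eval (y c) := by
    ext a c
    by_cases hac : a = c
    · subst hac; simp
    · rw [Matrix.diagonal_apply_ne _ hac, Matrix.of_apply]
      exact Lagrange.eval_nodal_at_node (by simp [hac])
  have hy' : ∀ i, ∀ j ∈ Finset.Ioi i, y j - y i ≠ 0 := by
    intro i j hj h0
    exact (Finset.mem_Ioi.1 hj).ne (hy (sub_eq_zero.1 h0)).symm
  have hV : Matrix.det (Matrix.vandermonde y) ≠ 0 := by
    rw [Matrix.det_vandermonde]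
    exact Finset.prod_ne_zero_iff.2 fun i _ => Finset.prod_ne_zero_iff.2 fun j hj => hy' i j hj
  have hB : B.det = ∏ a, ∏ c ∈ Finset.Ioi a, (y a - y c) := by
    have h1 := congrArg Matrix.det (hG y)
    rw [hdiag, Matrix.det_diagonal, Matrix.det_mul] at h1
    have h2 : ∏ c, (p c).eval (y c) =
        Matrix.det (Matrix.vandermonde y) * ∏ a, ∏ c ∈ Finset.Ioi a, (y a - y c) := by
      rw [Matrix.det_vandermonde, ← Finset.prod_mul_distrib]
      have h3 := Finset.prod_prod_Ioi_mul_eq_prod_prod_off_diag (fun i j => y j - y i)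
      rw [show (∏ a, (∏ c ∈ Finset.Ioi a, (y c - y a)) * ∏ c ∈ Finset.Ioi a, (y a - y c)) =
        ∏ i, ∏ j ∈ Finset.Ioi i, (y i - y j) * (y j - y i) from Finset.prod_congr rfl fun a _ => by
          rw [← Finset.prod_mul_distrib]
          exact Finset.prod_congr rfl fun c _ => mul_comm _ _, h3]
      refine Finset.prod_congr rfl fun c _ => ?_
      rw [Lagrange.eval_nodal]
      refine Finset.prod_congr ?_ fun _ _ => rfl
      ext i; simp [eq_comm]
    exact mul_left_cancel₀ hV (h1.symm.trans h2)
  rw [← Matrix.det_mul_column]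
  have hE : (Matrix.of fun a c => (∏ k, (x a - y k)) *
      (Matrix.of fun a c => 1 / (x a - y c)) a c) = Matrix.vandermonde x * B := by
    rw [← hG]
    ext a c
    rw [Matrix.of_apply, Matrix.of_apply, Matrix.of_apply, Lagrange.eval_nodal,
      ← Finset.mul_prod_erase Finset.univ (fun k => x a - y k) (Finset.mem_univ c)]
    have := sub_ne_zero.2 (hxy a c)
    field_simp
  rw [hE, Matrix.det_mul, Matrix.det_vandermonde, hB, ← Finset.prod_mul_distrib]
  refine Finset.prod_congr rfl fun a _ => ?_
  rw [← Finset.prod_mul_distrib]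
  exact Finset.prod_congr rfl fun c _ => by ring

/-- The matrix that expresses the Cauchy matrix with poles `z` through the one with poles `y`. -/
noncomputable def transferX (x y z : Fin n → K) : Matrix (Fin n) (Fin n) K :=
  Matrix.of fun j k => (∏ a, (y j - x a)) / (∏ a, (z k - x a)) *
    ∏ i ∈ Finset.univ.erase j, (z k - y i) / (y j - y i)

theorem cauchy_mul_transferX (x y z : Fin n → K) (hy : Function.Injective y)
    (hxy : ∀ a c, x a ≠ y c) (hxz : ∀ a c, x a ≠ z c) :
    (Matrix.of fun a c => 1 / (x a - y c)) * transferX x y z =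
      Matrix.of fun a c => 1 / (x a - z c) := by
  classical
  ext a k
  have h := Lagrange.eq_interpolate (s := Finset.univ) (v := y)
    (f := Lagrange.nodal (Finset.univ.erase a) x) hy.injOn (by
      rw [Lagrange.degree_nodal]
      have : 0 < n := a.pos
      simp only [Finset.card_erase_of_mem (Finset.mem_univ a), Finset.card_univ, Fintype.card_fin]
      exact_mod_cast (by omega : n - 1 < n))
  have h2 := congrArg (Polynomial.eval (z k)) h
  rw [Lagrange.interpolate_apply, Polynomial.eval_finsetSum, Lagrange.eval_nodal] at h2
  have hz : ∏ a, (z k - x a) ≠ 0 :=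
    Finset.prod_ne_zero_iff.2 fun a _ => sub_ne_zero.2 (hxz a k).symm
  have hza : z k - x a ≠ 0 := sub_ne_zero.2 (hxz a k).symm
  have hza' : x a - z k ≠ 0 := sub_ne_zero.2 (hxz a k)
  have h3 : (1 : K) / (x a - z k) = -(∏ i ∈ Finset.univ.erase a, (z k - x i)) /
      ∏ a, (z k - x a) := by
    rw [← Finset.mul_prod_erase Finset.univ (fun i => z k - x i) (Finset.mem_univ a)] at hz ⊢
    have := right_ne_zero_of_mul hz
    field_simp
    ring
  rw [Matrix.mul_apply, Matrix.of_apply, h3, h2, neg_div, Finset.sum_div, ← Finset.sum_neg_distrib]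
  refine Finset.sum_congr rfl fun j _ => ?_
  have hj : x a - y j ≠ 0 := sub_ne_zero.2 (hxy a j)
  rw [Matrix.of_apply, transferX, Matrix.of_apply, Polynomial.eval_mul, Polynomial.eval_C,
    Lagrange.eval_nodal, Lagrange.basis, Polynomial.eval_prod,
    ← Finset.mul_prod_erase Finset.univ (fun i => y j - x i) (Finset.mem_univ a)]
  have h4 : ∏ i ∈ Finset.univ.erase j, (z k - y i) / (y j - y i) =
      ∏ i ∈ Finset.univ.erase j, Polynomial.eval (z k) (Lagrange.basisDivisor (y j) (y i)) := by
    refine Finset.prod_congr rfl fun i _ => ?_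
    simp [Lagrange.basisDivisor]
    ring
  rw [h4]
  generalize (∏ i ∈ Finset.univ.erase j,
    Polynomial.eval (z k) (Lagrange.basisDivisor (y j) (y i))) = A
  generalize (∏ i ∈ Finset.univ.erase a, (y j - x i)) = B
  field_simp
  ring

theorem prod_mul_det_cauchy_sub (x y z : Fin n → K) (hy : Function.Injective y)
    (hxy : ∀ a c, x a ≠ y c) (hxz : ∀ a c, x a ≠ z c) :
    (∏ a, ∏ c, (x a - y c)) *
        Matrix.det (Matrix.of fun a c => 1 / (x a - y c) - 1 / (x a - z c)) =
      (∏ a, ∏ c ∈ Finset.Ioi a, (x a - x c) * (y c - y a)) *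
        Matrix.det (1 - transferX x y z) := by
  have h : (Matrix.of fun a c => 1 / (x a - y c) - 1 / (x a - z c)) =
      (Matrix.of fun a c => 1 / (x a - y c)) * (1 - transferX x y z) := by
    rw [mul_sub, mul_one, cauchy_mul_transferX x y z hy hxy hxz]
    rfl
  rw [h, Matrix.det_mul, ← mul_assoc, prod_mul_det_cauchy x y hy hxy]

end Cauchy

namespace Params

variable {P : Params} {h : ℝ} {μ : Fin P.N → ℂ}

variable (P) in
/-- The variable in which the entries of Tsuchiya's determinant are of Cauchy type. -/
noncomputable def ratU (ξ : ℂ) : ℂ := cosh (2 * ξ - P.iζ) / 2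

theorem cosh_sub_cosh (A B : ℂ) : cosh (A + B) / 2 - cosh (A - B) / 2 = sinh A * sinh B := by
  rw [cosh_add, cosh_sub]; ring

theorem ratU_sub (s t : ℂ) : P.ratU s - P.ratU t = sinh (s - t) * sinh (s + t - P.iζ) := by
  rw [← cosh_sub_cosh, ratU, ratU]
  have h2 : s - t - (s + t - P.iζ) = -(2 * t - P.iζ) := by ring
  rw [h2, cosh_neg]
  ring_nf

theorem ratU_sub_neg (s t : ℂ) : P.ratU s - P.ratU (-t) = sinh (s + t) * sinh (s - t - P.iζ) := by
  rw [ratU_sub]; ring_nf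

theorem continuous_ratU : Continuous P.ratU := by unfold ratU; fun_prop

variable (P) in
/-- Tsuchiya's partition function in a form that is regular at coinciding inhomogeneities. -/
noncomputable def tsuchiyaReg (ξ μ : Fin P.N → ℂ) : ℂ :=
  (∏ i, ∏ j ∈ Finset.Ioi i, P.f (μ i) (μ j)) * (∏ a, sinh (2 * ξ a)) *
  (∏ c, sinh (P.ξm + μ c) / sinh (2 * μ c)) *
  (∏ a, ∏ c, (P.ratU (ξ a) - P.ratU (-μ c))) *
  Matrix.det (1 - transferX (fun a => P.ratU (ξ a)) (fun c => P.ratU (μ c))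
    (fun c => P.ratU (-μ c)))

theorem tsuchiya_eq_reg {ξ : Fin P.N → ℂ} (hμ : ∀ i j, i ≠ j → sinh (μ i - μ j) ≠ 0)
    (h1 : ∀ j k, sinh (μ j + μ k) ≠ 0) (h2 : ∀ j k, sinh (μ j + μ k - P.iζ) ≠ 0)
    (hξ : ∀ a c, a < c → sinh (ξ a - ξ c) ≠ 0)
    (hξ' : ∀ a c, a < c → sinh (ξ a + ξ c - P.iζ) ≠ 0)
    (hm : ∀ a c, P.ratU (ξ a) ≠ P.ratU (μ c)) (hp : ∀ a c, P.ratU (ξ a) ≠ P.ratU (-μ c)) :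
    P.tsuchiya ξ μ = P.tsuchiyaReg ξ μ := by
  have hinj : Function.Injective fun c => P.ratU (μ c) := by
    intro i j hij
    by_contra hne
    have h3 := ratU_sub (P := P) (μ i) (μ j)
    rw [sub_eq_zero.2 hij] at h3
    exact mul_ne_zero (hμ i j hne) (h2 i j) h3.symm
  have key := prod_mul_det_cauchy_sub (fun a => P.ratU (ξ a)) (fun c => P.ratU (μ c))
    (fun c => P.ratU (-μ c)) hinj hm hp
  have hdet : (Matrix.of fun a c : Fin P.N =>
    sinh (-P.iζ) * sinh (P.ξm + μ c) * sinh (2 * ξ a) /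
      ((sinh (ξ a - P.iζ + μ c) * sinh (ξ a + μ c)) *
        (sinh (ξ a - P.iζ - μ c) * sinh (ξ a - μ c)))) =
      Matrix.of fun a c => (sinh (2 * ξ a)) * (Matrix.of fun a c =>
        (sinh (P.ξm + μ c) / sinh (2 * μ c)) * (Matrix.of fun a c : Fin P.N =>
        1 / (P.ratU (ξ a) - P.ratU (μ c)) - 1 / (P.ratU (ξ a) - P.ratU (-μ c))) a c) a c := by
    ext a c
    simp only [Matrix.of_apply]
    have e1 := sub_ne_zero.2 (hm a c)
    have e2 := sub_ne_zero.2 (hp a c)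
    have e3 : P.ratU (μ c) - P.ratU (-μ c) = sinh (-P.iζ) * sinh (2 * μ c) := by
      rw [ratU_sub_neg]; ring_nf
    have e4 : sinh (2 * μ c) ≠ 0 := by rw [two_mul]; exact h1 c c
    rw [div_sub_div _ _ e1 e2, show (1 : ℂ) * (P.ratU (ξ a) - P.ratU (-μ c)) -
      (P.ratU (ξ a) - P.ratU (μ c)) * 1 = P.ratU (μ c) - P.ratU (-μ c) by ring, e3]
    rw [show (sinh (ξ a - P.iζ + μ c) * sinh (ξ a + μ c)) *
        (sinh (ξ a - P.iζ - μ c) * sinh (ξ a - μ c)) =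
        (P.ratU (ξ a) - P.ratU (μ c)) * (P.ratU (ξ a) - P.ratU (-μ c)) by
      rw [ratU_sub, ratU_sub_neg, sub_add_eq_add_sub, sub_right_comm (ξ a)]; ring]
    generalize sinh (2 * μ c) = A at *
    field_simp
  have hprod : (∏ a, ∏ c, (sinh (ξ a + μ c) * sinh (ξ a - P.iζ + μ c)) *
      (sinh (ξ a - μ c) * sinh (ξ a - P.iζ - μ c))) =
      (∏ a, ∏ c, (P.ratU (ξ a) - P.ratU (μ c))) * ∏ a, ∏ c, (P.ratU (ξ a) - P.ratU (-μ c)) := by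
    simp_rw [← Finset.prod_mul_distrib]
    refine Finset.prod_congr rfl fun a _ => Finset.prod_congr rfl fun c _ => ?_
    rw [ratU_sub, ratU_sub_neg, sub_add_eq_add_sub, sub_right_comm (ξ a)]; ring
  have hden : ∀ a, ∀ c ∈ Finset.Ioi a, sinh (ξ a - ξ c) * sinh (ξ a + ξ c - P.iζ) *
      (sinh (μ c + μ a) * sinh (μ c - μ a)) ≠ 0 := by
    intro a c hc
    have hac := Finset.mem_Ioi.1 hc
    exact mul_ne_zero (mul_ne_zero (hξ a c hac) (hξ' a c hac))
      (mul_ne_zero (h1 c a) (hμ c a hac.ne'))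
  have hden' : (∏ a, ∏ c ∈ Finset.Ioi a, sinh (ξ a - ξ c) * sinh (ξ a + ξ c - P.iζ) *
      (sinh (μ c + μ a) * sinh (μ c - μ a))) ≠ 0 :=
    Finset.prod_ne_zero_iff.2 fun a _ => Finset.prod_ne_zero_iff.2 fun c hc => hden a c hc
  have hq : (∏ a, ∏ c ∈ Finset.Ioi a, (P.ratU (ξ a) - P.ratU (ξ c)) *
      (P.ratU (μ c) - P.ratU (μ a))) = (∏ i, ∏ j ∈ Finset.Ioi i, P.f (μ i) (μ j)) *
      ∏ a, ∏ c ∈ Finset.Ioi a, sinh (ξ a - ξ c) * sinh (ξ a + ξ c - P.iζ) *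
      (sinh (μ c + μ a) * sinh (μ c - μ a)) := by
    simp_rw [← Finset.prod_mul_distrib]
    refine Finset.prod_congr rfl fun a _ => Finset.prod_congr rfl fun c _ => ?_
    have := h1 a c
    rw [ratU_sub, ratU_sub, f, add_comm (μ c) (μ a)]
    field_simp
  unfold tsuchiya tsuchiyaReg
  rw [hdet, hprod, Matrix.det_mul_column, Matrix.det_mul_row]
  rw [hq] at key
  rw [div_mul_eq_mul_div, div_eq_iff hden']
  linear_combination ((∏ a, sinh (2 * ξ a)) *
    (∏ c, sinh (P.ξm + μ c) / sinh (2 * μ c)) *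
    (∏ a, ∏ c, (P.ratU (ξ a) - P.ratU (-μ c)))) * key

theorem continuousAt_tsuchiyaReg (hp : ∀ c, P.ratU (-P.b) ≠ P.ratU (-μ c)) :
    ContinuousAt (fun ξ => P.tsuchiyaReg ξ μ) fun _ => -P.b := by
  have hU : ∀ a, ContinuousAt (fun ξ : Fin P.N → ℂ => P.ratU (ξ a)) fun _ => -P.b := fun a =>
    (continuous_ratU.comp (continuous_apply a)).continuousAt
  unfold tsuchiyaReg
  refine ContinuousAt.mul (ContinuousAt.mul ((ContinuousAt.mul continuousAt_const
    (tendsto_finsetProd _ fun a _ => ?_)).mul continuousAt_const) ?_) ?_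
  · exact (continuous_sinh.comp (by fun_prop : Continuous fun ξ : Fin P.N → ℂ =>
      2 * ξ a)).tendsto _
  · exact tendsto_finsetProd _ fun a _ => tendsto_finsetProd _ fun c _ =>
      ((hU a).sub continuousAt_const).tendsto
  · have : ContinuousAt (fun ξ : Fin P.N → ℂ => 1 - transferX (fun a => P.ratU (ξ a))
        (fun c => P.ratU (μ c)) (fun c => P.ratU (-μ c))) fun _ => -P.b := by
      refine continuousAt_const.sub ?_
      refine continuousAt_pi.2 fun j => continuousAt_pi.2 fun k => ?_
      unfold transferX
      simp only [Matrix.of_apply]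
      refine ContinuousAt.mul (ContinuousAt.div ?_ ?_ ?_) continuousAt_const
      · exact tendsto_finsetProd _ fun a _ => (continuousAt_const.sub (hU a)).tendsto
      · exact tendsto_finsetProd _ fun a _ => (continuousAt_const.sub (hU a)).tendsto
      · exact Finset.prod_ne_zero_iff.2 fun a _ => sub_ne_zero.2 (hp k).symm
    exact (Continuous.matrix_det continuous_id).continuousAt.comp this

variable (P h μ) in
/-- The value of the partition function at the coinciding inhomogeneities. -/
noncomputable def Zval : ℂ :=
  (∏ i, ∏ j ∈ Finset.Ioi i, P.f (μ i) (μ j)) * sinh (-(2 * P.b)) ^ P.N *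
  (∏ c, sinh (P.ξm + μ c) / sinh (2 * μ c)) *
  (∏ c, (sinh (μ c - P.b) * sinh (-P.b - μ c - P.iζ))) ^ P.N * Matrix.det (1 + P.bM h μ)

theorem det_one_sub_transferX (hN : 0 < P.N) (hμ : P.IsBethe h μ)
    (h1 : ∀ j k, sinh (μ j + μ k) ≠ 0) (h3 : ∀ j k, sinh (μ j - μ k - P.iζ) ≠ 0) :
    Matrix.det (1 - transferX (fun _ => P.ratU (-P.b)) (fun c => P.ratU (μ c))
      (fun c => P.ratU (-μ c))) = Matrix.det (1 + P.bM h μ) := by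
  let A : Fin P.N → ℂ := fun j => (P.ratU (μ j) - P.ratU (-P.b)) ^ P.N /
    ∏ i ∈ Finset.univ.erase j, (P.ratU (μ j) - P.ratU (μ i))
  let B : Fin P.N → ℂ := fun k => (∏ i, (P.ratU (-μ k) - P.ratU (μ i))) /
    (P.ratU (-μ k) - P.ratU (-P.b)) ^ P.N
  let G : Matrix (Fin P.N) (Fin P.N) ℂ := Matrix.of fun j k =>
    1 / (sinh (μ j + μ k) * sinh (μ j - μ k - P.iζ))
  have hVm : ∀ k i, P.ratU (-μ k) - P.ratU (μ i) = -(sinh (μ i + μ k) * sinh (μ i - μ k - P.iζ)) := by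
    intro k i
    rw [← ratU_sub_neg]; ring
  have hX : -transferX (fun _ => P.ratU (-P.b)) (fun c => P.ratU (μ c))
      (fun c => P.ratU (-μ c)) = Matrix.diagonal A * (G * Matrix.diagonal B) := by
    ext j k
    rw [Matrix.diagonal_mul, Matrix.mul_diagonal]
    simp only [Matrix.neg_apply, transferX, Matrix.of_apply, A, B, G, Finset.prod_const,
      Finset.card_univ, Fintype.card_fin]
    rw [Finset.prod_div_distrib,
      ← Finset.mul_prod_erase Finset.univ (fun i => P.ratU (-μ k) - P.ratU (μ i)) (Finset.mem_univ j)]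
    rw [hVm k j]
    have e1 := h1 j k
    have e2 := h3 j k
    generalize sinh (μ j + μ k) = s1 at *
    generalize sinh (μ j - μ k - P.iζ) = s2 at *
    field_simp
  have hM : P.bM h μ = G * Matrix.diagonal B * Matrix.diagonal A := by
    ext j k
    rw [Matrix.mul_diagonal, Matrix.mul_diagonal]
    simp only [bM, Matrix.of_apply, G]
    suffices hs : P.bRes h μ k = B k * A k by rw [hs]; ring
    have hbe := hμ.1 k
    obtain ⟨n1, n2, n3, n4⟩ := hμ.ne_zero hN k
    have er : (P.ratU (μ k) - P.ratU (-P.b)) = -(sinh (P.iζ - μ k + P.b) * sinh (μ k + P.b)) := by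
      rw [ratU_sub, show μ k + -P.b - P.iζ = -(P.iζ - μ k + P.b) by ring, sinh_neg]
      ring_nf
    have er' : (P.ratU (-μ k) - P.ratU (-P.b)) = sinh (μ k + P.b + P.iζ) * sinh (μ k - P.b) := by
      rw [ratU_sub, show -μ k + -P.b - P.iζ = -(μ k + P.b + P.iζ) by ring,
        show -μ k - -P.b = -(μ k - P.b) by ring, sinh_neg, sinh_neg]
      ring
    have hl : ∏ l, sinh (P.iζ + μ l - μ k) / sinh (P.iζ + μ k - μ l) =
        (-1) ^ (P.N - 1) * ∏ l ∈ Finset.univ.erase k,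
          sinh (μ k - μ l - P.iζ) / sinh (P.iζ + μ k - μ l) := by
      have hk : sinh P.iζ ≠ 0 := by
        have := h3 k k
        rw [sub_self, zero_sub, sinh_neg] at this
        exact neg_ne_zero.1 this
      rw [← Finset.mul_prod_erase Finset.univ _ (Finset.mem_univ k)]
      rw [show sinh (P.iζ + μ k - μ k) / sinh (P.iζ + μ k - μ k) = 1 by
        rw [add_sub_cancel_right, div_self hk], one_mul,
        show (-1 : ℂ) ^ (P.N - 1) = ∏ _l ∈ Finset.univ.erase k, (-1 : ℂ) by
          rw [Finset.prod_const, Finset.card_erase_of_mem (Finset.mem_univ k)]; simp,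
        ← Finset.prod_mul_distrib]
      refine Finset.prod_congr rfl fun l _ => ?_
      rw [show P.iζ + μ l - μ k = -(μ k - μ l - P.iζ) by ring, sinh_neg]
      ring
    rw [hl] at hbe
    simp only [A, B]
    rw [er, er', ← Finset.mul_prod_erase Finset.univ (fun i => P.ratU (-μ k) - P.ratU (μ i))
      (Finset.mem_univ k), bRes]
    have hd : P.ratU (-μ k) - P.ratU (μ k) = sinh P.iζ * sinh (2 * μ k) := by
      rw [hVm, sub_self, zero_sub, sinh_neg]
      ring_nf
    have hp1 : ∏ l ∈ Finset.univ.erase k, sinh (μ k + μ l) * sinh (μ k - μ l - P.iζ) /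
        (sinh (μ k - μ l) * sinh (μ k + μ l - P.iζ)) =
        (∏ l ∈ Finset.univ.erase k, sinh (μ k - μ l - P.iζ) / sinh (P.iζ + μ k - μ l)) *
        ((∏ l ∈ Finset.univ.erase k, (P.ratU (-μ k) - P.ratU (μ l))) /
        ∏ l ∈ Finset.univ.erase k, (P.ratU (μ k) - P.ratU (μ l))) := by
      rw [← Finset.prod_div_distrib, ← Finset.prod_mul_distrib]
      refine Finset.prod_congr rfl fun l hl => ?_
      have e1 := h3 l k
      rw [hVm, ratU_sub, show P.iζ + μ k - μ l = -(μ l - μ k - P.iζ) by ring, sinh_neg,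
        add_comm (μ l) (μ k)]
      generalize sinh (μ l - μ k - P.iζ) = s1 at *
      generalize sinh (μ k - μ l) = s2 at *
      generalize sinh (μ k + μ l - P.iζ) = s3 at *
      field_simp
    rw [hp1, hd]
    generalize (∏ l ∈ Finset.univ.erase k, (P.ratU (-μ k) - P.ratU (μ l))) = Q1
    generalize (∏ l ∈ Finset.univ.erase k, (P.ratU (μ k) - P.ratU (μ l))) = Q2
    generalize (∏ l ∈ Finset.univ.erase k, sinh (μ k - μ l - P.iζ) / sinh (P.iζ + μ k - μ l)) = Q3
      at *
    generalize sinh (μ k + P.b + P.iζ) = s1 at *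
    generalize sinh (μ k - P.b) = s2 at *
    generalize sinh (P.iζ - μ k + P.b) = s3 at *
    generalize sinh (μ k + P.b) = s4 at *
    generalize exp (-(h / P.T : ℝ)) = E at *
    have hs : (-1 : ℂ) ^ P.N = -(-1) ^ (P.N - 1) := by
      obtain ⟨m, hm⟩ : ∃ m, P.N = m + 1 := ⟨P.N - 1, by omega⟩
      rw [hm, pow_succ]; simp
    have hsq : ((-1 : ℂ) ^ (P.N - 1)) * (-1) ^ (P.N - 1) = 1 := by
      rw [← mul_pow]; norm_num
    rw [neg_pow (s3 * s4), hs]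
    rw [div_pow, ← mul_div_assoc, eq_div_iff (pow_ne_zero _ (mul_ne_zero n3 n4))] at hbe
    have hne : (s1 * s2) ^ P.N ≠ 0 := pow_ne_zero _ (mul_ne_zero n1 n2)
    generalize (s1 * s2) ^ P.N = q1 at *
    generalize (s3 * s4) ^ P.N = q2 at *
    generalize (-1 : ℂ) ^ (P.N - 1) = e at *
    have : E * Q3 = -e * q2 / q1 := by
      rw [eq_div_iff hne]
      linear_combination -(E * Q3 * q1) * hsq - e * hbe
    generalize sinh P.iζ = t1
    generalize sinh (2 * μ k) = t2
    linear_combination (t1 * t2 * (Q1 / Q2)) * this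
  rw [sub_eq_add_neg, hX, Matrix.det_one_add_mul_comm, hM]

theorem tendsto_tsuchiya (hN : 0 < P.N) (hμ : P.IsBethe h μ) (hb : sinh (2 * P.b + P.iζ) ≠ 0)
    (h1 : ∀ j k, sinh (μ j + μ k) ≠ 0) (h2 : ∀ j k, sinh (μ j + μ k - P.iζ) ≠ 0)
    (h3 : ∀ j k, sinh (μ j - μ k - P.iζ) ≠ 0) :
    Tendsto (fun ξ => P.tsuchiya ξ μ) P.homogeneous (𝓝 (P.Zval h μ)) := by
  have hm : ∀ c, P.ratU (-P.b) ≠ P.ratU (μ c) := by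
    intro c hc
    obtain ⟨n1, n2, n3, n4⟩ := hμ.ne_zero hN c
    have h4 := ratU_sub (P := P) (μ c) (-P.b)
    rw [hc, sub_self, sub_neg_eq_add, show μ c + -P.b - P.iζ = -(P.iζ - μ c + P.b) by ring,
      sinh_neg] at h4
    exact mul_ne_zero n4 (neg_ne_zero.2 n3) h4.symm
  have hp : ∀ c, P.ratU (-P.b) ≠ P.ratU (-μ c) := by
    intro c hc
    obtain ⟨n1, n2, n3, n4⟩ := hμ.ne_zero hN c
    have h4 := ratU_sub_neg (P := P) (-P.b) (μ c)
    rw [hc, sub_self, show -P.b + μ c = μ c - P.b by ring,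
      show -P.b - μ c - P.iζ = -(μ c + P.b + P.iζ) by ring, sinh_neg] at h4
    exact mul_ne_zero n2 (neg_ne_zero.2 n1) h4.symm
  have hval : P.tsuchiyaReg (fun _ => -P.b) μ = P.Zval h μ := by
    unfold tsuchiyaReg Zval
    rw [det_one_sub_transferX hN hμ h1 h3]
    congr 2
    · congr 2
      rw [Finset.prod_const, Finset.card_univ, Fintype.card_fin, mul_neg]
    · rw [Finset.prod_const, Finset.card_univ, Fintype.card_fin]
      congr 1
      refine Finset.prod_congr rfl fun c _ => ?_
      rw [ratU_sub_neg, show -P.b + μ c = μ c - P.b by ring]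
  have hU : ∀ a, ContinuousAt (fun ξ : Fin P.N → ℂ => P.ratU (ξ a)) fun _ => -P.b := fun a =>
    (continuous_ratU.comp (continuous_apply a)).continuousAt
  have hlim : Tendsto (fun ξ => P.tsuchiyaReg ξ μ) P.homogeneous (𝓝 (P.Zval h μ)) := by
    rw [← hval]
    exact (continuousAt_tsuchiyaReg hp).tendsto.mono_left nhdsWithin_le_nhds
  refine hlim.congr' ?_
  have e1 : ∀ᶠ ξ : Fin P.N → ℂ in 𝓝 (fun _ => -P.b), ∀ a c, P.ratU (ξ a) ≠ P.ratU (μ c) :=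
    eventually_all.2 fun a => eventually_all.2 fun c => (hU a).eventually_ne (hm c)
  have e2 : ∀ᶠ ξ : Fin P.N → ℂ in 𝓝 (fun _ => -P.b), ∀ a c, P.ratU (ξ a) ≠ P.ratU (-μ c) :=
    eventually_all.2 fun a => eventually_all.2 fun c => (hU a).eventually_ne (hp c)
  have e3 : ∀ᶠ ξ : Fin P.N → ℂ in 𝓝 (fun _ => -P.b), ∀ a c, sinh (ξ a + ξ c - P.iζ) ≠ 0 := by
    refine eventually_all.2 fun a => eventually_all.2 fun c => ?_
    refine ContinuousAt.eventually_ne (g := fun ξ : Fin P.N → ℂ => sinh (ξ a + ξ c - P.iζ))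
      (continuous_sinh.comp (by fun_prop : Continuous fun ξ : Fin P.N → ℂ =>
        ξ a + ξ c - P.iζ)).continuousAt ?_
    rw [show -P.b + -P.b - P.iζ = -(2 * P.b + P.iζ) by ring, sinh_neg]
    exact neg_ne_zero.2 hb
  filter_upwards [nhdsWithin_le_nhds e1, nhdsWithin_le_nhds e2, nhdsWithin_le_nhds e3,
    self_mem_nhdsWithin] with ξ g1 g2 g3 g4
  exact (tsuchiya_eq_reg hμ.2 h1 h2 g4 (fun a c _ => g3 a c) g1 g2).symm

instance homogeneous_neBot : P.homogeneous.NeBot := by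
  unfold homogeneous
  rw [← mem_closure_iff_nhdsWithin_neBot]
  have hc : Tendsto (fun t : ℝ => fun a : Fin P.N => -P.b + ((t * (a : ℕ) : ℝ) : ℂ)) (𝓝[>] 0)
      (𝓝 fun _ => -P.b) := by
    have : Continuous (fun t : ℝ => fun a : Fin P.N => -P.b + ((t * (a : ℕ) : ℝ) : ℂ)) := by
      fun_prop
    have h0 := this.tendsto 0
    simp only [zero_mul, ofReal_zero, add_zero] at h0
    exact h0.mono_left nhdsWithin_le_nhds
  refine mem_closure_of_tendsto hc ?_
  filter_upwards [self_mem_nhdsWithin] with t ht a c hac h0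
  have ht' : (0 : ℝ) < t := ht
  rw [show -P.b + ((t * (a : ℕ) : ℝ) : ℂ) - (-P.b + ((t * (c : ℕ) : ℝ) : ℂ)) =
    ((t * ((a : ℕ) - (c : ℕ)) : ℝ) : ℂ) by push_cast; ring, ← ofReal_sinh, ofReal_eq_zero,
    Real.sinh_eq_zero, mul_eq_zero] at h0
  rcases h0 with h0 | h0
  · exact ht'.ne' h0
  · have : ((a : ℕ) : ℝ) = (c : ℕ) := by linarith
    exact hac.ne (Fin.ext (by exact_mod_cast this))

theorem Z_eq {z : ℂ}
    (hz : Tendsto (fun ξ => P.tsuchiya ξ μ) P.homogeneous (𝓝 z)) : P.Z μ = z := hz.limUnder_eq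

theorem boundaryFactor_eq (h h' : ℝ) (μ lam : Fin P.N → ℂ) :
    P.boundaryFactor h h' μ lam = P.Z μ / P.Z lam := by
  have h1 : exp ((P.N * (h' - h) / (2 * P.T) : ℝ)) * (exp (-(P.N * h' / (2 * P.T) : ℝ)) /
      exp (-(P.N * h / (2 * P.T) : ℝ))) = 1 := by
    rw [← exp_sub, ← exp_add, ← exp_zero]
    congr 1
    push_cast
    ring
  unfold boundaryFactor Fminus
  linear_combination (P.Z μ / P.Z lam) * h1

end Params

section Exchange

variable {M : Type*} [CommMonoid M] {N n : ℕ}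

theorem prod_Ioi_eq_prod_ite {α : Type*} [LinearOrder α] [Fintype α] [LocallyFiniteOrderTop α]
    (G : α → α → M) :
    ∏ i, ∏ j ∈ Finset.Ioi i, G i j = ∏ i, ∏ j, if i < j then G i j else 1 := by
  refine Finset.prod_congr rfl fun i _ => ?_
  rw [← Finset.prod_filter]
  refine Finset.prod_congr ?_ fun _ _ => rfl
  ext j; simp

/-- The product of a symmetric function over the unordered pairs does not depend on the order. -/
theorem prod_ite_lt_comp {α β : Type*} [LinearOrder α] [Fintype α] [LinearOrder β] {ι : α → β}
    (hι : Function.Injective ι) (G : α → α → M) (hG : ∀ i j, G i j = G j i) :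
    (∏ i, ∏ j, if ι i < ι j then G i j else 1) = ∏ i, ∏ j, if i < j then G i j else 1 := by
  have h1 : (∏ i, ∏ j, if ι i < ι j then G i j else 1) =
      (∏ i, ∏ j, if i < j ∧ ι i < ι j then G i j else 1) *
        ∏ j, ∏ i, if j < i ∧ ι i < ι j then G i j else 1 := by
    rw [Finset.prod_comm (γ := α) (f := fun j i => if j < i ∧ ι i < ι j then G i j else 1),
      ← Finset.prod_mul_distrib]
    refine Finset.prod_congr rfl fun i _ => ?_
    rw [← Finset.prod_mul_distrib]
    refine Finset.prod_congr rfl fun j _ => ?_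
    rcases lt_trichotomy i j with h | h | h
    · simp [h, h.not_gt]
    · simp [h]
    · simp [h, h.not_gt]
  rw [h1, ← Finset.prod_mul_distrib]
  refine Finset.prod_congr rfl fun i _ => ?_
  rw [← Finset.prod_mul_distrib]
  refine Finset.prod_congr rfl fun j _ => ?_
  by_cases h : i < j
  · rcases lt_or_gt_of_ne (hι.ne h.ne) with h' | h'
    · simp [h, h', h'.not_gt]
    · simp [h, h', h'.not_gt, hG j i]
  · simp [h]

theorem prod_extend {ι : Fin n → Fin N} (hι : Function.Injective ι) (g : Fin N → M) :
    ∏ k, g k = (∏ k ∈ (Finset.univ.image ι)ᶜ, g k) * ∏ j, g (ι j) := by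
  rw [← Finset.prod_compl_mul_prod (Finset.univ.image ι), Finset.prod_image fun _ _ _ _ h => hι h]

theorem prod_pairs_split {ι : Fin n → Fin N} (hι : Function.Injective ι) (g : Fin N → Fin N → M)
    (hg : ∀ i j, g i j = g j i) :
    ∏ i, ∏ j ∈ Finset.Ioi i, g i j =
      (∏ i ∈ (Finset.univ.image ι)ᶜ, ∏ j ∈ (Finset.univ.image ι)ᶜ, if i < j then g i j else 1) *
      (∏ i ∈ (Finset.univ.image ι)ᶜ, ∏ j, g i (ι j)) *
      ∏ i, ∏ j ∈ Finset.Ioi i, g (ι i) (ι j) := by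
  rw [prod_Ioi_eq_prod_ite, prod_Ioi_eq_prod_ite,
    ← prod_ite_lt_comp hι (fun i j => g (ι i) (ι j)) fun _ _ => hg _ _,
    prod_extend hι fun i => ∏ j, if i < j then g i j else 1]
  rw [Finset.prod_congr rfl fun i _ => prod_extend hι fun j => if i < j then g i j else 1,
    Finset.prod_congr (s₁ := Finset.univ) rfl fun i _ =>
      prod_extend hι fun j => if ι i < j then g (ι i) j else 1,
    Finset.prod_mul_distrib, Finset.prod_mul_distrib,
    Finset.prod_comm (s := Finset.univ) (t := (Finset.univ.image ι)ᶜ)]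
  rw [mul_mul_mul_comm, mul_assoc, mul_assoc]
  congr 1
  rw [← mul_assoc]
  congr 1
  rw [← Finset.prod_mul_distrib]
  refine Finset.prod_congr rfl fun i hi => ?_
  rw [← Finset.prod_mul_distrib]
  refine Finset.prod_congr rfl fun j _ => ?_
  have hne : i ≠ ι j := fun h0 => by simp [h0] at hi
  rcases lt_or_gt_of_ne hne with h | h
  · simp [h, h.not_gt]
  · simp [h, h.not_gt, hg (ι j) i]

variable {ι : Fin n → Fin N} {x y : Fin n → ℂ} {μ : Fin N → ℂ}

/-- Replacing the particles by the holes in a product over the roots. -/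
theorem prod_exchange (hι : Function.Injective ι) (hy : ∀ j, μ (ι j) = y j) (F : ℂ → M) :
    (∏ k, F (μ k)) * ∏ j, F (x j) = (∏ k, F (Function.extend ι x μ k)) * ∏ j, F (y j) := by
  rw [prod_extend hι fun k => F (μ k), prod_extend hι fun k => F (Function.extend ι x μ k)]
  have h1 : ∏ k ∈ (Finset.univ.image ι)ᶜ, F (Function.extend ι x μ k) =
      ∏ k ∈ (Finset.univ.image ι)ᶜ, F (μ k) := Finset.prod_congr rfl fun k hk => by
    rw [Function.extend_apply' _ _ _ fun ⟨j, hj⟩ => by simp [← hj] at hk]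
  simp_rw [h1, hι.extend_apply, hy]
  rw [mul_right_comm]

theorem prod_prod_eq_sq_mul_diag (F : ℂ → ℂ → M) (hF : ∀ u v, F u v = F v u) (x : Fin n → ℂ) :
    ∏ i, ∏ j, F (x i) (x j) = (∏ i, ∏ j ∈ Finset.Ioi i, F (x i) (x j)) *
      (∏ i, ∏ j ∈ Finset.Ioi i, F (x i) (x j)) * ∏ i, F (x i) (x i) := by
  have h := Finset.prod_prod_Ioi_mul_eq_prod_prod_off_diag (fun i j => F (x i) (x j))
  rw [Finset.prod_congr rfl fun i _ => Finset.prod_mul_distrib (s := Finset.Ioi i)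
    (f := fun j => F (x j) (x i)) (g := fun j => F (x i) (x j)), Finset.prod_mul_distrib] at h
  simp_rw [fun i j : Fin n => hF (x j) (x i)] at h
  rw [h, ← Finset.prod_mul_distrib]
  refine Finset.prod_congr rfl fun i _ => ?_
  rw [← Finset.prod_compl_mul_prod {i}, Finset.prod_singleton]

/-- Replacing the particles by the holes in a product over the pairs of roots. -/
theorem prod_pairs_exchange (hι : Function.Injective ι) (hy : ∀ j, μ (ι j) = y j)
    (F : ℂ → ℂ → M) (hF : ∀ u v, F u v = F v u) :
    (∏ i, ∏ j ∈ Finset.Ioi i, F (μ i) (μ j)) * (∏ k, ∏ j, F (Function.extend ι x μ k) (x j)) *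
        (∏ i, ∏ j, F (x i) (y j)) =
      (∏ i, ∏ j ∈ Finset.Ioi i, F (Function.extend ι x μ i) (Function.extend ι x μ j)) *
        (∏ k, ∏ j, F (Function.extend ι x μ k) (y j)) *
        ((∏ i, ∏ j ∈ Finset.Ioi i, F (y i) (y j)) * (∏ i, ∏ j ∈ Finset.Ioi i, F (x i) (x j)) *
          ∏ i, F (x i) (x i)) := by
  have hA : ∀ k ∈ (Finset.univ.image ι)ᶜ, Function.extend ι x μ k = μ k := fun k hk =>
    Function.extend_apply' _ _ _ fun ⟨j, hj⟩ => by simp [← hj] at hk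
  rw [prod_pairs_split hι (fun i j => F (μ i) (μ j)) fun _ _ => hF _ _,
    prod_pairs_split hι (fun i j => F (Function.extend ι x μ i) (Function.extend ι x μ j))
      fun _ _ => hF _ _,
    prod_extend hι fun k => ∏ j, F (Function.extend ι x μ k) (x j),
    prod_extend hι fun k => ∏ j, F (Function.extend ι x μ k) (y j)]
  have e1 : (∏ i ∈ (Finset.univ.image ι)ᶜ, ∏ j ∈ (Finset.univ.image ι)ᶜ,
      if i < j then F (Function.extend ι x μ i) (Function.extend ι x μ j) else 1) =
      ∏ i ∈ (Finset.univ.image ι)ᶜ, ∏ j ∈ (Finset.univ.image ι)ᶜ,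
        if i < j then F (μ i) (μ j) else 1 :=
    Finset.prod_congr rfl fun i hi => Finset.prod_congr rfl fun j hj => by rw [hA i hi, hA j hj]
  have e2 : ∀ z : Fin n → ℂ, (∏ i ∈ (Finset.univ.image ι)ᶜ, ∏ j, F (Function.extend ι x μ i) (z j)) =
      ∏ i ∈ (Finset.univ.image ι)ᶜ, ∏ j, F (μ i) (z j) := fun z =>
    Finset.prod_congr rfl fun i hi => by rw [hA i hi]
  simp_rw [hι.extend_apply, e1, e2, hy, prod_prod_eq_sq_mul_diag F hF x]
  generalize (∏ i, ∏ j ∈ Finset.Ioi i, F (x i) (x j)) = a1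
  generalize (∏ i, F (x i) (x i)) = a2
  generalize (∏ i, ∏ j, F (x i) (y j)) = a3
  generalize (∏ i, ∏ j ∈ Finset.Ioi i, F (y i) (y j)) = a4
  simp only [mul_assoc, mul_comm, mul_left_comm]

end Exchange

namespace Params

variable {P : Params} {h : ℝ} {μ : Fin P.N → ℂ} {C : Contour} {n : ℕ} {x y : Fin n → ℂ}

theorem IsBethe.injective (hμ : P.IsBethe h μ) : Function.Injective μ := fun p q hpq => by
  by_contra hne
  exact hμ.2 p q hne (by rw [hpq, sub_self, sinh_zero])

/-- The zeros of `1 + â` inside of the contour: the roots, with the particles replaced by the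
holes. -/
theorem ParticleHole.exists_embedding (hY : P.ParticleHole h μ C x y) (hμ : P.IsBethe h μ) :
    ∃ ι : Fin n → Fin P.N, Function.Injective ι ∧ (∀ j, μ (ι j) = y j) ∧
      Function.Injective (Function.extend ι x μ) ∧
      ∀ k, Function.extend ι x μ k ∈ C.inner ∧
        P.countingFn h μ (Function.extend ι x μ k) = -1 := by
  have h1 : ∀ j, ∃ a, μ a = y j := fun j =>
    let ⟨a, ha⟩ := (hY.y_range (y j)).1 ⟨j, rfl⟩
    ⟨a, ha.1⟩
  choose ι hι using h1
  have hinj : Function.Injective ι := fun i j hij => hY.y_injective (by rw [← hι i, ← hι j, hij])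
  have hx := fun j => (hY.x_range (x j)).1 ⟨j, rfl⟩
  have hmem : ∀ k, (∃ j, ι j = k) ∨
      (Function.extend ι x μ k = μ k ∧ μ k ∈ C.inner) := by
    intro k
    by_cases hk : ∃ j, ι j = k
    · exact Or.inl hk
    · refine Or.inr ⟨Function.extend_apply' _ _ _ hk, ?_⟩
      refine (hY.off k).resolve_right fun ho => hk ?_
      obtain ⟨j, hj⟩ := (hY.y_range (μ k)).2 ⟨k, rfl, ho⟩
      exact ⟨j, hμ.injective (by rw [hι, hj])⟩
  refine ⟨ι, hinj, hι, fun k l hkl => ?_, fun k => ?_⟩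
  · rcases hmem k with ⟨i, rfl⟩ | ⟨hk, -⟩ <;> rcases hmem l with ⟨j, rfl⟩ | ⟨hl, -⟩
    · rw [hinj.extend_apply, hinj.extend_apply] at hkl
      rw [hY.x_injective hkl]
    · rw [hinj.extend_apply, hl] at hkl
      exact absurd hkl.symm ((hx i).2.2 l)
    · rw [hinj.extend_apply, hk] at hkl
      exact absurd hkl ((hx j).2.2 k)
    · rw [hk, hl] at hkl
      exact hμ.injective hkl
  · rcases hmem k with ⟨i, rfl⟩ | ⟨hk, hk'⟩
    · rw [hinj.extend_apply]
      exact ⟨(hx i).1, (hx i).2.1⟩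
    · rw [hk]
      exact ⟨hk', hμ.countingFn_eq k⟩

theorem ParticleHole.exists_isFactored (hY : P.ParticleHole h μ C x y) (hC : P.BaseContour C)
    (hN : 0 < P.N) {w : Fin P.N → ℂ} (hw : Function.Injective w)
    (hw' : ∀ k, w k ∈ C.inner ∧ P.countingFn h μ (w k) = -1) :
    ∃ e, C.IsFactored (fun s => 1 + P.countingFn h μ s) (-P.b) P.N w e := by
  obtain ⟨w₀, e, h1, -⟩ := exists_isFactored_countingFn (h := h) hC.neg_b_mem hC.shift.1
    hY.no_singular 1 (fun s hs => by simpa using hY.ne_zero s hs) (by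
      rw [← hY.monodromy, Contour.monodromy]
      congr 1
      funext s
      rw [← Contour.logDeriv_one_add]
      simp)
  simp only [one_mul] at h1
  refine ⟨e, h1.perm hw (fun k => (hw' k).1) (fun k => by simp [(hw' k).2]) fun k hk => ?_⟩
  have := (hw' k).2
  rw [hk, countingFn_neg_b _ _ _ hN] at this
  norm_num at this

theorem ParticleHole.isLogAlong (hY : P.ParticleHole h μ C x y) (hC : P.BaseContour C) {v : ℂ}
    (hv : exp v = 1 + P.countingFn h μ (C.toFun 0)) :
    C.IsLogAlong (fun s => 1 + P.countingFn h μ s) (C.logAlong (P.countingFn h μ) v) :=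
  isLogAlong_countingFn hC.neg_b_mem hC.shift.1 hY.no_singular hY.ne_zero hY.monodromy hv

theorem InnerContour.isLogAlong {C' : Contour} (hC' : P.InnerContour (P.countingFn h μ) C C')
    (hY : P.ParticleHole h μ C x y) (hC : P.BaseContour C)
    {w : Fin P.N → ℂ} {e : ℂ → ℂ} (hw' : ∀ k, w k ∈ C.inner ∧ P.countingFn h μ (w k) = -1)
    (hF : C.IsFactored (fun s => 1 + P.countingFn h μ s) (-P.b) P.N w e) :
    C'.IsFactored (fun s => 1 + P.countingFn h μ s) (-P.b) P.N w e ∧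
    C'.IsLogAlong (fun s => 1 + P.countingFn h μ s)
      (C'.logAlong (P.countingFn h μ) (log (1 + P.countingFn h μ (C'.toFun 0)))) := by
  have hsub : C'.hull ⊆ C.hull := fun s hs => Or.inr (hC'.subset hs)
  have hF' := hF.restrict hsub hC'.neg_b_mem fun i => hC'.zeros_mem _ (hw' i).1 (hw' i).2
  have hout : ∀ p, C.OutsideMod p → C'.OutsideMod p := fun p hp k hk => hp k (hsub hk)
  have hne : ∀ s ∈ C'.trace, 1 + P.countingFn h μ s ≠ 0 := fun s hs h0 =>
    (hC'.zeros_mem s (hC'.subset (Or.inl hs)) (by linear_combination h0)).1 hs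
  refine ⟨hF', isLogAlong_countingFn hC'.neg_b_mem (hout _ hC.shift.1)
    (fun k => hout _ (hY.no_singular k)) hne ?_ (exp_log (hne _ (C'.mem_trace (by simp))))⟩
  have := hF'.integral_logDeriv
  rw [Contour.monodromy, ← this]
  congr 1
  funext s
  rw [Contour.logDeriv_one_add]

end Params

namespace Contour

variable {C : Contour}

/-- `∮_C L(s) coth(s - p) ds`. -/
noncomputable def cothInt (C : Contour) (L : ℝ → ℂ) (p : ℂ) : ℂ :=
  C.integralW L (fun s => coth (s - p))

theorem continuousOn_weight {L : ℝ → ℂ} (hL : ContinuousOn L (Set.Icc 0 1)) {f : ℂ → ℂ}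
    (hf : ∀ s ∈ C.trace, ContinuousAt f s) :
    ContinuousOn (fun t => f (C.toFun t) * L t) (Set.Icc 0 1) := (C.continuousOn_comp hf).mul hL

theorem integralW_add {L : ℝ → ℂ} (hL : ContinuousOn L (Set.Icc 0 1)) {f g : ℂ → ℂ}
    (hf : ∀ s ∈ C.trace, ContinuousAt f s) (hg : ∀ s ∈ C.trace, ContinuousAt g s) :
    C.integralW L (fun s => f s + g s) = C.integralW L f + C.integralW L g := by
  unfold integralW
  rw [← C.pathIntegral_add (continuousOn_weight hL hf) (continuousOn_weight hL hg)]
  simp only [add_mul]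

theorem integralW_sub {L : ℝ → ℂ} (hL : ContinuousOn L (Set.Icc 0 1)) {f g : ℂ → ℂ}
    (hf : ∀ s ∈ C.trace, ContinuousAt f s) (hg : ∀ s ∈ C.trace, ContinuousAt g s) :
    C.integralW L (fun s => f s - g s) = C.integralW L f - C.integralW L g := by
  unfold integralW
  rw [← C.pathIntegral_sub (continuousOn_weight hL hf) (continuousOn_weight hL hg)]
  simp only [sub_mul]

theorem integralW_const_mul (L : ℝ → ℂ) (c : ℂ) (f : ℂ → ℂ) :
    C.integralW L (fun s => c * f s) = c * C.integralW L f := by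
  unfold integralW
  rw [← pathIntegral_const_mul]
  simp only [mul_assoc]

theorem integralW_sum {ι : Type*} {S : Finset ι} {L : ℝ → ℂ} (hL : ContinuousOn L (Set.Icc 0 1))
    {f : ι → ℂ → ℂ} (hf : ∀ i ∈ S, ∀ s ∈ C.trace, ContinuousAt (f i) s) :
    C.integralW L (fun s => ∑ i ∈ S, f i s) = ∑ i ∈ S, C.integralW L (f i) := by
  unfold integralW
  rw [← C.pathIntegral_sum S fun i hi => continuousOn_weight hL (hf i hi)]
  simp only [Finset.sum_mul]

theorem integralW_weight_sub {L M : ℝ → ℂ} (hL : ContinuousOn L (Set.Icc 0 1))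
    (hM : ContinuousOn M (Set.Icc 0 1)) {f : ℂ → ℂ} (hf : ∀ s ∈ C.trace, ContinuousAt f s) :
    C.integralW (fun t => L t - M t) f = C.integralW L f - C.integralW M f := by
  unfold integralW
  rw [← C.pathIntegral_sub (continuousOn_weight hL hf) (continuousOn_weight hM hf)]
  simp only [mul_sub]

/-- `p` is not on the contour, modulo `iπ`. -/
def OffMod (C : Contour) (p : ℂ) : Prop := ∀ s ∈ C.trace, sinh (s - p) ≠ 0

theorem OutsideMod.offMod {p : ℂ} (hp : C.OutsideMod p) : C.OffMod p := fun _ hs =>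
  sinh_sub_ne_zero_of_outsideMod hp (Or.inl hs)

theorem offMod_of_mem {p : ℂ} (hp : p ∈ C.inner) : C.OffMod p := fun _ hs =>
  sinh_sub_ne_zero_of_inner_of_trace hp hs

theorem OffMod.continuousAt {p : ℂ} (hp : C.OffMod p) :
    ∀ s ∈ C.trace, ContinuousAt (fun s => coth (s - p)) s := fun s hs =>
  (analyticAt_coth_comp (analyticAt_id.sub analyticAt_const) (hp s hs)).continuousAt

theorem cothInt_add_int (L : ℝ → ℂ) (p : ℂ) (k : ℤ) :
    C.cothInt L (p + k * (Real.pi * I)) = C.cothInt L p := integralW_coth_add_int L p k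

end Contour

namespace Params

variable {P : Params} {h : ℝ} {μ : Fin P.N → ℂ} {C C' : Contour} {n : ℕ} {x y : Fin n → ℂ}

variable (P) in
/-- Twice the part of the exponent that is built from `φ₂` and the first two terms of `φ₁`. -/
noncomputable def expX (C : Contour) (L : ℝ → ℂ) (w : Fin P.N → ℂ) : ℂ :=
  (∑ i, (C.cothInt L (-w i) - C.cothInt L (P.iζ - w i))) -
    P.N * (C.cothInt L P.b - C.cothInt L (P.iζ + P.b)) +
    (C.cothInt L (P.iζ / 2) + C.cothInt L ((P.iζ - Real.pi * I) / 2) + C.cothInt L 0 +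
      C.cothInt L (Real.pi * I / 2))

theorem inner_integral {L' : ℝ → ℂ} {e : ℂ → ℂ} {φ : ℂ → ℂ} {w : Fin P.N → ℂ} {s : ℂ}
    (h1 : C'.OutsideMod (-s)) (h2 : C'.OutsideMod (P.iζ - s))
    (hF' : C'.IsFactored φ (-P.b) P.N w e) (hL' : C'.IsLogAlong φ L') :
    C'.integralW L' (P.φ₂ s) = P.N * ((coth (s - (P.iζ + P.b)) - coth (s - P.b)) / 2) -
      ∑ i, (coth (s - (P.iζ - w i)) - coth (s - -w i)) / 2 := by
  have n1 : ∀ s' ∈ C'.hull, sinh (s + s') ≠ 0 := fun s' hs' => by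
    have := Contour.sinh_sub_ne_zero_of_outsideMod h1 hs'
    rwa [sub_neg_eq_add, add_comm] at this
  have n2 : ∀ s' ∈ C'.hull, sinh (s + s' - P.iζ) ≠ 0 := fun s' hs' => by
    have := Contour.sinh_sub_ne_zero_of_outsideMod h2 hs'
    rwa [sub_sub_eq_add_sub, add_comm] at this
  have hd : ∀ s' ∈ C'.trace, P.φ₂ s s' =
      deriv (fun s' => (coth (s + s' - P.iζ) - coth (s + s')) / 2) s' := by
    intro s' hs'
    have d1 := hasDerivAt_coth (n1 s' (Or.inl hs'))
    have d2 := hasDerivAt_coth (n2 s' (Or.inl hs'))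
    have d3 := d1.comp s' ((hasDerivAt_id s').const_add s)
    have d4 := d2.comp s' (((hasDerivAt_id s').const_add s).sub_const P.iζ)
    rw [φ₂, d1.deriv, d2.deriv]
    exact ((d4.sub d3).div_const 2).deriv.symm ▸ by simp
  rw [Contour.integralW_congr hd, hF'.integralW_deriv hL' fun s' hs' => ?_]
  · congr 2
    · ring_nf
    · funext i
      congr 3 <;> ring
  · exact AnalyticAt.div ((analyticAt_coth_comp ((analyticAt_const.add analyticAt_id).sub
      analyticAt_const) (n2 s' hs')).sub (analyticAt_coth_comp (analyticAt_const.add analyticAt_id)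
      (n1 s' hs'))) analyticAt_const two_ne_zero

theorem coth_two_mul {z : ℂ} (h0 : sinh (2 * z) ≠ 0) :
    coth (2 * z) = (coth z + coth (z - Real.pi * I / 2)) / 2 := by
  have e1 : sinh (z - Real.pi * I / 2) = -I * cosh z := by
    rw [sinh_sub, show (Real.pi : ℂ) * I / 2 = (Real.pi / 2 : ℂ) * I by ring, cosh_mul_I,
      sinh_mul_I, Complex.cos_pi_div_two, Complex.sin_pi_div_two]
    ring
  have e2 : cosh (z - Real.pi * I / 2) = -I * sinh z := by
    rw [cosh_sub, show (Real.pi : ℂ) * I / 2 = (Real.pi / 2 : ℂ) * I by ring, cosh_mul_I,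
      sinh_mul_I, Complex.cos_pi_div_two, Complex.sin_pi_div_two]
    ring
  rw [sinh_two_mul] at h0
  have h1 : sinh z ≠ 0 := fun h => h0 (by simp [h])
  have h2 : cosh z ≠ 0 := fun h => h0 (by simp [h])
  rw [coth, coth, coth, e1, e2, cosh_two_mul, sinh_two_mul]
  field_simp

theorem sinh_two_mul_sub (s p : ℂ) : sinh (2 * s - 2 * p) =
    2 * -I * (sinh (s - p) * sinh (s - (p - Real.pi * I / 2))) := by
  have e1 : sinh (s - (p - Real.pi * I / 2)) = I * cosh (s - p) := by
    rw [show s - (p - Real.pi * I / 2) = (s - p) + Real.pi / 2 * I by ring, sinh_add, cosh_mul_I,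
      sinh_mul_I, Complex.cos_pi_div_two, Complex.sin_pi_div_two]
    ring
  rw [e1, show 2 * s - 2 * p = 2 * (s - p) by ring, sinh_two_mul]
  linear_combination (2 * sinh (s - p) * cosh (s - p)) * I_sq

theorem BaseContour.offMod_ξm (hC : P.BaseContour C) : C.OffMod (-P.ξm) := fun s hs h0 => by
  obtain ⟨k, hk⟩ := sinh_eq_zero_iff.1 h0
  refine hC.ξm_off k ?_
  rw [← hk]
  simpa using! hs

/-- The simple integrals in the exponent. -/
theorem integralW_φ₁ (hC : P.BaseContour C) {L : ℝ → ℂ} (hL : ContinuousOn L (Set.Icc 0 1)) :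
    C.integralW L P.φ₁ = (C.cothInt L (P.iζ / 2) + C.cothInt L ((P.iζ - Real.pi * I) / 2) +
      C.cothInt L 0 + C.cothInt L (Real.pi * I / 2)) / 2 - C.cothInt L (-P.ξm) := by
  have o1 := hC.half_shift.1.offMod
  have o2 := hC.half_shift.2.offMod
  have o3 := Contour.offMod_of_mem hC.zero_mem
  have o4 := hC.half_period.offMod
  have o5 := hC.offMod_ξm
  have o4' : ∀ s ∈ C.trace, sinh (s - (0 - Real.pi * I / 2)) ≠ 0 := fun s hs h0 => by
    refine o4 s hs ?_
    have := sinh_add_int_mul_pi (s - (0 - Real.pi * I / 2)) (-1)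
    rw [h0, mul_zero] at this
    rw [← this]
    congr 1
    push_cast
    ring
  have key : ∀ s ∈ C.trace, P.φ₁ s = (1 / 2 : ℂ) * (coth (s - P.iζ / 2) +
      coth (s - (P.iζ - Real.pi * I) / 2) + coth (s - 0) + coth (s - Real.pi * I / 2)) -
      coth (s - -P.ξm) := by
    intro s hs
    have n1 : sinh (2 * (s - P.iζ / 2)) ≠ 0 := by
      rw [mul_sub, sinh_two_mul_sub]
      refine mul_ne_zero (mul_ne_zero two_ne_zero (neg_ne_zero.2 I_ne_zero)) (mul_ne_zero (o1 s hs) ?_)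
      rw [show P.iζ / 2 - Real.pi * I / 2 = (P.iζ - Real.pi * I) / 2 by ring]
      exact o2 s hs
    have n2 : sinh (2 * s) ≠ 0 := by
      have := sinh_two_mul_sub s 0
      rw [mul_zero, sub_zero, sub_zero] at this
      rw [this]
      refine mul_ne_zero (mul_ne_zero two_ne_zero (neg_ne_zero.2 I_ne_zero)) (mul_ne_zero ?_ (o4' s hs))
      simpa using o3 s hs
    have c1 := coth_two_mul n1
    have c2 := coth_two_mul n2
    rw [φ₁, show 2 * s - P.iζ = 2 * (s - P.iζ / 2) by ring, c1, c2, sub_zero, sub_neg_eq_add,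
      show s - (P.iζ - Real.pi * I) / 2 =
        s - P.iζ / 2 - Real.pi * I / 2 + (1 : ℤ) * (Real.pi * I) by push_cast; ring,
      coth_add_int_mul_pi]
    ring
  rw [Contour.integralW_congr key]
  have cc := fun p (hp : C.OffMod p) => hp.continuousAt
  rw [Contour.integralW_sub hL (f := fun s => (1 / 2 : ℂ) * (coth (s - P.iζ / 2) +
      coth (s - (P.iζ - Real.pi * I) / 2) + coth (s - 0) + coth (s - Real.pi * I / 2)))
      (fun s hs => continuousAt_const.mul ((((cc _ o1 s hs).add (cc _ o2 s hs)).add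
        (cc _ o3 s hs)).add (cc _ o4 s hs))) (cc _ o5), Contour.integralW_const_mul,
    Contour.integralW_add hL (f := fun s => coth (s - P.iζ / 2) +
      coth (s - (P.iζ - Real.pi * I) / 2) + coth (s - 0))
      (fun s hs => ((cc _ o1 s hs).add (cc _ o2 s hs)).add (cc _ o3 s hs)) (cc _ o4),
    Contour.integralW_add hL (f := fun s => coth (s - P.iζ / 2) +
      coth (s - (P.iζ - Real.pi * I) / 2))
      (fun s hs => (cc _ o1 s hs).add (cc _ o2 s hs)) (cc _ o3),
    Contour.integralW_add hL (cc _ o1) (cc _ o2)]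
  unfold Contour.cothInt
  ring

theorem logDeriv_mul_sinh {p q s : ℂ} (hp : sinh (s - p) ≠ 0) (hq : sinh (s - q) ≠ 0) :
    logDeriv (fun s => sinh (s - p) * sinh (s - q)) s = coth (s - p) + coth (s - q) := by
  rw [logDeriv_mul (f := fun s => sinh (s - p)) (g := fun s => sinh (s - q)) s hp hq
    (by fun_prop) (by fun_prop), logDeriv_sinh_sub, logDeriv_sinh_sub]

theorem integralW_sinh₂ (hC : P.BaseContour C) {L : ℝ → ℂ} (hL : ContinuousOn L (Set.Icc 0 1)) :
    C.integralW L (logDeriv fun s => sinh₂ s (P.iζ + P.b)) =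
      C.cothInt L (-(P.iζ + P.b)) + C.cothInt L (P.iζ + P.b) := by
  have o1 := hC.shift.1.offMod
  have o2 := hC.shift.2.offMod
  rw [Contour.integralW_congr (g := fun s => coth (s - -(P.iζ + P.b)) + coth (s - (P.iζ + P.b)))
    fun s hs => ?_, Contour.integralW_add hL o2.continuousAt o1.continuousAt]
  · rfl
  · rw [← logDeriv_mul_sinh (o2 s hs) (o1 s hs)]
    unfold sinh₂
    simp only [sub_neg_eq_add]

theorem integralW_logDeriv_f {L : ℝ → ℂ} (hL : ContinuousOn L (Set.Icc 0 1)) {p : ℂ}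
    (h1 : C.OffMod (-p)) (h2 : C.OffMod (P.iζ - p)) :
    C.integralW L (logDeriv fun s => P.f s p) = C.cothInt L (P.iζ - p) - C.cothInt L (-p) := by
  rw [Contour.integralW_congr (g := fun s => coth (s - (P.iζ - p)) - coth (s - -p))
    fun s hs => ?_, Contour.integralW_sub hL h2.continuousAt h1.continuousAt]
  · rfl
  · have e : (fun s => P.f s p) = fun s => sinh (s - (P.iζ - p)) / sinh (s - -p) := by
      funext s
      rw [f]
      congr 2 <;> ring
    rw [e, logDeriv_div (f := fun s => sinh (s - (P.iζ - p))) (g := fun s => sinh (s - -p)) s (h2 s hs) (h1 s hs)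
      (by fun_prop) (by fun_prop), logDeriv_sinh_sub,
      logDeriv_sinh_sub]

/-- The double integral of `φ₂`. -/
theorem double_integral (hC : P.BaseContour C) {L L' : ℝ → ℂ} (hL : ContinuousOn L (Set.Icc 0 1))
    {e : ℂ → ℂ} {φ : ℂ → ℂ} {w : Fin P.N → ℂ}
    (h1 : ∀ s ∈ C.trace, C'.OutsideMod (-s) ∧ C'.OutsideMod (P.iζ - s))
    (hF' : C'.IsFactored φ (-P.b) P.N w e) (hL' : C'.IsLogAlong φ L')
    (hw : ∀ i, C.OffMod (-w i) ∧ C.OffMod (P.iζ - w i)) :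
    ContinuousOn (fun t => C'.integralW L' (P.φ₂ (C.toFun t)) * L t) (Set.Icc 0 1) ∧
    C.integralW L (fun s => C'.integralW L' (P.φ₂ s)) =
      ((∑ i, (C.cothInt L (-w i) - C.cothInt L (P.iζ - w i))) -
        P.N * (C.cothInt L P.b - C.cothInt L (P.iζ + P.b))) / 2 := by
  have key : ∀ s ∈ C.trace, C'.integralW L' (P.φ₂ s) =
      (P.N / 2 : ℂ) * (coth (s - (P.iζ + P.b)) - coth (s - P.b)) -
      ∑ i, (1 / 2 : ℂ) * (coth (s - (P.iζ - w i)) - coth (s - -w i)) := fun s hs => by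
    rw [inner_integral (h1 s hs).1 (h1 s hs).2 hF' hL']
    congr 1
    · ring
    · exact Finset.sum_congr rfl fun i _ => by ring
  have o1 := hC.shift.1.offMod
  have o2 := Contour.offMod_of_mem hC.b_mem
  have cc := fun p (hp : C.OffMod p) => hp.continuousAt
  have c1 : ∀ s ∈ C.trace, ContinuousAt (fun s => (P.N / 2 : ℂ) * (coth (s - (P.iζ + P.b)) -
      coth (s - P.b))) s := fun s hs =>
    continuousAt_const.mul ((cc _ o1 s hs).sub (cc _ o2 s hs))
  have c2 : ∀ i ∈ Finset.univ, ∀ s ∈ C.trace, ContinuousAt (fun s => (1 / 2 : ℂ) *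
      (coth (s - (P.iζ - w i)) - coth (s - -w i))) s := fun i _ s hs =>
    continuousAt_const.mul ((cc _ (hw i).2 s hs).sub (cc _ (hw i).1 s hs))
  have c3 : ∀ s ∈ C.trace, ContinuousAt (fun s => ∑ i, (1 / 2 : ℂ) *
      (coth (s - (P.iζ - w i)) - coth (s - -w i))) s := fun s hs =>
    tendsto_finsetSum _ fun i hi => c2 i hi s hs
  constructor
  · exact (Contour.continuousOn_weight hL (f := fun s => (P.N / 2 : ℂ) *
      (coth (s - (P.iζ + P.b)) - coth (s - P.b)) -
      ∑ i, (1 / 2 : ℂ) * (coth (s - (P.iζ - w i)) - coth (s - -w i)))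
      fun s hs => (c1 s hs).sub (c3 s hs)).congr fun t ht => by
        rw [key _ (C.mem_trace ht)]
  · rw [Contour.integralW_congr key, Contour.integralW_sub hL c1 c3, Contour.integralW_sum hL c2,
      Contour.integralW_const_mul, Contour.integralW_sub hL (cc _ o1) (cc _ o2),
      Finset.sum_congr rfl fun i _ => by
        rw [Contour.integralW_const_mul, Contour.integralW_sub hL (cc _ (hw i).2) (cc _ (hw i).1)],
      ← Finset.mul_sum]
    unfold Contour.cothInt
    rw [Finset.sum_sub_distrib, Finset.sum_sub_distrib]
    ring

end Params

theorem sinh_sub_half_period (z : ℂ) : sinh (z - Real.pi * I / 2) = -I * cosh z := by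
  rw [sinh_sub, show (Real.pi : ℂ) * I / 2 = (Real.pi / 2 : ℂ) * I by ring, cosh_mul_I,
    sinh_mul_I, Complex.cos_pi_div_two, Complex.sin_pi_div_two]
  ring

namespace Params

variable {P : Params} {C C' : Contour}

variable (P) in
/-- The exponent of a state, without the contribution of the boundary parameter. -/
noncomputable def stateExp (C : Contour) (L : ℝ → ℂ) (w : Fin P.N → ℂ) : ℂ :=
  P.expX C L w / 2 - P.N * (C.cothInt L (-(P.iζ + P.b)) + C.cothInt L (P.iζ + P.b))

variable (P) in
/-- The regular part of `φ(-u)` for a function `φ = e · ∏ sinh(s - w_i) / sinh(s + β/N)^N`. -/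
noncomputable def regE (e : ℂ → ℂ) (u : ℂ) : ℂ := e (-u) / sinh (u - P.b) ^ P.N

variable (P) in
/-- The square of the amplitude of a state, as a function of the zeros of `φ`. -/
noncomputable def ampSq (φ₀ : ℂ) (e : ℂ → ℂ) (w : Fin P.N → ℂ) : ℂ :=
  (∏ i, P.regE e (w i)) * (∏ i, ∏ l, sinh (w l + w i - P.iζ)) /
    ((∏ i, sinh (2 * w i)) * ∏ i, sinh (2 * w i - P.iζ)) *
    ((∏ i, sinh (w i - P.b)) * ∏ i, sinh (w i - -(P.iζ + P.b))) ^ (2 * P.N) * φ₀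

variable (P) in
/-- A constant that does not depend on the state. -/
noncomputable def ampConst : ℂ :=
  ((-1) ^ P.N) ^ P.N * (-1) ^ P.N * sinh (-P.b - (P.iζ + P.b)) ^ (P.N * P.N) *
    sinh (2 * -P.b - P.iζ) ^ P.N * sinh (2 * P.b) ^ P.N /
    ((sinh (2 * P.b) ^ P.N) ^ P.N *
      (sinh (-P.b - (P.iζ + P.b)) ^ P.N * sinh (-P.b - -(P.iζ + P.b)) ^ P.N) ^ (2 * P.N))

theorem prod_sinh_neg {N : ℕ} (g : Fin N → ℂ) :
    ∏ i, sinh (-g i) = (-1) ^ N * ∏ i, sinh (g i) := by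
  simp_rw [sinh_neg]
  rw [Finset.prod_neg]
  simp

section Factored

variable {φ : ℂ → ℂ} {w : Fin P.N → ℂ} {e : ℂ → ℂ} {L : ℝ → ℂ}

theorem factored_neg (hF : C.IsFactored φ (-P.b) P.N w e) {u : ℂ} (hu : -u ∈ C.hull)
    (hub : sinh (u - P.b) ≠ 0) : φ (-u) = P.regE e u * ∏ l, sinh (u + w l) := by
  have h1 := (hF.eq _ hu).self_of_nhds (fun h0 => hub (by
    rw [neg_inj.1 h0, sub_self, sinh_zero]))
  rw [sub_neg_eq_add, show -u + P.b = -(u - P.b) by ring, sinh_neg, neg_pow,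
    show (∏ i, sinh (-u - w i)) = ∏ i, sinh (-(u + w i)) from
      Finset.prod_congr rfl fun i _ => by ring_nf, prod_sinh_neg] at h1
  have hs : (-1 : ℂ) ^ P.N ≠ 0 := pow_ne_zero _ (by norm_num)
  have h2 : sinh (u - P.b) ^ P.N ≠ 0 := pow_ne_zero _ hub
  rw [regE, div_mul_eq_mul_div, eq_div_iff h2]
  exact mul_left_cancel₀ hs (by linear_combination h1)

theorem exp_stateExp (hC : P.BaseContour C) (hb : sinh (2 * P.b) ≠ 0)
    (hF : C.IsFactored φ (-P.b) P.N w e) (hL : C.IsLogAlong φ L) (hφb : φ P.b = 1)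
    (hφ0 : φ 0 ≠ 0) (hw : ∀ i, -w i ∈ C.inner ∧ C.OutsideMod (P.iζ - w i)) :
    exp (2 * P.stateExp C L w) = P.ampConst * P.ampSq (φ 0) e w := by
  have hb0 : P.b ≠ 0 := fun h0 => hb (by rw [h0]; simp)
  have hbs : sinh P.b ≠ 0 := fun h0 => hb (by rw [sinh_two_mul, h0]; ring)
  have hbb : P.b ≠ -P.b := fun h0 => hb0 (by
    have : (2 : ℂ) * P.b = 0 := by linear_combination h0
    simpa using this)
  have f1 := (hF.eq _ (Or.inr hC.b_mem)).self_of_nhds hbb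
  have f2 := (hF.eq _ (Or.inr hC.zero_mem)).self_of_nhds (neg_ne_zero.2 hb0).symm
  rw [hφb, one_mul, show P.b - -P.b = 2 * P.b by ring,
    show (∏ i, sinh (P.b - w i)) = ∏ i, sinh (-(w i - P.b)) from
      Finset.prod_congr rfl fun i _ => by ring_nf, prod_sinh_neg] at f1
  rw [sub_neg_eq_add, zero_add, show (∏ i, sinh (0 - w i)) = ∏ i, sinh (-(w i)) from
      Finset.prod_congr rfl fun i _ => by ring_nf, prod_sinh_neg] at f2
  have nB : ∏ i, sinh (w i - P.b) ≠ 0 := fun h0 => by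
    rw [h0, mul_zero, mul_zero] at f1
    exact pow_ne_zero _ hb f1
  have nS : ∏ i, sinh (w i) ≠ 0 := fun h0 => by
    rw [h0, mul_zero, mul_zero] at f2
    exact mul_ne_zero hφ0 (pow_ne_zero _ hbs) f2
  have nC : ∀ i, cosh (w i) ≠ 0 := fun i h0 => by
    have := Contour.sinh_sub_ne_zero_of_outsideMod hC.half_period (Or.inr (hF.w_mem i))
    rw [sinh_sub_half_period, h0, mul_zero] at this
    exact this rfl
  have o1 : ∏ i, sinh (w i - (P.iζ + P.b)) ≠ 0 := Finset.prod_ne_zero_iff.2 fun i _ =>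
    Contour.sinh_sub_ne_zero_of_outsideMod hC.shift.1 (Or.inr (hF.w_mem i))
  have o2 : ∏ i, sinh (w i - -(P.iζ + P.b)) ≠ 0 := Finset.prod_ne_zero_iff.2 fun i _ =>
    Contour.sinh_sub_ne_zero_of_outsideMod hC.shift.2 (Or.inr (hF.w_mem i))
  have v1 := hF.exp_coth_outside hL hC.shift.1
  have v2 := hF.exp_coth_outside hL hC.shift.2
  have v3 := hF.exp_coth_outside hL hC.half_shift.1
  have v4 := hF.exp_coth_outside hL hC.half_shift.2
  have v5 := hF.exp_coth_outside hL hC.half_period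
  have v6 := hF.exp_coth_inside hL hC.zero_mem
  have v7 := hF.exp_coth_inside hL hC.b_mem
  have v8 := fun i => hF.exp_coth_inside hL (hw i).1
  have v9 := fun i => hF.exp_coth_outside hL (hw i).2
  have hhalf : ∀ s, sinh (s - P.iζ / 2) * sinh (s - (P.iζ - Real.pi * I) / 2) =
      sinh (2 * s - P.iζ) / (2 * -I) := fun s => by
    have := sinh_two_mul_sub s (P.iζ / 2)
    rw [show 2 * s - 2 * (P.iζ / 2) = 2 * s - P.iζ by ring,
      show P.iζ / 2 - Real.pi * I / 2 = (P.iζ - Real.pi * I) / 2 by ring] at this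
    rw [this, mul_div_cancel_left₀ _ (mul_ne_zero two_ne_zero (neg_ne_zero.2 I_ne_zero))]
  have hI : (2 * -I : ℂ) ^ P.N ≠ 0 :=
    pow_ne_zero _ (mul_ne_zero two_ne_zero (neg_ne_zero.2 I_ne_zero))
  have v34 : exp (C.cothInt L (P.iζ / 2)) * exp (C.cothInt L ((P.iζ - Real.pi * I) / 2)) =
      sinh (2 * -P.b - P.iζ) ^ P.N / ∏ i, sinh (2 * w i - P.iζ) := by
    rw [Contour.cothInt, Contour.cothInt, v3, v4, div_mul_div_comm, ← mul_pow, hhalf,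
      ← Finset.prod_mul_distrib, Finset.prod_congr rfl fun i _ => hhalf (w i), Finset.prod_div_distrib,
      Finset.prod_const, Finset.card_univ, Fintype.card_fin, div_pow, div_div_div_cancel_right₀ hI]
  have v56 : exp (C.cothInt L 0) * exp (C.cothInt L (Real.pi * I / 2)) =
      (-1) ^ P.N * φ 0 * sinh (2 * P.b) ^ P.N / ∏ i, sinh (2 * w i) := by
    rw [Contour.cothInt, Contour.cothInt, v5, v6]
    simp_rw [sinh_sub_half_period]
    rw [Finset.prod_mul_distrib, Finset.prod_const, Finset.card_univ, Fintype.card_fin, mul_pow,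
      mul_div_mul_left _ _ (pow_ne_zero _ (neg_ne_zero.2 I_ne_zero))]
    simp_rw [sinh_two_mul, mul_assoc (2 : ℂ)]
    rw [Finset.prod_mul_distrib, Finset.prod_const, Finset.card_univ, Fintype.card_fin, mul_pow,
      Finset.prod_mul_distrib, cosh_neg]
    have hC' : ∏ i, cosh (w i) ≠ 0 := Finset.prod_ne_zero_iff.2 fun i _ => nC i
    have h2 : (2 : ℂ) ^ P.N ≠ 0 := pow_ne_zero _ two_ne_zero
    have hss : ((-1 : ℂ) ^ P.N) * (-1) ^ P.N = 1 := by rw [← mul_pow]; norm_num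
    rw [mul_pow, eq_div_iff (mul_ne_zero h2 (mul_ne_zero nS hC'))]
    generalize (∏ i, cosh (w i)) = c at *
    generalize (∏ i, sinh (w i)) = s at *
    generalize (-1 : ℂ) ^ P.N = σ at *
    generalize (2 : ℂ) ^ P.N = τ at *
    generalize sinh P.b ^ P.N = s' at *
    generalize cosh P.b ^ P.N = c' at *
    field_simp
    linear_combination (-c' * σ) * f2 - (c' * e 0 * s) * hss
  have v89 : exp (∑ i, (C.cothInt L (-w i) - C.cothInt L (P.iζ - w i))) =
      (∏ i, P.regE e (w i)) * (∏ i, sinh (w i - P.b)) ^ P.N *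
        (∏ i, ∏ l, sinh (w l + w i - P.iζ)) / (∏ i, sinh (w i - (P.iζ + P.b))) ^ P.N := by
    rw [exp_sum]
    have : ∀ i, exp (C.cothInt L (-w i) - C.cothInt L (P.iζ - w i)) =
        P.regE e (w i) * sinh (w i - P.b) ^ P.N * (∏ l, sinh (w l + w i - P.iζ)) /
          sinh (w i - (P.iζ + P.b)) ^ P.N := fun i => by
      have nb := Finset.prod_ne_zero_iff.1 nB i (Finset.mem_univ i)
      rw [exp_sub, Contour.cothInt, Contour.cothInt, v8, v9, regE,
        div_mul_cancel₀ _ (pow_ne_zero _ nb), div_div_eq_mul_div,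
        show -P.b - (P.iζ - w i) = w i - (P.iζ + P.b) by ring]
      simp_rw [show ∀ l, w l - (P.iζ - w i) = w l + w i - P.iζ from fun l => by ring]
    rw [Finset.prod_congr rfl fun i _ => this i, Finset.prod_div_distrib, Finset.prod_mul_distrib,
      Finset.prod_mul_distrib, Finset.prod_pow, Finset.prod_pow]
  have hexp : exp (2 * P.stateExp C L w) =
      exp (∑ i, (C.cothInt L (-w i) - C.cothInt L (P.iζ - w i))) *
      (exp (C.cothInt L (P.iζ + P.b)) / exp (C.cothInt L P.b)) ^ P.N *
      (exp (C.cothInt L (P.iζ / 2)) * exp (C.cothInt L ((P.iζ - Real.pi * I) / 2))) *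
      (exp (C.cothInt L 0) * exp (C.cothInt L (Real.pi * I / 2))) /
      (exp (C.cothInt L (P.iζ + P.b)) * exp (C.cothInt L (-(P.iζ + P.b)))) ^ (2 * P.N) := by
    rw [← exp_sub, ← exp_add, ← exp_add, ← exp_add, ← exp_nat_mul, ← exp_nat_mul, ← exp_add,
      ← exp_add, ← exp_add, ← exp_sub]
    congr 1
    unfold stateExp expX
    push_cast
    ring
  rw [hexp, v34, v56, v89, Contour.cothInt, Contour.cothInt, Contour.cothInt, v1, v2, v7, ampSq,
    ampConst]
  have he : e P.b = sinh (2 * P.b) ^ P.N / ((-1) ^ P.N * ∏ i, sinh (w i - P.b)) := by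
    rw [eq_div_iff (mul_ne_zero (pow_ne_zero _ (by norm_num)) nB)]
    exact f1.symm
  rw [he]
  generalize (∏ i, sinh (w i - P.b)) = p1 at *
  generalize (∏ i, sinh (w i - (P.iζ + P.b))) = p2 at *
  generalize (∏ i, sinh (w i - -(P.iζ + P.b))) = p3 at *
  generalize (∏ i, P.regE e (w i)) = p4 at *
  generalize (∏ i, ∏ l, sinh (w l + w i - P.iζ)) = p5 at *
  generalize (∏ i, sinh (2 * w i - P.iζ)) = p6 at *
  generalize (∏ i, sinh (2 * w i)) = p7 at *
  generalize (-1 : ℂ) ^ P.N = σ at *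
  generalize sinh (-P.b - (P.iζ + P.b)) = s1 at *
  generalize sinh (-P.b - -(P.iζ + P.b)) = s2 at *
  generalize sinh (2 * -P.b - P.iζ) = s3 at *
  generalize φ 0 = z at *
  have n4 : sinh (2 * P.b) ^ P.N ≠ 0 := pow_ne_zero _ hb
  generalize sinh (2 * P.b) ^ P.N = s4 at *
  simp only [div_pow, mul_pow, pow_mul s1 P.N P.N, div_mul_div_comm, div_div_div_eq]
  rw [pow_mul' p3, pow_mul' p1, pow_mul' p2, pow_mul' (s1 ^ P.N), pow_mul' (s2 ^ P.N), pow_two,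
    pow_two, pow_two]
  have m1 : p1 ^ P.N ≠ 0 := pow_ne_zero _ nB
  have m2 : p2 ^ P.N ≠ 0 := pow_ne_zero _ o1
  have m3 : p3 ^ P.N ≠ 0 := pow_ne_zero _ o2
  have m4 : s4 ^ P.N ≠ 0 := pow_ne_zero _ n4
  generalize p1 ^ P.N = q1 at *
  generalize p2 ^ P.N = q2 at *
  generalize p3 ^ P.N = q3 at *
  generalize s4 ^ P.N = q4 at *
  generalize (s1 ^ P.N) ^ P.N = q5 at *
  generalize (s2 ^ P.N) ^ P.N = q6 at *
  field_simp

end Factored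
end Params

namespace Params

variable {P : Params} {h : ℝ} {μ : Fin P.N → ℂ} {C : Contour} {n : ℕ} {x y : Fin n → ℂ}
  {w : Fin P.N → ℂ} {e : ℂ → ℂ} {L : ℝ → ℂ}

variable (P) in
/-- A state together with the factorization of `1 + â` inside of the contour: the zeros `w` are the
roots `μ`, with the particles `y` replaced by the holes `x`. -/
structure StateData (h : ℝ) (μ : Fin P.N → ℂ) (C : Contour) {n : ℕ} (x y : Fin n → ℂ)
    (w : Fin P.N → ℂ) (e : ℂ → ℂ) : Prop where
  base : P.BaseContour C
  pos : 0 < P.N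
  b_ne : sinh (2 * P.b) ≠ 0
  bethe : P.IsBethe h μ
  fac : C.IsFactored (fun s => 1 + P.countingFn h μ s) (-P.b) P.N w e
  single : ∀ F : ℂ → ℂ, (∏ k, F (μ k)) * ∏ j, F (x j) = (∏ k, F (w k)) * ∏ j, F (y j)
  pairs : ∀ F : ℂ → ℂ → ℂ, (∀ u v, F u v = F v u) →
    (∏ i, ∏ j ∈ Finset.Ioi i, F (μ i) (μ j)) * (∏ k, ∏ j, F (w k) (x j)) *
        (∏ i, ∏ j, F (x i) (y j)) =
      (∏ i, ∏ j ∈ Finset.Ioi i, F (w i) (w j)) * (∏ k, ∏ j, F (w k) (y j)) *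
        ((∏ i, ∏ j ∈ Finset.Ioi i, F (y i) (y j)) * (∏ i, ∏ j ∈ Finset.Ioi i, F (x i) (x j)) *
          ∏ i, F (x i) (x i))
  w_zero : ∀ i, P.countingFn h μ (w i) = -1
  w_neg : ∀ i, -w i ∈ C.inner ∧ C.OutsideMod (P.iζ - w i)
  x_mem : ∀ j, ∃ i, x j = w i
  y_mem : ∀ j, ∃ k, y j = μ k
  y_neg : ∀ j, C.OutsideMod (-y j) ∧ C.OutsideMod (P.iζ - y j)
  a_zero : ‖P.countingFn h μ 0‖ < 1
  a_neg : ∀ k, ‖P.countingFn h μ (-μ k)‖ < 1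
  add_ne : ∀ j k, sinh (μ j + μ k) ≠ 0
  add_sub_ne : ∀ j k, sinh (μ j + μ k - P.iζ) ≠ 0

variable (P) in
/-- The particle-hole factor without the hole factor and the boundary parameter. -/
noncomputable def Kfac (a : ℂ → ℂ) (C : Contour) (L : ℝ → ℂ) {n : ℕ} (x y : Fin n → ℂ) : ℂ :=
  (∏ i, ∏ j ∈ Finset.Ioi i, P.f (y i) (y j)) / (∏ i, ∏ j, P.f (x i) (y j)) *
  (∏ i, sinh (2 * x i - P.iζ) / sinh (2 * y i) * (1 + a (-y i)) ^ (1 / 2 : ℂ)) *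
  (∏ i, (sinh₂ (P.iζ + P.b) (y i) / sinh₂ (P.iζ + P.b) (x i)) ^ P.N) *
  ((∏ i, exp (C.cothInt L (-y i) - C.cothInt L (P.iζ - y i))) /
    ∏ i, exp (C.cothInt L (-x i) - C.cothInt L (P.iζ - x i)))

variable (P) in
/-- The amplitude of a state, as a product over the roots. -/
noncomputable def stateW (h : ℝ) (μ : Fin P.N → ℂ) : ℂ :=
  (∏ i, ∏ j ∈ Finset.Ioi i, P.f (μ i) (μ j)) / (∏ i, sinh (2 * μ i)) *
  (∏ i, sinh (μ i - P.b) * sinh (μ i - -(P.iζ + P.b))) ^ P.N *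
  (∏ i, (1 + P.countingFn h μ (-μ i)) ^ (1 / 2 : ℂ)) *
  (1 + P.countingFn h μ 0) ^ (1 / 2 : ℂ)

theorem one_add_ne_zero_of_norm_lt_one {a : ℂ} (ha : ‖a‖ < 1) : 1 + a ≠ 0 := fun h0 => by
  have : a = -1 := by linear_combination h0
  rw [this] at ha
  norm_num at ha

theorem sq_cpow_half (z : ℂ) : (z ^ (1 / 2 : ℂ)) ^ 2 = z := by
  simp

theorem f_comm (u v : ℂ) : P.f u v = P.f v u := by rw [f, f, add_comm]

theorem countingFn_b (hN : 0 < P.N) : P.countingFn h μ P.b = 0 := by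
  rw [countingFn, sub_self, sinh_zero, zero_mul, zero_div, zero_pow hN.ne', mul_zero]

namespace StateData

theorem countingFn_eq_of_sinh (u v : ℂ) (h0 : sinh (u - v) = 0) :
    P.countingFn h μ u = P.countingFn h μ v := by
  obtain ⟨k, hk⟩ := sinh_eq_zero_iff.1 h0
  rw [show u = v + k * (Real.pi * I) by linear_combination hk, countingFn_add_int]

theorem mu_add_w (D : P.StateData h μ C x y w e) (k l : Fin P.N) : sinh (μ k + w l) ≠ 0 :=
  fun h0 => by
    have := countingFn_eq_of_sinh (P := P) (h := h) (μ := μ) (-μ k) (w l) (by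
      rw [show -μ k - w l = -(μ k + w l) by ring, sinh_neg, h0, neg_zero])
    have h1 := D.a_neg k
    rw [this, D.w_zero l] at h1
    norm_num at h1

theorem w_sub_b (D : P.StateData h μ C x y w e) (i : Fin P.N) : sinh (w i - P.b) ≠ 0 :=
  fun h0 => by
    have := countingFn_eq_of_sinh (P := P) (h := h) (μ := μ) _ _ h0
    rw [D.w_zero i, countingFn_b D.pos] at this
    norm_num at this

theorem sinh_two_w (D : P.StateData h μ C x y w e) (i : Fin P.N) : sinh (2 * w i) ≠ 0 := by
  rw [sinh_two_mul]
  refine mul_ne_zero (mul_ne_zero two_ne_zero fun h0 => ?_) fun h0 => ?_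
  · have := countingFn_eq_of_sinh (P := P) (h := h) (μ := μ) (w i) 0 (by rwa [sub_zero])
    have h1 := D.a_zero
    rw [← this, D.w_zero i] at h1
    norm_num at h1
  · have := Contour.sinh_sub_ne_zero_of_outsideMod D.base.half_period (Or.inr (D.fac.w_mem i))
    rw [sinh_sub_half_period, h0, mul_zero] at this
    exact this rfl

theorem w_add_w_sub (D : P.StateData h μ C x y w e) (i j : Fin P.N) :
    sinh (w i + w j - P.iζ) ≠ 0 := by
  have := Contour.sinh_sub_ne_zero_of_outsideMod (D.w_neg j).2 (Or.inr (D.fac.w_mem i))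
  rwa [show w i - (P.iζ - w j) = w i + w j - P.iζ by ring] at this

theorem w_add_y (D : P.StateData h μ C x y w e) (i : Fin P.N) (j : Fin n) :
    sinh (w i + y j) ≠ 0 := by
  have := Contour.sinh_sub_ne_zero_of_outsideMod (D.y_neg j).1 (Or.inr (D.fac.w_mem i))
  rwa [sub_neg_eq_add] at this

theorem w_add_y_sub (D : P.StateData h μ C x y w e) (i : Fin P.N) (j : Fin n) :
    sinh (w i + y j - P.iζ) ≠ 0 := by
  have := Contour.sinh_sub_ne_zero_of_outsideMod (D.y_neg j).2 (Or.inr (D.fac.w_mem i))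
  rwa [show w i - (P.iζ - y j) = w i + y j - P.iζ by ring] at this

theorem w_shift (D : P.StateData h μ C x y w e) (i : Fin P.N) :
    sinh (w i - (P.iζ + P.b)) ≠ 0 ∧ sinh (w i - -(P.iζ + P.b)) ≠ 0 :=
  ⟨Contour.sinh_sub_ne_zero_of_outsideMod D.base.shift.1 (Or.inr (D.fac.w_mem i)),
    Contour.sinh_sub_ne_zero_of_outsideMod D.base.shift.2 (Or.inr (D.fac.w_mem i))⟩

theorem y_shift (D : P.StateData h μ C x y w e) (j : Fin n) :
    sinh (y j - (P.iζ + P.b)) ≠ 0 ∧ sinh (y j - -(P.iζ + P.b)) ≠ 0 ∧ sinh (y j - P.b) ≠ 0 := by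
  obtain ⟨k, hk⟩ := D.y_mem j
  obtain ⟨n1, n2, n3, -⟩ := D.bethe.ne_zero D.pos k
  rw [hk]
  refine ⟨?_, ?_, n2⟩
  · rw [show μ k - (P.iζ + P.b) = -(P.iζ - μ k + P.b) by ring, sinh_neg]
    exact neg_ne_zero.2 n3
  · rwa [show μ k - -(P.iζ + P.b) = μ k + P.b + P.iζ by ring]

theorem regE_ne_zero (D : P.StateData h μ C x y w e) (i : Fin P.N) : P.regE e (w i) ≠ 0 :=
  div_ne_zero (D.fac.logNear.ne_zero (Or.inr (D.w_neg i).1)) (pow_ne_zero _ (D.w_sub_b i))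

theorem Kfac_eq (D : P.StateData h μ C x y w e)
    (hL : C.IsLogAlong (fun s => 1 + P.countingFn h μ s) L) :
    P.Kfac (P.countingFn h μ) C L x y =
      (∏ i, ∏ j ∈ Finset.Ioi i, P.f (y i) (y j)) / (∏ i, ∏ j, P.f (x i) (y j)) *
      ((∏ i, sinh (2 * x i - P.iζ)) / (∏ i, sinh (2 * y i)) *
        ∏ i, (1 + P.countingFn h μ (-y i)) ^ (1 / 2 : ℂ)) *
      ((∏ i, sinh (y i - P.b) * sinh (y i - -(P.iζ + P.b))) ^ P.N *
        ∏ l, ∏ j, P.f (w l) (y j)) /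
      ((∏ i, P.regE e (x i)) * (∏ i, sinh (x i - P.b) * sinh (x i - -(P.iζ + P.b))) ^ P.N *
        ∏ l, ∏ j, sinh (w l + x j - P.iζ)) := by
  have hs : ∀ u, sinh₂ (P.iζ + P.b) u = -(sinh (u - -(P.iζ + P.b)) * sinh (u - (P.iζ + P.b))) := by
    intro u
    rw [sinh₂, show P.iζ + P.b + u = u - -(P.iζ + P.b) by ring,
      show P.iζ + P.b - u = -(u - (P.iζ + P.b)) by ring, sinh_neg]
    ring
  have ey : ∀ j, exp (C.cothInt L (-y j) - C.cothInt L (P.iζ - y j)) =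
      sinh (y j - P.b) ^ P.N * (∏ l, P.f (w l) (y j)) / sinh (y j - (P.iζ + P.b)) ^ P.N := by
    intro j
    have n1 : ∏ l, sinh (w l + y j) ≠ 0 := Finset.prod_ne_zero_iff.2 fun l _ => D.w_add_y l j
    have n2 : ∏ l, sinh (w l + y j - P.iζ) ≠ 0 :=
      Finset.prod_ne_zero_iff.2 fun l _ => D.w_add_y_sub l j
    have n3 := pow_ne_zero P.N (D.y_shift j).1
    rw [exp_sub, Contour.cothInt, Contour.cothInt, D.fac.exp_coth_outside hL (D.y_neg j).1,
      D.fac.exp_coth_outside hL (D.y_neg j).2]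
    simp only [f, Finset.prod_div_distrib]
    simp_rw [show ∀ l, w l - -y j = w l + y j from fun l => by ring,
      show ∀ l, w l - (P.iζ - y j) = w l + y j - P.iζ from fun l => by ring]
    rw [show -P.b - -y j = y j - P.b by ring,
      show -P.b - (P.iζ - y j) = y j - (P.iζ + P.b) by ring]
    generalize sinh (y j - (P.iζ + P.b)) ^ P.N = c at *
    generalize (∏ l, sinh (w l + y j)) = c2 at *
    generalize (∏ l, sinh (w l + y j - P.iζ)) = c3 at *
    field_simp
  have ex : ∀ j, exp (C.cothInt L (-x j) - C.cothInt L (P.iζ - x j)) =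
      P.regE e (x j) * sinh (x j - P.b) ^ P.N * (∏ l, sinh (w l + x j - P.iζ)) /
        sinh (x j - (P.iζ + P.b)) ^ P.N := by
    intro j
    obtain ⟨i, hi⟩ := D.x_mem j
    rw [hi]
    have n2 : ∏ l, sinh (w l + w i - P.iζ) ≠ 0 :=
      Finset.prod_ne_zero_iff.2 fun l _ => D.w_add_w_sub l i
    rw [exp_sub, Contour.cothInt, Contour.cothInt, D.fac.exp_coth_inside hL (D.w_neg i).1,
      D.fac.exp_coth_outside hL (D.w_neg i).2, regE,
      div_mul_cancel₀ _ (pow_ne_zero _ (D.w_sub_b i))]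
    simp_rw [show ∀ l, w l - (P.iζ - w i) = w l + w i - P.iζ from fun l => by ring]
    rw [show -P.b - (P.iζ - w i) = w i - (P.iζ + P.b) by ring]
    rw [div_div_eq_mul_div]
  have nx : (∏ i, sinh (x i - (P.iζ + P.b))) ^ P.N ≠ 0 :=
    pow_ne_zero _ (Finset.prod_ne_zero_iff.2 fun j _ => by
      obtain ⟨i, hi⟩ := D.x_mem j; rw [hi]; exact (D.w_shift i).1)
  have nx2 : (∏ i, sinh (x i - -(P.iζ + P.b))) ^ P.N ≠ 0 :=
    pow_ne_zero _ (Finset.prod_ne_zero_iff.2 fun j _ => by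
      obtain ⟨i, hi⟩ := D.x_mem j; rw [hi]; exact (D.w_shift i).2)
  have nx3 : (∏ i, sinh (x i - P.b)) ^ P.N ≠ 0 :=
    pow_ne_zero _ (Finset.prod_ne_zero_iff.2 fun j _ => by
      obtain ⟨i, hi⟩ := D.x_mem j; rw [hi]; exact D.w_sub_b i)
  have nx4 : ∏ i, P.regE e (x i) ≠ 0 := Finset.prod_ne_zero_iff.2 fun j _ => by
      obtain ⟨i, hi⟩ := D.x_mem j; rw [hi]; exact D.regE_ne_zero i
  have nx5 : ∏ j, ∏ l, sinh (w l + x j - P.iζ) ≠ 0 :=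
    Finset.prod_ne_zero_iff.2 fun j _ => Finset.prod_ne_zero_iff.2 fun l _ => by
      obtain ⟨i, hi⟩ := D.x_mem j; rw [hi]; exact D.w_add_w_sub l i
  have ny : (∏ i, sinh (y i - (P.iζ + P.b))) ^ P.N ≠ 0 :=
    pow_ne_zero _ (Finset.prod_ne_zero_iff.2 fun j _ => (D.y_shift j).1)
  unfold Kfac
  rw [Finset.prod_congr rfl fun j _ => ey j, Finset.prod_congr rfl fun j _ => ex j]
  simp_rw [hs, neg_div_neg_eq]
  rw [Finset.prod_comm (s := Finset.univ (α := Fin P.N)) (t := Finset.univ (α := Fin n))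
    (f := fun l j => P.f (w l) (y j)),
    Finset.prod_comm (s := Finset.univ (α := Fin P.N)) (t := Finset.univ (α := Fin n))
    (f := fun l j => sinh (w l + x j - P.iζ))]
  simp only [Finset.prod_div_distrib, Finset.prod_mul_distrib, Finset.prod_pow, mul_pow, div_pow]
  generalize (∏ j, ∏ l, P.f (w l) (y j)) = c1 at *
  generalize (∏ j, ∏ l, sinh (w l + x j - P.iζ)) = c2 at *
  generalize (∏ i, P.regE e (x i)) = c3 at *
  generalize (∏ i, sinh (y i - (P.iζ + P.b))) ^ P.N = c4 at *
  generalize (∏ i, sinh (x i - (P.iζ + P.b))) ^ P.N = c5 at *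
  generalize (∏ i, sinh (x i - -(P.iζ + P.b))) ^ P.N = c6 at *
  generalize (∏ i, sinh (x i - P.b)) ^ P.N = c7 at *
  generalize (∏ i, sinh (y i - -(P.iζ + P.b))) ^ P.N = c8 at *
  generalize (∏ i, sinh (y i - P.b)) ^ P.N = c9 at *
  generalize (∏ i, ∏ j ∈ Finset.Ioi i, P.f (y i) (y j)) / (∏ i, ∏ j, P.f (x i) (y j)) = c10
  generalize (∏ i, sinh (2 * x i - P.iζ)) / (∏ i, sinh (2 * y i)) = c11
  generalize (∏ i, (1 + P.countingFn h μ (-y i)) ^ (1 / 2 : ℂ)) = c12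
  field_simp

variable (P) in
/-- The value of the squared hole factor. -/
noncomputable def holeSq (e : ℂ → ℂ) (μ : Fin P.N → ℂ) {n : ℕ} (x y : Fin n → ℂ) (ε : ℂ) : ℂ :=
  (∏ i, ∏ j ∈ Finset.Ioi i, sinh (x i + (x j + ε) - P.iζ)) ^ 2 * (∏ i, P.regE e (x i + ε)) *
    (∏ i, sinh (x i + (x i + ε))) *
    (∏ i, ∏ k, sinh (x i + ε + μ k)) / ∏ i, ∏ j, sinh (x i + ε + y j)

theorem x_ne (D : P.StateData h μ C x y w e) (j : Fin n) : P.regE e (x j) ≠ 0 ∧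
    sinh (2 * x j) ≠ 0 ∧ (∀ k, sinh (x j + μ k) ≠ 0) ∧ (∀ i, sinh (x j + y i) ≠ 0) ∧
    (∀ i, sinh (x j + x i - P.iζ) ≠ 0) ∧ sinh (x j - P.b) ≠ 0 ∧ -x j ∈ C.inner ∧
    (∀ i, sinh (x j + y i - P.iζ) ≠ 0) := by
  obtain ⟨i, hi⟩ := D.x_mem j
  rw [hi]
  refine ⟨D.regE_ne_zero i, D.sinh_two_w i, fun k => ?_, fun k => D.w_add_y i k, fun k => ?_,
    D.w_sub_b i, (D.w_neg i).1, fun k => D.w_add_y_sub i k⟩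
  · rw [add_comm]; exact D.mu_add_w k i
  · obtain ⟨l, hl⟩ := D.x_mem k
    rw [hl]; exact D.w_add_w_sub i l

theorem eventually_sinh_add_ne_zero (c : ℂ) : ∀ᶠ ε in 𝓝[≠] (0 : ℂ), sinh (c + ε) ≠ 0 := by
  by_cases hc : sinh c = 0
  · have hd : HasDerivAt (fun ε : ℂ => sinh (c + ε)) (cosh (c + 0) * 1) 0 :=
      ((hasDerivAt_id (0 : ℂ)).const_add c).csinh
    refine hd.eventually_ne ?_
    rw [add_zero, mul_one]
    intro h0
    have := cosh_sq c
    rw [h0, hc] at this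
    norm_num at this
  · refine nhdsWithin_le_nhds (ContinuousAt.eventually_ne (g := fun ε : ℂ => sinh (c + ε)) ?_ ?_)
    · exact (continuous_sinh.comp (by fun_prop : Continuous fun ε : ℂ => c + ε)).continuousAt
    · simpa using hc

theorem tendsto_holeFactorSq (D : P.StateData h μ C x y w e) :
    Tendsto (P.holeFactorSq (P.countingFn h μ) x) (𝓝[≠] 0) (𝓝 (holeSq P e μ x y 0)) := by
  have cs : ∀ c : ℂ, ContinuousAt (fun ε : ℂ => sinh (c + ε)) 0 := fun c =>
    (continuous_sinh.comp (by fun_prop : Continuous fun ε : ℂ => c + ε)).continuousAt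
  have hcont : ContinuousAt (holeSq P e μ x y) 0 := by
    unfold holeSq
    refine ContinuousAt.div ?_ ?_ ?_
    · refine ContinuousAt.mul (ContinuousAt.mul (ContinuousAt.mul (ContinuousAt.pow
        (tendsto_finsetProd _ fun i _ => tendsto_finsetProd _ fun j _ => ?_) 2)
        (tendsto_finsetProd _ fun i _ => ?_)) (tendsto_finsetProd _ fun i _ => ?_))
        (tendsto_finsetProd _ fun i _ => tendsto_finsetProd _ fun j _ => ?_)
      · have := cs (x i + x j - P.iζ)
        simp only [show ∀ ε, x i + x j - P.iζ + ε = x i + (x j + ε) - P.iζ from fun ε => by ring]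
          at this
        exact this
      · have h1 := D.fac.logNear.analyticAt (Or.inr (D.x_ne i).2.2.2.2.2.2.1)
        have h2 : ContinuousAt (P.regE e) (x i) := by
          refine ContinuousAt.div ?_ ?_ (pow_ne_zero _ (D.x_ne i).2.2.2.2.2.1)
          · exact ContinuousAt.comp (f := fun u : ℂ => -u) h1.continuousAt continuousAt_neg
          · exact ((continuous_sinh.comp (by fun_prop : Continuous fun u : ℂ =>
              u - P.b)).continuousAt).pow _
        have h3 : ContinuousAt (P.regE e) (x i + 0) := by rwa [add_zero]
        exact ContinuousAt.comp (f := fun ε : ℂ => x i + ε) h3 (by fun_prop)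
      · have := cs (x i + x i)
        simp only [add_assoc] at this
        exact this
      · have := cs (x i + μ j)
        simp only [add_right_comm] at this
        exact this
    · refine tendsto_finsetProd _ fun i _ => tendsto_finsetProd _ fun j _ => ?_
      have := cs (x i + y j)
      simp only [add_right_comm] at this
      exact this
    · simp only [add_zero]
      exact Finset.prod_ne_zero_iff.2 fun i _ => Finset.prod_ne_zero_iff.2 fun k _ =>
        (D.x_ne i).2.2.2.1 k
  refine (hcont.tendsto.mono_left nhdsWithin_le_nhds).congr' ?_
  have e1 : ∀ᶠ ε in 𝓝[≠] (0 : ℂ), ∀ i j, sinh (x i + x j + ε) ≠ 0 :=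
    eventually_all.2 fun i => eventually_all.2 fun j => eventually_sinh_add_ne_zero _
  have e2 : ∀ᶠ ε in 𝓝[≠] (0 : ℂ), ∀ i j, sinh (x i + y j + ε) ≠ 0 :=
    eventually_all.2 fun i => eventually_all.2 fun j => eventually_sinh_add_ne_zero _
  have e3 : ∀ᶠ ε in 𝓝[≠] (0 : ℂ), ∀ i, sinh (x i - P.b + ε) ≠ 0 :=
    eventually_all.2 fun i => eventually_sinh_add_ne_zero _
  have e4 : ∀ᶠ ε in 𝓝[≠] (0 : ℂ), ∀ i, -(x i + ε) ∈ C.inner := by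
    refine eventually_all.2 fun i => nhdsWithin_le_nhds ?_
    have hc : ContinuousAt (fun ε : ℂ => -(x i + ε)) 0 := by fun_prop
    refine hc.eventually_mem (C.isOpen_inner.mem_nhds ?_)
    rw [add_zero]
    exact (D.x_ne i).2.2.2.2.2.2.1
  filter_upwards [e1, e2, e3, e4] with ε g1 g2 g3 g4
  have hφ : ∀ i, 1 + P.countingFn h μ (-x i - ε) =
      P.regE e (x i + ε) * ∏ l, sinh (x i + ε + w l) := fun i => by
    have := factored_neg (P := P) D.fac (u := x i + ε) (Or.inr (g4 i)) (by
      have := g3 i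
      rwa [sub_add_eq_add_sub] at this)
    rw [← this]
    ring_nf
  have hex : (∏ i, ∏ l, sinh (x i + ε + w l)) * ∏ i, ∏ j, sinh (x i + ε + y j) =
      (∏ i, ∏ k, sinh (x i + ε + μ k)) * ∏ i, ∏ j, sinh (x i + ε + x j) := by
    rw [← Finset.prod_mul_distrib, ← Finset.prod_mul_distrib]
    exact Finset.prod_congr rfl fun i _ => (D.single fun v => sinh (x i + ε + v)).symm
  have hsq := prod_prod_eq_sq_mul_diag (fun u v => sinh (u + ε + v))
    (fun u v => by ring_nf) x
  have hns : (∏ i, ∏ j ∈ Finset.Ioi i, sinh (x i + ε + x j)) ≠ 0 :=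
    Finset.prod_ne_zero_iff.2 fun i _ => Finset.prod_ne_zero_iff.2 fun j _ => by
      have := g1 i j
      rwa [add_right_comm] at this
  have hny : (∏ i, ∏ j, sinh (x i + ε + y j)) ≠ 0 :=
    Finset.prod_ne_zero_iff.2 fun i _ => Finset.prod_ne_zero_iff.2 fun j _ => by
      have := g2 i j
      rwa [add_right_comm] at this
  unfold holeSq holeFactorSq
  rw [Finset.prod_congr rfl fun i _ => hφ i, Finset.prod_mul_distrib]
  simp only [f, Finset.prod_div_distrib]
  simp only [show ∀ u v : ℂ, u + (v + ε) = u + ε + v from fun u v => by ring]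
  rw [hsq] at hex
  generalize (∏ i, ∏ j ∈ Finset.Ioi i, sinh (x i + ε + x j)) = c1 at *
  generalize (∏ i, ∏ j, sinh (x i + ε + y j)) = c2 at *
  generalize (∏ i, ∏ j ∈ Finset.Ioi i, sinh (x i + ε + x j - P.iζ)) = c3 at *
  generalize (∏ i, ∏ l, sinh (x i + ε + w l)) = c4 at *
  generalize (∏ i, ∏ k, sinh (x i + ε + μ k)) = c5 at *
  generalize (∏ i, sinh (x i + ε + x i)) = c6 at *
  generalize (∏ i, P.regE e (x i + ε)) = c7 at *
  field_simp
  linear_combination (-(c3 ^ 2 * c7)) * hex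

end StateData
end Params

namespace Params

variable {P : Params} {h : ℝ} {μ : Fin P.N → ℂ} {C : Contour} {n : ℕ} {x y : Fin n → ℂ}
  {w : Fin P.N → ℂ} {e : ℂ → ℂ} {L : ℝ → ℂ}

namespace StateData

/-- The squared amplitude of a state in terms of the zeros of `1 + â` inside of the contour. -/
theorem stateW_sq (D : P.StateData h μ C x y w e)
    (hL : C.IsLogAlong (fun s => 1 + P.countingFn h μ s) L) :
    P.stateW h μ ^ 2 = P.ampSq (1 + P.countingFn h μ 0) e w *
      P.Kfac (P.countingFn h μ) C L x y ^ 2 * holeSq P e μ x y 0 := by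
  classical
  let F : ℂ → ℂ := fun u => if -u ∈ C.hull then P.regE e u else
    (1 + P.countingFn h μ (-u)) / ∏ l, sinh (u + w l)
  have hFw : ∀ i, F (w i) = P.regE e (w i) := fun i => if_pos (Or.inr (D.w_neg i).1)
  have hFx : ∀ j, F (x j) = P.regE e (x j) := fun j => by
    obtain ⟨i, hi⟩ := D.x_mem j
    rw [hi, hFw]
  have hFμ : ∀ k, 1 + P.countingFn h μ (-μ k) = F (μ k) * ∏ l, sinh (μ k + w l) := fun k => by
    by_cases hk : -μ k ∈ C.hull
    · simp only [F, if_pos hk]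
      exact factored_neg (P := P) D.fac hk (D.bethe.ne_zero D.pos k).2.1
    · simp only [F, if_neg hk]
      rw [div_mul_cancel₀ _ (Finset.prod_ne_zero_iff.2 fun l _ => D.mu_add_w k l)]
  have hFy : ∀ j, 1 + P.countingFn h μ (-y j) = F (y j) * ∏ l, sinh (w l + y j) := fun j => by
    obtain ⟨k, hk⟩ := D.y_mem j
    rw [hk, hFμ]
    simp_rw [add_comm (μ k)]
  have t1 := D.pairs (fun u v => sinh (u + v - P.iζ)) fun u v => by rw [add_comm]
  have t2 := prod_prod_eq_sq_mul_diag (fun u v => sinh (u + v)) (fun u v => by rw [add_comm]) μ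
  have t3 := D.single F
  have t4 : (∏ k, ∏ l, sinh (μ k + μ l)) * (∏ k, ∏ j, sinh (μ k + x j)) =
      (∏ k, ∏ l, sinh (μ k + w l)) * ∏ k, ∏ j, sinh (μ k + y j) := by
    rw [← Finset.prod_mul_distrib, ← Finset.prod_mul_distrib]
    exact Finset.prod_congr rfl fun k _ => D.single fun v => sinh (μ k + v)
  have t5 : (∏ j, ∏ k, sinh (μ k + y j)) * (∏ j, ∏ i, sinh (x i + y j)) =
      (∏ j, ∏ l, sinh (w l + y j)) * ∏ j, ∏ i, sinh (y i + y j) := by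
    rw [← Finset.prod_mul_distrib, ← Finset.prod_mul_distrib]
    exact Finset.prod_congr rfl fun j _ => D.single fun v => sinh (v + y j)
  have t6 := prod_prod_eq_sq_mul_diag (fun u v => sinh (u + v)) (fun u v => by rw [add_comm]) y
  have t7 := D.single fun u => sinh (u + u)
  have t8 := D.single fun u => sinh (u - P.b) * sinh (u - -(P.iζ + P.b))
  have t9 := prod_prod_eq_sq_mul_diag (fun u v => sinh (u + v - P.iζ)) (fun u v => by rw [add_comm]) w
  have ny : ∀ i j, sinh (y i + y j) ≠ 0 := fun i j => by
    obtain ⟨k, hk⟩ := D.y_mem i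
    obtain ⟨l, hl⟩ := D.y_mem j
    rw [hk, hl]; exact D.add_ne k l
  have nGw : ∏ i, sinh (w i + w i - P.iζ) ≠ 0 :=
    Finset.prod_ne_zero_iff.2 fun i _ => D.w_add_w_sub i i
  have hW : P.stateW h μ ^ 2 = (∏ i, ∏ j ∈ Finset.Ioi i, sinh (μ i + μ j - P.iζ)) ^ 2 /
      (∏ i, ∏ j ∈ Finset.Ioi i, sinh (μ i + μ j)) ^ 2 / (∏ i, sinh (μ i + μ i)) ^ 2 *
      ((∏ i, sinh (μ i - P.b) * sinh (μ i - -(P.iζ + P.b))) ^ P.N) ^ 2 *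
      ((∏ k, F (μ k)) * ∏ k, ∏ l, sinh (μ k + w l)) * (1 + P.countingFn h μ 0) := by
    rw [stateW]
    simp only [f, Finset.prod_div_distrib, mul_pow, div_pow, ← Finset.prod_pow _ 2, sq_cpow_half]
    simp only [Finset.prod_pow _ 2]
    rw [Finset.prod_congr rfl fun k _ => hFμ k, Finset.prod_mul_distrib (f := fun k => F (μ k))]
    simp only [two_mul]
  have hA : P.ampSq (1 + P.countingFn h μ 0) e w = (∏ k, F (w k)) *
      ((∏ i, ∏ j ∈ Finset.Ioi i, sinh (w i + w j - P.iζ)) *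
        ∏ i, ∏ j ∈ Finset.Ioi i, sinh (w i + w j - P.iζ)) / (∏ i, sinh (w i + w i)) *
      ((∏ i, sinh (w i - P.b) * sinh (w i - -(P.iζ + P.b))) ^ P.N) ^ 2 *
      (1 + P.countingFn h μ 0) := by
    rw [ampSq, Finset.prod_comm, t9, Finset.prod_mul_distrib, ← pow_mul, mul_comm P.N 2,
      Finset.prod_congr rfl fun i _ => hFw i]
    simp only [two_mul]
    rw [← mul_assoc, mul_div_mul_right _ _ nGw]
  have hK : P.Kfac (P.countingFn h μ) C L x y ^ 2 =
      ((∏ i, ∏ j ∈ Finset.Ioi i, sinh (y i + y j - P.iζ)) ^ 2 /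
        (∏ i, ∏ j ∈ Finset.Ioi i, sinh (y i + y j)) ^ 2) /
      ((∏ i, ∏ j, sinh (x i + y j - P.iζ)) ^ 2 / (∏ i, ∏ j, sinh (x i + y j)) ^ 2) *
      ((∏ i, sinh (x i + x i - P.iζ)) ^ 2 / (∏ i, sinh (y i + y i)) ^ 2 *
        ((∏ j, F (y j)) * ∏ l, ∏ j, sinh (w l + y j))) *
      (((∏ i, sinh (y i - P.b) * sinh (y i - -(P.iζ + P.b))) ^ P.N) ^ 2 *
        ((∏ l, ∏ j, sinh (w l + y j - P.iζ)) ^ 2 / (∏ l, ∏ j, sinh (w l + y j)) ^ 2)) /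
      ((∏ i, F (x i)) ^ 2 *
        ((∏ i, sinh (x i - P.b) * sinh (x i - -(P.iζ + P.b))) ^ P.N) ^ 2 *
        (∏ l, ∏ j, sinh (w l + x j - P.iζ)) ^ 2) := by
    rw [D.Kfac_eq hL, Finset.prod_congr rfl fun i _ => hFx i]
    simp only [f, Finset.prod_div_distrib, mul_pow, div_pow, ← Finset.prod_pow _ 2, sq_cpow_half]
    simp only [Finset.prod_pow _ 2]
    rw [Finset.prod_congr rfl fun j _ => hFy j, Finset.prod_mul_distrib (f := fun j => F (y j)),
      Finset.prod_comm (f := fun j l => sinh (w l + y j))]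
    simp only [two_mul]
  have hH : holeSq P e μ x y 0 = (∏ i, ∏ j ∈ Finset.Ioi i, sinh (x i + x j - P.iζ)) ^ 2 *
      (∏ i, F (x i)) * (∏ i, sinh (x i + x i)) * (∏ k, ∏ j, sinh (μ k + x j)) /
      ∏ i, ∏ j, sinh (x i + y j) := by
    rw [holeSq, Finset.prod_congr rfl fun i _ => hFx i, Finset.prod_comm]
    simp only [add_zero, add_comm]
  have hB : ((∏ i, sinh (μ i - P.b) * sinh (μ i - -(P.iζ + P.b))) ^ P.N) ^ 2 *
      ((∏ i, sinh (x i - P.b) * sinh (x i - -(P.iζ + P.b))) ^ P.N) ^ 2 =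
      ((∏ i, sinh (w i - P.b) * sinh (w i - -(P.iζ + P.b))) ^ P.N) ^ 2 *
      ((∏ i, sinh (y i - P.b) * sinh (y i - -(P.iζ + P.b))) ^ P.N) ^ 2 := by
    rw [← mul_pow, ← mul_pow, t8, mul_pow, mul_pow]
  have ne2 : ∀ {m k : ℕ} {g : Fin m → Fin k → ℂ}, (∀ i j, g i j ≠ 0) → ∏ i, ∏ j, g i j ≠ 0 :=
    fun hg => Finset.prod_ne_zero_iff.2 fun i _ => Finset.prod_ne_zero_iff.2 fun j _ => hg i j
  have m1 : ∏ i, ∏ j ∈ Finset.Ioi i, sinh (μ i + μ j) ≠ 0 :=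
    Finset.prod_ne_zero_iff.2 fun i _ => Finset.prod_ne_zero_iff.2 fun j _ => D.add_ne i j
  have m2 : ∏ i, sinh (μ i + μ i) ≠ 0 := Finset.prod_ne_zero_iff.2 fun i _ => D.add_ne i i
  have m3 : ∏ i, sinh (w i + w i) ≠ 0 := Finset.prod_ne_zero_iff.2 fun i _ => by
    rw [← two_mul]; exact D.sinh_two_w i
  have m4 : ∏ i, ∏ j ∈ Finset.Ioi i, sinh (y i + y j) ≠ 0 :=
    Finset.prod_ne_zero_iff.2 fun i _ => Finset.prod_ne_zero_iff.2 fun j _ => ny i j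
  have m5 : ∏ i, ∏ j, sinh (x i + y j - P.iζ) ≠ 0 := ne2 fun i j => (D.x_ne i).2.2.2.2.2.2.2 j
  have m6 : ∏ i, ∏ j, sinh (x i + y j) ≠ 0 := ne2 fun i j => (D.x_ne i).2.2.2.1 j
  have m7 : ∏ i, sinh (y i + y i) ≠ 0 := Finset.prod_ne_zero_iff.2 fun i _ => ny i i
  have m8 : ∏ l, ∏ j, sinh (w l + y j) ≠ 0 := ne2 fun i j => D.w_add_y i j
  have m9 : ∏ i, F (x i) ≠ 0 := Finset.prod_ne_zero_iff.2 fun i _ => by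
    rw [hFx]; exact (D.x_ne i).1
  have m10 : ∏ l, ∏ j, sinh (w l + x j - P.iζ) ≠ 0 := ne2 fun i j => by
    obtain ⟨l, hl⟩ := D.x_mem j
    rw [hl]; exact D.w_add_w_sub i l
  have m11 : ∏ k, ∏ j, sinh (μ k + x j) ≠ 0 := ne2 fun i j => by
    rw [add_comm]; exact (D.x_ne j).2.2.1 i
  have m12 : ((∏ i, sinh (x i - P.b) * sinh (x i - -(P.iζ + P.b))) ^ P.N) ^ 2 ≠ 0 :=
    pow_ne_zero _ (pow_ne_zero _ (Finset.prod_ne_zero_iff.2 fun j _ => by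
      obtain ⟨i, hi⟩ := D.x_mem j
      rw [hi]; exact mul_ne_zero (D.w_sub_b i) (D.w_shift i).2))
  have m13 : ∏ k, ∏ j, sinh (μ k + y j) ≠ 0 := ne2 fun i j => by
    obtain ⟨l, hl⟩ := D.y_mem j
    rw [hl]; exact D.add_ne i l
  have m14 : ∏ i, sinh (x i + x i) ≠ 0 := Finset.prod_ne_zero_iff.2 fun i _ => by
    rw [← two_mul]; exact (D.x_ne i).2.1
  rw [Finset.prod_comm (f := fun j k => sinh (μ k + y j)),
    Finset.prod_comm (f := fun j i => sinh (x i + y j)),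
    Finset.prod_comm (f := fun j l => sinh (w l + y j)),
    Finset.prod_comm (f := fun j i => sinh (y i + y j)), t6] at t5
  rw [t2] at t4
  rw [hW, hA, hK, hH]
  clear hW hA hK hH t2 t6 t8 t9 hFy hFμ hFx hFw ny nGw ne2
  generalize ((∏ i, sinh (μ i - P.b) * sinh (μ i - -(P.iζ + P.b))) ^ P.N) ^ 2 = Bμ at *
  generalize ((∏ i, sinh (x i - P.b) * sinh (x i - -(P.iζ + P.b))) ^ P.N) ^ 2 = Bx at *
  generalize ((∏ i, sinh (w i - P.b) * sinh (w i - -(P.iζ + P.b))) ^ P.N) ^ 2 = Bw at *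
  generalize ((∏ i, sinh (y i - P.b) * sinh (y i - -(P.iζ + P.b))) ^ P.N) ^ 2 = By at *
  generalize (∏ i, ∏ j ∈ Finset.Ioi i, sinh (μ i + μ j - P.iζ)) = Gμ at *
  generalize (∏ i, ∏ j ∈ Finset.Ioi i, sinh (w i + w j - P.iζ)) = Gw at *
  generalize (∏ i, ∏ j ∈ Finset.Ioi i, sinh (x i + x j - P.iζ)) = Gx at *
  generalize (∏ i, ∏ j ∈ Finset.Ioi i, sinh (y i + y j - P.iζ)) = Gy at *
  generalize (∏ i, ∏ j ∈ Finset.Ioi i, sinh (μ i + μ j)) = sμ at *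
  generalize (∏ i, ∏ j ∈ Finset.Ioi i, sinh (y i + y j)) = sy at *
  generalize (∏ i, sinh (μ i + μ i)) = dμ at *
  generalize (∏ i, sinh (w i + w i)) = dw at *
  generalize (∏ i, sinh (x i + x i)) = dx at *
  generalize (∏ i, sinh (y i + y i)) = dy at *
  generalize (∏ i, sinh (x i + x i - P.iζ)) = gx at *
  generalize (∏ k, F (μ k)) = Fμ at *
  generalize (∏ k, F (w k)) = Fw at *
  generalize (∏ k, F (x k)) = Fx at *
  generalize (∏ k, F (y k)) = Fy at *
  generalize (∏ k, ∏ l, sinh (μ k + w l)) = sμw at *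
  generalize (∏ k, ∏ j, sinh (μ k + x j)) = sμx at *
  generalize (∏ k, ∏ j, sinh (μ k + y j)) = sμy at *
  generalize (∏ l, ∏ j, sinh (w l + y j)) = swy at *
  generalize (∏ i, ∏ j, sinh (x i + y j)) = sxy at *
  generalize (∏ i, ∏ j, sinh (x i + y j - P.iζ)) = Gxy at *
  generalize (∏ l, ∏ j, sinh (w l + y j - P.iζ)) = Gwy at *
  generalize (∏ l, ∏ j, sinh (w l + x j - P.iζ)) = Gwx at *
  generalize 1 + P.countingFn h μ 0 = φ₀
  have r1 : Gμ = Gw * Gwy * (Gy * Gx * gx) / (Gwx * Gxy) := by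
    rw [eq_div_iff (mul_ne_zero m10 m5)]; linear_combination t1
  have r2 : Fμ = Fw * Fy / Fx := by rw [eq_div_iff m9]; linear_combination t3
  have r3 : Bμ = Bw * By / Bx := by rw [eq_div_iff m12]; linear_combination hB
  have r4 : sμw = sμ * sμ * dμ * sμx / sμy := by rw [eq_div_iff m13]; linear_combination -t4
  have r5 : sμy = swy * (sy * sy * dy) / sxy := by rw [eq_div_iff m6]; linear_combination t5
  have r6 : dμ = dw * dy / dx := by rw [eq_div_iff m14]; linear_combination t7
  rw [r4, r5, r1, r2, r3, r6]
  field_simp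

end StateData
end Params

namespace Params

variable {P : Params} {h : ℝ} {μ : Fin P.N → ℂ} {C C' : Contour} {n : ℕ} {x y : Fin n → ℂ}
  {w : Fin P.N → ℂ} {e : ℂ → ℂ} {L : ℝ → ℂ}

theorem sinh_iζ_ne_zero (hζ₀ : 0 < P.ζ) (hζπ : P.ζ < Real.pi) : sinh P.iζ ≠ 0 := by
  rw [iζ, mul_comm, sinh_mul_I, ← ofReal_sin]
  exact mul_ne_zero (ofReal_ne_zero.2 (Real.sin_pos_of_pos_of_lt_pi hζ₀ hζπ).ne') I_ne_zero

theorem BaseContour.two_b_add (hC : P.BaseContour C) : sinh (2 * P.b + P.iζ) ≠ 0 := by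
  have := Contour.sinh_sub_ne_zero_of_outsideMod hC.shift.1 (Or.inr hC.neg_b_mem)
  rw [show -P.b - (P.iζ + P.b) = -(2 * P.b + P.iζ) by ring, sinh_neg] at this
  exact neg_ne_zero.1 this

theorem ParticleHole.exists_stateData {CU : Contour} {Γ : ℕ → Contour}
    (hY : P.ParticleHole h μ C x y) (hC : P.BaseContour C)
    (hN : 0 < P.N) (hb : sinh (2 * P.b) ≠ 0) (hζ : sinh P.iζ ≠ 0) (hμ : P.IsBethe h μ)
    (S : P.SeriesContours h μ CU Γ) : ∃ w e, P.StateData h μ C x y w e := by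
  obtain ⟨ι, hι, hιy, hinj, hw⟩ := hY.exists_embedding hμ
  obtain ⟨e, he⟩ := hY.exists_isFactored hC hN hinj hw
  obtain ⟨-, ha0, ha, hs1, -, hs2⟩ := S.exp_seriesF hN hμ hζ hb
  exact ⟨Function.extend ι x μ, e,
    { base := hC
      pos := hN
      b_ne := hb
      bethe := hμ
      fac := he
      single := prod_exchange hι hιy
      pairs := prod_pairs_exchange hι hιy
      w_zero := fun i => (hw i).2
      w_neg := fun i => hY.zeros_neg _ (hw i).1 (hw i).2
      x_mem := fun j => ⟨ι j, (hι.extend_apply _ _ _).symm⟩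
      y_mem := fun j => ⟨ι j, (hιy j).symm⟩
      y_neg := hY.y_neg
      a_zero := ha0
      a_neg := ha
      add_ne := hs1
      add_sub_ne := hs2 }⟩

theorem one_sub_sq_mem {a : ℂ} (ha : ‖a‖ < 1) : log (1 - a ^ 2) = log (1 + a) + log (1 - a) := by
  have hr : ∀ {b : ℂ}, ‖b‖ < 1 → 0 < (1 + b).re := fun {b} hb => by
    have := (abs_le.1 (Complex.abs_re_le_norm b)).1
    rw [add_re, one_re]
    linarith
  have h1 := hr ha
  have h2 := hr (b := -a) (by rwa [norm_neg])
  rw [← sub_eq_add_neg] at h2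
  have n1 : 1 + a ≠ 0 := fun h0 => by rw [h0] at h1; simp at h1
  have n2 : 1 - a ≠ 0 := fun h0 => by rw [h0] at h2; simp at h2
  have a1 := abs_lt.1 (Complex.abs_arg_lt_pi_div_two_iff.2 (Or.inl h1))
  have a2 := abs_lt.1 (Complex.abs_arg_lt_pi_div_two_iff.2 (Or.inl h2))
  rw [show 1 - a ^ 2 = (1 + a) * (1 - a) by ring, Complex.log_mul n1 n2]
  constructor <;> linarith

/-- The partition function of a state, in terms of its amplitude and of its series. -/
theorem Z_mul_exp {CU : Contour} {Γ : ℕ → Contour}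
    (hN : 0 < P.N) (hb : sinh (2 * P.b) ≠ 0) (hζ : sinh P.iζ ≠ 0)
    (hb' : sinh (2 * P.b + P.iζ) ≠ 0) (hμ : P.IsBethe h μ) (S : P.SeriesContours h μ CU Γ) :
    Tendsto (fun ξ => P.tsuchiya ξ μ) P.homogeneous (𝓝 (P.Z μ)) ∧
    P.Z μ * exp (1 / 4 * log (1 - P.countingFn h μ 0 ^ 2)) =
      ((-1) ^ P.N) ^ P.N * sinh (-(2 * P.b)) ^ P.N * (∏ k, sinh (P.ξm + μ k)) *
        P.stateW h μ * exp (P.seriesF h μ CU Γ) := by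
  obtain ⟨hF, ha0, ha, hs1, hs3, hs2⟩ := S.exp_seriesF hN hμ hζ hb
  have ht := tendsto_tsuchiya hN hμ hb' hs1 hs2 hs3
  have hZ := Z_eq ht
  refine ⟨hZ ▸ ht, ?_⟩
  have e1 : (∏ c, (sinh (μ c - P.b) * sinh (-P.b - μ c - P.iζ))) ^ P.N =
      ((-1) ^ P.N) ^ P.N * (∏ i, sinh (μ i - P.b) * sinh (μ i - -(P.iζ + P.b))) ^ P.N := by
    rw [← mul_pow]
    congr 1
    rw [Finset.prod_mul_distrib, Finset.prod_mul_distrib,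
      show (∏ i, sinh (-P.b - μ i - P.iζ)) = ∏ i, sinh (-(μ i - -(P.iζ + P.b))) from
        Finset.prod_congr rfl fun i _ => by ring_nf, prod_sinh_neg]
    ring
  have hcp : ∀ {z : ℂ}, z ≠ 0 → z ^ (1 / 2 : ℂ) = exp (1 / 2 * log z) := fun hz => by
    rw [Complex.cpow_def_of_ne_zero hz, mul_comm]
  have e2 : (∏ i, (1 + P.countingFn h μ (-μ i)) ^ (1 / 2 : ℂ)) *
      (∏ k, exp (-(1 / 2) * log (1 + P.countingFn h μ (-μ k)))) = 1 := by
    rw [← Finset.prod_mul_distrib]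
    refine Finset.prod_eq_one fun k _ => ?_
    rw [hcp (one_add_ne_zero_of_norm_lt_one (ha k)), ← exp_add]
    simp
  have e3 : exp (1 / 4 * log (1 - P.countingFn h μ 0 ^ 2)) =
      (1 + P.countingFn h μ 0) ^ (1 / 2 : ℂ) *
        exp (-(1 / 4) * (log (1 + P.countingFn h μ 0) - log (1 - P.countingFn h μ 0))) := by
    rw [hcp (one_add_ne_zero_of_norm_lt_one ha0), ← exp_add, one_sub_sq_mem ha0]
    congr 1
    ring
  rw [hZ, hF, e3, Zval, stateW, e1, Finset.prod_div_distrib]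
  linear_combination (-(((∏ i, ∏ j ∈ Finset.Ioi i, P.f (μ i) (μ j)) * sinh (-(2 * P.b)) ^ P.N *
    ((∏ c, sinh (P.ξm + μ c)) / ∏ c, sinh (2 * μ c)) * (((-1) ^ P.N) ^ P.N *
    (∏ i, sinh (μ i - P.b) * sinh (μ i - -(P.iζ + P.b))) ^ P.N) * Matrix.det (1 + P.bM h μ) *
    ((1 + P.countingFn h μ 0) ^ (1 / 2 : ℂ) *
        exp (-(1 / 4) * (log (1 + P.countingFn h μ 0) - log (1 - P.countingFn h μ 0))))))) * e2

namespace StateData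

theorem stateW_ne_zero (D : P.StateData h μ C x y w e) : P.stateW h μ ≠ 0 := by
  have hcp : ∀ {z : ℂ}, z ≠ 0 → z ^ (1 / 2 : ℂ) ≠ 0 := fun hz => by
    rw [Complex.cpow_def_of_ne_zero hz]; exact exp_ne_zero _
  refine mul_ne_zero (mul_ne_zero (mul_ne_zero (div_ne_zero ?_ ?_) (pow_ne_zero _ ?_)) ?_)
    (hcp (one_add_ne_zero_of_norm_lt_one D.a_zero))
  · exact Finset.prod_ne_zero_iff.2 fun i _ => Finset.prod_ne_zero_iff.2 fun j _ =>
      div_ne_zero (D.add_sub_ne i j) (D.add_ne i j)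
  · exact Finset.prod_ne_zero_iff.2 fun i _ => by rw [two_mul]; exact D.add_ne i i
  · refine Finset.prod_ne_zero_iff.2 fun i _ => ?_
    obtain ⟨n1, n2, -, -⟩ := D.bethe.ne_zero D.pos i
    refine mul_ne_zero n2 ?_
    rwa [show μ i - -(P.iζ + P.b) = μ i + P.b + P.iζ by ring]
  · exact Finset.prod_ne_zero_iff.2 fun i _ => hcp (one_add_ne_zero_of_norm_lt_one (D.a_neg i))

/-- The contribution of the boundary parameter. -/
theorem ind_mul_exp (D : P.StateData h μ C x y w e)
    (hL : C.IsLogAlong (fun s => 1 + P.countingFn h μ s) L) (hξb : sinh (P.ξm - P.b) ≠ 0) :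
    (1 + P.countingFn h μ (-P.ξm)) ^ C.ind (-P.ξm) * exp (-C.cothInt L (-P.ξm)) =
      (∏ i, sinh (w i + P.ξm)) / sinh (P.ξm - P.b) ^ P.N := by
  have hb : sinh (P.ξm - P.b) ^ P.N ≠ 0 := pow_ne_zero _ hξb
  by_cases hin : C.InsideMod (-P.ξm)
  · rw [Contour.ind, if_pos hin, pow_one]
    obtain ⟨k, hk⟩ := hin
    have e1 : exp (C.cothInt L (-P.ξm)) = e (-P.ξm + k * (Real.pi * I)) := by
      rw [← Contour.cothInt_add_int L (-P.ξm) k]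
      exact D.fac.exp_coth_inside hL hk
    have h1 := (D.fac.eq _ (Or.inr hk)).self_of_nhds (fun h0 => hξb (sinh_eq_zero_iff.2
      ⟨k, by linear_combination -h0⟩))
    have e2 : ∀ v, sinh (-P.ξm + k * (Real.pi * I) - v) = -(-1) ^ k * sinh (v + P.ξm) := fun v => by
      rw [show -P.ξm + k * (Real.pi * I) - v = -(v + P.ξm) + k * (Real.pi * I) by ring,
        sinh_add_int_mul_pi, sinh_neg]
      ring
    simp only [e2] at h1
    rw [countingFn_add_int, mul_pow, Finset.prod_mul_distrib, Finset.prod_const, Finset.card_univ,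
      Fintype.card_fin, show -P.b + P.ξm = P.ξm - P.b by ring] at h1
    have hs : (-(-1 : ℂ) ^ k) ^ P.N ≠ 0 :=
      pow_ne_zero _ (neg_ne_zero.2 (zpow_ne_zero _ (by norm_num)))
    rw [exp_neg, e1, ← div_eq_mul_inv, div_eq_div_iff (D.fac.logNear.ne_zero (Or.inr hk)) hb]
    exact mul_left_cancel₀ hs (by linear_combination h1)
  · rw [Contour.ind, if_neg hin, pow_zero, one_mul]
    have hout : C.OutsideMod (-P.ξm) := fun k hk => by
      rcases hk with hk | hk
      · exact D.base.ξm_off k hk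
      · exact hin ⟨k, hk⟩
    rw [exp_neg, Contour.cothInt, D.fac.exp_coth_outside hL hout, inv_div]
    congr 2
    · funext i; rw [sub_neg_eq_add]
    · congr 1; ring

theorem K₁_eq (D : P.StateData h μ C x y w e)
    (hL : C.IsLogAlong (fun s => 1 + P.countingFn h μ s) L) (H : ℂ) :
    P.K₁ (P.countingFn h μ) C L x y H = H * P.Kfac (P.countingFn h μ) C L x y *
      ((∏ i, sinh (y i + P.ξm)) / ∏ i, sinh (x i + P.ξm)) := by
  have ey : ∀ i, -C.integralW L (logDeriv fun s => P.f s (y i)) =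
      C.cothInt L (-y i) - C.cothInt L (P.iζ - y i) := fun i => by
    rw [integralW_logDeriv_f hL.continuousOn (D.y_neg i).1.offMod (D.y_neg i).2.offMod]
    ring
  have ex : ∀ i, -C.integralW L (logDeriv fun s => P.f s (x i)) =
      C.cothInt L (-x i) - C.cothInt L (P.iζ - x i) := fun i => by
    obtain ⟨j, hj⟩ := D.x_mem i
    rw [hj, integralW_logDeriv_f hL.continuousOn (Contour.offMod_of_mem (D.w_neg j).1)
      (D.w_neg j).2.offMod]
    ring
  unfold K₁ Kfac
  simp_rw [ey, ex]
  simp only [Finset.prod_mul_distrib, Finset.prod_div_distrib]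
  ring

end StateData

theorem stateExp_eq (hC : P.BaseContour C) (hL : ContinuousOn L (Set.Icc 0 1)) {L' : ℝ → ℂ}
    {φ : ℂ → ℂ}
    (h1 : ∀ s ∈ C.trace, C'.OutsideMod (-s) ∧ C'.OutsideMod (P.iζ - s))
    (hF' : C'.IsFactored φ (-P.b) P.N w e) (hL' : C'.IsLogAlong φ L')
    (hw : ∀ i, C.OffMod (-w i) ∧ C.OffMod (P.iζ - w i)) :
    C.integralW L (fun s => C'.integralW L' (P.φ₂ s)) + C.integralW L P.φ₁ -
      P.N * C.integralW L (logDeriv fun s => sinh₂ s (P.iζ + P.b)) =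
      P.stateExp C L w - C.cothInt L (-P.ξm) := by
  rw [(double_integral hC hL h1 hF' hL' hw).2, integralW_φ₁ hC hL, integralW_sinh₂ hC hL, stateExp,
    expX]
  ring

theorem continuousAt_φ₂ {s s' : ℂ} (h1 : sinh (s + s') ≠ 0) (h2 : sinh (s + s' - P.iζ) ≠ 0) :
    ContinuousAt (P.φ₂ s) s' := by
  have hd : ∀ {z : ℂ}, sinh z ≠ 0 → ContinuousAt (deriv coth) z := fun {z} hz =>
    (AnalyticAt.deriv (f := coth) (analyticAt_coth_comp (f := fun z => z) analyticAt_id hz)).continuousAt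
  unfold φ₂
  refine ContinuousAt.div_const (ContinuousAt.sub ?_ ?_) 2
  · exact ContinuousAt.comp (g := deriv coth) (f := fun s' => s + s' - P.iζ) (hd h2) (by fun_prop)
  · exact ContinuousAt.comp (g := deriv coth) (f := fun s' => s + s') (hd h1) (by fun_prop)

end Params

namespace Params

variable {P : Params} {C C' : Contour} {n : ℕ} {x y : Fin n → ℂ}

theorem integral_integral_sub {LY LE LY' LE' : ℝ → ℂ} {φY φE : ℂ → ℂ} {wY wE : Fin P.N → ℂ}
    {eY eE : ℂ → ℂ} (hC : P.BaseContour C) (hLY : ContinuousOn LY (Set.Icc 0 1))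
    (hLE : ContinuousOn LE (Set.Icc 0 1))
    (h1 : ∀ s ∈ C.trace, C'.OutsideMod (-s) ∧ C'.OutsideMod (P.iζ - s))
    (hFY : C'.IsFactored φY (-P.b) P.N wY eY) (hLY' : C'.IsLogAlong φY LY')
    (hFE : C'.IsFactored φE (-P.b) P.N wE eE) (hLE' : C'.IsLogAlong φE LE')
    (hwY : ∀ i, C.OffMod (-wY i) ∧ C.OffMod (P.iζ - wY i))
    (hwE : ∀ i, C.OffMod (-wE i) ∧ C.OffMod (P.iζ - wE i)) :
    pathIntegral C.toFun (fun t => pathIntegral C'.toFun (fun t' =>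
        P.φ₂ (C.toFun t) (C'.toFun t') * (LY t * LY' t' - LE t * LE' t'))) =
      C.integralW LY (fun s => C'.integralW LY' (P.φ₂ s)) -
        C.integralW LE (fun s => C'.integralW LE' (P.φ₂ s)) := by
  refine Eq.trans ?_ (C.pathIntegral_sub (double_integral hC hLY h1 hFY hLY' hwY).1
    (double_integral hC hLE h1 hFE hLE' hwE).1)
  refine Contour.pathIntegral_congr fun t ht => ?_
  have hc : ∀ {M : ℝ → ℂ}, ContinuousOn M (Set.Icc 0 1) →
      ContinuousOn (fun t' => P.φ₂ (C.toFun t) (C'.toFun t') * M t') (Set.Icc 0 1) := fun hM =>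
    Contour.continuousOn_weight hM fun s' hs' => by
      obtain ⟨g1, g2⟩ := h1 _ (C.mem_trace ht)
      have k1 := Contour.sinh_sub_ne_zero_of_outsideMod g1 (Or.inl hs')
      have k2 := Contour.sinh_sub_ne_zero_of_outsideMod g2 (Or.inl hs')
      refine continuousAt_φ₂ ?_ ?_
      · rwa [sub_neg_eq_add, add_comm] at k1
      · rwa [sub_sub_eq_add_sub, add_comm] at k2
  unfold Contour.integralW
  rw [mul_comm _ (LY t), mul_comm _ (LE t), ← Contour.pathIntegral_const_mul,
    ← Contour.pathIntegral_const_mul,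
    ← C'.pathIntegral_sub (g := fun t' => LY t * (P.φ₂ (C.toFun t) (C'.toFun t') * LY' t'))
      (g' := fun t' => LE t * (P.φ₂ (C.toFun t) (C'.toFun t') * LE' t'))
      (continuousOn_const.mul (hc hLY'.continuousOn))
      (continuousOn_const.mul (hc hLE'.continuousOn))]
  exact Contour.pathIntegral_congr fun t' _ => by ring

theorem BaseContour.sinh_two_mul_ne (hC : P.BaseContour C) {s : ℂ} (hs : s ∈ C.hull)
    (h0 : s ≠ 0) : sinh (2 * s) ≠ 0 := by
  rw [sinh_two_mul]
  refine mul_ne_zero (mul_ne_zero two_ne_zero ?_) fun h1 => ?_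
  · simpa using Contour.sinh_sub_ne_zero_of_mem (Or.inr hC.zero_mem) hs h0
  · have := Contour.sinh_sub_ne_zero_of_outsideMod hC.half_period hs
    rw [sinh_sub_half_period, h1, mul_zero] at this
    exact this rfl

theorem BaseContour.sinh_two_mul_sub_ne (hC : P.BaseContour C) {s : ℂ} (hs : s ∈ C.hull) :
    sinh (2 * s - P.iζ) ≠ 0 := by
  have h1 := Contour.sinh_sub_ne_zero_of_outsideMod hC.half_shift.1 hs
  have h2 := Contour.sinh_sub_ne_zero_of_outsideMod hC.half_shift.2 hs
  have := sinh_two_mul_sub s (P.iζ / 2)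
  rw [show 2 * s - 2 * (P.iζ / 2) = 2 * s - P.iζ by ring,
    show P.iζ / 2 - Real.pi * I / 2 = (P.iζ - Real.pi * I) / 2 by ring] at this
  rw [this]
  exact mul_ne_zero (mul_ne_zero two_ne_zero (neg_ne_zero.2 I_ne_zero)) (mul_ne_zero h1 h2)

theorem BaseContour.continuousAt_φ₁ (hC : P.BaseContour C) {s : ℂ} (hs : s ∈ C.trace) :
    ContinuousAt P.φ₁ s := by
  have n1 := hC.sinh_two_mul_sub_ne (Or.inl hs)
  have n2 := hC.sinh_two_mul_ne (Or.inl hs) fun h0 => hC.zero_mem.1 (h0 ▸ hs)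
  have n3 := hC.offMod_ξm s hs
  rw [sub_neg_eq_add] at n3
  have a2 : AnalyticAt ℂ (fun s : ℂ => 2 * s) s := analyticAt_const.mul analyticAt_id
  exact ((((analyticAt_coth_comp (a2.sub analyticAt_const) n1).add
    (analyticAt_coth_comp a2 n2)).sub (analyticAt_coth_comp (f := fun s => s + P.ξm)
      (analyticAt_id.add analyticAt_const) n3))).continuousAt

theorem BaseContour.continuousAt_logDeriv (hC : P.BaseContour C) {s : ℂ} (hs : s ∈ C.trace) :
    ContinuousAt (logDeriv fun s => sinh₂ s (P.iζ + P.b)) s := by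
  have n1 := hC.shift.1.offMod s hs
  have n2 := hC.shift.2.offMod s hs
  rw [sub_neg_eq_add] at n2
  have ha : AnalyticAt ℂ (fun s => sinh₂ s (P.iζ + P.b)) s :=
    (analyticAt_sinh_comp (analyticAt_id.add analyticAt_const)).mul
      (analyticAt_sinh_comp (analyticAt_id.sub analyticAt_const))
  exact (ha.deriv.div ha (mul_ne_zero n2 n1)).continuousAt

theorem log_div_of_re_pos {a b : ℂ} (ha : 0 < a.re) (hb : 0 < b.re) :
    (a / b) ^ (1 / 4 : ℂ) = exp (1 / 4 * log a) / exp (1 / 4 * log b) := by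
  have n1 : a ≠ 0 := fun h0 => by rw [h0] at ha; simp at ha
  have n2 : b ≠ 0 := fun h0 => by rw [h0] at hb; simp at hb
  have a1 := abs_lt.1 (Complex.abs_arg_lt_pi_div_two_iff.2 (Or.inl ha))
  have a2 := abs_lt.1 (Complex.abs_arg_lt_pi_div_two_iff.2 (Or.inl hb))
  have hlog : log (a / b) = log a - log b := by
    have h1 : log (b⁻¹) = -log b := Complex.log_inv b (by
      have := Real.pi_pos
      intro h0
      rw [h0] at a2
      linarith)
    rw [div_eq_mul_inv, Complex.log_mul n1 (inv_ne_zero n2), h1, sub_eq_add_neg]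
    have h2 : arg b⁻¹ = -arg b := by
      rw [Complex.arg_inv, if_neg]
      intro h0
      rw [h0] at a2
      have := Real.pi_pos
      linarith
    rw [h2]
    constructor <;> linarith
  rw [Complex.cpow_def_of_ne_zero (div_ne_zero n1 n2), hlog, ← exp_sub]
  congr 1
  ring

theorem re_one_sub_sq_pos {a : ℂ} (ha : ‖a‖ < 1) : 0 < (1 - a ^ 2).re := by
  have h1 : ‖a ^ 2‖ < 1 := by
    rw [norm_pow]
    exact pow_lt_one₀ (norm_nonneg _) ha two_ne_zero
  have := Complex.re_le_norm (a ^ 2)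
  rw [sub_re, one_re]
  linarith

/-- The representation of the boundary factor, reduced to an identity between the amplitudes of
the two states. -/
theorem boundaryFactor_eq_rhs {h h' : ℝ} {lam mu : Fin P.N → ℂ} (hζ : sinh P.iζ ≠ 0)
    {wY wE : Fin P.N → ℂ} {eY eE : ℂ → ℂ} (DY : P.StateData h' mu C x y wY eY)
    (DE : P.StateData h lam C (Fin.elim0 : Fin 0 → ℂ) (Fin.elim0 : Fin 0 → ℂ) wE eE)
    (hE : P.ParticleHole h lam C (Fin.elim0 : Fin 0 → ℂ) (Fin.elim0 : Fin 0 → ℂ))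
    (hY : P.ParticleHole h' mu C x y)
    (hC'E : P.InnerContour (P.countingFn h lam) C C')
    (hC'Y : P.InnerContour (P.countingFn h' mu) C C')
    (hξb : sinh (P.ξm - P.b) ≠ 0) (hξlam : ∀ a, sinh (lam a + P.ξm) ≠ 0)
    (hξx : ∀ j, sinh (x j + P.ξm) ≠ 0)
    {UE UY : Contour} {ΓE ΓY : ℕ → Contour}
    (hFE : P.SeriesContours h lam UE ΓE) (hFY : P.SeriesContours h' mu UY ΓY)
    {vY vE : ℂ} (hvY : exp vY = 1 + P.countingFn h' mu (C.toFun 0))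
    (hvE : exp vE = 1 + P.countingFn h lam (C.toFun 0)) {H : ℂ}
    (hH : P.stateW h' mu * exp (P.stateExp C (C.logAlong (P.countingFn h lam) vE) wE) =
      P.stateW h lam * exp (P.stateExp C (C.logAlong (P.countingFn h' mu) vY) wY) *
        (H * P.Kfac (P.countingFn h' mu) C (C.logAlong (P.countingFn h' mu) vY) x y)) :
    P.boundaryFactor h h' mu lam =
      P.rhs (P.countingFn h' mu) (P.countingFn h lam) (P.seriesF h' mu UY ΓY)
        (P.seriesF h lam UE ΓE) C C' x y H vY vE := by
  have hC := DY.base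
  have hLY := hY.isLogAlong hC hvY
  have hLE := hE.isLogAlong hC hvE
  have hwY' : ∀ k, wY k ∈ C.inner ∧ P.countingFn h' mu (wY k) = -1 := fun k =>
    ⟨DY.fac.w_mem k, DY.w_zero k⟩
  have hwE' : ∀ k, wE k ∈ C.inner ∧ P.countingFn h lam (wE k) = -1 := fun k =>
    ⟨DE.fac.w_mem k, DE.w_zero k⟩
  obtain ⟨hFY', hLY'⟩ := hC'Y.isLogAlong hY hC hwY' DY.fac
  obtain ⟨hFE', hLE'⟩ := hC'E.isLogAlong hE hC hwE' DE.fac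
  have oY : ∀ i, C.OffMod (-wY i) ∧ C.OffMod (P.iζ - wY i) := fun i =>
    ⟨Contour.offMod_of_mem (DY.w_neg i).1, (DY.w_neg i).2.offMod⟩
  have oE : ∀ i, C.OffMod (-wE i) ∧ C.OffMod (P.iζ - wE i) := fun i =>
    ⟨Contour.offMod_of_mem (DE.w_neg i).1, (DE.w_neg i).2.offMod⟩
  have cφ : ∀ s ∈ C.trace, ContinuousAt P.φ₁ s := fun s hs => hC.continuousAt_φ₁ hs
  have cs : ∀ s ∈ C.trace, ContinuousAt (logDeriv fun s => sinh₂ s (P.iζ + P.b)) s :=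
    fun s hs => hC.continuousAt_logDeriv hs
  have sY := stateExp_eq hC hLY.continuousOn hC'Y.poles hFY' hLY' oY
  have sE := stateExp_eq hC hLE.continuousOn hC'Y.poles hFE' hLE' oE
  have iY := DY.ind_mul_exp hLY hξb
  have iE := DE.ind_mul_exp hLE hξb
  have zY := (Z_mul_exp DY.pos DY.b_ne hζ hC.two_b_add DY.bethe hFY).2
  have zE := (Z_mul_exp DE.pos DE.b_ne hζ hC.two_b_add DE.bethe hFE).2
  have xY := DY.single fun u => sinh (u + P.ξm)
  have xE := DE.single fun u => sinh (u + P.ξm)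
  simp only [Finset.univ_eq_empty, Finset.prod_empty, mul_one] at xE
  rw [boundaryFactor_eq, rhs]
  rw [integral_integral_sub hC hLY.continuousOn hLE.continuousOn hC'Y.poles hFY' hLY' hFE' hLE'
    oY oE, Contour.integralW_weight_sub hLY.continuousOn hLE.continuousOn cφ,
    Contour.integralW_weight_sub hLY.continuousOn hLE.continuousOn cs, DY.K₁_eq hLY,
    log_div_of_re_pos (re_one_sub_sq_pos DE.a_zero) (re_one_sub_sq_pos DY.a_zero), div_pow,
    show ∀ A B D E G K : ℂ, A - B + (D - E) - P.N * (G - K) =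
      (A + D - P.N * G) - (B + E - P.N * K) from fun _ _ _ _ _ _ => by ring, sY, sE, exp_sub,
    exp_sub, exp_sub (P.stateExp C (C.logAlong (P.countingFn h lam) vE) wE), exp_sub]
  rw [exp_neg, ← div_eq_mul_inv] at iY iE
  simp_rw [add_comm P.ξm] at zY zE
  have nx : ∏ j, sinh (x j + P.ξm) ≠ 0 := Finset.prod_ne_zero_iff.2 fun j _ => hξx j
  have nl : ∏ k, sinh (lam k + P.ξm) ≠ 0 := Finset.prod_ne_zero_iff.2 fun j _ => hξlam j
  have nW := DE.stateW_ne_zero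
  have nb := pow_ne_zero P.N hξb
  have nc : ((-1 : ℂ) ^ P.N) ^ P.N * sinh (-(2 * P.b)) ^ P.N ≠ 0 :=
    mul_ne_zero (pow_ne_zero _ (pow_ne_zero _ (by norm_num)))
      (pow_ne_zero _ (by rw [sinh_neg]; exact neg_ne_zero.2 DY.b_ne))
  have E1 := exp_ne_zero (1 / 4 * log (1 - P.countingFn h' mu 0 ^ 2))
  have E2 := exp_ne_zero (1 / 4 * log (1 - P.countingFn h lam 0 ^ 2))
  have E3 := exp_ne_zero (C.cothInt (C.logAlong (P.countingFn h' mu) vY) (-P.ξm))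
  have E4 := exp_ne_zero (C.cothInt (C.logAlong (P.countingFn h lam) vE) (-P.ξm))
  have E5 := exp_ne_zero (P.stateExp C (C.logAlong (P.countingFn h' mu) vY) wY)
  have E6 := exp_ne_zero (P.stateExp C (C.logAlong (P.countingFn h lam) vE) wE)
  have E7 := exp_ne_zero (P.seriesF h' mu UY ΓY)
  have E8 := exp_ne_zero (P.seriesF h lam UE ΓE)
  rw [← xE] at iE
  clear sY sE cφ cs hFY' hLY' hFE' hLE' oY oE hwY' hwE' hLY hLE xE
  generalize exp (1 / 4 * log (1 - P.countingFn h' mu 0 ^ 2)) = q1 at *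
  generalize exp (1 / 4 * log (1 - P.countingFn h lam 0 ^ 2)) = q2 at *
  generalize exp (C.cothInt (C.logAlong (P.countingFn h' mu) vY) (-P.ξm)) = q3 at *
  generalize exp (C.cothInt (C.logAlong (P.countingFn h lam) vE) (-P.ξm)) = q4 at *
  generalize exp (P.stateExp C (C.logAlong (P.countingFn h' mu) vY) wY) = q5 at *
  generalize exp (P.stateExp C (C.logAlong (P.countingFn h lam) vE) wE) = q6 at *
  generalize exp (P.seriesF h' mu UY ΓY) = q7 at *
  generalize exp (P.seriesF h lam UE ΓE) = q8 at *
  generalize P.Kfac (P.countingFn h' mu) C (C.logAlong (P.countingFn h' mu) vY) x y = K at *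
  generalize P.stateW h' mu = WY at *
  generalize P.stateW h lam = WE at *
  generalize ((-1 : ℂ) ^ P.N) ^ P.N * sinh (-(2 * P.b)) ^ P.N = c at *
  generalize (∏ k, sinh (mu k + P.ξm)) = m1 at *
  generalize (∏ k, sinh (lam k + P.ξm)) = m2 at *
  generalize (∏ k, sinh (wY k + P.ξm)) = m3 at *
  generalize (∏ k, sinh (x k + P.ξm)) = m4 at *
  generalize (∏ k, sinh (y k + P.ξm)) = m5 at *
  generalize (1 + P.countingFn h' mu (-P.ξm)) ^ C.ind (-P.ξm) = i1 at *
  generalize (1 + P.countingFn h lam (-P.ξm)) ^ C.ind (-P.ξm) = i2 at *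
  generalize sinh (P.ξm - P.b) ^ P.N = s at *
  generalize P.Z mu = ZY at *
  generalize P.Z lam = ZE at *
  have r1 : ZY = c * m1 * WY * q7 / q1 := by rw [eq_div_iff E1]; exact zY
  have r2 : ZE = c * m2 * WE * q8 / q2 := by rw [eq_div_iff E2]; exact zE
  have r3 : i1 = m3 * q3 / s := by rw [div_eq_iff E3] at iY; rw [iY]; ring
  have r4 : i2 = m2 * q4 / s := by rw [div_eq_iff E4] at iE; rw [iE]; ring
  have r5 : m1 = m3 * m5 / m4 := by rw [eq_div_iff nx]; exact xY
  have r6 : WY = WE * q5 * (H * K) / q6 := by rw [eq_div_iff E6]; exact hH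
  rw [r1, r2, r3, r4, r5, r6]
  field_simp

end Params

namespace Params

variable {P : Params} {h : ℝ} {μ : Fin P.N → ℂ} {C : Contour} {n : ℕ} {x y : Fin n → ℂ}
  {w : Fin P.N → ℂ} {e : ℂ → ℂ} {L : ℝ → ℂ}

theorem Kfac_zero (a : ℂ → ℂ) (x y : Fin 0 → ℂ) : P.Kfac a C L x y = 1 := by simp [Kfac]

namespace StateData

theorem exp_stateExp (D : P.StateData h μ C x y w e)
    (hL : C.IsLogAlong (fun s => 1 + P.countingFn h μ s) L) :
    exp (2 * P.stateExp C L w) = P.ampConst * P.ampSq (1 + P.countingFn h μ 0) e w :=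
  Params.exp_stateExp D.base D.b_ne D.fac hL (by simp [countingFn_b D.pos])
    (one_add_ne_zero_of_norm_lt_one D.a_zero) D.w_neg

theorem Kfac_ne_zero (D : P.StateData h μ C x y w e)
    (hL : C.IsLogAlong (fun s => 1 + P.countingFn h μ s) L) :
    P.Kfac (P.countingFn h μ) C L x y ≠ 0 := fun h0 => by
  have := D.stateW_sq hL
  rw [h0] at this
  exact pow_ne_zero 2 D.stateW_ne_zero (by rw [this]; ring)

/-- The identity between the amplitudes of two states, up to a determination of the hole factor. -/
theorem exists_hole {h' : ℝ} {mu : Fin P.N → ℂ} {wY : Fin P.N → ℂ} {eY : ℂ → ℂ} {LY : ℝ → ℂ}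
    (DE : P.StateData h μ C (Fin.elim0 : Fin 0 → ℂ) (Fin.elim0 : Fin 0 → ℂ) w e)
    (DY : P.StateData h' mu C x y wY eY)
    (hL : C.IsLogAlong (fun s => 1 + P.countingFn h μ s) L)
    (hLY : C.IsLogAlong (fun s => 1 + P.countingFn h' mu s) LY) :
    ∃ H : ℂ, H ≠ 0 ∧ P.IsHoleFactor (P.countingFn h' mu) x H ∧
      P.stateW h' mu * exp (P.stateExp C L w) =
        P.stateW h μ * exp (P.stateExp C LY wY) *
          (H * P.Kfac (P.countingFn h' mu) C LY x y) := by
  have sE := DE.stateW_sq hL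
  have sY := DY.stateW_sq hLY
  have tE := DE.exp_stateExp hL
  have tY := DY.exp_stateExp hLY
  have nE := DE.stateW_ne_zero
  have nY := DY.stateW_ne_zero
  have nK := DY.Kfac_ne_zero hLY
  have e1 := exp_ne_zero (P.stateExp C L w)
  have e2 := exp_ne_zero (P.stateExp C LY wY)
  refine ⟨P.stateW h' mu * exp (P.stateExp C L w) /
    (P.stateW h μ * exp (P.stateExp C LY wY) * P.Kfac (P.countingFn h' mu) C LY x y), ?_, ?_, ?_⟩
  · exact div_ne_zero (mul_ne_zero nY e1) (mul_ne_zero (mul_ne_zero nE e2) nK)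
  · have hlim := DY.tendsto_holeFactorSq
    rw [IsHoleFactor]
    refine (congrArg 𝓝 ?_).subst (motive := fun F => Tendsto _ _ F) hlim
    have hh : holeSq P e μ (Fin.elim0 : Fin 0 → ℂ) (Fin.elim0 : Fin 0 → ℂ) 0 = 1 := by
      simp [holeSq]
    rw [Kfac_zero, hh, one_pow, mul_one, mul_one] at sE
    rw [two_mul, exp_add, ← sq] at tE tY
    have n4 : P.ampConst * P.ampSq (1 + P.countingFn h' mu 0) eY wY ≠ 0 := by
      rw [← tY]; exact pow_ne_zero _ e2
    have n5 : P.ampSq (1 + P.countingFn h μ 0) e w ≠ 0 := by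
      rw [← sE]; exact pow_ne_zero _ nE
    have n6 := left_ne_zero_of_mul n4
    have n7 := right_ne_zero_of_mul n4
    rw [div_pow, mul_pow, mul_pow, mul_pow, sE, sY, tE, tY]
    generalize P.ampSq (1 + P.countingFn h μ 0) e w = a at *
    generalize P.ampSq (1 + P.countingFn h' mu 0) eY wY = b at *
    generalize P.ampConst = c at *
    generalize P.Kfac (P.countingFn h' mu) C LY x y = K at *
    field_simp
  · generalize P.Kfac (P.countingFn h' mu) C LY x y = K at *
    field_simp

end StateData
end Params

namespace Params

variable {P : Params} {h : ℝ} {μ : Fin P.N → ℂ} {C : Contour} {n : ℕ} {x y : Fin n → ℂ}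
  {w : Fin P.N → ℂ} {e : ℂ → ℂ} {L : ℝ → ℂ}

variable (P) in
/-- The amplitude attached to the points `w`, with principal square roots of `1 + a`. -/
noncomputable def amp (a : ℂ → ℂ) (w : Fin P.N → ℂ) : ℂ :=
  (∏ i, ∏ j ∈ Finset.Ioi i, P.f (w i) (w j)) / (∏ i, sinh (2 * w i)) *
  (∏ i, sinh (w i - P.b) * sinh (w i - -(P.iζ + P.b))) ^ P.N *
  (∏ i, (1 + a (-w i)) ^ (1 / 2 : ℂ)) * (1 + a 0) ^ (1 / 2 : ℂ)

/-- The amplitude of a state in terms of the zeros of `1 + â` inside of the contour. -/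
theorem StateData.stateW_eq (D : P.StateData h μ C x y w e)
    (hL : C.IsLogAlong (fun s => 1 + P.countingFn h μ s) L)
    (hw : ∀ i j, sinh (w i + w j) ≠ 0) :
    P.stateW h μ = P.amp (P.countingFn h μ) w * P.Kfac (P.countingFn h μ) C L x y *
      P.holeFactor (P.countingFn h μ) x := by
  have t1 := D.pairs P.f f_comm
  have t2 := D.single fun u => sinh (2 * u)
  have t3 := D.single fun u => sinh (u - P.b) * sinh (u - -(P.iζ + P.b))
  have t4 := D.single fun u => (1 + P.countingFn h μ (-u)) ^ (1 / 2 : ℂ)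
  have hx : ∀ j, 1 + P.countingFn h μ (-x j) = P.regE e (x j) * ∏ l, sinh (x j + w l) := fun j =>
    factored_neg (P := P) D.fac (Or.inr (D.x_ne j).2.2.2.2.2.2.1) (D.x_ne j).2.2.2.2.2.1
  have hxw : ∀ j l, sinh (w l + x j) ≠ 0 := fun j l => by
    obtain ⟨i, hi⟩ := D.x_mem j
    rw [hi]; exact hw l i
  have hxw' : ∀ j l, sinh (w l + x j - P.iζ) ≠ 0 := fun j l => by
    obtain ⟨i, hi⟩ := D.x_mem j
    rw [hi]; exact D.w_add_w_sub l i
  have hx0 : ∀ j, 1 + P.countingFn h μ (-x j) ≠ 0 := fun j => by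
    rw [hx]
    exact mul_ne_zero (D.x_ne j).1 (Finset.prod_ne_zero_iff.2 fun l _ => by
      rw [add_comm]; exact hxw j l)
  have hR : (∏ i, P.regE e (x i)) * ∏ l, ∏ j, sinh (w l + x j - P.iζ) =
      (∏ i, (1 + P.countingFn h μ (-x i)) ^ (1 / 2 : ℂ)) ^ 2 * ∏ l, ∏ j, P.f (w l) (x j) := by
    rw [← Finset.prod_pow]
    simp_rw [sq_cpow_half, hx, f]
    rw [Finset.prod_mul_distrib, Finset.prod_comm (f := fun l j => sinh (w l + x j - P.iζ)),
      Finset.prod_comm (f := fun l j => sinh (w l + x j - P.iζ) / sinh (w l + x j)), mul_assoc,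
      ← Finset.prod_mul_distrib (f := fun j => ∏ l, sinh (x j + w l))]
    congr 1
    refine Finset.prod_congr rfl fun j _ => ?_
    rw [← Finset.prod_mul_distrib]
    refine Finset.prod_congr rfl fun l _ => ?_
    rw [add_comm (x j), mul_div_cancel₀ _ (hxw j l)]
  have hff : ∏ i, P.f (x i) (x i) = (∏ i, sinh (2 * x i - P.iζ)) / ∏ i, sinh (2 * x i) := by
    simp_rw [f, ← two_mul, Finset.prod_div_distrib]
  have n1 : ∏ i, (1 + P.countingFn h μ (-x i)) ^ (1 / 2 : ℂ) ≠ 0 :=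
    Finset.prod_ne_zero_iff.2 fun j _ => by
      rw [Complex.cpow_def_of_ne_zero (hx0 j)]; exact exp_ne_zero _
  have n2 : ∏ l, ∏ j, P.f (w l) (x j) ≠ 0 := Finset.prod_ne_zero_iff.2 fun l _ =>
    Finset.prod_ne_zero_iff.2 fun j _ => div_ne_zero (hxw' j l) (hxw j l)
  have n3 : ∏ i, ∏ j, P.f (x i) (y j) ≠ 0 := Finset.prod_ne_zero_iff.2 fun i _ =>
    Finset.prod_ne_zero_iff.2 fun j _ => div_ne_zero ((D.x_ne i).2.2.2.2.2.2.2 j)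
      ((D.x_ne i).2.2.2.1 j)
  have n4 : ∏ i, sinh (2 * x i) ≠ 0 := Finset.prod_ne_zero_iff.2 fun i _ => (D.x_ne i).2.1
  have n5 : ∏ i, sinh (2 * w i) ≠ 0 := Finset.prod_ne_zero_iff.2 fun i _ => D.sinh_two_w i
  have n6 : ∏ i, sinh (2 * y i) ≠ 0 := Finset.prod_ne_zero_iff.2 fun i _ => by
    obtain ⟨k, hk⟩ := D.y_mem i
    rw [hk, two_mul]; exact D.add_ne k k
  have n7 : ∏ i, sinh (x i - P.b) * sinh (x i - -(P.iζ + P.b)) ≠ 0 :=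
    Finset.prod_ne_zero_iff.2 fun j _ => by
      obtain ⟨i, hi⟩ := D.x_mem j
      rw [hi]; exact mul_ne_zero (D.w_sub_b i) (D.w_shift i).2
  rw [D.Kfac_eq hL, mul_right_comm (∏ i, P.regE e (x i)), hR, stateW, amp, holeFactor]
  rw [hff] at t1
  have t3' := congrArg (· ^ P.N) t3
  simp only [mul_pow] at t3'
  have n7' := pow_ne_zero P.N n7
  generalize (∏ i, sinh (x i - P.b) * sinh (x i - -(P.iζ + P.b))) ^ P.N = Bx at *
  generalize (∏ i, sinh (y i - P.b) * sinh (y i - -(P.iζ + P.b))) ^ P.N = By at *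
  generalize (∏ i, sinh (w i - P.b) * sinh (w i - -(P.iζ + P.b))) ^ P.N = Bw at *
  generalize (∏ i, sinh (μ i - P.b) * sinh (μ i - -(P.iζ + P.b))) ^ P.N = Bμ at *
  generalize (∏ i, sinh (2 * x i)) = Sx at *
  generalize (∏ i, sinh (2 * y i)) = Sy at *
  generalize (∏ i, sinh (2 * w i)) = Sw at *
  generalize (∏ i, sinh (2 * μ i)) = Sμ at *
  generalize (∏ i, sinh (2 * x i - P.iζ)) = Tx at *
  generalize (∏ i, (1 + P.countingFn h μ (-x i)) ^ (1 / 2 : ℂ)) = Rx at *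
  generalize (∏ i, (1 + P.countingFn h μ (-y i)) ^ (1 / 2 : ℂ)) = Ry at *
  generalize (∏ i, (1 + P.countingFn h μ (-w i)) ^ (1 / 2 : ℂ)) = Rw at *
  generalize (∏ i, (1 + P.countingFn h μ (-μ i)) ^ (1 / 2 : ℂ)) = Rμ at *
  generalize (1 + P.countingFn h μ 0) ^ (1 / 2 : ℂ) = R₀
  generalize (∏ i, ∏ j ∈ Finset.Ioi i, P.f (x i) (x j)) = Fx at *
  generalize (∏ i, ∏ j ∈ Finset.Ioi i, P.f (y i) (y j)) = Fy at *
  generalize (∏ i, ∏ j ∈ Finset.Ioi i, P.f (w i) (w j)) = Fw at *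
  generalize (∏ i, ∏ j ∈ Finset.Ioi i, P.f (μ i) (μ j)) = Fμ at *
  generalize (∏ i, ∏ j, P.f (x i) (y j)) = Fxy at *
  generalize (∏ l, ∏ j, P.f (w l) (y j)) = Fwy at *
  generalize (∏ l, ∏ j, P.f (w l) (x j)) = Fwx at *
  have r1 : Fμ = Fw * Fwy * (Fy * Fx * (Tx / Sx)) / (Fwx * Fxy) := by
    rw [eq_div_iff (mul_ne_zero n2 n3)]; linear_combination t1
  have r2 : Sμ = Sw * Sy / Sx := by rw [eq_div_iff n4]; exact t2
  have r3 : Bμ = Bw * By / Bx := by rw [eq_div_iff n7']; exact t3'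
  have r4 : Rμ = Rw * Ry / Rx := by rw [eq_div_iff n1]; exact t4
  rw [r1, r2, r3, r4]
  field_simp

/-- The square of the amplitude, when the `w` are the zeros of `1 + a` inside of the contour. -/
theorem amp_sq {a : ℂ → ℂ} (hF : C.IsFactored (fun s => 1 + a s) (-P.b) P.N w e)
    (hn : ∀ i, -w i ∈ C.inner) (hb : ∀ i, sinh (w i - P.b) ≠ 0)
    (hw : ∀ i j, sinh (w i + w j) ≠ 0) (hw' : ∀ i, sinh (2 * w i - P.iζ) ≠ 0) :
    P.amp a w ^ 2 = P.ampSq (1 + a 0) e w := by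
  have t1 := prod_prod_eq_sq_mul_diag (fun u v => sinh (u + v - P.iζ)) (fun u v => by rw [add_comm]) w
  have t2 := prod_prod_eq_sq_mul_diag (fun u v => sinh (u + v)) (fun u v => by rw [add_comm]) w
  have n1 : ∏ i, sinh (2 * w i) ≠ 0 := Finset.prod_ne_zero_iff.2 fun i _ => by
    rw [two_mul]; exact hw i i
  have n2 : ∏ i, sinh (2 * w i - P.iζ) ≠ 0 := Finset.prod_ne_zero_iff.2 fun i _ => hw' i
  have n3 : ∏ i, ∏ j ∈ Finset.Ioi i, sinh (w i + w j) ≠ 0 := Finset.prod_ne_zero_iff.2 fun i _ =>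
    Finset.prod_ne_zero_iff.2 fun j _ => hw i j
  have hR : ∀ i, 1 + a (-w i) = P.regE e (w i) * ∏ l, sinh (w i + w l) := fun i =>
    factored_neg (P := P) hF (Or.inr (hn i)) (hb i)
  rw [amp, ampSq, Finset.prod_comm (f := fun i l => sinh (w l + w i - P.iζ)), t1]
  simp only [mul_pow, div_pow, ← Finset.prod_pow _ 2, sq_cpow_half, hR]
  rw [Finset.prod_mul_distrib (f := fun i => P.regE e (w i)), t2]
  simp only [Finset.prod_pow _ 2, f, Finset.prod_div_distrib, Finset.prod_mul_distrib, ← two_mul]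
  rw [pow_mul', pow_mul', sq (_ ^ P.N), sq (_ ^ P.N)]
  generalize (∏ i, ∏ j ∈ Finset.Ioi i, sinh (w i + w j)) = G at *
  generalize (∏ i, ∏ j ∈ Finset.Ioi i, sinh (w i + w j - P.iζ)) = G' at *
  generalize (∏ i, sinh (2 * w i)) = S at *
  generalize (∏ i, sinh (2 * w i - P.iζ)) = T at *
  field_simp
  ring

theorem amp_perm (a : ℂ → ℂ) (w : Fin P.N → ℂ) (σ : Equiv.Perm (Fin P.N)) :
    P.amp a (w ∘ σ) = P.amp a w := by
  have h1 : ∏ i, ∏ j ∈ Finset.Ioi i, P.f (w (σ i)) (w (σ j)) =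
      ∏ i, ∏ j ∈ Finset.Ioi i, P.f (w i) (w j) := by
    rw [prod_Ioi_eq_prod_ite, prod_Ioi_eq_prod_ite (fun i j => P.f (w i) (w j)),
      ← prod_ite_lt_comp σ.injective _ fun _ _ => f_comm _ _,
      ← Equiv.prod_comp σ fun i => ∏ j, if i < j then P.f (w i) (w j) else 1]
    exact Finset.prod_congr rfl fun i _ =>
      Equiv.prod_comp σ fun j => if σ i < j then P.f (w (σ i)) (w j) else 1
  unfold amp
  simp only [Function.comp_apply]
  rw [h1, Equiv.prod_comp σ fun i => sinh (2 * w i),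
    Equiv.prod_comp σ fun i => sinh (w i - P.b) * sinh (w i - -(P.iζ + P.b)),
    Equiv.prod_comp σ fun i => (1 + a (-w i)) ^ (1 / 2 : ℂ)]

theorem stateExp_perm (w : Fin P.N → ℂ) (σ : Equiv.Perm (Fin P.N)) :
    P.stateExp C L (w ∘ σ) = P.stateExp C L w := by
  unfold stateExp expX
  simp only [Function.comp_apply]
  rw [Equiv.sum_comp σ fun i => C.cothInt L (-w i) - C.cothInt L (P.iζ - w i)]

end Params

theorem exists_perm_of_map_eq {N : ℕ} {α : Type*} {u v : Fin N → α}
    (h : Finset.univ.val.map u = Finset.univ.val.map v) : ∃ σ : Equiv.Perm (Fin N), u = v ∘ σ := by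
  classical
  have key : ∀ z, Nonempty ({i // u i = z} ≃ {i // v i = z}) := fun z => by
    have := congrArg (Multiset.count z) h
    rw [Multiset.count_map, Multiset.count_map] at this
    refine Fintype.card_eq.1 ?_
    rw [Fintype.card_subtype, Fintype.card_subtype]
    simp_rw [eq_comm (a := z)] at this
    exact this
  let e := fun z => (key z).some
  exact ⟨Equiv.ofFiberEquiv (f := u) (g := v) e, funext fun i =>
    (Equiv.ofFiberEquiv_map (f := u) (g := v) e i).symm⟩

open Polynomial in
/-- Products of linear factors that are proportional at infinitely many points have the same
roots. -/
theorem exists_perm_of_prod_eq {N : ℕ} {u v : Fin N → ℂ} {c d : ℂ} (hc : c ≠ 0) {S : Set ℂ}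
    (hS : S.Infinite) (h : ∀ z ∈ S, c * ∏ i, (z - u i) = d * ∏ i, (z - v i)) :
    ∃ σ : Equiv.Perm (Fin N), u = v ∘ σ := by
  have hp : C c * ∏ i, (X - C (u i)) = C d * ∏ i, (X - C (v i)) :=
    Polynomial.eq_of_infinite_eval_eq _ _ (hS.mono fun z hz => by
      simpa [Polynomial.eval_prod] using h z hz)
  have hd : d ≠ 0 := fun h0 => by
    rw [h0, C_0, zero_mul] at hp
    exact mul_ne_zero (C_ne_zero.2 hc) (Finset.prod_ne_zero_iff.2 fun i _ => X_sub_C_ne_zero _) hp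
  refine exists_perm_of_map_eq ?_
  have hr := congrArg Polynomial.roots hp
  rw [roots_C_mul _ hc, roots_C_mul _ hd] at hr
  have hm : ∀ u : Fin N → ℂ, ∏ i, (X - C (u i)) =
      ((Finset.univ.val.map u).map fun a => X - C a).prod := fun u => by
    rw [Multiset.map_map]; rfl
  rwa [hm u, hm v, roots_multiset_prod_X_sub_C, roots_multiset_prod_X_sub_C] at hr

theorem sinh_sub_eq_exp (w p : ℂ) :
    sinh (w - p) = -(exp (-w) / 2 * exp (-p)) * (exp (2 * p) - exp (2 * w)) := by
  rw [sinh]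
  have e1 : exp (w - p) = exp (-w) * exp (-p) * exp (2 * w) := by
    rw [← exp_add, ← exp_add]; congr 1; ring
  have e2 : exp (-(w - p)) = exp (-w) * exp (-p) * exp (2 * p) := by
    rw [← exp_add, ← exp_add]; congr 1; ring
  rw [e1, e2]; ring

namespace Contour

variable {C : Contour}

theorem exists_outsideMod_of_lt : ∃ R : ℝ, ∀ r : ℝ, R < r → C.OutsideMod r := by
  obtain ⟨R, hR⟩ := C.isBounded_hull.exists_norm_le
  refine ⟨R, fun r hr k hk => ?_⟩
  have h1 := (abs_re_le_norm _).trans (hR _ hk)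
  have h2 : ((r : ℂ) + k * (Real.pi * I)).re = r := by simp
  rw [h2] at h1
  linarith [le_abs_self r]

/-- Points of the closed domain bounded by `C` are determined, up to their order, by the product
of the `sinh(w_i - p)` for `p` outside of `C`. -/
theorem exists_perm_of_prod_sinh_eq {N : ℕ} {u v : Fin N → ℂ} (hu : ∀ i, u i ∈ C.hull)
    (hv : ∀ i, v i ∈ C.hull)
    (h : ∀ p, C.OutsideMod p → ∏ i, sinh (u i - p) = ∏ i, sinh (v i - p)) :
    ∃ σ : Equiv.Perm (Fin N), u = v ∘ σ := by
  obtain ⟨R, hR⟩ := C.exists_outsideMod_of_lt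
  have hS : ((fun r : ℝ => exp (2 * r)) '' Set.Ioi R).Infinite := by
    refine (Set.Ioi_infinite R).image fun r _ r' _ hrr => ?_
    have h2 : Real.exp (2 * r) = Real.exp (2 * r') := by
      have : ((Real.exp (2 * r) : ℝ) : ℂ) = (Real.exp (2 * r') : ℝ) := by push_cast; exact hrr
      exact_mod_cast this
    linarith [Real.exp_injective h2]
  have hn : ∀ w : Fin N → ℂ, ∀ p, ∏ i, sinh (w i - p) =
      (∏ i, (exp (-w i) / 2)) * (-exp (-p)) ^ N * ∏ i, (exp (2 * p) - exp (2 * w i)) := fun w p => by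
    simp_rw [sinh_sub_eq_exp]
    rw [Finset.prod_mul_distrib, ← Fin.prod_const,
      ← Finset.prod_mul_distrib (f := fun i => exp (-w i) / 2)]
    congr 1
    exact Finset.prod_congr rfl fun i _ => by ring
  obtain ⟨σ, hσ⟩ := exists_perm_of_prod_eq (u := fun i => exp (2 * u i)) (v := fun i => exp (2 * v i))
    (c := ∏ i, (exp (-u i) / 2)) (d := ∏ i, (exp (-v i) / 2)) (Finset.prod_ne_zero_iff.2
      fun i _ => div_ne_zero (exp_ne_zero _) two_ne_zero) hS (by
      rintro z ⟨r, hr, rfl⟩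
      have h1 := h r (hR r hr)
      rw [hn u, hn v] at h1
      have h2 : (-exp (-(r : ℂ))) ^ N ≠ 0 := pow_ne_zero _ (neg_ne_zero.2 (exp_ne_zero _))
      exact mul_left_cancel₀ h2 (by linear_combination h1))
  refine ⟨σ, funext fun i => by_contra fun hne => ?_⟩
  refine sinh_sub_ne_zero_of_mem (hv (σ i)) (hu i) hne ?_
  have := congrFun hσ i
  simp only [Function.comp_apply] at this
  rw [sinh_sub_eq_exp, this, sub_self, mul_zero]

theorem IsFactored.comp_perm {φ : ℂ → ℂ} {v : ℂ} {N : ℕ} {w : Fin N → ℂ} {e : ℂ → ℂ}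
    (h : C.IsFactored φ v N w e) (σ : Equiv.Perm (Fin N)) : C.IsFactored φ v N (w ∘ σ) e :=
  ⟨h.v_mem, fun i => h.w_mem _, h.logNear, fun s hs => (h.eq s hs).mono fun z hz hzv => by
    rw [hz hzv]
    congr 1
    exact (Equiv.prod_comp σ fun i => sinh (z - w i)).symm⟩

/-- The principal logarithm along `C`. -/
noncomputable def logPr (C : Contour) (a : ℂ → ℂ) (τ : ℝ) (t : ℝ) : ℂ :=
  log (1 + τ * a (C.toFun t)) / (2 * Real.pi * I)

theorem one_add_mul_mem_slitPlane {z : ℂ} (hz : 1 + z ∈ slitPlane) {τ : ℝ}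
    (hτ : τ ∈ Set.Icc (0 : ℝ) 1) : 1 + τ * z ∈ slitPlane := by
  have := starConvex_one_slitPlane hz (sub_nonneg.2 hτ.2) hτ.1 (sub_add_cancel 1 τ)
  rw [real_smul, real_smul] at this
  rwa [show 1 + (τ : ℂ) * z = ((1 - τ : ℝ) : ℂ) * 1 + τ * (1 + z) by push_cast; ring]

variable {a : ℂ → ℂ}

theorem isLogAlong_logPr (ha : ∀ s ∈ C.trace, AnalyticAt ℂ a s) {τ : ℝ}
    (hs : ∀ s ∈ C.trace, 1 + τ * a s ∈ slitPlane) :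
    C.IsLogAlong (fun s => 1 + τ * a s) (C.logPr a τ) := by
  have hpi : (2 * Real.pi * I : ℂ) ≠ 0 := two_pi_I_ne_zero
  have han : ∀ s ∈ C.trace, AnalyticAt ℂ (fun s => 1 + τ * a s) s := fun s hs =>
    analyticAt_const.add (analyticAt_const.mul (ha s hs))
  refine ⟨?_, ?_, fun t ht => ?_, han, fun s h => slitPlane_ne_zero (hs s h), fun t ht hb => ?_⟩
  · refine ContinuousOn.div_const (C.continuousOn_comp (f := fun s => log (1 + τ * a s))
      fun s h => ?_) _
    exact (han s h).continuousAt.clog (hs s h)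
  · rw [logPr, logPr, C.closed]
  · rw [logPr, mul_div_cancel₀ _ hpi]
    exact exp_log (slitPlane_ne_zero (hs _ (C.mem_trace ht)))
  · have hm := C.mem_trace (Set.Ioo_subset_Icc_self ht)
    have h1 : HasDerivAt (fun t => 1 + τ * a (C.toFun t))
        (deriv (fun s => 1 + τ * a s) (C.toFun t) * deriv C.toFun t) t :=
      HasDerivAt.comp t (h₂ := fun s => 1 + τ * a s) (han _ hm).differentiableAt.hasDerivAt
        (C.hasDerivAt_toFun ht hb)
    refine ((h1.clog_real (hs _ hm)).div_const (2 * Real.pi * I)).congr_deriv ?_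
    rw [logDeriv_apply]
    ring

theorem IsLogAlong.integral_logDeriv {φ : ℂ → ℂ} {L : ℝ → ℂ} (hL : C.IsLogAlong φ L) :
    C.integral (logDeriv φ) = 0 := by
  have hpi : (2 * Real.pi * I : ℂ) ≠ 0 := two_pi_I_ne_zero
  rw [integral, C.pathIntegral_eq_sub (F := fun t => 2 * Real.pi * I * L t)
    (g := fun t => logDeriv φ (C.toFun t))
    (continuousOn_const.mul hL.continuousOn) (C.continuousOn_comp (f := logDeriv φ) fun s hs =>
      (hL.analyticAt s hs).deriv.continuousAt.div (hL.analyticAt s hs).continuousAt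
        (hL.ne_zero s hs)) fun t ht hb => ?_, hL.closed, sub_self]
  refine ((hL.hasDerivAt t ht hb).const_mul (2 * Real.pi * I)).congr_deriv ?_
  rw [← mul_assoc, mul_div_cancel₀ _ hpi]

theorem IsLogAlong.eqOn {φ : ℂ → ℂ} {L L' : ℝ → ℂ} (hL : C.IsLogAlong φ L)
    (hL' : C.IsLogAlong φ L') (h0 : L 0 = L' 0) : Set.EqOn L L' (Set.Icc 0 1) := fun t ht => by
  have : PreconnectedSpace (Set.Icc (0 : ℝ) 1) :=
    isPreconnected_iff_preconnectedSpace.1 isPreconnected_Icc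
  have key := exp_lift_unique (X := Set.Icc (0 : ℝ) 1)
    (g₁ := fun t => 2 * Real.pi * I * L t) (g₂ := fun t => 2 * Real.pi * I * L' t)
    (continuous_const.mul (continuousOn_iff_continuous_domRestrict.1 hL.continuousOn))
    (continuous_const.mul (continuousOn_iff_continuous_domRestrict.1 hL'.continuousOn))
    (fun t => by rw [hL.exp_eq t t.2, hL'.exp_eq t t.2]) (a := ⟨0, by simp⟩) (by
      simp only [h0])
  exact mul_left_cancel₀ two_pi_I_ne_zero (congrFun key ⟨t, ht⟩)

theorem cothInt_congr {L L' : ℝ → ℂ} (h : Set.EqOn L L' (Set.Icc 0 1)) (p : ℂ) :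
    C.cothInt L p = C.cothInt L' p :=
  pathIntegral_congr fun t ht => by rw [h ht]

theorem continuousAt_cothInt_logPr (ha : ∀ s ∈ C.trace, AnalyticAt ℂ a s) {τ : ℝ}
    (hs : ∀ s ∈ C.trace, 1 + τ * a s ∈ slitPlane) {p : ℂ} (hp : C.OffMod p) :
    ContinuousAt (fun q : ℝ × ℂ => C.cothInt (C.logPr a q.1) q.2) (τ, p) := by
  have e : (fun q : ℝ × ℂ => C.cothInt (C.logPr a q.1) q.2) = fun q =>
      C.integralW (fun _ => 1) (fun s =>
        coth (s - q.2) * (log (1 + q.1 * a s) / (2 * Real.pi * I))) := by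
    funext q
    refine pathIntegral_congr fun t _ => ?_
    rw [mul_one, logPr]
  have c1 : ∀ s ∈ C.trace,
      ContinuousAt (fun q : (ℝ × ℂ) × ℂ => sinh (q.2 - q.1.2)) ((τ, p), s) := fun s _ =>
    (continuous_sinh.comp (by fun_prop : Continuous fun q : (ℝ × ℂ) × ℂ =>
      q.2 - q.1.2)).continuousAt
  have c2 : ∀ s ∈ C.trace,
      ContinuousAt (fun q : (ℝ × ℂ) × ℂ => 1 + (q.1.1 : ℂ) * a q.2) ((τ, p), s) := fun s h => by
    have h1 : ContinuousAt (fun q : (ℝ × ℂ) × ℂ => a q.2) ((τ, p), s) :=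
      ContinuousAt.comp (g := a) (f := Prod.snd) (ha s h).continuousAt continuousAt_snd
    have h2 : Continuous fun q : (ℝ × ℂ) × ℂ => (q.1.1 : ℂ) :=
      continuous_ofReal.comp (by fun_prop)
    exact continuousAt_const.add (h2.continuousAt.mul h1)
  have c3 : ∀ s q, sinh (s - q) ≠ 0 → ContinuousAt coth (s - q) := fun s q h0 =>
    (hasDerivAt_coth h0).continuousAt
  rw [e]
  refine C.continuousAt_integralW continuousOn_const ?_ fun s h => ?_
  · refine C.isCompact_trace.eventually_forall_of_forall_eventually fun s h => ?_
    filter_upwards [(c1 s h).eventually_ne (hp s h), (c2 s h).eventually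
      (isOpen_slitPlane.mem_nhds (hs s h)), (ha s h).eventually_analyticAt.prod_inr_nhds _]
      with q h1 h2 h3
    refine ContinuousAt.mul ?_ (ContinuousAt.div_const (ContinuousAt.clog
      (f := fun s => 1 + (q.1.1 : ℂ) * a s) ?_ h2) _)
    · exact ContinuousAt.comp (f := fun s => s - q.1.2) (c3 _ _ h1) (by fun_prop)
    · exact continuousAt_const.add (continuousAt_const.mul h3.continuousAt)
  · refine ContinuousAt.mul ?_ (ContinuousAt.div_const (ContinuousAt.clog (c2 s h) (hs s h)) _)
    exact ContinuousAt.comp (g := coth) (f := fun q : (ℝ × ℂ) × ℂ => q.2 - q.1.2)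
      (c3 _ _ (hp s h)) (by fun_prop)

end Contour

namespace Params

variable {P : Params} {h : ℝ} {μ : Fin P.N → ℂ} {C : Contour} {n : ℕ} {x y : Fin n → ℂ}
  {w : Fin P.N → ℂ} {e : ℂ → ℂ}

variable (P) in
/-- A state for which the principal determinations are the right ones. -/
structure PrincipalState (h : ℝ) (μ : Fin P.N → ℂ) (C : Contour) : Prop where
  base : P.BaseContour C
  pos : 0 < P.N
  b_ne : sinh (2 * P.b) ≠ 0
  sub_outside : ∀ k, C.OutsideMod (μ k - P.iζ)
  rev_outside : ∀ k, C.OutsideMod (P.iζ - μ k)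
  principal : P.Principal h μ C
  a_zero : ‖P.countingFn h μ 0‖ < 1

theorem ParticleHole.principalState (hY : P.ParticleHole h μ C x y) (D : P.StateData h μ C x y w e)
    (hP : P.Principal h μ C) : P.PrincipalState h μ C where
  base := D.base
  pos := D.pos
  b_ne := D.b_ne
  sub_outside := hY.no_singular
  rev_outside k := by
    rcases hY.off k with hk | hk
    · exact (hY.zeros_neg _ hk (D.bethe.countingFn_eq k)).2
    · obtain ⟨j, hj⟩ := (hY.y_range (μ k)).2 ⟨k, rfl, hk⟩
      rw [← hj]; exact (hY.y_neg j).2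
  principal := hP
  a_zero := D.a_zero

variable (P h μ C) in
/-- The zeros of `1 + τ â`, together with the pole `-β/N` from which they start at `τ = 0`. -/
def IsDeformedZero (τ : ℝ) (u : ℂ) : Prop :=
  u ∈ C.inner ∧ (u = -P.b ∨ τ * P.countingFn h μ u = -1)

namespace PrincipalState

variable {τ : ℝ}

theorem norm_bR_lt_one (D : P.PrincipalState h μ C) {s : ℂ} (hs : s ∈ C.hull) :
    ‖P.bR h μ s‖ < 1 := by
  refine C.norm_lt_one_of_trace (fun s hs => analyticAt_bR (fun l => ?_) fun l => ?_)
    (fun s hs => ?_) s hs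
  · rw [show s - μ l + P.iζ = s - (μ l - P.iζ) by ring]
    exact Contour.sinh_sub_ne_zero_of_outsideMod (D.sub_outside l) hs
  · rw [show s + μ l - P.iζ = s - (P.iζ - μ l) by ring]
    exact Contour.sinh_sub_ne_zero_of_outsideMod (D.rev_outside l) hs
  · have := D.principal.r_lt_one s hs
    rwa [bR, show (∏ l, (sinh (s + μ l + P.iζ) * sinh (s - μ l - P.iζ)) /
      (sinh (s - μ l + P.iζ) * sinh (s + μ l - P.iζ))) = ∏ k, sinh (μ k + s + P.iζ) *
        sinh (μ k - s + P.iζ) / (sinh (μ k + s - P.iζ) * sinh (μ k - s - P.iζ)) from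
      Finset.prod_congr rfl fun l _ => by
        rw [show s - μ l - P.iζ = -(μ l - s + P.iζ) by ring,
          show s - μ l + P.iζ = -(μ l - s - P.iζ) by ring, sinh_neg, sinh_neg, add_comm s,
          mul_neg, neg_mul, neg_div_neg_eq, mul_comm (sinh (μ l - s - P.iζ))]]

theorem neg_b_isDeformedZero (D : P.PrincipalState h μ C) : P.IsDeformedZero h μ C τ (-P.b) :=
  ⟨D.base.neg_b_mem, Or.inl rfl⟩

theorem norm_neg_lt_one (D : P.PrincipalState h μ C) (hτ : τ ∈ Set.Icc (0 : ℝ) 1) {u : ℂ}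
    (hu : P.IsDeformedZero h μ C τ u) : ‖τ * P.countingFn h μ (-u)‖ < 1 := by
  rcases hu.2 with h0 | h0
  · rw [h0, neg_neg, countingFn_b D.pos]; simp
  · have ha : P.countingFn h μ u ≠ 0 := fun h1 => by rw [h1] at h0; norm_num at h0
    have n1 : sinh (u - P.b) ≠ 0 := fun h1 => ha (by
      rw [StateData.countingFn_eq_of_sinh u _ h1, countingFn_b D.pos])
    have n2 : sinh (u + P.b) ≠ 0 := fun h1 => ha (by
      rw [StateData.countingFn_eq_of_sinh u (-P.b) (by rwa [sub_neg_eq_add]),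
        countingFn_neg_b _ _ _ D.pos])
    have n3 := Contour.sinh_sub_ne_zero_of_outsideMod D.base.shift.2 (Or.inr hu.1)
    have n4 := Contour.sinh_sub_ne_zero_of_outsideMod D.base.shift.1 (Or.inr hu.1)
    have hm := countingFn_mul_neg (P := P) (h := h) (μ := μ) n1 n2
      (by rwa [show P.iζ + u + P.b = u - -(P.iζ + P.b) by ring])
      (by rw [show P.iζ - u + P.b = -(u - (P.iζ + P.b)) by ring, sinh_neg]
          exact neg_ne_zero.2 n4)
    have e1 : (τ : ℂ) * P.countingFn h μ (-u) = -((τ : ℂ) ^ 2 * P.bR h μ u) := by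
      rw [← hm]
      linear_combination ((τ : ℂ) * P.countingFn h μ (-u)) * h0
    rw [e1, norm_neg, norm_mul, norm_pow, norm_real, Real.norm_of_nonneg hτ.1]
    have := D.norm_bR_lt_one (Or.inr hu.1)
    have h2 : τ ^ 2 ≤ 1 := by nlinarith [hτ.1, hτ.2]
    nlinarith [norm_nonneg (P.bR h μ u), sq_nonneg τ]

theorem sinh_add_ne_zero (D : P.PrincipalState h μ C) (hτ : τ ∈ Set.Icc (0 : ℝ) 1) {u v : ℂ}
    (hu : P.IsDeformedZero h μ C τ u) (hv : P.IsDeformedZero h μ C τ v) : sinh (u + v) ≠ 0 := by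
  have key : ∀ {u v : ℂ}, P.IsDeformedZero h μ C τ u → τ * P.countingFn h μ v = -1 →
      sinh (u + v) ≠ 0 := fun {u v} hu hv h0 => by
    have := D.norm_neg_lt_one hτ hu
    rw [StateData.countingFn_eq_of_sinh (-u) v (by
      rw [show -u - v = -(u + v) by ring, sinh_neg, h0, neg_zero]), hv] at this
    norm_num at this
  rcases hv.2 with h1 | h1
  · rcases hu.2 with h2 | h2
    · rw [h1, h2, show -P.b + -P.b = -(2 * P.b) by ring, sinh_neg]
      exact neg_ne_zero.2 D.b_ne
    · rw [add_comm]; exact key hv h2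
  · exact key hu h1

theorem sinh_sub_b_ne_zero (D : P.PrincipalState h μ C) (hτ : τ ∈ Set.Icc (0 : ℝ) 1) {u : ℂ}
    (hu : P.IsDeformedZero h μ C τ u) : sinh (u - P.b) ≠ 0 := by
  have := D.sinh_add_ne_zero hτ hu D.neg_b_isDeformedZero
  rwa [← sub_eq_add_neg] at this

theorem analyticAt_countingFn (D : P.PrincipalState h μ C) {s : ℂ} (hs : s ∈ C.hull)
    (hb : sinh (s + P.b) ≠ 0) :
    AnalyticAt ℂ (P.countingFn h μ) s :=
  Params.analyticAt_countingFn hb (cden_ne_zero D.base.shift.1 D.sub_outside hs)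

theorem analyticAt_trace (D : P.PrincipalState h μ C) :
    ∀ s ∈ C.trace, AnalyticAt ℂ (P.countingFn h μ) s := fun s hs =>
  D.analyticAt_countingFn (Or.inl hs) (by
    simpa using Contour.sinh_sub_ne_zero_of_inner_of_trace D.base.neg_b_mem hs)

theorem slit (D : P.PrincipalState h μ C) (hτ : τ ∈ Set.Icc (0 : ℝ) 1) :
    ∀ s ∈ C.trace, 1 + τ * P.countingFn h μ s ∈ slitPlane := fun s hs =>
  Contour.one_add_mul_mem_slitPlane (D.principal.slit s hs) hτ

theorem isLogAlong (D : P.PrincipalState h μ C) (hτ : τ ∈ Set.Icc (0 : ℝ) 1) :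
    C.IsLogAlong (fun s => 1 + τ * P.countingFn h μ s) (C.logPr (P.countingFn h μ) τ) :=
  Contour.isLogAlong_logPr D.analyticAt_trace (D.slit hτ)

theorem exists_isFactored (D : P.PrincipalState h μ C) (hτ : τ ∈ Set.Icc (0 : ℝ) 1) :
    ∃ (w : Fin P.N → ℂ) (e : ℂ → ℂ), C.IsFactored (fun s => 1 + τ * P.countingFn h μ s) (-P.b) P.N w e := by
  obtain ⟨w, e, h1, -⟩ := exists_isFactored_countingFn (h := h) D.base.neg_b_mem D.base.shift.1
    D.sub_outside τ (fun s hs => slitPlane_ne_zero (D.slit hτ s hs))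
    (D.isLogAlong hτ).integral_logDeriv
  exact ⟨w, e, h1⟩

theorem isDeformedZero (D : P.PrincipalState h μ C)
    (hF : C.IsFactored (fun s => 1 + (τ : ℂ) * P.countingFn h μ s) (-P.b) P.N w e) (i : Fin P.N) :
    P.IsDeformedZero h μ C τ (w i) := by
  refine ⟨hF.w_mem i, or_iff_not_imp_left.2 fun hne => ?_⟩
  have hi : w i ∈ C.hull := Or.inr (hF.w_mem i)
  have h1 := (hF.eq _ hi).self_of_nhds hne
  rw [Finset.prod_eq_zero (Finset.mem_univ i) (by rw [sub_self, sinh_zero]), mul_zero,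
    mul_eq_zero, or_iff_left (pow_ne_zero _ (Contour.sinh_sub_ne_zero_of_mem
      (Or.inr D.base.neg_b_mem) hi hne))] at h1
  linear_combination h1

variable (P h μ C) in
/-- The amplitude of the deformed state, divided by its representation by contour integrals. -/
noncomputable def ampRatio (q : ℝ × (Fin P.N → ℂ)) : ℂ :=
  P.amp (fun s => q.1 * P.countingFn h μ s) q.2 *
    exp (-P.stateExp C (C.logPr (P.countingFn h μ) q.1) q.2)

theorem ampRatio_sq (D : P.PrincipalState h μ C) (hτ : τ ∈ Set.Icc (0 : ℝ) 1)
    (hF : C.IsFactored (fun s => 1 + (τ : ℂ) * P.countingFn h μ s) (-P.b) P.N w e) :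
    P.ampConst * ampRatio P h μ C (τ, w) ^ 2 = 1 := by
  have hz := fun i => D.isDeformedZero hF i
  have h0 : 1 + (τ : ℂ) * P.countingFn h μ 0 ≠ 0 := by
    refine one_add_ne_zero_of_norm_lt_one ?_
    rw [norm_mul, norm_real, Real.norm_of_nonneg hτ.1]
    nlinarith [D.a_zero, hτ.1, hτ.2, norm_nonneg (P.countingFn h μ 0)]
  have h1 := Params.exp_stateExp D.base D.b_ne hF (D.isLogAlong hτ)
    (by simp [countingFn_b D.pos]) h0
    fun i => ⟨D.principal.symm _ (hF.w_mem i), D.principal.shift _ (hF.w_mem i)⟩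
  have h2 := amp_sq (P := P) hF (fun i => D.principal.symm _ (hF.w_mem i))
    (fun i => D.sinh_sub_b_ne_zero hτ (hz i)) (fun i j => D.sinh_add_ne_zero hτ (hz i) (hz j))
    fun i => D.base.sinh_two_mul_sub_ne (Or.inr (hF.w_mem i))
  rw [ampRatio, mul_pow, h2, ← mul_assoc, ← h1, ← exp_nat_mul, ← exp_add]
  rw [show (2 * P.stateExp C (C.logPr (P.countingFn h μ) τ) w +
    (2 : ℕ) * -P.stateExp C (C.logPr (P.countingFn h μ) τ) w) = 0 by push_cast; ring, exp_zero]

theorem continuousAt_ampRatio (D : P.PrincipalState h μ C) (hτ : τ ∈ Set.Icc (0 : ℝ) 1)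
    (hF : C.IsFactored (fun s => 1 + (τ : ℂ) * P.countingFn h μ s) (-P.b) P.N w e) :
    ContinuousAt (ampRatio P h μ C) (τ, w) := by
  have hz := fun i => D.isDeformedZero hF i
  have cs : ∀ g : ℝ × (Fin P.N → ℂ) → ℂ, Continuous g →
      ContinuousAt (fun q => sinh (g q)) (τ, w) := fun g hg =>
    (continuous_sinh.comp hg).continuousAt
  have cτ : Continuous fun q : ℝ × (Fin P.N → ℂ) => (q.1 : ℂ) :=
    continuous_ofReal.comp continuous_fst
  have cJ : ∀ g : ℝ × (Fin P.N → ℂ) → ℂ, Continuous g → C.OffMod (g (τ, w)) →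
      ContinuousAt (fun q => C.cothInt (C.logPr (P.countingFn h μ) q.1) (g q)) (τ, w) :=
    fun g hg ho => ContinuousAt.comp
      (g := fun q : ℝ × ℂ => C.cothInt (C.logPr (P.countingFn h μ) q.1) q.2)
      (f := fun q : ℝ × (Fin P.N → ℂ) => (q.1, g q))
      (Contour.continuousAt_cothInt_logPr D.analyticAt_trace (D.slit hτ) ho)
      (continuous_fst.prodMk hg).continuousAt
  have cr : ∀ g : ℝ × (Fin P.N → ℂ) → ℂ, Continuous g → g (τ, w) ∈ C.hull →
      sinh (g (τ, w) + P.b) ≠ 0 → ‖τ * P.countingFn h μ (g (τ, w))‖ < 1 →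
      ContinuousAt (fun q => (1 + q.1 * P.countingFn h μ (g q)) ^ (1 / 2 : ℂ)) (τ, w) :=
    fun g hg h1 h2 h3 => by
      refine ContinuousAt.cpow ?_ continuousAt_const (mem_slitPlane_of_norm_lt_one h3)
      exact continuousAt_const.add (cτ.continuousAt.mul (ContinuousAt.comp
        (g := P.countingFn h μ) (f := g) (D.analyticAt_countingFn h1 h2).continuousAt
        hg.continuousAt))
  have hb0 : sinh (0 + P.b) ≠ 0 := fun h0 => D.b_ne (by
    rw [zero_add] at h0
    rw [sinh_two_mul, h0]; ring)
  unfold ampRatio amp stateExp expX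
  refine ContinuousAt.mul (ContinuousAt.mul (ContinuousAt.mul (ContinuousAt.mul (ContinuousAt.div
    ?_ ?_ ?_) (ContinuousAt.pow ?_ _)) ?_) ?_) (ContinuousAt.cexp (ContinuousAt.neg
    (ContinuousAt.sub (ContinuousAt.div_const (ContinuousAt.add (ContinuousAt.sub ?_
    (continuousAt_const.mul (ContinuousAt.sub ?_ ?_))) (((ContinuousAt.add ?_ ?_).add ?_).add ?_))
    _) (continuousAt_const.mul (ContinuousAt.add ?_ ?_)))))
  · refine tendsto_finsetProd _ fun i _ => tendsto_finsetProd _ fun j _ => ?_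
    exact (cs (fun q => q.2 i + q.2 j - P.iζ) (by fun_prop)).div
      (cs (fun q => q.2 i + q.2 j) (by fun_prop)) (D.sinh_add_ne_zero hτ (hz i) (hz j))
  · exact tendsto_finsetProd _ fun i _ => cs (fun q => 2 * q.2 i) (by fun_prop)
  · exact Finset.prod_ne_zero_iff.2 fun i _ => by
      rw [two_mul]; exact D.sinh_add_ne_zero hτ (hz i) (hz i)
  · exact tendsto_finsetProd _ fun i _ => (cs (fun q => q.2 i - P.b) (by fun_prop)).mul
      (cs (fun q => q.2 i - -(P.iζ + P.b)) (by fun_prop))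
  · refine tendsto_finsetProd _ fun i _ => cr (fun q => -q.2 i) (by fun_prop)
      (Or.inr (D.principal.symm _ (hF.w_mem i))) ?_ (D.norm_neg_lt_one hτ (hz i))
    rw [show -w i + P.b = -(w i - P.b) by ring, sinh_neg]
    exact neg_ne_zero.2 (D.sinh_sub_b_ne_zero hτ (hz i))
  · refine cr (fun _ => 0) continuous_const (Or.inr D.base.zero_mem) hb0 ?_
    rw [norm_mul, norm_real, Real.norm_of_nonneg hτ.1]
    nlinarith [D.a_zero, hτ.1, hτ.2, norm_nonneg (P.countingFn h μ 0)]
  · refine tendsto_finsetSum _ fun i _ => ContinuousAt.sub (cJ (fun q => -q.2 i) (by fun_prop)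
      (Contour.offMod_of_mem (D.principal.symm _ (hF.w_mem i)))) (cJ (fun q => P.iζ - q.2 i)
      (by fun_prop) (D.principal.shift _ (hF.w_mem i)).offMod)
  · exact cJ _ continuous_const (Contour.offMod_of_mem D.base.b_mem)
  · exact cJ _ continuous_const D.base.shift.1.offMod
  · exact cJ _ continuous_const D.base.half_shift.1.offMod
  · exact cJ _ continuous_const D.base.half_shift.2.offMod
  · exact cJ _ continuous_const (Contour.offMod_of_mem D.base.zero_mem)
  · exact cJ _ continuous_const D.base.half_period.offMod
  · exact cJ _ continuous_const D.base.shift.2.offMod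
  · exact cJ _ continuous_const D.base.shift.1.offMod

variable (P h μ C) in
/-- The configurations of zeros along the deformation, characterized by contour integrals. -/
def zeroSet : Set (ℝ × (Fin P.N → ℂ)) :=
  {q | q.1 ∈ Set.Icc (0 : ℝ) 1 ∧ (∀ i, q.2 i ∈ C.hull) ∧ ∀ p, C.OutsideMod p →
    (∏ i, sinh (q.2 i - p)) * exp (C.cothInt (C.logPr (P.countingFn h μ) q.1) p) =
      sinh (-P.b - p) ^ P.N}

theorem mem_zeroSet (D : P.PrincipalState h μ C) (hτ : τ ∈ Set.Icc (0 : ℝ) 1)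
    (hF : C.IsFactored (fun s => 1 + (τ : ℂ) * P.countingFn h μ s) (-P.b) P.N w e) :
    (τ, w) ∈ zeroSet P h μ C := by
  refine ⟨hτ, fun i => Or.inr (hF.w_mem i), fun p hp => ?_⟩
  rw [Contour.cothInt, hF.exp_coth_outside (D.isLogAlong hτ) hp, mul_div_cancel₀]
  exact Finset.prod_ne_zero_iff.2 fun i _ =>
    Contour.sinh_sub_ne_zero_of_outsideMod hp (Or.inr (hF.w_mem i))

theorem exists_perm {w' : Fin P.N → ℂ} (hw : (τ, w) ∈ zeroSet P h μ C)
    (hw' : (τ, w') ∈ zeroSet P h μ C) : ∃ σ : Equiv.Perm (Fin P.N), w = w' ∘ σ :=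
  Contour.exists_perm_of_prod_sinh_eq hw.2.1 hw'.2.1 fun p hp =>
    mul_right_cancel₀ (exp_ne_zero _) ((hw.2.2 p hp).trans (hw'.2.2 p hp).symm)

theorem isFactored_of_mem (D : P.PrincipalState h μ C) (hw : (τ, w) ∈ zeroSet P h μ C) :
    ∃ e, C.IsFactored (fun s => 1 + (τ : ℂ) * P.countingFn h μ s) (-P.b) P.N w e := by
  obtain ⟨w', e, hF⟩ := D.exists_isFactored hw.1
  obtain ⟨σ, hσ⟩ := exists_perm hw (D.mem_zeroSet hw.1 hF)
  exact ⟨e, hσ ▸ hF.comp_perm σ⟩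

theorem ampRatio_eq_of_mem {w' : Fin P.N → ℂ} (hw : (τ, w) ∈ zeroSet P h μ C)
    (hw' : (τ, w') ∈ zeroSet P h μ C) : ampRatio P h μ C (τ, w) = ampRatio P h μ C (τ, w') := by
  obtain ⟨σ, hσ⟩ := exists_perm hw hw'
  simp only [ampRatio, hσ]
  rw [amp_perm, stateExp_perm]

theorem isCompact_zeroSet (D : P.PrincipalState h μ C) : IsCompact (zeroSet P h μ C) := by
  have hS : IsCompact (Set.Icc (0 : ℝ) 1 ×ˢ Set.univ.pi fun _ : Fin P.N => C.hull) :=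
    isCompact_Icc.prod (isCompact_univ_pi fun _ => C.isCompact_hull)
  set S := Set.Icc (0 : ℝ) 1 ×ˢ Set.univ.pi fun _ : Fin P.N => C.hull
  have hK : zeroSet P h μ C = S ∩ ⋂ p, ⋂ (_ : C.OutsideMod p), S ∩ (fun q =>
      (∏ i, sinh (q.2 i - p)) * exp (C.cothInt (C.logPr (P.countingFn h μ) q.1) p)) ⁻¹'
        {sinh (-P.b - p) ^ P.N} := by
    ext q
    simp only [zeroSet, S, Set.mem_ofPred_eq, Set.mem_inter_iff, Set.mem_iInter, Set.mem_prod,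
      Set.mem_univ_pi, Set.mem_preimage, Set.mem_singleton_iff]
    exact ⟨fun ⟨h1, h2, h3⟩ => ⟨⟨h1, h2⟩, fun p hp => ⟨⟨h1, h2⟩, h3 p hp⟩⟩,
      fun ⟨⟨h1, h2⟩, h3⟩ => ⟨h1, h2, fun p hp => (h3 p hp).2⟩⟩
  rw [hK]
  refine hS.inter_right (isClosed_iInter fun p => isClosed_iInter fun hp =>
    ContinuousOn.preimage_isClosed_of_isClosed ?_ hS.isClosed isClosed_singleton)
  intro q hq
  refine ContinuousAt.continuousWithinAt (ContinuousAt.mul ?_ (ContinuousAt.cexp ?_))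
  · exact tendsto_finsetProd _ fun i _ => (continuous_sinh.comp (by fun_prop :
      Continuous fun q : ℝ × (Fin P.N → ℂ) => q.2 i - p)).continuousAt
  · exact ContinuousAt.comp
      (g := fun q : ℝ × ℂ => C.cothInt (C.logPr (P.countingFn h μ) q.1) q.2)
      (f := fun q : ℝ × (Fin P.N → ℂ) => (q.1, p))
      (Contour.continuousAt_cothInt_logPr D.analyticAt_trace (D.slit hq.1) hp.offMod)
      (continuous_fst.prodMk continuous_const).continuousAt

/-- The ratio is constant along the deformation. -/
theorem ampRatio_eq (D : P.PrincipalState h μ C) {τ' : ℝ} {w' : Fin P.N → ℂ}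
    (hw : (τ, w) ∈ zeroSet P h μ C) (hw' : (τ', w') ∈ zeroSet P h μ C) :
    ampRatio P h μ C (τ, w) = ampRatio P h μ C (τ', w') := by
  have hsq : ∀ q ∈ zeroSet P h μ C, P.ampConst * ampRatio P h μ C q ^ 2 = 1 := fun q hq => by
    obtain ⟨e, he⟩ := D.isFactored_of_mem (τ := q.1) (w := q.2) hq
    exact D.ampRatio_sq hq.1 he
  have hcont : ContinuousOn (ampRatio P h μ C) (zeroSet P h μ C) := fun q hq => by
    obtain ⟨e, he⟩ := D.isFactored_of_mem (τ := q.1) (w := q.2) hq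
    exact (D.continuousAt_ampRatio hq.1 he).continuousWithinAt
  have hA : P.ampConst ≠ 0 := left_ne_zero_of_mul (by rw [hsq _ hw]; exact one_ne_zero)
  have hcl : ∀ c : ℂ, IsClosed (Prod.fst '' (zeroSet P h μ C ∩ ampRatio P h μ C ⁻¹' {c})) :=
    fun c => by
      have h1 := hcont.preimage_isClosed_of_isClosed D.isCompact_zeroSet.isClosed
        (isClosed_singleton (x := c))
      exact ((D.isCompact_zeroSet.of_isClosed_subset h1 Set.inter_subset_left).image
        continuous_fst).isClosed
  set c := ampRatio P h μ C (τ', w')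
  have hpm : ∀ q ∈ zeroSet P h μ C, ampRatio P h μ C q = c ∨ ampRatio P h μ C q = -c :=
    fun q hq => sq_eq_sq_iff_eq_or_eq_neg.1
      (mul_left_cancel₀ hA ((hsq q hq).trans (hsq _ hw').symm))
  refine (hpm _ hw).resolve_right fun hneg => ?_
  obtain ⟨t, -, ⟨q, ⟨hq, hqc⟩, rfl⟩, ⟨q', ⟨hq', hqc'⟩, hqq⟩⟩ :=
    isPreconnected_closed_iff.1 (isPreconnected_Icc (a := (0 : ℝ)) (b := 1)) _ _ (hcl c) (hcl (-c))
    (fun t ht => by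
      obtain ⟨v, e, hF⟩ := D.exists_isFactored ht
      have hm := D.mem_zeroSet ht hF
      exact (hpm _ hm).imp (fun h1 => ⟨(t, v), ⟨hm, h1⟩, rfl⟩) fun h1 => ⟨(t, v), ⟨hm, h1⟩, rfl⟩)
    ⟨τ', hw'.1, (τ', w'), ⟨hw', rfl⟩, rfl⟩ ⟨τ, hw.1, (τ, w), ⟨hw, hneg⟩, rfl⟩
  obtain ⟨t, u⟩ := q
  obtain ⟨t', u'⟩ := q'
  obtain rfl : t' = t := hqq
  have h1 := ampRatio_eq_of_mem hq hq'
  rw [Set.mem_preimage, Set.mem_singleton_iff] at hqc hqc'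
  rw [hqc, hqc'] at h1
  have h2 : c = 0 := by
    have : (2 : ℂ) * c = 0 := by linear_combination h1
    simpa using this
  have h3 := hsq _ hw'
  rw [show ampRatio P h μ C (τ', w') = c from rfl, h2] at h3
  norm_num at h3

theorem ampRatio_zero : ampRatio P h μ C (0, fun _ => -P.b) = P.amp 0 fun _ => -P.b := by
  have hL : ∀ p, C.cothInt (C.logPr (P.countingFn h μ) 0) p = 0 := fun p => by
    simp [Contour.cothInt, Contour.integralW, pathIntegral, Contour.logPr]
  have h1 : P.stateExp C (C.logPr (P.countingFn h μ) 0) (fun _ => -P.b) = 0 := by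
    simp [stateExp, expX, hL]
  simp only [ampRatio, h1, neg_zero, exp_zero, mul_one]
  congr 1
  funext s
  simp

/-- The amplitude attached to the zeros of `1 + â` inside of the contour. -/
theorem amp_eq (D : P.PrincipalState h μ C) {x y : Fin n → ℂ} (hY : P.ParticleHole h μ C x y)
    (DS : P.StateData h μ C x y w e) :
    P.amp (P.countingFn h μ) w = P.amp 0 (fun _ => -P.b) * exp (P.stateExp C
      (C.logAlong (P.countingFn h μ) (log (1 + P.countingFn h μ (C.toFun 0)))) w) := by
  have hF : C.IsFactored (fun s => 1 + ((1 : ℝ) : ℂ) * P.countingFn h μ s) (-P.b) P.N w e := by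
    simpa using DS.fac
  have h1 : (1 : ℝ) ∈ Set.Icc (0 : ℝ) 1 := by simp
  have h0 : (0 : ℝ) ∈ Set.Icc (0 : ℝ) 1 := by simp
  have hz : ((0 : ℝ), fun _ : Fin P.N => -P.b) ∈ zeroSet P h μ C := by
    refine ⟨h0, fun _ => Or.inr D.base.neg_b_mem, fun p _ => ?_⟩
    simp [Contour.cothInt, Contour.integralW, pathIntegral, Contour.logPr]
  have key := D.ampRatio_eq (D.mem_zeroSet h1 hF) hz
  rw [ampRatio_zero] at key
  have hv : exp (log (1 + P.countingFn h μ (C.toFun 0))) = 1 + P.countingFn h μ (C.toFun 0) :=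
    exp_log (hY.ne_zero _ (C.mem_trace (by simp)))
  have hL := hY.isLogAlong D.base hv
  have hL' : C.IsLogAlong (fun s => 1 + P.countingFn h μ s) (C.logPr (P.countingFn h μ) 1) := by
    simpa using D.isLogAlong h1
  have hE := hL'.eqOn hL (by simp [Contour.logPr, Contour.logAlong])
  have hX : P.stateExp C (C.logPr (P.countingFn h μ) 1) w = P.stateExp C
      (C.logAlong (P.countingFn h μ) (log (1 + P.countingFn h μ (C.toFun 0)))) w := by
    unfold stateExp expX
    simp only [Contour.cothInt_congr hE]
  rw [← key]
  simp only [ampRatio, hX]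
  rw [mul_assoc, ← exp_add, neg_add_cancel, exp_zero, mul_one]
  simp

theorem stateW_eq (D : P.PrincipalState h μ C) {x y : Fin n → ℂ} (hY : P.ParticleHole h μ C x y)
    (DS : P.StateData h μ C x y w e) :
    P.stateW h μ = P.amp 0 (fun _ => -P.b) * exp (P.stateExp C
      (C.logAlong (P.countingFn h μ) (log (1 + P.countingFn h μ (C.toFun 0)))) w) *
      P.Kfac (P.countingFn h μ) C
        (C.logAlong (P.countingFn h μ) (log (1 + P.countingFn h μ (C.toFun 0)))) x y *
      P.holeFactor (P.countingFn h μ) x := by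
  have hF : C.IsFactored (fun s => 1 + ((1 : ℝ) : ℂ) * P.countingFn h μ s) (-P.b) P.N w e := by
    simpa using DS.fac
  have h1 : (1 : ℝ) ∈ Set.Icc (0 : ℝ) 1 := by simp
  rw [← D.amp_eq hY DS]
  exact DS.stateW_eq (hY.isLogAlong D.base (exp_log (hY.ne_zero _ (C.mem_trace (by simp)))))
    fun i j => D.sinh_add_ne_zero h1 (D.isDeformedZero hF i) (D.isDeformedZero hF j)

end PrincipalState
end Params

end BoundaryXXZ

open BoundaryXXZ in
theorem mainTheorem2 (P : Params) (hN : 0 < P.N) (hT : 0 < P.T) (hζ₀ : 0 < P.ζ)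
    (hζπ : P.ζ < Real.pi) (hb : Complex.sinh (2 * P.b) ≠ 0) (h h' : ℝ)
    -- the Bethe roots of the reference state at `h` and of the other state at `h'`
    (lam mu : Fin P.N → ℂ) (hlam : P.IsBethe h lam) (hmu : P.IsBethe h' mu)
    -- the base contour; the roots `lam` are the zeros of `1 + â_∅` that it encircles
    (C C' : Contour) (hC : P.BaseContour C)
    (hE : P.ParticleHole h lam C (Fin.elim0 : Fin 0 → ℂ) (Fin.elim0 : Fin 0 → ℂ))
    -- the holes `x` and the particles `y` of the state `mu`
    {n : ℕ} (x y : Fin n → ℂ) (hY : P.ParticleHole h' mu C x y)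
    (hC'E : P.InnerContour (P.countingFn h lam) C C')
    (hC'Y : P.InnerContour (P.countingFn h' mu) C C')
    -- genericity of the boundary parameter
    (hξb : Complex.sinh (P.ξm - P.b) ≠ 0) (hξlam : ∀ a, Complex.sinh (lam a + P.ξm) ≠ 0)
    (hξx : ∀ j, Complex.sinh (x j + P.ξm) ≠ 0)
    -- the contours and the convergence of the series `F̂` of the two states
    (UE UY : Contour) (ΓE ΓY : ℕ → Contour)
    (hFE : P.SeriesContours h lam UE ΓE) (hFY : P.SeriesContours h' mu UY ΓY) :
    Filter.Tendsto (fun ξ => P.tsuchiya ξ mu) P.homogeneous (nhds (P.Z mu)) ∧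
    Filter.Tendsto (fun ξ => P.tsuchiya ξ lam) P.homogeneous (nhds (P.Z lam)) ∧
    P.Z lam ≠ 0 ∧
    (∀ vY vE : ℂ, Complex.exp vY = 1 + P.countingFn h' mu (C.toFun 0) →
      Complex.exp vE = 1 + P.countingFn h lam (C.toFun 0) →
      ∃ H : ℂ, H ≠ 0 ∧ P.IsHoleFactor (P.countingFn h' mu) x H ∧
        P.boundaryFactor h h' mu lam =
          P.rhs (P.countingFn h' mu) (P.countingFn h lam) (P.seriesF h' mu UY ΓY)
            (P.seriesF h lam UE ΓE) C C' x y H vY vE) ∧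
    (P.Principal h lam C → P.Principal h' mu C →
      P.boundaryFactor h h' mu lam =
        P.rhs (P.countingFn h' mu) (P.countingFn h lam) (P.seriesF h' mu UY ΓY)
          (P.seriesF h lam UE ΓE) C C' x y
          (P.holeFactor (P.countingFn h' mu) x)
          (Complex.log (1 + P.countingFn h' mu (C.toFun 0)))
          (Complex.log (1 + P.countingFn h lam (C.toFun 0)))) := by
  have hζ := Params.sinh_iζ_ne_zero hζ₀ hζπ
  obtain ⟨wE, eE, DE⟩ := hE.exists_stateData hC hN hb hζ hlam hFE
  obtain ⟨wY, eY, DY⟩ := hY.exists_stateData hC hN hb hζ hmu hFY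
  have hZE := Params.Z_mul_exp hN hb hζ hC.two_b_add hlam hFE
  have hZY := Params.Z_mul_exp hN hb hζ hC.two_b_add hmu hFY
  refine ⟨hZY.1, hZE.1, fun h0 => ?_, fun vY vE hvY hvE => ?_, fun hPE hPY => ?_⟩
  · have h1 := hZE.2
    rw [h0, zero_mul, eq_comm] at h1
    refine mul_ne_zero (mul_ne_zero (mul_ne_zero (mul_ne_zero ?_ (pow_ne_zero _ ?_)) ?_)
      DE.stateW_ne_zero) (Complex.exp_ne_zero _) h1
    · exact pow_ne_zero _ (pow_ne_zero _ (by norm_num))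
    · rw [Complex.sinh_neg]; exact neg_ne_zero.2 hb
    · exact Finset.prod_ne_zero_iff.2 fun a _ => by rw [add_comm]; exact hξlam a
  · obtain ⟨H, hH0, hH, hid⟩ := DE.exists_hole DY (hE.isLogAlong hC hvE) (hY.isLogAlong hC hvY)
    exact ⟨H, hH0, hH, Params.boundaryFactor_eq_rhs hζ DY DE hE hY hC'E hC'Y hξb hξlam hξx hFE hFY
      hvY hvE hid⟩
  · have h0 : C.toFun 0 ∈ C.trace := C.mem_trace (by simp)
    refine Params.boundaryFactor_eq_rhs hζ DY DE hE hY hC'E hC'Y hξb hξlam hξx hFE hFY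
      (Complex.exp_log (hY.ne_zero _ h0)) (Complex.exp_log (hE.ne_zero _ h0)) ?_
    have e1 : P.holeFactor (P.countingFn h lam) (Fin.elim0 : Fin 0 → ℂ) = 1 := by
      simp [Params.holeFactor]
    rw [(hY.principalState DY hPY).stateW_eq hY DY, (hE.principalState DE hPE).stateW_eq hE DE,
      Params.Kfac_zero, e1]
    ring
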